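/- **Setting.** Let $g>0$, $\bar\rho_0>0$, and let $p\in C^2((0,\infty))$ satisfy $p(\bar\rho_0)=0$, and $p'(\rho)>0$ and $2p'(\rho)+\rho p''(\rho)>0$ for all $\rho\ge\bar\rho_0$. Put $h(\rho)=\int_{\bar\rho_0}^{\rho}\frac{p'(s)}{s}\,ds$ and $y_{\rm st}=\frac{p'(\bar\rho_0)}{2g}$. A number $\rho_{\rm cr}>0$ is a critical density at height $y$ if $\frac{p'(\rho_{\rm cr})}2+h(\rho_{\rm cr})+gy=\frac{p'(\bar\rho_0)}2$; assume that for each $y\in[0,y_{\rm st}]$ there is exactly one. Let $\rho(t;y)$ be the solution $\rho$ of Bernoulli's law $\frac{t}{2\rho^2}+h(\rho)+gy=\frac{p'(\bar\rho_0)}2$ that is larger than the critical density at height $y$. Define $$H(t;s)=\rho(2\bar\rho_0^2gt;\,y_{\rm st}-s),\quad F(t;s)=\int_0^t\frac{d\tau}{H(\tau;s)},\quad \Lambda(t;s)=2t\,\partial_1F(t;s)-F(t;s),\quad \lambda(s)=\Lambda(s;s),$$ where $\partial_1F=1/H$; $\lambda(s)$ is defined for $0\le s<y_{\rm st}$. Let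 $\Omega\subset\mathbb R^2$ be a bounded domain with $\Omega\cap\{x_2=0\}\ne\varnothing$. A function $u\in W^{1,2}_{\rm loc}(\Omega)$ is a *subsonic variational solution* of $$\operatorname{div}\Big(\frac{\nabla u}{H(|\nabla u|^2;x_2)}\Big)=0\ \text{ in }\Omega\cap\{u>0\},\qquad |\nabla u|^2=x_2\ \text{ on }\Omega\cap\partial\{u>0\}$$ if 1. $u\ge0$ in $\Omega$ and $u=0$ in $\Omega\cap\{x_2\le0\}$; 2. $u\in C^0(\Omega)\cap C^2(\Omega\cap\{u>0\})$; 3. there is $\varepsilon_0>0$ such that at every $x\in\Omega\cap\{u>0\}$ the density $H(|\nabla u|^2;x_2)$ exists and exceeds the critical density at height $y_{\rm st}-x_2$ by at least $\varepsilon_0$; 4. for every vector field $\phi\in C^1_c(\Omega\cap\{x_2<y_{\rm st}\};\mathbb R^2)$, $$0=\int_\Omega\big(F(|\nabla u|^2;x_2)+\lambda(x_2)\chi_{\{u>0\}}\big)\operatorname{div}\phi\,dx-2\int_\Omega\partial_1F(|\nabla u|^2;x_2)\,\nabla u\,D\phi\,\nabla u\,dx+\int_\Omega\big(\lambda'(x_2)\chi_{\{u>0\}}+\partial_2F(|\nabla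 u|^2;x_2)\big)\phi_2\,dx .$$ The set of stagnation points is $S^u=\{x\in\Omega\cap\partial\{u>0\}: x_2=0\}$. A point $x^\circ\in S^u$ is *non-degenerate* if there are $r_m\to0^+$ such that $x\mapsto u(x^\circ+r_mx)/r_m^{3/2}$ converges weakly in $W^{1,2}_{\rm loc}(\mathbb R^2)$ to a function $u_0\not\equiv0$. **Proposition.** Let $u$ be a subsonic variational solution. Suppose that $|\nabla u|^2\le \mathscr C x_2^+$ locally in $\Omega$ (on each compact subset of $\Omega$, with some constant $\mathscr C$ for that subset), and that there is a constant $\mathscr C_0$ such that $$r^{-3/2}\int_{B_r(y)}\sqrt{x_2^+}\;|\nabla\chi_{\{u>0\}}|\,dx\le\mathscr C_0\qquad\text{for all } B_r(y)\subset\subset\Omega\text{ with }y_2=0,$$ where $|\nabla\chi_{\{u>0\}}|$ is the total variation measure of $\chi_{\{u>0\}}$ in $\Omega\cap\{x_2>0\}$. If $x^\circ\in S^u$ is a non-degenerate stagnation point, then $x^\circ$ has an open neighbourhood in which it is the only non-degenerate stagnation point. -/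

import Mathlib

open MeasureTheory Filter Topology Set

noncomputable section

namespace GravityWave

/-- The plane with its Euclidean norm; the coordinates `x₁, x₂` are `x 0, x 1`. -/
abbrev Plane : Type := EuclideanSpace ℝ (Fin 2)

/-! ### Calculus in the plane -/

/-- The divergence of a vector field. -/
def divergence (φ : Plane → Plane) (x : Plane) : ℝ :=
  ∑ i : Fin 2, (fderiv ℝ φ x (EuclideanSpace.single i 1)) i

/-- `G` is the weak gradient of `v` on `U`, and both are in `L²_loc(U)`. -/
structure IsWeakGradientOn (U : Set Plane) (v : Plane → ℝ) (G : Plane → Plane) : Prop where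
  memLp_fun : ∀ K ⊆ U, IsCompact K → MemLp v 2 (volume.restrict K)
  memLp_grad : ∀ K ⊆ U, IsCompact K → MemLp G 2 (volume.restrict K)
  integral_eq : ∀ η : Plane → ℝ, ContDiff ℝ (⊤ : ℕ∞) η → HasCompactSupport η → tsupport η ⊆ U →
    ∀ i : Fin 2,
      ∫ x, v x * fderiv ℝ η x (EuclideanSpace.single i 1) = -∫ x, (G x) i * η x

/-- The space `W^{1,2}_loc(U)`. -/
def MemW12Loc (U : Set Plane) (v : Plane → ℝ) : Prop :=
  ∃ G : Plane → Plane, IsWeakGradientOn U v G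

/-- Weak convergence in `W^{1,2}_loc(ℝ²)` of functions `v m` with gradients `Dv m`. Each `v m` only
has to be meaningful on a set that contains any given compact set for large `m`. -/
def WeakConvW12Loc (v : ℕ → Plane → ℝ) (Dv : ℕ → Plane → Plane)
    (v₀ : Plane → ℝ) (Dv₀ : Plane → Plane) : Prop :=
  (∀ η : Plane → ℝ, MemLp η 2 volume → HasCompactSupport η →
    Tendsto (fun m => ∫ x, v m x * η x) atTop (𝓝 (∫ x, v₀ x * η x))) ∧
  (∀ η : Plane → Plane, MemLp η 2 volume → HasCompactSupport η →
    Tendsto (fun m => ∫ x, inner ℝ (Dv m x) (η x)) atTop (𝓝 (∫ x, inner ℝ (Dv₀ x) (η x))))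

/-- The variation in the open set `V` of the characteristic function of `P`. -/
def variation (P V : Set Plane) : ENNReal :=
  ⨆ φ ∈ {φ : Plane → Plane | ContDiff ℝ 1 φ ∧ HasCompactSupport φ ∧ tsupport φ ⊆ V ∧
      ∀ x, ‖φ x‖ ≤ 1},
    ENNReal.ofReal (∫ x in P, divergence φ x)

/-- `μ` is the total variation measure of the characteristic function of `P` in the open set `U`: on
open subsets of `U` it is the variation. (It is a Radon measure there exactly if the characteristic
function is of locally bounded variation in `U`.) -/
def IsTotalVariationMeasure (μ : Measure Plane) (U P : Set Plane) : Prop :=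
  ∀ V ⊆ U, IsOpen V → μ V = variation P V

/-! ### The density as a function of momentum and height

`p` is the pressure law, `ρ₀` the constant density on the free surface, `g` the gravity constant. -/

/-- The enthalpy `h(ρ) = ∫_{ρ₀}^ρ p'(s) / s ds`. -/
def enthalpy (p : ℝ → ℝ) (ρ₀ ρ : ℝ) : ℝ := ∫ s in ρ₀..ρ, deriv p s / s

/-- The height `p'(ρ₀) / (2 g)` of the stagnation points. -/
def stagnationHeight (p : ℝ → ℝ) (ρ₀ g : ℝ) : ℝ := deriv p ρ₀ / (2 * g)

/-- `ρ` is the critical density at height `y`. -/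
def IsCriticalDensity (p : ℝ → ℝ) (ρ₀ g y ρ : ℝ) : Prop :=
  0 < ρ ∧ deriv p ρ / 2 + enthalpy p ρ₀ ρ + g * y = deriv p ρ₀ / 2

/-- `ρ` solves Bernoulli's law at height `y` with squared momentum `t`, and exceeds the critical
density at that height. -/
def IsSubsonicDensity (p : ℝ → ℝ) (ρ₀ g t y ρ : ℝ) : Prop :=
  0 < ρ ∧ t / (2 * ρ ^ 2) + enthalpy p ρ₀ ρ + g * y = deriv p ρ₀ / 2 ∧
    ∃ ρc, IsCriticalDensity p ρ₀ g y ρc ∧ ρc < ρ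

/-- Assumptions on the pressure law. The critical density is required to exist and to be unique
only at heights between `0` (the sonic level of the free surface) and the stagnation height. -/
structure IsPressureLaw (p : ℝ → ℝ) (ρ₀ g : ℝ) : Prop where
  gravity_pos : 0 < g
  density_pos : 0 < ρ₀
  contDiffOn : ContDiffOn ℝ 2 p (Ioi 0)
  pressure_surface : p ρ₀ = 0
  deriv_pos : ∀ ρ, ρ₀ ≤ ρ → 0 < deriv p ρ
  genuine : ∀ ρ, ρ₀ ≤ ρ → 0 < 2 * deriv p ρ + ρ * deriv (deriv p) ρ
  critical : ∀ y ∈ Icc 0 (stagnationHeight p ρ₀ g), ∃! ρ, IsCriticalDensity p ρ₀ g y ρ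

open Classical in
/-- The subsonic density `ρ(t; y)`; the value is `0` if there is none. -/
def density (p : ℝ → ℝ) (ρ₀ g t y : ℝ) : ℝ :=
  if h : ∃ ρ, IsSubsonicDensity p ρ₀ g t y ρ then h.choose else 0

/-- `H(t; s) = ρ(2 ρ₀² g t; y_st - s)`: the density in the normalised variables, where `s` is the
depth below the stagnation height. -/
def H (p : ℝ → ℝ) (ρ₀ g t s : ℝ) : ℝ :=
  density p ρ₀ g (2 * ρ₀ ^ 2 * g * t) (stagnationHeight p ρ₀ g - s)

/-- `F(t; s) = ∫_0^t dτ / H(τ; s)`. -/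
def F (p : ℝ → ℝ) (ρ₀ g t s : ℝ) : ℝ := ∫ τ in (0 : ℝ)..t, 1 / H p ρ₀ g τ s

/-- `∂₁F(t; s) = 1 / H(t; s)`. -/
def dF₁ (p : ℝ → ℝ) (ρ₀ g t s : ℝ) : ℝ := 1 / H p ρ₀ g t s

/-- `∂₂F(t; s)`. -/
def dF₂ (p : ℝ → ℝ) (ρ₀ g t s : ℝ) : ℝ := deriv (fun s' => F p ρ₀ g t s') s

/-- `Λ(t; s) = 2 t ∂₁F(t; s) - F(t; s)`. -/
def Lam (p : ℝ → ℝ) (ρ₀ g t s : ℝ) : ℝ := 2 * t * dF₁ p ρ₀ g t s - F p ρ₀ g t s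

/-- `λ(s) = Λ(s; s)`. -/
def lam (p : ℝ → ℝ) (ρ₀ g s : ℝ) : ℝ := Lam p ρ₀ g s s

/-! ### Solutions -/

/-- The fluid `{u > 0}` in `Ω`. -/
def fluid (Ω : Set Plane) (u : Plane → ℝ) : Set Plane := {x | x ∈ Ω ∧ 0 < u x}

/-- The gradient of a function `u ≥ 0` that is `C²` in `{u > 0}`: the classical one in `{u > 0}`, and
zero in `{u = 0}`. If `u` is in `W^{1,2}_loc`, this is its weak gradient almost everywhere. -/
def grad (u : Plane → ℝ) (x : Plane) : Plane := if 0 < u x then gradient u x else 0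

open Classical in
/-- The characteristic function of `{u > 0}`. -/
def chi (u : Plane → ℝ) (x : Plane) : ℝ := if 0 < u x then 1 else 0

/-- The first variation, with respect to the domain variation `φ`, of the functional
`∫ F(|∇u|²; x₂) + λ(x₂) χ_{u > 0}`, up to sign. -/
def firstVariation (p : ℝ → ℝ) (ρ₀ g : ℝ) (Ω : Set Plane) (u : Plane → ℝ) (φ : Plane → Plane) : ℝ :=
  (∫ x in Ω, (F p ρ₀ g (‖grad u x‖ ^ 2) (x 1) + lam p ρ₀ g (x 1) * chi u x) * divergence φ x)
  - 2 * (∫ x in Ω, dF₁ p ρ₀ g (‖grad u x‖ ^ 2) (x 1) *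
      inner ℝ (grad u x) (fderiv ℝ φ x (grad u x)))
  + ∫ x in Ω, (deriv (lam p ρ₀ g) (x 1) * chi u x + dF₂ p ρ₀ g (‖grad u x‖ ^ 2) (x 1)) * (φ x) 1

/-- Subsonic variational solutions. The number `λ(s)` is defined only for `s < y_st`, where the
density `ρ₀` is subsonic, and so the test fields are supported there. -/
structure IsSubsonicVariationalSolution (p : ℝ → ℝ) (ρ₀ g : ℝ) (Ω : Set Plane) (u : Plane → ℝ) :
    Prop where
  isOpen : IsOpen Ω
  isConnected : IsConnected Ω
  isBounded : Bornology.IsBounded Ω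
  meets_axis : ∃ x ∈ Ω, x 1 = 0
  memW12Loc : MemW12Loc Ω u
  nonneg : ∀ x ∈ Ω, 0 ≤ u x
  eq_zero : ∀ x ∈ Ω, x 1 ≤ 0 → u x = 0
  continuousOn : ContinuousOn u Ω
  contDiffOn : ContDiffOn ℝ 2 u (fluid Ω u)
  subsonic : ∃ ε₀ > 0, ∀ x ∈ fluid Ω u,
    ∃ ρc, IsCriticalDensity p ρ₀ g (stagnationHeight p ρ₀ g - x 1) ρc ∧
      ε₀ ≤ H p ρ₀ g (‖grad u x‖ ^ 2) (x 1) - ρc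
  variation_eq_zero : ∀ φ : Plane → Plane, ContDiff ℝ 1 φ → HasCompactSupport φ →
    tsupport φ ⊆ Ω ∩ {x | x 1 < stagnationHeight p ρ₀ g} →
    firstVariation p ρ₀ g Ω u φ = 0

/-- `|∇u|² ≤ C x₂⁺` locally in `Ω`. -/
def GrowthBound (Ω : Set Plane) (u : Plane → ℝ) : Prop :=
  ∀ K ⊆ Ω, IsCompact K → ∃ C : ℝ, ∀ x ∈ K, ‖grad u x‖ ^ 2 ≤ C * max (x 1) 0

/-- `r^{-3/2} ∫_{B_r(y)} √x₂ |∇χ_{u > 0}| dx ≤ C₀` for all `B_r(y) ⊂⊂ Ω` with `y₂ = 0`, where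
`|∇χ_{u > 0}|` is the total variation measure in `Ω ∩ {x₂ > 0}`. -/
def WeightedPerimeterBound (Ω : Set Plane) (u : Plane → ℝ) (C₀ : ℝ) : Prop :=
  ∃ μ : Measure Plane, IsTotalVariationMeasure μ (Ω ∩ {x | 0 < x 1}) (fluid Ω u) ∧
    ∀ (y : Plane) (r : ℝ), y 1 = 0 → 0 < r → Metric.closedBall y r ⊆ Ω →
      ∫⁻ x in Metric.ball y r ∩ {x | 0 < x 1}, ENNReal.ofReal (Real.sqrt (x 1)) ∂μ
        ≤ ENNReal.ofReal (C₀ * r ^ (3 / 2 : ℝ))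

/-- The set `S^u` of stagnation points. -/
def stagnationSet (Ω : Set Plane) (u : Plane → ℝ) : Set Plane :=
  {x | x ∈ Ω ∧ x ∈ frontier (fluid Ω u) ∧ x 1 = 0}

/-- The rescaled function `u(x₀ + r x) / r^{3/2}`. -/
def rescale (u : Plane → ℝ) (x₀ : Plane) (r : ℝ) (x : Plane) : ℝ :=
  u (x₀ + r • x) / r ^ (3 / 2 : ℝ)

/-- The gradient of `rescale u x₀ r` for `r > 0`. -/
def rescaleGrad (u : Plane → ℝ) (x₀ : Plane) (r : ℝ) (x : Plane) : Plane :=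
  (r / r ^ (3 / 2 : ℝ)) • grad u (x₀ + r • x)

/-- `u₀` is a blow-up of `u` at `x₀`: the weak limit in `W^{1,2}_loc(ℝ²)` of rescaled functions along
a sequence of radii that tends to zero. -/
def IsBlowUp (u : Plane → ℝ) (x₀ : Plane) (u₀ : Plane → ℝ) : Prop :=
  ∃ Du₀ : Plane → Plane, IsWeakGradientOn univ u₀ Du₀ ∧
    ∃ r : ℕ → ℝ, (∀ m, 0 < r m) ∧ Tendsto r atTop (𝓝 0) ∧
      WeakConvW12Loc (fun m => rescale u x₀ (r m)) (fun m => rescaleGrad u x₀ (r m)) u₀ Du₀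

/-- The set of non-degenerate stagnation points: those with a blow-up that is not zero. -/
def nondegenerateSet (Ω : Set Plane) (u : Plane → ℝ) : Set Plane :=
  {x | x ∈ stagnationSet Ω u ∧ ∃ u₀, IsBlowUp u x u₀ ∧ ¬ u₀ =ᵐ[volume] 0}

end GravityWave

end

/-!
Near the stagnation level the density is almost constant: `H(t; s) = ρ₀ + O(|t| + s)`, and the
functions `F`, `λ` and their derivatives differ from `t / ρ₀`, `s / ρ₀` and theirs by terms of higher
order (`IsPressureLaw.exists_isExpansion`). With the bound `|∇u|² ≤ C x₂⁺`, a compressible solution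
therefore solves the incompressible problem `Δu = 0` in `{u > 0}`, `|∇u|² = x₂` on `∂{u > 0}`, in the
variational sense, up to an error that is multiplied by `r` when `u` is replaced by
`u(y + r x) / r^{3/2}` (`IsApproxSolution`). The structure of the density enters in no other way.

For approximate solutions the energy `weissEnergy u r`, a smooth version of Weiss's boundary-adjusted
energy with the weights `((r² - |x|²)⁺)³` and `((r² - |x|²)⁺)²`, is monotone in `r` up to an error `O(r)`,
and its increments control the distance `defect` of `u` from the functions homogeneous of degree `3/2`
(`exists_hasDerivAt_weissEnergy`, `defect_le`). So it has a limit as `r → 0`, the energy at the point, and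
rescalings converge, along subsequences, to a pair `(v, χ)` of a function with `v²` homogeneous of degree
`3` and a weak limit `χ` of the characteristic functions; the energies converge to
`∫ ((1 - |x|²)⁺)³ x₂ χ` (`IsBlowUpLimit.tendsto_weissEnergy`).

The limits are classified without a strong convergence of the gradients. Domain variations, the equation
and homogeneity combine to one identity for `v²` and `χ` alone (`IsBlowUpLimit.angular_identity`): in
polar coordinates with `v² = r³ q(θ)` it reads, weakly, `q''' + 9 q' = ` a first-order expression
in `χ`, which vanishes where `v > 0`, since `χ = 1` there. Hence `q = A (1 - cos 3(θ - α))` on an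
interval of length `2π/3`, the only one that fits into `(0, π)` (`profile_eq`). Outside of it `χ` is
locally constant, since the variation formula with `v = 0` gives `∇χ = 0`, and the constants are `0` or `1`
by the bound on the perimeter (`IsBlowUpLimit.const_eq_zero_or_one`). The angular identity with test
functions that do not vanish at the free boundary then leaves only `χ = 0` and `α = π/6`: a limit with
`v ≠ 0` is the Stokes corner flow (`IsBlowUpLimit.eq_zero_or_stokesCorner`). The limits with `v = 0` have
`χ = 0` or `χ = 1` in the upper half plane. The energies in the three cases are different, that of the
corner flow being strictly in between (`IsBlowUpLimit.energy_trichotomy`).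

At a non-degenerate point some limit is a corner flow, so the energy of the point is `cornerEnergy > 0` and
all limits there are corner flows. If non-degenerate points `xₘ ≠ x₀` tended to `x₀`, then rescaling at
`x₀` with the radii `2|xₘ - x₀|` would move them to `(±1/2, 0)`, a neighbourhood of which is in the air for
the corner flow. There the energies tend to zero (`IsBlowUpLimit.tendsto_weissEnergy_of_air`); but by
monotonicity they are at least `cornerEnergy`, up to a small error. This is
`IsPerimeterBounded.not_tendsto_of_nondegenerate`.
-/

noncomputable section

open Metric Real
open scoped ContDiff

namespace GravityWave

/-! ### The density near the stagnation level -/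

namespace IsPressureLaw

variable {p : ℝ → ℝ} {ρ₀ g : ℝ}

lemma continuousOn_deriv (hp : IsPressureLaw p ρ₀ g) : ContinuousOn (deriv p) (Ioi 0) :=
  hp.contDiffOn.continuousOn_deriv_of_isOpen isOpen_Ioi (by norm_num)

lemma hasDerivAt (hp : IsPressureLaw p ρ₀ g) {ρ : ℝ} (hρ : 0 < ρ) :
    HasDerivAt p (deriv p ρ) ρ :=
  ((hp.contDiffOn.contDiffAt (Ioi_mem_nhds hρ)).differentiableAt (by norm_num)).hasDerivAt

lemma hasDerivAt_deriv (hp : IsPressureLaw p ρ₀ g) {ρ : ℝ} (hρ : 0 < ρ) :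
    HasDerivAt (deriv p) (deriv (deriv p) ρ) ρ := by
  have h : ContDiffOn ℝ 1 (deriv p) (Ioi 0) :=
    hp.contDiffOn.deriv_of_isOpen isOpen_Ioi (by norm_num)
  exact ((h.contDiffAt (Ioi_mem_nhds hρ)).differentiableAt (by norm_num)).hasDerivAt

lemma hasDerivAt_enthalpy (hp : IsPressureLaw p ρ₀ g) {ρ : ℝ} (hρ : 0 < ρ) :
    HasDerivAt (enthalpy p ρ₀) (deriv p ρ / ρ) ρ := by
  have hc : ContinuousOn (fun s => deriv p s / s) (Ioi 0) :=
    hp.continuousOn_deriv.div continuousOn_id fun x hx => ne_of_gt hx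
  have hsub : uIcc ρ₀ ρ ⊆ Ioi 0 := fun x hx =>
    lt_of_lt_of_le (lt_min hp.density_pos hρ) hx.1
  refine intervalIntegral.integral_hasDerivAt_right
    (hc.mono hsub).intervalIntegrable ?_ (hc.continuousAt (Ioi_mem_nhds hρ))
  exact hc.stronglyMeasurableAtFilter isOpen_Ioi _ hρ

lemma stagnationHeight_pos (hp : IsPressureLaw p ρ₀ g) : 0 < stagnationHeight p ρ₀ g :=
  div_pos (hp.deriv_pos _ le_rfl) (by linarith [hp.gravity_pos])

lemma gravity_mul_stagnationHeight (hp : IsPressureLaw p ρ₀ g) :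
    g * stagnationHeight p ρ₀ g = deriv p ρ₀ / 2 := by
  have := hp.gravity_pos.ne'
  unfold stagnationHeight; field_simp

lemma continuousOn_critical (hp : IsPressureLaw p ρ₀ g) :
    ContinuousOn (fun ρ => deriv p ρ / 2 + enthalpy p ρ₀ ρ) (Ioi 0) :=
  (hp.continuousOn_deriv.div_const _).add fun _ hρ =>
    (hp.hasDerivAt_enthalpy hρ).continuousAt.continuousWithinAt

/-- Genuine nonlinearity makes the function whose zeros are the critical densities increase beyond
the surface density. -/
lemma half_deriv_le_critical (hp : IsPressureLaw p ρ₀ g) {ρ : ℝ} (hρ : ρ₀ ≤ ρ) :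
    deriv p ρ₀ / 2 ≤ deriv p ρ / 2 + enthalpy p ρ₀ ρ := by
  have hmono : MonotoneOn (fun ρ => deriv p ρ / 2 + enthalpy p ρ₀ ρ) (Ici ρ₀) := by
    have hd : ∀ x ∈ Ici ρ₀, HasDerivAt (fun ρ => deriv p ρ / 2 + enthalpy p ρ₀ ρ)
        (deriv (deriv p) x / 2 + deriv p x / x) x := fun x hx =>
      have hx0 : 0 < x := hp.density_pos.trans_le hx
      ((hp.hasDerivAt_deriv hx0).div_const 2).add (hp.hasDerivAt_enthalpy hx0)
    refine monotoneOn_of_deriv_nonneg (convex_Ici _)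
      (fun x hx => (hd x hx).continuousAt.continuousWithinAt)
      (fun x hx => (hd x (interior_subset hx)).differentiableAt.differentiableWithinAt) ?_
    intro x hx
    have hx' := interior_subset hx
    have hx0 : 0 < x := hp.density_pos.trans_le hx'
    rw [(hd x hx').deriv]
    have : deriv (deriv p) x / 2 + deriv p x / x
        = (2 * deriv p x + x * deriv (deriv p) x) / (2 * x) := by field_simp; ring
    rw [this]
    exact (div_pos (hp.genuine x hx') (by linarith)).le
  have := hmono (self_mem_Ici) (mem_Ici.2 hρ) hρ
  simpa [enthalpy] using this

lemma isCriticalDensity_iff (hp : IsPressureLaw p ρ₀ g) {s ρ : ℝ} :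
    IsCriticalDensity p ρ₀ g (stagnationHeight p ρ₀ g - s) ρ ↔
      0 < ρ ∧ deriv p ρ / 2 + enthalpy p ρ₀ ρ = g * s := by
  have := hp.gravity_mul_stagnationHeight
  unfold IsCriticalDensity
  rw [mul_sub, this]
  constructor <;> rintro ⟨h1, h2⟩ <;> exact ⟨h1, by linarith⟩

/-- Beyond the critical density at depth `s` the flow is subsonic. -/
lemma critical_pos (hp : IsPressureLaw p ρ₀ g) {s ρc ρ : ℝ} (hs : 0 ≤ s)
    (hs' : s < stagnationHeight p ρ₀ g)
    (hc : IsCriticalDensity p ρ₀ g (stagnationHeight p ρ₀ g - s) ρc) (hρ : ρc < ρ) :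
    g * s < deriv p ρ / 2 + enthalpy p ρ₀ ρ := by
  have huniq := hp.critical (stagnationHeight p ρ₀ g - s) ⟨by linarith, by linarith⟩
  have hgs : g * s < deriv p ρ₀ / 2 := by
    rw [← hp.gravity_mul_stagnationHeight]; exact mul_lt_mul_of_pos_left hs' hp.gravity_pos
  have hρ0 : 0 < ρ := hc.1.trans hρ
  by_contra! hle
  have hρlt : ρ < ρ₀ := by
    by_contra! h
    linarith [hp.half_deriv_le_critical h]
  have hcont : ContinuousOn (fun ρ => deriv p ρ / 2 + enthalpy p ρ₀ ρ) (Icc ρ ρ₀) :=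
    hp.continuousOn_critical.mono fun x hx => hρ0.trans_le hx.1
  obtain ⟨x, hx, hxe⟩ := intermediate_value_Icc hρlt.le hcont
    (show g * s ∈ Icc _ _ from ⟨hle, (hgs.le.trans (hp.half_deriv_le_critical le_rfl))⟩)
  have hxc : IsCriticalDensity p ρ₀ g (stagnationHeight p ρ₀ g - s) x :=
    hp.isCriticalDensity_iff.2 ⟨hρ0.trans_le hx.1, hxe⟩
  have := huniq.unique hxc hc
  linarith [hx.1]

end IsPressureLaw

/-- First order expansion of the constitutive functions at the stagnation level: in the range of
small squared momentum `t` and small depth `s` the functional `F(t; s) + λ(s) χ` is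
`(t + s χ) / ρ₀` up to terms of second order. -/
structure IsExpansion (p : ℝ → ℝ) (ρ₀ g η K : ℝ) : Prop where
  rho_pos : 0 < ρ₀
  eta_pos : 0 < η
  const_nonneg : 0 ≤ K
  lt_stagnationHeight : η < stagnationHeight p ρ₀ g
  continuousOn_dF₁ :
    ContinuousOn (fun z : ℝ × ℝ => dF₁ p ρ₀ g z.1 z.2) (Ioo (-η) η ×ˢ Ioo 0 η)
  continuousOn_dF₂ :
    ContinuousOn (fun z : ℝ × ℝ => dF₂ p ρ₀ g z.1 z.2) (Ioo (-η) η ×ˢ Ioo 0 η)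
  continuousOn_deriv_lam : ContinuousOn (deriv (lam p ρ₀ g)) (Ioo 0 η)
  hasFDerivAt_F : ∀ t ∈ Ioo (-η) η, ∀ s ∈ Ioo 0 η,
    HasFDerivAt (fun z : ℝ × ℝ => F p ρ₀ g z.1 z.2)
      (dF₁ p ρ₀ g t s • ContinuousLinearMap.fst ℝ ℝ ℝ
        + dF₂ p ρ₀ g t s • ContinuousLinearMap.snd ℝ ℝ ℝ) (t, s)
  hasDerivAt_lam : ∀ s ∈ Ioo 0 η, HasDerivAt (lam p ρ₀ g) (deriv (lam p ρ₀ g) s) s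
  dF₁_le : ∀ t ∈ Ioo (-η) η, ∀ s ∈ Ioo 0 η, |dF₁ p ρ₀ g t s - 1 / ρ₀| ≤ K * (|t| + s)
  F_le : ∀ t ∈ Ioo (-η) η, ∀ s ∈ Ioo 0 η, |F p ρ₀ g t s - t / ρ₀| ≤ K * ((|t| + s) * |t|)
  dF₂_le : ∀ t ∈ Ioo (-η) η, ∀ s ∈ Ioo 0 η, |dF₂ p ρ₀ g t s| ≤ K * |t|
  lam_le : ∀ s ∈ Ioo 0 η, |lam p ρ₀ g s - s / ρ₀| ≤ K * s ^ 2
  deriv_lam_le : ∀ s ∈ Ioo 0 η, |deriv (lam p ρ₀ g) s - 1 / ρ₀| ≤ K * s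

/-- Bernoulli's law solved for the squared momentum: the value of `t` for which the density at depth
`s` is `ρ`, in the normalised variables of `H`. -/
def momentum (p : ℝ → ℝ) (ρ₀ g ρ s : ℝ) : ℝ := (ρ / ρ₀) ^ 2 * (s - enthalpy p ρ₀ ρ / g)

namespace IsPressureLaw

variable {p : ℝ → ℝ} {ρ₀ g : ℝ}

lemma hasDerivAt_momentum (hp : IsPressureLaw p ρ₀ g) {ρ s : ℝ} (hρ : 0 < ρ) :
    HasDerivAt (fun ρ => momentum p ρ₀ g ρ s)
      (-(2 * ρ / (g * ρ₀ ^ 2)) * (deriv p ρ / 2 + enthalpy p ρ₀ ρ - g * s)) ρ := by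
  have h1 := (((hasDerivAt_id ρ).div_const ρ₀).pow 2).mul
    (((hp.hasDerivAt_enthalpy hρ).div_const g).const_sub s)
  refine h1.congr_deriv ?_
  have := hp.gravity_pos.ne'
  have := hp.density_pos.ne'
  have := hρ.ne'
  simp only [id, Pi.pow_apply]
  push_cast
  field_simp
  ring

lemma isSubsonicDensity_iff (hp : IsPressureLaw p ρ₀ g) {t s ρ : ℝ} :
    IsSubsonicDensity p ρ₀ g (2 * ρ₀ ^ 2 * g * t) (stagnationHeight p ρ₀ g - s) ρ ↔
      0 < ρ ∧ momentum p ρ₀ g ρ s = t ∧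
        ∃ ρc, IsCriticalDensity p ρ₀ g (stagnationHeight p ρ₀ g - s) ρc ∧ ρc < ρ := by
  unfold IsSubsonicDensity
  refine and_congr_right fun hρ => and_congr_left fun _ => ?_
  have hg := hp.gravity_pos.ne'
  have hρ0 := hp.density_pos.ne'
  have := hp.gravity_mul_stagnationHeight
  rw [mul_sub, this]
  unfold momentum
  constructor
  · intro h
    have h2 : enthalpy p ρ₀ ρ = g * s - 2 * ρ₀ ^ 2 * g * t / (2 * ρ ^ 2) := by linarith
    rw [h2]
    field_simp
    ring
  · rintro rfl
    field_simp
    ring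

/-- Bernoulli's law has at most one subsonic solution. -/
lemma H_eq (hp : IsPressureLaw p ρ₀ g) {t s ρ : ℝ} (hs : 0 ≤ s)
    (hs' : s < stagnationHeight p ρ₀ g)
    (hρ : IsSubsonicDensity p ρ₀ g (2 * ρ₀ ^ 2 * g * t) (stagnationHeight p ρ₀ g - s) ρ) :
    H p ρ₀ g t s = ρ := by
  have hex : ∃ ρ, IsSubsonicDensity p ρ₀ g (2 * ρ₀ ^ 2 * g * t) (stagnationHeight p ρ₀ g - s) ρ :=
    ⟨ρ, hρ⟩
  unfold H density
  rw [dif_pos hex]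
  obtain ⟨h0, hm, ρc, hc, hlt⟩ := hp.isSubsonicDensity_iff.1 hρ
  obtain ⟨h0', hm', ρc', hc', hlt'⟩ := hp.isSubsonicDensity_iff.1 hex.choose_spec
  have huniq := hp.critical (stagnationHeight p ρ₀ g - s) ⟨by linarith, by linarith⟩
  obtain rfl := huniq.unique hc hc'
  have hanti : StrictAntiOn (fun ρ => momentum p ρ₀ g ρ s) (Ioi ρc) := by
    refine strictAntiOn_of_deriv_neg (convex_Ioi _)
      (fun x hx => (hp.hasDerivAt_momentum (hc.1.trans hx)).continuousAt.continuousWithinAt) ?_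
    intro x hx
    rw [interior_Ioi] at hx
    have hx0 := hc.1.trans hx
    rw [(hp.hasDerivAt_momentum hx0).deriv]
    have h1 := hp.critical_pos hs hs' hc hx
    have h2 : 0 < 2 * x / (g * ρ₀ ^ 2) := by
      have := hp.gravity_pos; have := hp.density_pos; positivity
    nlinarith
  exact hanti.injOn hlt' hlt (hm'.trans hm.symm)

lemma contDiffAt_enthalpy (hp : IsPressureLaw p ρ₀ g) {ρ : ℝ} (hρ : 0 < ρ) :
    ContDiffAt ℝ 1 (enthalpy p ρ₀) ρ := by
  refine ContDiffOn.contDiffAt (s := Ioi 0) ?_ (Ioi_mem_nhds hρ)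
  rw [show (1 : WithTop ℕ∞) = 0 + 1 from rfl, contDiffOn_succ_iff_deriv_of_isOpen isOpen_Ioi]
  refine ⟨fun x hx => (hp.hasDerivAt_enthalpy hx).differentiableAt.differentiableWithinAt,
    by simp, ?_⟩
  rw [contDiffOn_zero]
  refine ContinuousOn.congr (f := fun s => deriv p s / s) ?_
    fun x hx => (hp.hasDerivAt_enthalpy hx).deriv
  exact hp.continuousOn_deriv.div continuousOn_id fun x hx => ne_of_gt hx

lemma contDiffAt_momentum (hp : IsPressureLaw p ρ₀ g) {ρ s : ℝ} (hρ : 0 < ρ) :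
    ContDiffAt ℝ 1 (fun z : ℝ × ℝ => momentum p ρ₀ g z.1 z.2) (ρ, s) := by
  unfold momentum
  have h1 : ContDiffAt ℝ 1 (fun z : ℝ × ℝ => enthalpy p ρ₀ z.1) (ρ, s) :=
    (hp.contDiffAt_enthalpy hρ).comp (ρ, s) contDiffAt_fst
  exact ((contDiffAt_fst.div_const _).pow 2).mul (contDiffAt_snd.sub (h1.div_const _))

/-- Near the stagnation level the subsonic density is a `C¹` function of squared momentum and depth,
which solves Bernoulli's law also at (fictitious) small negative arguments. -/
lemma exists_density_chart (hp : IsPressureLaw p ρ₀ g) :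
    ∃ G : ℝ × ℝ → ℝ, ContDiffAt ℝ 1 G 0 ∧ G 0 = ρ₀ ∧
      ∀ᶠ z in 𝓝 (0 : ℝ × ℝ), momentum p ρ₀ g (G z) z.2 = z.1 ∧ 0 < G z ∧
        (0 ≤ z.2 → H p ρ₀ g z.1 z.2 = G z) := by
  have hρ := hp.density_pos
  have hg := hp.gravity_pos
  have hp0 := hp.deriv_pos ρ₀ le_rfl
  have hent : enthalpy p ρ₀ ρ₀ = 0 := by simp [enthalpy]
  set f : (ℝ × ℝ) × ℝ → ℝ := fun z => momentum p ρ₀ g z.2 z.1.2 - z.1.1 with hf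
  have hcd : ContDiffAt ℝ 1 f ((0 : ℝ × ℝ), ρ₀) := by
    have h1 : ContDiffAt ℝ 1 (fun z : (ℝ × ℝ) × ℝ => momentum p ρ₀ g z.2 z.1.2)
        ((0 : ℝ × ℝ), ρ₀) :=
      ContDiffAt.comp (g := fun z : ℝ × ℝ => momentum p ρ₀ g z.1 z.2)
        (f := fun z : (ℝ × ℝ) × ℝ => (z.2, z.1.2)) _ (hp.contDiffAt_momentum hρ) (by fun_prop)
    exact h1.sub (by fun_prop)
  set c : ℝ := -(2 * ρ₀ / (g * ρ₀ ^ 2)) * (deriv p ρ₀ / 2) with hc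
  have hc0 : c ≠ 0 := by
    rw [hc]
    have : 0 < (2 * ρ₀ / (g * ρ₀ ^ 2)) * (deriv p ρ₀ / 2) := by positivity
    linarith
  have hder : (fderiv ℝ f ((0 : ℝ × ℝ), ρ₀) ∘L .inr ℝ (ℝ × ℝ) ℝ) =
      (ContinuousLinearEquiv.smulLeft (Units.mk0 c hc0) : ℝ ≃L[ℝ] ℝ) := by
    ext
    have h1 : HasDerivAt (fun ρ : ℝ => f ((0 : ℝ × ℝ), ρ))
        (fderiv ℝ f ((0 : ℝ × ℝ), ρ₀) ((0 : ℝ × ℝ), 1)) ρ₀ :=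
      (hcd.differentiableAt (by norm_num)).hasFDerivAt.comp_hasDerivAt ρ₀
        ((hasDerivAt_const ρ₀ (0 : ℝ × ℝ)).prodMk (hasDerivAt_id ρ₀))
    have h2 : HasDerivAt (fun ρ : ℝ => f ((0 : ℝ × ℝ), ρ)) c ρ₀ := by
      have := hp.hasDerivAt_momentum (s := 0) hρ
      simpa [hf, hc, hent] using this
    simpa using h1.unique h2
  have hinv : (fderiv ℝ f ((0 : ℝ × ℝ), ρ₀) ∘L .inr ℝ (ℝ × ℝ) ℝ).IsInvertible := ⟨_, hder.symm⟩
  set G := hcd.implicitFunction (by norm_num) hinv with hG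
  have hG0 : G 0 = ρ₀ := hcd.implicitFunction_apply_self (by norm_num) hinv
  have hGc : ContDiffAt ℝ 1 G 0 := hcd.contDiffAt_implicitFunction (by norm_num) hinv
  refine ⟨G, hGc, hG0, ?_⟩
  have hf0 : f ((0 : ℝ × ℝ), ρ₀) = 0 := by simp [hf, momentum, hent]
  have e1 := hcd.eventually_apply_implicitFunction (by norm_num) hinv
  have hcrit : ∀ᶠ ρ in 𝓝 ρ₀, deriv p ρ₀ / 4 < deriv p ρ / 2 + enthalpy p ρ₀ ρ := by
    have := (hp.continuousOn_critical.continuousAt (Ioi_mem_nhds hρ))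
    refine this.eventually (lt_mem_nhds ?_)
    show _ < deriv p ρ₀ / 2 + enthalpy p ρ₀ ρ₀
    rw [hent]; linarith
  obtain ⟨δ, hδ, hball⟩ := Metric.eventually_nhds_iff.1 hcrit
  have hGt : Tendsto G (𝓝 0) (𝓝 ρ₀) := hG0 ▸ hGc.continuousAt.tendsto
  have e2 : ∀ᶠ z in 𝓝 (0 : ℝ × ℝ), dist (G z) ρ₀ < δ := hGt (ball_mem_nhds _ hδ)
  have e3 : ∀ᶠ z in 𝓝 (0 : ℝ × ℝ), 0 < G z := hGt (lt_mem_nhds hρ)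
  have hst : Tendsto (fun z : ℝ × ℝ => z.2) (𝓝 0) (𝓝 0) := continuous_snd.tendsto' _ _ rfl
  have e4 : ∀ᶠ z in 𝓝 (0 : ℝ × ℝ), z.2 < stagnationHeight p ρ₀ g / 2 :=
    hst (gt_mem_nhds (half_pos hp.stagnationHeight_pos))
  filter_upwards [e1, e2, e3, e4] with z h1 h2 h3 h4
  have hm : momentum p ρ₀ g (G z) z.2 = z.1 := by
    have h1' : f (z, G z) = f ((0 : ℝ × ℝ), ρ₀) := h1
    rw [hf0] at h1'
    have : momentum p ρ₀ g (G z) z.2 - z.1 = 0 := h1'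
    linarith
  have hgs : g * z.2 < deriv p ρ₀ / 4 := by
    have := mul_lt_mul_of_pos_left h4 hg
    have h5 := hp.gravity_mul_stagnationHeight
    linarith
  refine ⟨hm, h3, fun hs => ?_⟩
  have hs' : z.2 < stagnationHeight p ρ₀ g := by linarith [hp.stagnationHeight_pos]
  refine hp.H_eq hs hs' (hp.isSubsonicDensity_iff.2 ⟨h3, hm, ?_⟩)
  obtain ⟨ρc, hρc, -⟩ := hp.critical (stagnationHeight p ρ₀ g - z.2) ⟨by linarith, by linarith⟩
  refine ⟨ρc, hρc, ?_⟩
  by_contra! hle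
  obtain ⟨hc0, hce⟩ := hp.isCriticalDensity_iff.1 hρc
  rcases le_total ρ₀ ρc with h | h
  · linarith [hp.half_deriv_le_critical h]
  · have : dist ρc ρ₀ < δ := by
      rw [Real.dist_eq, abs_lt] at h2 ⊢
      constructor <;> linarith [h2.1, h2.2]
    linarith [hball this]

/-- On the free surface Bernoulli's law gives back the surface density. -/
lemma H_self (hp : IsPressureLaw p ρ₀ g) {s : ℝ} (hs : 0 ≤ s)
    (hs' : s < stagnationHeight p ρ₀ g) : H p ρ₀ g s s = ρ₀ := by
  have hgs : g * s < deriv p ρ₀ / 2 := by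
    rw [← hp.gravity_mul_stagnationHeight]; exact mul_lt_mul_of_pos_left hs' hp.gravity_pos
  refine hp.H_eq hs hs' (hp.isSubsonicDensity_iff.2 ⟨hp.density_pos, ?_, ?_⟩)
  · have := hp.density_pos.ne'
    simp [momentum, enthalpy, this]
  · obtain ⟨ρc, hρc, -⟩ := hp.critical (stagnationHeight p ρ₀ g - s) ⟨by linarith, by linarith⟩
    refine ⟨ρc, hρc, ?_⟩
    by_contra! h
    linarith [hp.half_deriv_le_critical h, (hp.isCriticalDensity_iff.1 hρc).2]

/-- A primitive of `1 / H` in the first variable, evaluated along the density chart `G`. -/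
lemma hasFDerivAt_primitive (hp : IsPressureLaw p ρ₀ g) {G : ℝ × ℝ → ℝ} {z : ℝ × ℝ}
    (hG : DifferentiableAt ℝ G z)
    (hm : ∀ᶠ y in 𝓝 z, momentum p ρ₀ g (G y) y.2 = y.1) (hpos : 0 < G z) :
    HasFDerivAt (fun y : ℝ × ℝ =>
        (2 * G y * (y.2 - enthalpy p ρ₀ (G y) / g) + p (G y) / g) / ρ₀ ^ 2)
      ((1 / G z) • ContinuousLinearMap.fst ℝ ℝ ℝ
        + (G z / ρ₀ ^ 2) • ContinuousLinearMap.snd ℝ ℝ ℝ) z := by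
  have hg := hp.gravity_pos.ne'
  have hρ := hp.density_pos.ne'
  have hG' := hG.hasFDerivAt
  have hh : HasFDerivAt (fun y => enthalpy p ρ₀ (G y)) _ z :=
    (hp.hasDerivAt_enthalpy hpos).comp_hasFDerivAt z hG'
  have hpp : HasFDerivAt (fun y => p (G y)) _ z := (hp.hasDerivAt hpos).comp_hasFDerivAt z hG'
  have hs : HasFDerivAt (fun y : ℝ × ℝ => y.2) (ContinuousLinearMap.snd ℝ ℝ ℝ) z := hasFDerivAt_snd
  have hmom : HasFDerivAt (fun y => momentum p ρ₀ g (G y) y.2) _ z :=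
    ((hG'.mul_const (ρ₀⁻¹)).pow 2).mul (hs.sub (hh.mul_const g⁻¹))
  have hid : HasFDerivAt (fun y => momentum p ρ₀ g (G y) y.2) (ContinuousLinearMap.fst ℝ ℝ ℝ) z :=
    hasFDerivAt_fst.congr_of_eventuallyEq hm
  have key := hmom.unique hid
  have hK := ((((hG'.const_mul 2).mul (hs.sub (hh.mul_const g⁻¹))).add (hpp.mul_const g⁻¹)).mul_const
    ((ρ₀ ^ 2)⁻¹))
  refine hK.congr_fderiv ?_
  ext
  · have k1 := DFunLike.congr_fun key (1, 0)
    simp at k1 ⊢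
    field_simp at k1 ⊢
    linarith
  · have k1 := DFunLike.congr_fun key (0, 1)
    simp at k1 ⊢
    field_simp at k1 ⊢
    have k2 := (mul_eq_zero.1 (k1.trans (mul_zero _))).resolve_left hpos.ne'
    linarith

lemma exists_isExpansion (hp : IsPressureLaw p ρ₀ g) : ∃ η K, IsExpansion p ρ₀ g η K := by
  have hρ := hp.density_pos
  obtain ⟨G, hGc, hG0, hev⟩ := hp.exists_density_chart
  obtain ⟨L, W, hW, hLip⟩ := hGc.exists_lipschitzOnWith
  have hhalf : ∀ᶠ z in 𝓝 (0 : ℝ × ℝ), ρ₀ / 2 < G z :=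
    hGc.continuousAt.eventually (by rw [hG0]; exact lt_mem_nhds (by linarith))
  have hdiff : ∀ᶠ z in 𝓝 (0 : ℝ × ℝ), ContDiffAt ℝ 1 G z := hGc.eventually (by simp)
  have hst : ∀ᶠ z in 𝓝 (0 : ℝ × ℝ), z.2 < stagnationHeight p ρ₀ g / 2 :=
    (continuous_snd.tendsto' _ _ rfl : Tendsto (fun z : ℝ × ℝ => z.2) (𝓝 0) (𝓝 0))
      (gt_mem_nhds (half_pos hp.stagnationHeight_pos))
  obtain ⟨η, hη, hall⟩ := Metric.eventually_nhds_iff.1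
    ((hev.and hhalf).and ((hdiff.and hst).and hW))
  have hbox : ∀ t s : ℝ, |t| < η → |s| < η → dist ((t, s) : ℝ × ℝ) 0 < η := by
    intro t s h1 h2
    rw [dist_zero_right, Prod.norm_def]
    exact max_lt h1 h2
  have hmem : ∀ t ∈ Ioo (-η) η, ∀ s ∈ Ioo (-η) η, dist ((t, s) : ℝ × ℝ) 0 < η :=
    fun t ht s hs => hbox t s (abs_lt.2 ht) (abs_lt.2 hs)
  have hopen : IsOpen (Ioo (-η) η ×ˢ Ioo (-η) η : Set (ℝ × ℝ)) := isOpen_Ioo.prod isOpen_Ioo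
  have hz0 : (0 : ℝ) ∈ Ioo (-η) η := ⟨by linarith, hη⟩
  have hsub : ∀ s ∈ Ioo 0 η, s ∈ Ioo (-η) η := fun s hs => ⟨by linarith [hs.1], hs.2⟩
  -- everything is expressed through the chart
  have hH : ∀ t ∈ Ioo (-η) η, ∀ s ∈ Ioo 0 η, H p ρ₀ g t s = G (t, s) := fun t ht s hs =>
    (hall (hmem t ht s (hsub s hs))).1.1.2.2 hs.1.le
  have hd1 : ∀ t ∈ Ioo (-η) η, ∀ s ∈ Ioo 0 η, dF₁ p ρ₀ g t s = 1 / G (t, s) := fun t ht s hs => by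
    rw [dF₁, hH t ht s hs]
  have hGpos : ∀ t ∈ Ioo (-η) η, ∀ s ∈ Ioo (-η) η, 0 < G (t, s) := fun t ht s hs =>
    (hall (hmem t ht s hs)).1.1.2.1
  set Q : ℝ × ℝ → ℝ := fun y =>
    (2 * G y * (y.2 - enthalpy p ρ₀ (G y) / g) + p (G y) / g) / ρ₀ ^ 2 with hQ
  have hQd : ∀ t ∈ Ioo (-η) η, ∀ s ∈ Ioo (-η) η, HasFDerivAt Q
      ((1 / G (t, s)) • ContinuousLinearMap.fst ℝ ℝ ℝ
        + (G (t, s) / ρ₀ ^ 2) • ContinuousLinearMap.snd ℝ ℝ ℝ) (t, s) := by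
    intro t ht s hs
    have h := hall (hmem t ht s hs)
    refine hp.hasFDerivAt_primitive (h.2.1.1.differentiableAt (by norm_num)) ?_ h.1.1.2.1
    filter_upwards [hopen.mem_nhds (⟨ht, hs⟩ : (t, s) ∈ Ioo (-η) η ×ˢ Ioo (-η) η)] with y hy
    exact (hall (hmem y.1 hy.1 y.2 hy.2)).1.1.1
  have hGcont : ∀ t ∈ Ioo (-η) η, ∀ s ∈ Ioo (-η) η, ContinuousAt G (t, s) := fun t ht s hs =>
    (hall (hmem t ht s hs)).2.1.1.continuousAt
  have hseg : ∀ t ∈ Ioo (-η) η, uIcc 0 t ⊆ Ioo (-η) η := fun t ht =>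
    ordConnected_Ioo.uIcc_subset hz0 ht
  have hint : ∀ t ∈ Ioo (-η) η, ∀ s ∈ Ioo 0 η,
      IntervalIntegrable (fun τ => 1 / H p ρ₀ g τ s) volume 0 t := by
    intro t ht s hs
    refine (ContinuousOn.congr (f := fun τ => 1 / G (τ, s)) (fun τ hτ => ?_)
      fun τ hτ => by simp only [hH τ (hseg t ht hτ) s hs]).intervalIntegrable
    refine ContinuousAt.continuousWithinAt (continuousAt_const.div ?_
      (hGpos τ (hseg t ht hτ) s (hsub s hs)).ne')
    exact ContinuousAt.comp (f := fun τ : ℝ => (τ, s)) (hGcont τ (hseg t ht hτ) s (hsub s hs))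
      (by fun_prop)
  have hF : ∀ t ∈ Ioo (-η) η, ∀ s ∈ Ioo 0 η, F p ρ₀ g t s = Q (t, s) - Q (0, s) := by
    intro t ht s hs
    have hder : ∀ τ ∈ uIcc 0 t, HasDerivAt (fun τ => Q (τ, s)) (1 / H p ρ₀ g τ s) τ := by
      intro τ hτ
      have : HasDerivAt (fun τ => Q (τ, s)) _ τ :=
        HasFDerivAt.comp_hasDerivAt (f := fun τ : ℝ => (τ, s)) τ (hQd τ (hseg t ht hτ) s (hsub s hs))
          ((hasDerivAt_id' τ).prodMk (hasDerivAt_const τ s))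
      rw [hH τ (hseg t ht hτ) s hs]
      simpa using this
    exact intervalIntegral.integral_eq_sub_of_hasDerivAt hder (hint t ht s hs)
  have hFd : ∀ t ∈ Ioo (-η) η, ∀ s ∈ Ioo 0 η, HasFDerivAt (fun z : ℝ × ℝ => F p ρ₀ g z.1 z.2)
      ((1 / G (t, s)) • ContinuousLinearMap.fst ℝ ℝ ℝ
        + ((G (t, s) - G (0, s)) / ρ₀ ^ 2) • ContinuousLinearMap.snd ℝ ℝ ℝ) (t, s) := by
    intro t ht s hs
    have h1 := hQd t ht s (hsub s hs)
    have h2 :=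
      HasFDerivAt.comp (g := Q) (f := fun z : ℝ × ℝ => ((0 : ℝ), z.2)) (t, s)
        (hQd 0 hz0 s (hsub s hs)) ((hasFDerivAt_const (0 : ℝ) (t, s)).prodMk
          (hasFDerivAt_snd : HasFDerivAt Prod.snd (ContinuousLinearMap.snd ℝ ℝ ℝ) (t, s)))
    have h3 := h1.sub h2
    refine HasFDerivAt.congr_fderiv (h3.congr_of_eventuallyEq ?_) ?_
    · filter_upwards [(isOpen_Ioo.prod isOpen_Ioo).mem_nhds
        (⟨ht, hs⟩ : (t, s) ∈ Ioo (-η) η ×ˢ Ioo 0 η)] with y hy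
      exact hF y.1 hy.1 y.2 hy.2
    · ext <;> simp
      ring
  have hd2 : ∀ t ∈ Ioo (-η) η, ∀ s ∈ Ioo 0 η,
      dF₂ p ρ₀ g t s = (G (t, s) - G (0, s)) / ρ₀ ^ 2 := by
    intro t ht s hs
    have : HasDerivAt (fun s' => F p ρ₀ g t s') _ s :=
      (hFd t ht s hs).comp_hasDerivAt s ((hasDerivAt_const s t).prodMk (hasDerivAt_id' s))
    have h2 : HasDerivAt (fun s' => F p ρ₀ g t s') ((G (t, s) - G (0, s)) / ρ₀ ^ 2) s := by
      simpa using this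
    exact h2.deriv
  have hLipG : ∀ t ∈ Ioo (-η) η, ∀ s ∈ Ioo (-η) η, ∀ t' ∈ Ioo (-η) η, ∀ s' ∈ Ioo (-η) η,
      |G (t, s) - G (t', s')| ≤ L * max |t - t'| |s - s'| := by
    intro t ht s hs t' ht' s' hs'
    have := hLip.dist_le_mul _ (hall (hmem t ht s hs)).2.2 _ (hall (hmem t' ht' s' hs')).2.2
    simpa [Prod.dist_eq, Real.dist_eq] using this
  have hst' : η < stagnationHeight p ρ₀ g := by
    by_contra! hcon
    have hy := hp.stagnationHeight_pos
    have := (hall (hmem 0 hz0 (stagnationHeight p ρ₀ g / 2) ⟨by linarith, by linarith⟩)).2.1.2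
    exact lt_irrefl _ this
  have hself : ∀ s ∈ Ioo 0 η, G (s, s) = ρ₀ := fun s hs => by
    rw [← hH s (hsub s hs) s hs]; exact hp.H_self hs.1.le (hs.2.trans hst')
  have hlam : ∀ s ∈ Ioo 0 η, lam p ρ₀ g s = 2 * s / ρ₀ - F p ρ₀ g s s := fun s hs => by
    rw [lam, Lam, hd1 s (hsub s hs) s hs, hself s hs]; ring
  have hlamd : ∀ s ∈ Ioo 0 η,
      HasDerivAt (lam p ρ₀ g) (1 / ρ₀ - (ρ₀ - G (0, s)) / ρ₀ ^ 2) s := by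
    intro s hs
    have h1 : HasDerivAt (fun s => F p ρ₀ g s s) _ s :=
      HasFDerivAt.comp_hasDerivAt (f := fun s : ℝ => (s, s)) s (hFd s (hsub s hs) s hs)
        ((hasDerivAt_id' s).prodMk (hasDerivAt_id' s))
    have h2 : HasDerivAt (fun s => 2 * s / ρ₀) (2 / ρ₀) s := by
      simpa using ((hasDerivAt_id s).const_mul 2).div_const ρ₀
    have h3 := (h2.sub h1).congr_of_eventuallyEq (f₁ := lam p ρ₀ g) (by
      filter_upwards [isOpen_Ioo.mem_nhds hs] with y hy
      exact hlam y hy)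
    refine h3.congr_deriv ?_
    simp [hself s hs]
    ring
  set L' : ℝ := (L : ℝ) with hL'
  have hL0 : 0 ≤ L' := L.2
  have hd1b : ∀ t ∈ Ioo (-η) η, ∀ s ∈ Ioo 0 η,
      |dF₁ p ρ₀ g t s - 1 / ρ₀| ≤ 2 * L' / ρ₀ ^ 2 * (|t| + s) := by
    intro t ht s hs
    have h1 := (hall (hmem t ht s (hsub s hs))).1.2
    have h2 := hLipG t ht s (hsub s hs) 0 hz0 0 hz0
    have h3 : max |t - 0| |s - 0| ≤ |t| + s := by
      rw [sub_zero, sub_zero, abs_of_pos hs.1]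
      exact max_le (by linarith [hs.1]) (by linarith [abs_nonneg t])
    rw [show G (0, 0) = ρ₀ from hG0] at h2
    rw [hd1 t ht s hs, div_sub_div _ _ (by linarith) hρ.ne', abs_div, one_mul, mul_one, abs_sub_comm,
      abs_of_pos (mul_pos (by linarith : 0 < G (t, s)) hρ), div_le_iff₀ (mul_pos (by linarith) hρ)]
    have h4 : L' * max |t - 0| |s - 0| ≤ L' * (|t| + s) := mul_le_mul_of_nonneg_left h3 hL0
    have h5 : 0 ≤ L' * (|t| + s) := mul_nonneg hL0 (by linarith [abs_nonneg t, hs.1])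
    calc |G (t, s) - ρ₀| ≤ L' * (|t| + s) := h2.trans h4
      _ = 2 * L' / ρ₀ ^ 2 * (|t| + s) * (ρ₀ / 2 * ρ₀) := by field_simp
      _ ≤ _ := by
        refine mul_le_mul_of_nonneg_left (mul_le_mul_of_nonneg_right h1.le hρ.le) ?_
        have : 0 ≤ |t| + s := by linarith [abs_nonneg t, hs.1]
        positivity
  have hFb : ∀ t ∈ Ioo (-η) η, ∀ s ∈ Ioo 0 η,
      |F p ρ₀ g t s - t / ρ₀| ≤ 2 * L' / ρ₀ ^ 2 * ((|t| + s) * |t|) := by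
    intro t ht s hs
    have h1 : F p ρ₀ g t s - t / ρ₀ = ∫ τ in (0 : ℝ)..t, (1 / H p ρ₀ g τ s - 1 / ρ₀) := by
      rw [intervalIntegral.integral_sub (hint t ht s hs) (by simp)]
      simp [F]; ring
    have h2 : ∀ τ ∈ uIoc 0 t, ‖1 / H p ρ₀ g τ s - 1 / ρ₀‖ ≤ 2 * L' / ρ₀ ^ 2 * (|t| + s) := by
      intro τ hτ
      have hτ' := uIoc_subset_uIcc hτ
      have h3 := hd1b τ (hseg t ht hτ') s hs
      rw [dF₁] at h3
      have h4 : |τ| ≤ |t| := by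
        have := abs_sub_left_of_mem_uIcc hτ'
        simpa using this
      rw [Real.norm_eq_abs]
      refine h3.trans (mul_le_mul_of_nonneg_left (by linarith) (by positivity))
    have h5 := intervalIntegral.norm_integral_le_of_norm_le_const h2
    rw [h1]
    calc _ ≤ _ := h5
      _ = _ := by rw [sub_zero]; ring
  have hd2b : ∀ t ∈ Ioo (-η) η, ∀ s ∈ Ioo 0 η, |dF₂ p ρ₀ g t s| ≤ L' / ρ₀ ^ 2 * |t| := by
    intro t ht s hs
    have h2 := hLipG t ht s (hsub s hs) 0 hz0 s (hsub s hs)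
    rw [hd2 t ht s hs, abs_div, abs_of_pos (pow_pos hρ 2), div_mul_eq_mul_div]
    refine div_le_div_of_nonneg_right ?_ (pow_pos hρ 2).le
    simpa using h2
  have hmonoK : L' / ρ₀ ^ 2 ≤ 4 * L' / ρ₀ ^ 2 :=
    div_le_div_of_nonneg_right (by linarith) (by positivity)
  have hmonoK' : 2 * L' / ρ₀ ^ 2 ≤ 4 * L' / ρ₀ ^ 2 :=
    div_le_div_of_nonneg_right (by linarith) (by positivity)
  refine ⟨η, 4 * L' / ρ₀ ^ 2, hρ, hη, by positivity, hst', ?_, ?_, ?_, fun t ht s hs => ?_,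
    fun s hs => ?_, fun t ht s hs => ?_, fun t ht s hs => ?_, fun t ht s hs => ?_, fun s hs => ?_,
    fun s hs => ?_⟩
  · refine ContinuousOn.congr (f := fun z => 1 / G z) ?_ fun z hz => hd1 z.1 hz.1 z.2 hz.2
    intro z hz
    exact (continuousAt_const.div (hGcont z.1 hz.1 z.2 (hsub _ hz.2))
      (hGpos z.1 hz.1 z.2 (hsub _ hz.2)).ne').continuousWithinAt
  · refine ContinuousOn.congr (f := fun z => (G z - G (0, z.2)) / ρ₀ ^ 2) ?_
      fun z hz => hd2 z.1 hz.1 z.2 hz.2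
    intro z hz
    refine ContinuousAt.continuousWithinAt (ContinuousAt.div_const (ContinuousAt.sub
      (hGcont z.1 hz.1 z.2 (hsub _ hz.2)) ?_) _)
    exact ContinuousAt.comp (f := fun z : ℝ × ℝ => ((0 : ℝ), z.2)) (hGcont 0 hz0 z.2 (hsub _ hz.2))
      (by fun_prop)
  · refine ContinuousOn.congr (f := fun s => 1 / ρ₀ - (ρ₀ - G (0, s)) / ρ₀ ^ 2) ?_
      fun s hs => (hlamd s hs).deriv
    intro s hs
    refine ContinuousAt.continuousWithinAt (continuousAt_const.sub (ContinuousAt.div_const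
      (continuousAt_const.sub ?_) _))
    exact ContinuousAt.comp (f := fun s : ℝ => ((0 : ℝ), s)) (hGcont 0 hz0 s (hsub _ hs))
      (by fun_prop)
  · rw [hd1 t ht s hs, hd2 t ht s hs]; exact hFd t ht s hs
  · exact (hlamd s hs).differentiableAt.hasDerivAt
  · exact (hd1b t ht s hs).trans
      (mul_le_mul_of_nonneg_right hmonoK' (by linarith [abs_nonneg t, hs.1]))
  · have hts : 0 ≤ |t| + s := by linarith [abs_nonneg t, hs.1]
    exact (hFb t ht s hs).trans (mul_le_mul_of_nonneg_right hmonoK' (by positivity))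
  · exact (hd2b t ht s hs).trans (mul_le_mul_of_nonneg_right hmonoK (abs_nonneg t))
  · have h1 := hFb s (hsub s hs) s hs
    rw [abs_of_pos hs.1] at h1
    rw [hlam s hs, show 2 * s / ρ₀ - F p ρ₀ g s s - s / ρ₀ = -(F p ρ₀ g s s - s / ρ₀) by ring, abs_neg]
    exact h1.trans (le_of_eq (by ring))
  · rw [(hlamd s hs).deriv]
    have h2 := hLipG 0 hz0 s (hsub s hs) 0 hz0 0 hz0
    rw [show G (0, 0) = ρ₀ from hG0, sub_self, abs_zero, sub_zero, abs_of_pos hs.1,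
      max_eq_right hs.1.le] at h2
    rw [show 1 / ρ₀ - (ρ₀ - G (0, s)) / ρ₀ ^ 2 - 1 / ρ₀ = (G (0, s) - ρ₀) / ρ₀ ^ 2 by ring, abs_div,
      abs_of_pos (pow_pos hρ 2)]
    calc |G (0, s) - ρ₀| / ρ₀ ^ 2 ≤ L' * s / ρ₀ ^ 2 :=
          div_le_div_of_nonneg_right h2 (pow_pos hρ 2).le
      _ = L' / ρ₀ ^ 2 * s := by ring
      _ ≤ _ := mul_le_mul_of_nonneg_right hmonoK hs.1.le

end IsPressureLaw

/-! ### Integration by parts in the plane -/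

lemma abs_divergence_le (φ : Plane → Plane) (x : Plane) :
    |divergence φ x| ≤ 2 * ‖fderiv ℝ φ x‖ := by
  have h : ∀ i : Fin 2, |(fderiv ℝ φ x (EuclideanSpace.single i 1)) i| ≤ ‖fderiv ℝ φ x‖ := by
    intro i
    have h1 := PiLp.norm_apply_le (fderiv ℝ φ x (EuclideanSpace.single i 1)) i
    have h2 := (fderiv ℝ φ x).le_opNorm (EuclideanSpace.single i (1 : ℝ))
    simp only [PiLp.norm_single, norm_one, mul_one] at h2
    exact h1.trans h2
  unfold divergence
  rw [Fin.sum_univ_two]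
  linarith [abs_add_le ((fderiv ℝ φ x (EuclideanSpace.single 0 1)) 0)
    ((fderiv ℝ φ x (EuclideanSpace.single 1 1)) 1), h 0, h 1]

lemma continuous_divergence {φ : Plane → Plane} (hφ : ContDiff ℝ 1 φ) :
    Continuous (divergence φ) := by
  have := hφ.continuous_fderiv (by norm_num)
  unfold divergence
  fun_prop

lemma divergence_eq_zero_of_notMem {φ : Plane → Plane} {x : Plane} (hx : x ∉ tsupport φ) :
    divergence φ x = 0 := by
  have : fderiv ℝ φ x = 0 := fderiv_of_notMem_tsupport ℝ hx
  simp [divergence, this]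

lemma hasCompactSupport_divergence {φ : Plane → Plane} (hφ : HasCompactSupport φ) :
    HasCompactSupport (divergence φ) :=
  HasCompactSupport.intro hφ fun _ hx => divergence_eq_zero_of_notMem hx

lemma integral_fderiv_apply_eq_zero {f : Plane → ℝ} (hf : ContDiff ℝ 1 f)
    (hc : HasCompactSupport f) (v : Plane) : ∫ x, fderiv ℝ f x v = 0 := by
  have hcont : Continuous fun x => fderiv ℝ f x v :=
    (hf.continuous_fderiv (by norm_num)).clm_apply continuous_const
  have hcs : HasCompactSupport fun x => fderiv ℝ f x v := hc.fderiv_apply ℝ v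
  have h := integral_mul_fderiv_eq_neg_fderiv_mul_of_integrable (μ := (volume : Measure Plane))
    (f := fun _ => (1 : ℝ)) (g := f) (v := v) (by simp)
    (by simpa using hcont.integrable_of_hasCompactSupport hcs)
    (by simpa using hf.continuous.integrable_of_hasCompactSupport hc)
    (fun x _ => differentiableAt_const _) (fun x _ => hf.differentiable (by norm_num) x)
  simpa using h

lemma integral_divergence_eq_zero {φ : Plane → Plane} (hφ : ContDiff ℝ 1 φ)
    (hc : HasCompactSupport φ) : ∫ x, divergence φ x = 0 := by
  have hi : ∀ i : Fin 2, ContDiff ℝ 1 (fun x => φ x i) := fun i => by fun_prop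
  have hci : ∀ i : Fin 2, HasCompactSupport (fun x => φ x i) := fun i =>
    hc.comp_left (g := fun y : Plane => y i) rfl
  have hd : ∀ (i : Fin 2) x v, fderiv ℝ (fun x => φ x i) x v = (fderiv ℝ φ x v) i := by
    intro i x v
    have := ((EuclideanSpace.proj i : Plane →L[ℝ] ℝ).hasFDerivAt.comp x
      (hφ.differentiable (by norm_num) x).hasFDerivAt)
    have h2 : HasFDerivAt (fun x => φ x i) _ x := this
    rw [h2.fderiv]; rfl
  unfold divergence
  rw [integral_finsetSum]
  · refine Finset.sum_eq_zero fun i _ => ?_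
    rw [← integral_fderiv_apply_eq_zero (hi i) (hci i) (EuclideanSpace.single i 1)]
    exact integral_congr_ae (.of_forall fun x => (hd i x _).symm)
  · intro i _
    refine Continuous.integrable_of_hasCompactSupport ?_ ?_
    · have := hφ.continuous_fderiv (by norm_num)
      fun_prop
    · exact (hc.fderiv_apply ℝ (EuclideanSpace.single i 1)).comp_left
        (g := fun y : Plane => y i) rfl

lemma plane_eq_sum (y : Plane) :
    y = ∑ i : Fin 2, y i • (EuclideanSpace.single i 1 : Plane) := by
  ext j
  fin_cases j <;> simp [Fin.sum_univ_two]

lemma divergence_smul {a : Plane → ℝ} {φ : Plane → Plane} {x : Plane}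
    (ha : DifferentiableAt ℝ a x) (hφ : DifferentiableAt ℝ φ x) :
    divergence (fun y => a y • φ y) x = a x * divergence φ x + fderiv ℝ a x (φ x) := by
  have h : fderiv ℝ (fun y => a y • φ y) x = _ := (ha.hasFDerivAt.smul hφ.hasFDerivAt).fderiv
  have h2 : fderiv ℝ a x (φ x) = ∑ i : Fin 2, φ x i * fderiv ℝ a x (EuclideanSpace.single i 1) := by
    conv_lhs => rw [plane_eq_sum (φ x)]
    simp
  unfold divergence
  rw [h, h2, Finset.mul_sum, ← Finset.sum_add_distrib]
  refine Finset.sum_congr rfl fun i _ => ?_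
  simp
  ring

lemma contDiff_of_tsupport {E F : Type*} [NormedAddCommGroup E] [NormedSpace ℝ E]
    [NormedAddCommGroup F] [NormedSpace ℝ F] {f : E → F} {n : WithTop ℕ∞}
    (h : ∀ x ∈ tsupport f, ContDiffAt ℝ n f x) : ContDiff ℝ n f := by
  rw [contDiff_iff_contDiffAt]
  intro x
  by_cases hx : x ∈ tsupport f
  · exact h x hx
  · exact (contDiffAt_const (c := (0 : F))).congr_of_eventuallyEq (notMem_tsupport_iff_eventuallyEq.1 hx)

/-- Integration by parts for a function that is `C¹` near the support of the test field. -/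
lemma integral_mul_divergence_add {a : Plane → ℝ} {φ : Plane → Plane} {W : Set Plane}
    (hW : IsOpen W) (ha : ContDiffOn ℝ 1 a W) (hφ : ContDiff ℝ 1 φ) (hc : HasCompactSupport φ)
    (hs : tsupport φ ⊆ W) : ∫ x, (a x * divergence φ x + fderiv ℝ a x (φ x)) = 0 := by
  have hsub : tsupport (fun y => a y • φ y) ⊆ tsupport φ := tsupport_smul_subset_right a φ
  have hcd : ContDiff ℝ 1 (fun y => a y • φ y) := contDiff_of_tsupport fun x hx =>
    (ha.contDiffAt (hW.mem_nhds (hs (hsub hx)))).smul hφ.contDiffAt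
  rw [← integral_divergence_eq_zero hcd (hc.mono' (subset_trans subset_closure hsub))]
  refine integral_congr_ae (.of_forall fun x => ?_)
  by_cases hx : x ∈ tsupport φ
  · exact (divergence_smul ((ha.contDiffAt (hW.mem_nhds (hs hx))).differentiableAt (by norm_num))
      (hφ.differentiable (by norm_num) x)).symm
  · have h1 := divergence_eq_zero_of_notMem hx
    have h2 := divergence_eq_zero_of_notMem (fun h => hx (hsub h))
    simp [h1, h2, image_eq_zero_of_notMem_tsupport hx]

/-! ### Functions that are smooth where they are positive -/

/-- The regularity of the solution near a stagnation point: `u ≥ 0` is continuous in the ball, `C¹`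
where it is positive, vanishes in the air and outside of the ball, and its gradient has the growth
`|∇u|² ≤ C x₂⁺`. -/
structure IsProfile (c : Plane) (R C : ℝ) (u : Plane → ℝ) : Prop where
  const_nonneg : 0 ≤ C
  nonneg : ∀ x, 0 ≤ u x
  eq_zero_of_le : ∀ x, x 1 ≤ 0 → u x = 0
  eq_zero_of_notMem : ∀ x ∉ ball c R, u x = 0
  continuousOn : ContinuousOn u (ball c R)
  contDiffOn : ContDiffOn ℝ 1 u {x | 0 < u x}
  grad_sq_le : ∀ x, ‖grad u x‖ ^ 2 ≤ C * max (x 1) 0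

lemma grad_of_pos {u : Plane → ℝ} {x : Plane} (h : 0 < u x) : grad u x = gradient u x := if_pos h
lemma grad_of_not_pos {u : Plane → ℝ} {x : Plane} (h : ¬ 0 < u x) : grad u x = 0 := if_neg h
lemma chi_of_pos {u : Plane → ℝ} {x : Plane} (h : 0 < u x) : chi u x = 1 := if_pos h
lemma chi_of_not_pos {u : Plane → ℝ} {x : Plane} (h : ¬ 0 < u x) : chi u x = 0 := if_neg h
lemma chi_nonneg (u : Plane → ℝ) (x : Plane) : 0 ≤ chi u x := by unfold chi; split_ifs <;> simp
lemma chi_le_one (u : Plane → ℝ) (x : Plane) : chi u x ≤ 1 := by unfold chi; split_ifs <;> simp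

/-- Smooth truncation of the positive part: it vanishes up to `ε`, its slope lies in `[0, 1]`, and it
tends to the identity on positive numbers as `ε → 0`. -/
def trunc (ε t : ℝ) : ℝ := max (t - ε) 0 ^ 2 / (max (t - ε) 0 + ε)

/-- The derivative of `trunc ε`. -/
def truncDeriv (ε t : ℝ) : ℝ := 1 - ε ^ 2 / (max (t - ε) 0 + ε) ^ 2

lemma hasDerivAt_max_pow (n : ℕ) (t : ℝ) :
    HasDerivAt (fun t : ℝ => max t 0 ^ (n + 2)) ((n + 2) * max t 0 ^ (n + 1)) t := by
  rcases lt_trichotomy t 0 with h | rfl | h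
  · have h1 : HasDerivAt (fun _ : ℝ => (0 : ℝ)) 0 t := hasDerivAt_const _ _
    rw [max_eq_right h.le, zero_pow (by omega), mul_zero]
    refine h1.congr_of_eventuallyEq ?_
    filter_upwards [gt_mem_nhds h] with y hy
    simp [max_eq_right hy.le]
  · have h1 : (fun t : ℝ => max t 0 ^ (n + 2)) =O[𝓝 0] fun t => t ^ 2 := by
      refine Asymptotics.IsBigO.of_bound 1 ?_
      filter_upwards [ball_mem_nhds (0 : ℝ) one_pos] with t ht
      rw [mem_ball, dist_zero_right, Real.norm_eq_abs] at ht
      have h2 : |max t 0| ≤ |t| := by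
        rw [abs_of_nonneg (le_max_right _ _)]
        exact max_le (le_abs_self t) (abs_nonneg t)
      rw [norm_pow, norm_pow, one_mul, Real.norm_eq_abs, Real.norm_eq_abs, pow_add]
      have h3 : |max t 0| ^ n ≤ 1 := pow_le_one₀ (abs_nonneg _) (h2.trans ht.le)
      have h4 : |max t 0| ^ 2 ≤ |t| ^ 2 := pow_le_pow_left₀ (abs_nonneg _) h2 2
      nlinarith [pow_nonneg (abs_nonneg (max t 0)) 2]
    have h2 : (fun t : ℝ => max t 0 ^ (n + 2)) =o[𝓝 0] fun t => t - 0 := by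
      refine h1.trans_isLittleO ?_
      simpa using Asymptotics.isLittleO_pow_id (one_lt_two) (𝕜 := ℝ)
    rw [hasDerivAt_iff_isLittleO]
    simpa using h2
  · rw [max_eq_left h.le]
    have h1 : HasDerivAt (fun t : ℝ => t ^ (n + 2)) ((n + 2) * t ^ (n + 1)) t := by
      simpa using hasDerivAt_pow (n + 2) t
    refine h1.congr_of_eventuallyEq ?_
    filter_upwards [lt_mem_nhds h] with y hy
    simp [max_eq_left hy.le]

lemma contDiff_max_pow (n : ℕ) : ContDiff ℝ 1 (fun t : ℝ => max t 0 ^ (n + 2)) := by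
  rw [contDiff_one_iff_deriv]
  refine ⟨fun t => (hasDerivAt_max_pow n t).differentiableAt, ?_⟩
  rw [show deriv (fun t : ℝ => max t 0 ^ (n + 2)) = fun t => ((n : ℝ) + 2) * max t 0 ^ (n + 1) from
    funext fun t => (hasDerivAt_max_pow n t).deriv]
  fun_prop

section trunc

variable {ε : ℝ}

lemma trunc_of_le {t : ℝ} (h : t ≤ ε) : trunc ε t = 0 := by
  simp [trunc, max_eq_right (sub_nonpos.2 h)]

lemma trunc_of_ge (hε : 0 < ε) {t : ℝ} (h : ε ≤ t) : trunc ε t = t - 2 * ε + ε ^ 2 / t := by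
  have : 0 < t := hε.trans_le h
  rw [trunc, max_eq_left (sub_nonneg.2 h), sub_add_cancel]
  field_simp
  ring

lemma trunc_nonneg (hε : 0 < ε) (t : ℝ) : 0 ≤ trunc ε t :=
  div_nonneg (sq_nonneg _) (add_nonneg (le_max_right _ _) hε.le)

lemma trunc_le (hε : 0 < ε) {t : ℝ} (ht : 0 ≤ t) : trunc ε t ≤ t := by
  rcases le_total t ε with h | h
  · rw [trunc_of_le h]; exact ht
  · rw [trunc_of_ge hε h]
    have : ε ^ 2 / t ≤ ε := by
      rw [div_le_iff₀ (hε.trans_le h)]; nlinarith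
    linarith

lemma truncDeriv_nonneg (hε : 0 < ε) (t : ℝ) : 0 ≤ truncDeriv ε t := by
  have h := le_max_right (t - ε) 0
  have : ε ^ 2 / (max (t - ε) 0 + ε) ^ 2 ≤ 1 :=
    div_le_one_of_le₀ (pow_le_pow_left₀ hε.le (by linarith) 2) (sq_nonneg _)
  unfold truncDeriv; linarith

lemma truncDeriv_le_one (ε t : ℝ) : truncDeriv ε t ≤ 1 := by
  have : 0 ≤ ε ^ 2 / (max (t - ε) 0 + ε) ^ 2 := by positivity
  unfold truncDeriv; linarith

lemma truncDeriv_of_le (hε : 0 < ε) {t : ℝ} (h : t ≤ ε) : truncDeriv ε t = 0 := by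
  simp [truncDeriv, max_eq_right (sub_nonpos.2 h), hε.ne']

lemma hasDerivAt_trunc (hε : 0 < ε) (t : ℝ) : HasDerivAt (trunc ε) (truncDeriv ε t) t := by
  have hpos : ∀ t, 0 < max (t - ε) 0 + ε := fun t => add_pos_of_nonneg_of_pos (le_max_right _ _) hε
  -- `trunc ε t = s - ε + ε² / (s + ε)` with `s = (t - ε)⁺`; the kink of `s` is not felt
  rcases lt_trichotomy t ε with h | rfl | h
  · rw [truncDeriv_of_le hε h.le]
    refine (hasDerivAt_const t (0 : ℝ)).congr_of_eventuallyEq ?_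
    filter_upwards [gt_mem_nhds h] with y hy
    exact trunc_of_le hy.le
  · rw [truncDeriv_of_le hε le_rfl, hasDerivAt_iff_isLittleO]
    have h1 : HasDerivAt (fun s : ℝ => max (s - t) 0 ^ 2) 0 t := by
      have := (hasDerivAt_max_pow 0 (t - t)).comp_sub_const t t
      simpa using this
    rw [hasDerivAt_iff_isLittleO] at h1
    have h2 : (fun s => trunc t s) =O[𝓝 t] fun s => max (s - t) 0 ^ 2 := by
      refine Asymptotics.IsBigO.of_bound (1 / t) (.of_forall fun s => ?_)
      rw [trunc, Real.norm_eq_abs, Real.norm_eq_abs, abs_div, abs_of_pos (hpos s), div_eq_mul_one_div,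
        mul_comm]
      refine mul_le_mul_of_nonneg_right ?_ (abs_nonneg _)
      exact one_div_le_one_div_of_le hε (by linarith [le_max_right (s - t) 0])
    have h3 : (fun s : ℝ => max (s - t) 0 ^ 2) =o[𝓝 t] fun s => s - t := by simpa using h1
    simpa [trunc_of_le le_rfl] using h2.trans_isLittleO h3
  · have ht : t ≠ 0 := (hε.trans h).ne'
    have h1 : HasDerivAt (fun t : ℝ => t - 2 * ε + ε ^ 2 / t) (1 + ε ^ 2 * (-(t ^ 2)⁻¹)) t := by
      simp only [div_eq_mul_inv]
      exact ((hasDerivAt_id' t).sub_const (2 * ε)).fun_add ((hasDerivAt_inv ht).const_mul (ε ^ 2))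
    have h2 : truncDeriv ε t = 1 + ε ^ 2 * (-(t ^ 2)⁻¹) := by
      rw [truncDeriv, max_eq_left (by linarith), sub_add_cancel]; ring
    rw [h2]
    refine h1.congr_of_eventuallyEq ?_
    filter_upwards [lt_mem_nhds h] with y hy
    exact trunc_of_ge hε hy.le

lemma continuous_truncDeriv (hε : 0 < ε) : Continuous (truncDeriv ε) := by
  unfold truncDeriv
  refine continuous_const.sub (continuous_const.div (by fun_prop) fun t => ?_)
  have := le_max_right (t - ε) 0
  positivity

lemma contDiff_trunc (hε : 0 < ε) : ContDiff ℝ 1 (trunc ε) := by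
  rw [contDiff_one_iff_deriv]
  refine ⟨fun t => (hasDerivAt_trunc hε t).differentiableAt, ?_⟩
  rw [show deriv (trunc ε) = truncDeriv ε from funext fun t => (hasDerivAt_trunc hε t).deriv]
  exact continuous_truncDeriv hε

lemma tendsto_trunc {t : ℝ} (ht : 0 ≤ t) : Tendsto (fun ε => trunc ε t) (𝓝[>] 0) (𝓝 t) := by
  rcases ht.eq_or_lt with rfl | ht
  · refine tendsto_const_nhds.congr' ?_
    filter_upwards [self_mem_nhdsWithin] with ε hε
    exact (trunc_of_le (le_of_lt hε)).symm
  · have h1 : Tendsto (fun ε : ℝ => t - 2 * ε + ε ^ 2 / t) (𝓝[>] 0) (𝓝 t) := by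
      have : Continuous (fun ε : ℝ => t - 2 * ε + ε ^ 2 / t) := by fun_prop
      exact (this.tendsto' 0 t (by simp)).mono_left nhdsWithin_le_nhds
    refine h1.congr' ?_
    filter_upwards [Ioo_mem_nhdsGT ht] with ε hε
    exact (trunc_of_ge hε.1 hε.2.le).symm

lemma tendsto_truncDeriv {t : ℝ} (ht : 0 < t) :
    Tendsto (fun ε => truncDeriv ε t) (𝓝[>] 0) (𝓝 1) := by
  have h1 : Tendsto (fun ε : ℝ => 1 - ε ^ 2 / t ^ 2) (𝓝[>] 0) (𝓝 1) := by
    have : Continuous (fun ε : ℝ => 1 - ε ^ 2 / t ^ 2) := by fun_prop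
    exact (this.tendsto' 0 1 (by simp)).mono_left nhdsWithin_le_nhds
  refine h1.congr' ?_
  filter_upwards [Ioo_mem_nhdsGT ht] with ε hε
  rw [truncDeriv, max_eq_left (by linarith [hε.2]), sub_add_cancel]

end trunc

lemma fderiv_eq_inner_grad {u : Plane → ℝ} {x : Plane} (h : 0 < u x) (v : Plane) :
    fderiv ℝ u x v = inner ℝ (grad u x) v := by
  rw [grad_of_pos h, gradient, InnerProductSpace.toDual_symm_apply]

namespace IsProfile

variable {c : Plane} {R C : ℝ} {u : Plane → ℝ}

lemma mem_ball (hu : IsProfile c R C u) {x : Plane} (hx : 0 < u x) : x ∈ ball c R := by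
  by_contra h
  rw [hu.eq_zero_of_notMem x h] at hx
  exact lt_irrefl _ hx

lemma height_pos (hu : IsProfile c R C u) {x : Plane} (hx : 0 < u x) : 0 < x 1 := by
  by_contra h
  rw [hu.eq_zero_of_le x (not_lt.1 h)] at hx
  exact lt_irrefl _ hx

lemma eq_zero_of_not_pos (hu : IsProfile c R C u) {x : Plane} (hx : ¬ 0 < u x) : u x = 0 :=
  le_antisymm (not_lt.1 hx) (hu.nonneg x)

lemma isOpen_pos (hu : IsProfile c R C u) : IsOpen {x | 0 < u x} := by
  have h := hu.continuousOn.isOpen_inter_preimage isOpen_ball (isOpen_Ioi (a := (0 : ℝ)))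
  convert h using 1
  ext x
  exact ⟨fun hx => ⟨hu.mem_ball hx, hx⟩, fun hx => hx.2⟩

lemma differentiableAt (hu : IsProfile c R C u) {x : Plane} (hx : 0 < u x) :
    DifferentiableAt ℝ u x :=
  (hu.contDiffOn.contDiffAt (hu.isOpen_pos.mem_nhds hx)).differentiableAt (by norm_num)

lemma hasFDerivAt (hu : IsProfile c R C u) {x : Plane} (hx : 0 < u x) :
    HasFDerivAt u (innerSL ℝ (grad u x)) x := by
  refine (hu.differentiableAt hx).hasFDerivAt.congr_fderiv ?_
  ext v
  simp [fderiv_eq_inner_grad hx]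

lemma continuousOn_grad (hu : IsProfile c R C u) : ContinuousOn (grad u) {x | 0 < u x} := by
  have h : ContinuousOn (fun x => gradient u x) {x | 0 < u x} :=
    (InnerProductSpace.toDual ℝ Plane).symm.continuous.comp_continuousOn
      (hu.contDiffOn.continuousOn_fderiv_of_isOpen hu.isOpen_pos (by norm_num))
  exact h.congr fun x hx => grad_of_pos hx

open Classical in
lemma measurable (hu : IsProfile c R C u) : Measurable u := by
  have h : u = (ball c R).indicator u := by
    ext x
    by_cases hx : x ∈ ball c R
    · rw [indicator_of_mem hx]
    · rw [indicator_of_notMem hx, hu.eq_zero_of_notMem x hx]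
  rw [h, ← piecewise_eq_indicator]
  exact (hu.continuousOn.measurable_piecewise continuousOn_const isOpen_ball.measurableSet)

lemma measurableSet_pos (hu : IsProfile c R C u) : MeasurableSet {x | 0 < u x} :=
  hu.isOpen_pos.measurableSet

open Classical in
lemma measurable_grad (hu : IsProfile c R C u) : Measurable (grad u) := by
  have h : grad u = ({x | 0 < u x} : Set Plane).piecewise (grad u) (fun _ => 0) := by
    ext1 x
    by_cases hx : 0 < u x
    · simp [piecewise, hx]
    · simp [piecewise, hx, grad_of_not_pos hx]
  rw [h]
  exact hu.continuousOn_grad.measurable_piecewise continuousOn_const hu.measurableSet_pos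

lemma measurable_chi (hu : IsProfile c R C u) : Measurable (chi u) := by
  unfold chi
  exact Measurable.ite hu.measurableSet_pos measurable_const measurable_const

lemma height_le (hu : IsProfile c R C u) {x : Plane} (hx : 0 < u x) : x 1 ≤ c 1 + R := by
  have h := hu.mem_ball hx
  rw [mem_ball_iff_norm] at h
  have h1 := PiLp.norm_apply_le (x - c) 1
  have h2 := le_abs_self ((x - c) 1)
  rw [Real.norm_eq_abs] at h1
  simp only [PiLp.sub_apply] at h1 h2
  linarith

lemma exists_bound_grad (hu : IsProfile c R C u) : ∃ M, 0 ≤ M ∧ ∀ x, ‖grad u x‖ ≤ M := by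
  refine ⟨Real.sqrt (C * max (c 1 + R) 0), Real.sqrt_nonneg _, fun x => ?_⟩
  by_cases hx : 0 < u x
  · refine Real.le_sqrt_of_sq_le ((hu.grad_sq_le x).trans ?_)
    exact mul_le_mul_of_nonneg_left (max_le_max_right 0 (hu.height_le hx)) hu.const_nonneg
  · rw [grad_of_not_pos hx, norm_zero]; exact Real.sqrt_nonneg _

/-- Composition with a function that vanishes near zero smooths out the free boundary. -/
lemma hasFDerivAt_comp (hu : IsProfile c R C u) {f f' : ℝ → ℝ} {ε : ℝ}
    (hε : 0 < ε) (hf : ∀ t, HasDerivAt f (f' t) t) (hf0 : ∀ t ≤ ε, f t = 0)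
    {x : Plane} (hx : x ∈ ball c R) :
    HasFDerivAt (fun x => f (u x)) (f' (u x) • innerSL ℝ (grad u x)) x := by
  by_cases h : 0 < u x
  · exact (hf (u x)).comp_hasFDerivAt x (hu.hasFDerivAt h)
  · rw [grad_of_not_pos h]
    have h1 : u x < ε := (not_lt.1 h).trans_lt hε
    have h2 : ∀ᶠ y in 𝓝 x, u y < ε :=
      (hu.continuousOn.continuousAt (isOpen_ball.mem_nhds hx)).eventually (gt_mem_nhds h1)
    have h3 : HasFDerivAt (fun _ : Plane => (0 : ℝ)) (0 : Plane →L[ℝ] ℝ) x := hasFDerivAt_const _ _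
    simp only [map_zero, smul_zero]
    refine h3.congr_of_eventuallyEq ?_
    filter_upwards [h2] with y hy
    exact hf0 _ hy.le

lemma contDiffOn_comp (hu : IsProfile c R C u) {f : ℝ → ℝ} {ε : ℝ}
    (hε : 0 < ε) (hf : ContDiff ℝ 1 f) (hf0 : ∀ t ≤ ε, f t = 0) :
    ContDiffOn ℝ 1 (fun x => f (u x)) (ball c R) := by
  intro x hx
  refine ContDiffAt.contDiffWithinAt ?_
  by_cases h : 0 < u x
  · exact hf.contDiffAt.comp x (hu.contDiffOn.contDiffAt (hu.isOpen_pos.mem_nhds h))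
  · have h1 : u x < ε := (not_lt.1 h).trans_lt hε
    have h2 : ∀ᶠ y in 𝓝 x, u y < ε :=
      (hu.continuousOn.continuousAt (isOpen_ball.mem_nhds hx)).eventually (gt_mem_nhds h1)
    refine (contDiffAt_const (c := (0 : ℝ))).congr_of_eventuallyEq ?_
    filter_upwards [h2] with y hy
    exact hf0 _ hy.le

lemma abs_sub_le (hu : IsProfile c R C u) {s : Set Plane} (hs : Convex ℝ s)
    (hsub : s ⊆ ball c R) {M : ℝ} (hM : ∀ x ∈ s, ‖grad u x‖ ≤ M)
    {x y : Plane} (hx : x ∈ s) (hy : y ∈ s) : |u x - u y| ≤ M * ‖x - y‖ := by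
  have hM0 : 0 ≤ M := (norm_nonneg _).trans (hM x hx)
  have key : ∀ ε > 0, |trunc ε (u x) - trunc ε (u y)| ≤ M * ‖x - y‖ := by
    intro ε hε
    rw [← Real.norm_eq_abs]
    refine hs.norm_image_sub_le_of_norm_hasFDerivWithin_le (f := fun x => trunc ε (u x))
      (f' := fun x => truncDeriv ε (u x) • innerSL ℝ (grad u x))
      (fun z hz => (hu.hasFDerivAt_comp hε (hasDerivAt_trunc hε) (fun t ht => trunc_of_le ht)
        (hsub hz)).hasFDerivWithinAt) (fun z hz => ?_) hy hx
    rw [norm_smul, innerSL_apply_norm, Real.norm_eq_abs, abs_of_nonneg (truncDeriv_nonneg hε _)]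
    calc _ ≤ 1 * ‖grad u z‖ := mul_le_mul_of_nonneg_right (truncDeriv_le_one _ _) (norm_nonneg _)
      _ ≤ M := by rw [one_mul]; exact hM z hz
  have hl : Tendsto (fun ε => |trunc ε (u x) - trunc ε (u y)|) (𝓝[>] 0) (𝓝 |u x - u y|) :=
    ((tendsto_trunc (hu.nonneg x)).sub (tendsto_trunc (hu.nonneg y))).abs
  exact le_of_tendsto hl (by filter_upwards [self_mem_nhdsWithin] with ε hε using key ε hε)

lemma exists_lipschitz (hu : IsProfile c R C u) :
    ∃ M, 0 ≤ M ∧ (∀ x, ‖grad u x‖ ≤ M) ∧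
      ∀ x ∈ ball c R, ∀ y ∈ ball c R, |u x - u y| ≤ M * ‖x - y‖ := by
  obtain ⟨M, hM0, hM⟩ := hu.exists_bound_grad
  exact ⟨M, hM0, hM, fun x hx y hy =>
    hu.abs_sub_le (convex_ball c R) subset_rfl (fun z _ => hM z) hx hy⟩

lemma exists_bound (hu : IsProfile c R C u) : ∃ M, 0 ≤ M ∧ ∀ x, u x ≤ M := by
  obtain ⟨M, hM0, -, hM⟩ := hu.exists_lipschitz
  rcases lt_or_ge 0 R with hR | hR
  · refine ⟨M * R + u c, add_nonneg (mul_nonneg hM0 hR.le) (hu.nonneg c), fun x => ?_⟩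
    by_cases hx : x ∈ ball c R
    · have h := hM x hx c (mem_ball_self hR)
      have h2 : M * ‖x - c‖ ≤ M * R := by
        rw [mem_ball_iff_norm] at hx
        exact mul_le_mul_of_nonneg_left hx.le hM0
      linarith [le_abs_self (u x - u c)]
    · rw [hu.eq_zero_of_notMem x hx]
      exact add_nonneg (mul_nonneg hM0 hR.le) (hu.nonneg c)
  · refine ⟨0, le_rfl, fun x => (hu.eq_zero_of_notMem x ?_).le⟩
    rw [ball_eq_empty.2 hR]; simp

/-- Near points of the axis the growth of the gradient gives `u = O(r^{3/2})`. -/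
lemma sq_le_of_center (hu : IsProfile c R C u) {y : Plane} (hy : y 1 = 0) {r : ℝ} (hr : 0 < r)
    (hsub : ball y r ⊆ ball c R) {x : Plane} (hx : x ∈ ball y r) :
    ‖grad u x‖ ^ 2 ≤ C * r ∧ u x ^ 2 ≤ C * r ^ 3 := by
  have hg : ∀ z ∈ ball y r, ‖grad u z‖ ^ 2 ≤ C * r := by
    intro z hz
    refine (hu.grad_sq_le z).trans (mul_le_mul_of_nonneg_left (max_le ?_ hr.le) hu.const_nonneg)
    rw [mem_ball_iff_norm] at hz
    have h1 := PiLp.norm_apply_le (z - y) 1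
    rw [Real.norm_eq_abs, PiLp.sub_apply, hy, sub_zero] at h1
    linarith [le_abs_self (z 1)]
  have hCr : 0 ≤ C * r := mul_nonneg hu.const_nonneg hr.le
  refine ⟨hg x hx, ?_⟩
  have h := hu.abs_sub_le (convex_ball y r) hsub (M := Real.sqrt (C * r))
    (fun z hz => Real.le_sqrt_of_sq_le (hg z hz)) hx (mem_ball_self hr)
  rw [hu.eq_zero_of_le y hy.le, sub_zero] at h
  have hx' : ‖x - y‖ ≤ r := by rw [mem_ball_iff_norm] at hx; exact hx.le
  calc u x ^ 2 = |u x| ^ 2 := (sq_abs _).symm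
    _ ≤ (Real.sqrt (C * r) * r) ^ 2 := by
      refine pow_le_pow_left₀ (abs_nonneg _) (h.trans ?_) 2
      exact mul_le_mul_of_nonneg_left hx' (Real.sqrt_nonneg _)
    _ = C * r ^ 3 := by rw [mul_pow, Real.sq_sqrt hCr]; ring

/-- The square of a profile is `C¹` across the free boundary. -/
lemma hasFDerivAt_sq (hu : IsProfile c R C u) {x : Plane} (hx : x ∈ ball c R) :
    HasFDerivAt (fun x => u x ^ 2) ((2 * u x) • innerSL ℝ (grad u x)) x := by
  by_cases h : 0 < u x
  · have := (hu.hasFDerivAt h).pow 2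
    refine this.congr_fderiv ?_
    ext v; simp
  · have h0 := hu.eq_zero_of_not_pos h
    rw [h0, mul_zero, zero_smul, hasFDerivAt_iff_isLittleO]
    obtain ⟨M, hM0, -, hM⟩ := hu.exists_lipschitz
    have h1 : (fun y => u y ^ 2) =O[𝓝 x] fun y => ‖y - x‖ ^ 2 := by
      refine Asymptotics.IsBigO.of_bound (M ^ 2) ?_
      filter_upwards [isOpen_ball.mem_nhds hx] with y hy
      have := hM y hy x hx
      rw [h0, sub_zero] at this
      rw [norm_pow, norm_pow, norm_norm, ← mul_pow, Real.norm_eq_abs]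
      exact pow_le_pow_left₀ (abs_nonneg _) this 2
    have h2 : (fun y : Plane => ‖y - x‖ ^ 2) =o[𝓝 x] fun y => y - x := by
      have := (Asymptotics.isLittleO_norm_pow_id (E' := Plane) one_lt_two)
      have h3 : Tendsto (fun y : Plane => y - x) (𝓝 x) (𝓝 0) := by
        have : Continuous fun y : Plane => y - x := by fun_prop
        exact this.tendsto' x 0 (by simp)
      exact this.comp_tendsto h3
    simpa [h0] using h1.trans_isLittleO h2

lemma continuousAt_smul_grad (hu : IsProfile c R C u) {x : Plane} (hx : x ∈ ball c R) :
    ContinuousAt (fun x => u x • grad u x) x := by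
  have huc := hu.continuousOn.continuousAt (isOpen_ball.mem_nhds hx)
  by_cases h : 0 < u x
  · exact huc.smul (hu.continuousOn_grad.continuousAt (hu.isOpen_pos.mem_nhds h))
  · obtain ⟨M, hM0, hM⟩ := hu.exists_bound_grad
    have h0 := hu.eq_zero_of_not_pos h
    rw [ContinuousAt, h0, zero_smul]
    refine squeeze_zero_norm (a := fun y => ‖u y‖ * M) (fun y => ?_) ?_
    · rw [norm_smul]
      exact mul_le_mul_of_nonneg_left (hM y) (norm_nonneg _)
    · have := huc.norm.mul_const M
      rw [ContinuousAt, h0, norm_zero, zero_mul] at this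
      exact this

lemma contDiffOn_sq (hu : IsProfile c R C u) :
    ContDiffOn ℝ 1 (fun x => u x ^ 2) (ball c R) := by
  rw [show (1 : WithTop ℕ∞) = 0 + 1 from rfl,
    contDiffOn_succ_iff_fderiv_of_isOpen isOpen_ball]
  refine ⟨fun x hx => (hu.hasFDerivAt_sq hx).differentiableAt.differentiableWithinAt, by simp, ?_⟩
  rw [contDiffOn_zero]
  refine ContinuousOn.congr (f := fun x => (2 : ℝ) • innerSL ℝ (u x • grad u x)) ?_ ?_
  · intro x hx
    have h := (innerSL ℝ (E := Plane)).continuous.continuousAt.comp (hu.continuousAt_smul_grad hx)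
    exact (h.const_smul (2 : ℝ)).continuousWithinAt
  · intro x hx
    rw [(hu.hasFDerivAt_sq hx).fderiv]
    ext v
    simp [mul_assoc]

lemma integral_sq_mul_divergence (hu : IsProfile c R C u) {φ : Plane → Plane}
    (hφ : ContDiff ℝ 1 φ) (hc : HasCompactSupport φ) (hs : tsupport φ ⊆ ball c R) :
    ∫ x, (u x ^ 2 * divergence φ x + 2 * u x * inner ℝ (grad u x) (φ x)) = 0 := by
  rw [← integral_mul_divergence_add isOpen_ball hu.contDiffOn_sq hφ hc hs]
  refine integral_congr_ae (.of_forall fun x => ?_)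
  by_cases hx : x ∈ tsupport φ
  · simp only
    rw [(hu.hasFDerivAt_sq (hs hx)).fderiv]
    simp
  · simp [image_eq_zero_of_notMem_tsupport hx]

/-- Bounded measurable expressions that vanish outside of the fluid are integrable. -/
lemma integrable_of_bound (hu : IsProfile c R C u) {E : Type*} [NormedAddCommGroup E]
    {f : Plane → E}
    (hf : AEStronglyMeasurable f) (h0 : ∀ x, ¬ 0 < u x → f x = 0) {M : ℝ}
    (hM : ∀ x, 0 < u x → ‖f x‖ ≤ M) : Integrable f := by
  have h1 : IntegrableOn f (ball c R) := by
    refine IntegrableOn.of_bound measure_ball_lt_top hf.restrict (max M 0)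
      (.of_forall fun x => ?_)
    by_cases h : 0 < u x
    · exact (hM x h).trans (le_max_left _ _)
    · rw [h0 x h, norm_zero]; exact le_max_right _ _
  rw [← integrableOn_iff_integrable_of_support_subset (s := ball c R)]
  · exact h1
  · intro x hx
    by_contra h
    exact hx (h0 x fun hpos => h (hu.mem_ball hpos))

end IsProfile

/-! ### The equation in the fluid -/

lemma integrable_of_continuousOn {f : Plane → ℝ} {P K : Set Plane} (hK : IsCompact K)
    (hKP : K ⊆ P) (hf : ContinuousOn f P) (h0 : ∀ x ∉ K, f x = 0) : Integrable f := by
  rw [← integrableOn_iff_integrable_of_support_subset (s := K)]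
  · exact (hf.mono hKP).integrableOn_compact hK
  · intro x hx
    by_contra h
    exact hx (h0 x h)

lemma continuousOn_divergence {φ : Plane → Plane} (hφ : ContDiff ℝ 1 φ) (s : Set Plane) :
    ContinuousOn (divergence φ) s := (continuous_divergence hφ).continuousOn

/-- A profile near the stagnation level that is a critical point with respect to domain variations:
the integrals of the first variation extend over the whole plane since everything vanishes outside of
the fluid. -/
structure IsLocalSolution (p : ℝ → ℝ) (ρ₀ g η : ℝ) (c : Plane) (R C : ℝ) (u : Plane → ℝ) : Prop
    extends IsProfile c R C u where
  contDiffOn_two : ContDiffOn ℝ 2 u {x | 0 < u x}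
  height_lt : ∀ x, 0 < u x → x 1 < η
  grad_lt : ∀ x, 0 < u x → ‖grad u x‖ ^ 2 < η
  variation_eq_zero : ∀ φ : Plane → Plane, ContDiff ℝ 1 φ → HasCompactSupport φ →
    tsupport φ ⊆ ball c R →
    (∫ x, (F p ρ₀ g (‖grad u x‖ ^ 2) (x 1) + lam p ρ₀ g (x 1) * chi u x) * divergence φ x)
      - 2 * (∫ x, dF₁ p ρ₀ g (‖grad u x‖ ^ 2) (x 1) *
        inner ℝ (grad u x) (fderiv ℝ φ x (grad u x)))
      + ∫ x, (deriv (lam p ρ₀ g) (x 1) * chi u x + dF₂ p ρ₀ g (‖grad u x‖ ^ 2) (x 1)) * (φ x) 1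
      = 0

lemma contDiffOn_grad {u : Plane → ℝ} (ho : IsOpen {x | 0 < u x})
    (h : ContDiffOn ℝ 2 u {x | 0 < u x}) : ContDiffOn ℝ 1 (grad u) {x | 0 < u x} := by
  have h1 : ContDiffOn ℝ 1 (fderiv ℝ u) {x | 0 < u x} :=
    h.fderiv_of_isOpen ho (by norm_num)
  have h2 : ContDiffOn ℝ 1 (fun x => (InnerProductSpace.toDual ℝ Plane).symm (fderiv ℝ u x))
      {x | 0 < u x} :=
    (InnerProductSpace.toDual ℝ Plane).symm.contDiff.comp_contDiffOn h1
  exact h2.congr fun x hx => grad_of_pos hx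

/-- The Hessian is symmetric. -/
lemma inner_fderiv_grad_comm {u : Plane → ℝ} (ho : IsOpen {x | 0 < u x})
    (h : ContDiffOn ℝ 2 u {x | 0 < u x}) {x : Plane} (hx : 0 < u x) (v w : Plane) :
    inner ℝ (fderiv ℝ (grad u) x v) w = inner ℝ (fderiv ℝ (grad u) x w) v := by
  have hd : DifferentiableAt ℝ (fderiv ℝ u) x :=
    ((h.fderiv_of_isOpen ho (m := 1) (by norm_num)).contDiffAt (ho.mem_nhds hx)).differentiableAt
      (by norm_num)
  have hgd : DifferentiableAt ℝ (grad u) x :=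
    ((contDiffOn_grad ho h).contDiffAt (ho.mem_nhds hx)).differentiableAt (by norm_num)
  have hsymm : IsSymmSndFDerivAt ℝ u x :=
    (h.contDiffAt (ho.mem_nhds hx)).isSymmSndFDerivAt (by simp)
  have h3 : ∀ v w, inner ℝ (fderiv ℝ (grad u) x v) w = fderiv ℝ (fderiv ℝ u) x v w := by
    intro v w
    have e1 : HasFDerivAt (fun y => inner ℝ (grad u y) w) _ x :=
      hgd.hasFDerivAt.inner ℝ (hasFDerivAt_const w x)
    have e2 : HasFDerivAt (fun y => fderiv ℝ u y w) _ x :=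
      hd.hasFDerivAt.clm_apply (hasFDerivAt_const w x)
    have e3 : (fun y => inner ℝ (grad u y) w) =ᶠ[𝓝 x] fun y => fderiv ℝ u y w := by
      filter_upwards [ho.mem_nhds hx] with y hy
      exact (fderiv_eq_inner_grad hy w).symm
    have e4 := DFunLike.congr_fun (e1.unique (e2.congr_of_eventuallyEq e3)) v
    simpa using e4
  rw [h3, h3, hsymm v w]

lemma F_zero (p : ℝ → ℝ) (ρ₀ g s : ℝ) : F p ρ₀ g 0 s = 0 := by simp [F]

lemma dF₂_zero (p : ℝ → ℝ) (ρ₀ g s : ℝ) : dF₂ p ρ₀ g 0 s = 0 := by simp [dF₂, F_zero]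

namespace IsLocalSolution

variable {p : ℝ → ℝ} {ρ₀ g η K : ℝ} {c : Plane} {R C : ℝ} {u : Plane → ℝ}

lemma mem_box (hu : IsLocalSolution p ρ₀ g η c R C u) {x : Plane} (hx : 0 < u x) :
    ‖grad u x‖ ^ 2 ∈ Ioo (-η) η ∧ x 1 ∈ Ioo 0 η := by
  have h1 := hu.toIsProfile.height_pos hx
  have h2 := hu.height_lt x hx
  exact ⟨⟨by linarith [sq_nonneg ‖grad u x‖], hu.grad_lt x hx⟩, h1, h2⟩

lemma continuousOn_args (hu : IsLocalSolution p ρ₀ g η c R C u) :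
    ContinuousOn (fun x : Plane => (‖grad u x‖ ^ 2, x 1)) {x | 0 < u x} := by
  have := hu.toIsProfile.continuousOn_grad
  exact (this.norm.pow 2).prodMk (by fun_prop)

lemma continuousOn_dF₁ (hu : IsLocalSolution p ρ₀ g η c R C u) (he : IsExpansion p ρ₀ g η K) :
    ContinuousOn (fun x : Plane => dF₁ p ρ₀ g (‖grad u x‖ ^ 2) (x 1)) {x | 0 < u x} :=
  he.continuousOn_dF₁.comp (f := fun x : Plane => (‖grad u x‖ ^ 2, x 1)) hu.continuousOn_args fun _ hx => hu.mem_box hx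

lemma continuousOn_dF₂ (hu : IsLocalSolution p ρ₀ g η c R C u) (he : IsExpansion p ρ₀ g η K) :
    ContinuousOn (fun x : Plane => dF₂ p ρ₀ g (‖grad u x‖ ^ 2) (x 1)) {x | 0 < u x} :=
  he.continuousOn_dF₂.comp (f := fun x : Plane => (‖grad u x‖ ^ 2, x 1)) hu.continuousOn_args fun _ hx => hu.mem_box hx

lemma continuousOn_F (hu : IsLocalSolution p ρ₀ g η c R C u) (he : IsExpansion p ρ₀ g η K) :
    ContinuousOn (fun x : Plane => F p ρ₀ g (‖grad u x‖ ^ 2) (x 1)) {x | 0 < u x} := by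
  have h : ContinuousOn (fun z : ℝ × ℝ => F p ρ₀ g z.1 z.2) (Ioo (-η) η ×ˢ Ioo 0 η) :=
    fun z hz => (he.hasFDerivAt_F z.1 hz.1 z.2 hz.2).continuousAt.continuousWithinAt
  exact h.comp (f := fun x : Plane => (‖grad u x‖ ^ 2, x 1)) hu.continuousOn_args fun _ hx => hu.mem_box hx

lemma continuousOn_lam (hu : IsLocalSolution p ρ₀ g η c R C u) (he : IsExpansion p ρ₀ g η K) :
    ContinuousOn (fun x : Plane => lam p ρ₀ g (x 1)) {x | 0 < u x} := by
  have h : ContinuousOn (lam p ρ₀ g) (Ioo 0 η) :=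
    fun s hs => (he.hasDerivAt_lam s hs).continuousAt.continuousWithinAt
  exact h.comp (f := fun x : Plane => x 1) (by fun_prop) fun _ hx => (hu.mem_box hx).2

lemma continuousOn_deriv_lam (hu : IsLocalSolution p ρ₀ g η c R C u)
    (he : IsExpansion p ρ₀ g η K) :
    ContinuousOn (fun x : Plane => deriv (lam p ρ₀ g) (x 1)) {x | 0 < u x} :=
  he.continuousOn_deriv_lam.comp (f := fun x : Plane => x 1) (by fun_prop)
    fun _ hx => (hu.mem_box hx).2

lemma continuousOn_chi (u : Plane → ℝ) : ContinuousOn (chi u) {x | 0 < u x} :=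
  (continuousOn_const (c := (1 : ℝ))).congr fun _ hx => chi_of_pos hx

lemma hasFDerivAt_energy (hu : IsLocalSolution p ρ₀ g η c R C u) (he : IsExpansion p ρ₀ g η K)
    {x : Plane} (hx : 0 < u x) :
    HasFDerivAt (fun x : Plane => F p ρ₀ g (‖grad u x‖ ^ 2) (x 1) + lam p ρ₀ g (x 1))
      ((2 * dF₁ p ρ₀ g (‖grad u x‖ ^ 2) (x 1)) • ((innerSL ℝ (grad u x)).comp
          (fderiv ℝ (grad u) x))
        + (dF₂ p ρ₀ g (‖grad u x‖ ^ 2) (x 1) + deriv (lam p ρ₀ g) (x 1)) •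
          (EuclideanSpace.proj 1 : Plane →L[ℝ] ℝ)) x := by
  have ho := hu.toIsProfile.isOpen_pos
  have hg : HasFDerivAt (grad u) (fderiv ℝ (grad u) x) x :=
    (((contDiffOn_grad ho hu.contDiffOn_two).contDiffAt (ho.mem_nhds hx)).differentiableAt
      (by norm_num)).hasFDerivAt
  have hpr : HasFDerivAt (fun x : Plane => x 1) (EuclideanSpace.proj 1 : Plane →L[ℝ] ℝ) x :=
    (EuclideanSpace.proj 1 : Plane →L[ℝ] ℝ).hasFDerivAt
  have h1 := HasFDerivAt.comp (f := fun x : Plane => (‖grad u x‖ ^ 2, x 1)) x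
    (he.hasFDerivAt_F _ (hu.mem_box hx).1 _ (hu.mem_box hx).2) (hg.norm_sq.prodMk hpr)
  have h2 := HasDerivAt.comp_hasFDerivAt (f := fun x : Plane => x 1) x
    (he.hasDerivAt_lam _ (hu.mem_box hx).2) hpr
  refine (h1.fun_add h2).congr_fderiv ?_
  ext v
  simp
  ring

/-- The domain variation formula for fields supported in the fluid, after one integration by
parts. -/
lemma integral_fderiv_inner (hu : IsLocalSolution p ρ₀ g η c R C u) (he : IsExpansion p ρ₀ g η K)
    {φ : Plane → Plane} (hφ : ContDiff ℝ 1 φ) (hc : HasCompactSupport φ)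
    (hs : tsupport φ ⊆ {x | 0 < u x}) :
    ∫ x, dF₁ p ρ₀ g (‖grad u x‖ ^ 2) (x 1) *
      fderiv ℝ (fun y => inner ℝ (grad u y) (φ y)) x (grad u x) = 0 := by
  have ho := hu.toIsProfile.isOpen_pos
  have hgc := hu.toIsProfile.continuousOn_grad
  have hg1 := contDiffOn_grad ho hu.contDiffOn_two
  have hgd : ∀ x, 0 < u x → DifferentiableAt ℝ (grad u) x := fun x hx =>
    (hg1.contDiffAt (ho.mem_nhds hx)).differentiableAt (by norm_num)
  have hDg : ContinuousOn (fderiv ℝ (grad u)) {x | 0 < u x} :=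
    hg1.continuousOn_fderiv_of_isOpen ho (by norm_num)
  have hA := hu.continuousOn_dF₁ he
  have hDφ := hφ.continuous_fderiv (by norm_num)
  have hout : ∀ x ∉ tsupport φ, fderiv ℝ φ x = 0 := fun x hx => fderiv_of_notMem_tsupport ℝ hx
  have hv := hu.variation_eq_zero φ hφ hc (hs.trans fun x hx => hu.toIsProfile.mem_ball hx)
  have hE : ContDiffOn ℝ 1 (fun x : Plane => F p ρ₀ g (‖grad u x‖ ^ 2) (x 1) + lam p ρ₀ g (x 1))
      {x | 0 < u x} := by
    rw [show (1 : WithTop ℕ∞) = 0 + 1 from rfl, contDiffOn_succ_iff_fderiv_of_isOpen ho]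
    refine ⟨fun x hx => (hu.hasFDerivAt_energy he hx).differentiableAt.differentiableWithinAt,
      by simp, ?_⟩
    rw [contDiffOn_zero]
    refine ContinuousOn.congr ?_ fun x hx => (hu.hasFDerivAt_energy he hx).fderiv
    refine ((continuousOn_const.mul hA).smul ?_).add
      (((hu.continuousOn_dF₂ he).add (hu.continuousOn_deriv_lam he)).smul continuousOn_const)
    exact ((innerSL ℝ (E := Plane)).continuous.comp_continuousOn hgc).clm_comp hDg
  have hib := integral_mul_divergence_add ho hE hφ hc hs
  have i1 : Integrable fun x => (F p ρ₀ g (‖grad u x‖ ^ 2) (x 1) + lam p ρ₀ g (x 1) * chi u x)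
      * divergence φ x :=
    integrable_of_continuousOn hc hs (((hu.continuousOn_F he).add ((hu.continuousOn_lam he).mul
      (continuousOn_chi u))).mul (continuousOn_divergence hφ _)) fun x hx => by
        rw [divergence_eq_zero_of_notMem hx, mul_zero]
  have i2 : Integrable fun x => dF₁ p ρ₀ g (‖grad u x‖ ^ 2) (x 1) *
      inner ℝ (grad u x) (fderiv ℝ φ x (grad u x)) :=
    integrable_of_continuousOn hc hs (hA.mul (hgc.inner (𝕜 := ℝ)
      (hDφ.continuousOn.clm_apply hgc))) fun x hx => by simp [hout x hx]
  have i3 : Integrable fun x => (deriv (lam p ρ₀ g) (x 1) * chi u x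
      + dF₂ p ρ₀ g (‖grad u x‖ ^ 2) (x 1)) * (φ x) 1 :=
    integrable_of_continuousOn hc hs ((((hu.continuousOn_deriv_lam he).mul
      (continuousOn_chi u)).add (hu.continuousOn_dF₂ he)).mul
      (by have := hφ.continuous; fun_prop)) fun x hx => by
        simp [image_eq_zero_of_notMem_tsupport hx]
  have i4 : Integrable fun x => (F p ρ₀ g (‖grad u x‖ ^ 2) (x 1) + lam p ρ₀ g (x 1))
      * divergence φ x + fderiv ℝ (fun x : Plane => F p ρ₀ g (‖grad u x‖ ^ 2) (x 1)
        + lam p ρ₀ g (x 1)) x (φ x) :=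
    integrable_of_continuousOn hc hs ((hE.continuousOn.mul (continuousOn_divergence hφ _)).add
      ((hE.continuousOn_fderiv_of_isOpen ho (by norm_num)).clm_apply hφ.continuous.continuousOn))
      fun x hx => by
        rw [divergence_eq_zero_of_notMem hx, image_eq_zero_of_notMem_tsupport hx]; simp
  have i123 := (i1.sub (i2.const_mul 2)).add i3
  have hd := integral_sub i4 i123
  rw [hib] at hd
  have hv' : ∫ (a : Plane), (((fun x => (F p ρ₀ g (‖grad u x‖ ^ 2) (x 1) + lam p ρ₀ g (x 1) * chi u x)
      * divergence φ x) - fun x => 2 * (dF₁ p ρ₀ g (‖grad u x‖ ^ 2) (x 1) *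
      inner ℝ (grad u x) (fderiv ℝ φ x (grad u x)))) + fun x => (deriv (lam p ρ₀ g) (x 1) * chi u x
      + dF₂ p ρ₀ g (‖grad u x‖ ^ 2) (x 1)) * (φ x) 1) a = 0 := by
    rw [integral_add' (i1.sub (i2.const_mul 2)) i3, integral_sub' i1 (i2.const_mul 2),
      integral_const_mul]
    exact hv
  rw [hv', sub_zero] at hd
  have h2 : ∫ x, 2 * (dF₁ p ρ₀ g (‖grad u x‖ ^ 2) (x 1) *
      fderiv ℝ (fun y => inner ℝ (grad u y) (φ y)) x (grad u x)) = 0 := by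
    rw [← hd]
    refine integral_congr_ae (.of_forall fun x => ?_)
    by_cases hx : x ∈ tsupport φ
    · have hpos := hs hx
      have hm : HasFDerivAt (fun y => inner ℝ (grad u y) (φ y)) _ x :=
        (hgd x hpos).hasFDerivAt.inner ℝ (hφ.differentiable (by norm_num) x).hasFDerivAt
      simp only [Pi.add_apply, Pi.sub_apply]
      rw [hm.fderiv, (hu.hasFDerivAt_energy he hpos).fderiv, chi_of_pos hpos]
      have hsym := inner_fderiv_grad_comm ho hu.contDiffOn_two hpos (grad u x) (φ x)
      simp
      rw [hsym, real_inner_comm (grad u x) ((fderiv ℝ (grad u) x) (φ x))]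
      ring
    · have hz : (fun y => inner ℝ (grad u y) (φ y)) =ᶠ[𝓝 x] fun _ => (0 : ℝ) := by
        filter_upwards [notMem_tsupport_iff_eventuallyEq.1 hx] with y hy
        simp [hy]
      simp only [Pi.add_apply, Pi.sub_apply]
      rw [hz.fderiv_eq, divergence_eq_zero_of_notMem hx, image_eq_zero_of_notMem_tsupport hx,
        hout x hx]
      simp
  rw [integral_const_mul] at h2
  linarith [mul_eq_zero.1 h2]

end IsLocalSolution

namespace IsLocalSolution

variable {p : ℝ → ℝ} {ρ₀ g η K : ℝ} {c : Plane} {R C : ℝ} {u : Plane → ℝ}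

/-- The equation holds weakly in the fluid. The domain variation formula gives it only when tested
with `⟨∇u, φ⟩`, so it is tested with `φ = ξ ∇u / (|∇u|² + δ)` and `δ → 0`: where `∇u` vanishes the
equation carries no information, and the error is controlled by the Hessian. -/
lemma integral_fderiv_grad (hu : IsLocalSolution p ρ₀ g η c R C u) (he : IsExpansion p ρ₀ g η K)
    {ξ : Plane → ℝ} (hξ : ContDiff ℝ 1 ξ) (hc : HasCompactSupport ξ)
    (hs : tsupport ξ ⊆ {x | 0 < u x}) :
    ∫ x, dF₁ p ρ₀ g (‖grad u x‖ ^ 2) (x 1) * fderiv ℝ ξ x (grad u x) = 0 := by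
  have ho := hu.toIsProfile.isOpen_pos
  have hgc := hu.toIsProfile.continuousOn_grad
  have hg1 := contDiffOn_grad ho hu.contDiffOn_two
  have hgd : ∀ x, 0 < u x → DifferentiableAt ℝ (grad u) x := fun x hx =>
    (hg1.contDiffAt (ho.mem_nhds hx)).differentiableAt (by norm_num)
  have hDg : ContinuousOn (fderiv ℝ (grad u)) {x | 0 < u x} :=
    hg1.continuousOn_fderiv_of_isOpen ho (by norm_num)
  have hA := hu.continuousOn_dF₁ he
  have hDξ := hξ.continuous_fderiv (by norm_num)
  have hout : ∀ x ∉ tsupport ξ, fderiv ℝ ξ x = 0 := fun x hx => fderiv_of_notMem_tsupport ℝ hx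
  have hpos : ∀ (x : Plane) {δ : ℝ}, 0 < δ → 0 < ‖grad u x‖ ^ 2 + δ := fun x δ hδ => by positivity
  -- the test fields
  have hφ : ∀ δ > 0, ContDiff ℝ 1 (fun x => (ξ x / (‖grad u x‖ ^ 2 + δ)) • grad u x) ∧
      tsupport (fun x => (ξ x / (‖grad u x‖ ^ 2 + δ)) • grad u x) ⊆ tsupport ξ := by
    intro δ hδ
    have hsub : tsupport (fun x => (ξ x / (‖grad u x‖ ^ 2 + δ)) • grad u x) ⊆ tsupport ξ := by
      refine closure_mono fun x hx => ?_
      rw [Function.mem_support] at hx ⊢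
      contrapose! hx
      simp [hx]
    refine ⟨contDiff_of_tsupport fun x hx => ?_, hsub⟩
    have hg := hg1.contDiffAt (ho.mem_nhds (hs (hsub hx)))
    exact (hξ.contDiffAt.div ((hg.norm_sq ℝ).add contDiffAt_const) (hpos x hδ).ne').smul hg
  have hder : ∀ δ > 0, ∀ x, 0 < u x →
      fderiv ℝ (fun y => inner ℝ (grad u y) ((ξ y / (‖grad u y‖ ^ 2 + δ)) • grad u y)) x (grad u x)
        = ‖grad u x‖ ^ 2 / (‖grad u x‖ ^ 2 + δ) * fderiv ℝ ξ x (grad u x)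
          + ξ x * (2 * δ / (‖grad u x‖ ^ 2 + δ) ^ 2
              * inner ℝ (grad u x) (fderiv ℝ (grad u) x (grad u x))) := by
    intro δ hδ x hx
    have he1 : (fun y => inner ℝ (grad u y) ((ξ y / (‖grad u y‖ ^ 2 + δ)) • grad u y))
        = fun y => ξ y * (1 - δ * (‖grad u y‖ ^ 2 + δ)⁻¹) := by
      ext y
      have := (hpos y hδ).ne'
      rw [real_inner_smul_right, real_inner_self_eq_norm_sq]
      field_simp
      ring
    have hq : HasFDerivAt (fun y => ‖grad u y‖ ^ 2 + δ) _ x :=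
      ((hgd x hx).hasFDerivAt.norm_sq).add_const δ
    have hinv : HasFDerivAt (fun y => (‖grad u y‖ ^ 2 + δ)⁻¹) _ x :=
      (hasDerivAt_inv (hpos x hδ).ne').comp_hasFDerivAt x hq
    have hm : HasFDerivAt (fun y => ξ y * (1 - δ * (‖grad u y‖ ^ 2 + δ)⁻¹)) _ x :=
      (hξ.differentiable (by norm_num) x).hasFDerivAt.mul ((hinv.const_mul δ).const_sub 1)
    rw [he1, hm.fderiv]
    have := (hpos x hδ).ne'
    simp
    field_simp
    ring
  -- the limit `δ → 0`
  set f : ℝ → Plane → ℝ := fun δ x => dF₁ p ρ₀ g (‖grad u x‖ ^ 2) (x 1) *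
    fderiv ℝ (fun y => inner ℝ (grad u y) ((ξ y / (‖grad u y‖ ^ 2 + δ)) • grad u y)) x (grad u x)
    with hf
  have hzero : ∀ δ > 0, ∫ x, f δ x = 0 := fun δ hδ =>
    hu.integral_fderiv_inner he (hφ δ hδ).1 (hc.mono' (subset_closure.trans (hφ δ hδ).2))
      ((hφ δ hδ).2.trans hs)
  have hf0 : ∀ δ, ∀ x ∉ tsupport ξ, f δ x = 0 := by
    intro δ x hx
    have hz : (fun y => inner ℝ (grad u y) ((ξ y / (‖grad u y‖ ^ 2 + δ)) • grad u y))
        =ᶠ[𝓝 x] fun _ => (0 : ℝ) := by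
      filter_upwards [notMem_tsupport_iff_eventuallyEq.1 hx] with y hy
      simp [hy]
    simp [hf, hz.fderiv_eq]
  set bound : Plane → ℝ := fun x => |dF₁ p ρ₀ g (‖grad u x‖ ^ 2) (x 1)| *
    (|fderiv ℝ ξ x (grad u x)| + |ξ x| * (2 * ‖fderiv ℝ (grad u) x‖)) with hbound
  have hbi : Integrable bound := by
    refine integrable_of_continuousOn hc hs ?_ fun x hx => by
      simp [hbound, hout x hx, image_eq_zero_of_notMem_tsupport hx]
    refine hA.abs.mul (ContinuousOn.add ?_ ?_)
    · exact (hDξ.continuousOn.clm_apply hgc).abs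
    · exact hξ.continuous.abs.continuousOn.mul (continuousOn_const.mul hDg.norm)
  have hcont : ∀ δ > 0, Integrable (f δ) := by
    intro δ hδ
    refine integrable_of_continuousOn hc hs ?_ (hf0 δ)
    refine hA.mul (ContinuousOn.congr ?_ fun x hx => hder δ hδ x hx)
    have hq : ContinuousOn (fun x => ‖grad u x‖ ^ 2 + δ) {x | 0 < u x} :=
      (hgc.norm.pow 2).add continuousOn_const
    refine ContinuousOn.add (((hgc.norm.pow 2).div hq fun x _ => (hpos x hδ).ne').mul
      (hDξ.continuousOn.clm_apply hgc)) (hξ.continuous.continuousOn.mul (ContinuousOn.mul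
        (continuousOn_const.div (hq.pow 2) fun x _ => (pow_pos (hpos x hδ) 2).ne')
        (hgc.inner (hDg.clm_apply hgc))))
  have hlim : Tendsto (fun δ => ∫ x, f δ x) (𝓝[>] 0)
      (𝓝 (∫ x, dF₁ p ρ₀ g (‖grad u x‖ ^ 2) (x 1) * fderiv ℝ ξ x (grad u x))) := by
    refine tendsto_integral_filter_of_dominated_convergence bound ?_ ?_ hbi ?_
    · filter_upwards [self_mem_nhdsWithin] with δ hδ using (hcont δ hδ).aestronglyMeasurable
    · filter_upwards [self_mem_nhdsWithin] with δ (hδ : 0 < δ)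
      refine .of_forall fun x => ?_
      by_cases hx : x ∈ tsupport ξ
      · have hq := hpos x hδ
        have hg2 := sq_nonneg ‖grad u x‖
        have h1 : ‖grad u x‖ ^ 2 / (‖grad u x‖ ^ 2 + δ) ≤ 1 :=
          div_le_one_of_le₀ (by linarith) hq.le
        have h2 : |inner ℝ (grad u x) (fderiv ℝ (grad u) x (grad u x))|
            ≤ ‖fderiv ℝ (grad u) x‖ * ‖grad u x‖ ^ 2 := by
          refine (abs_real_inner_le_norm _ _).trans ?_
          have := (fderiv ℝ (grad u) x).le_opNorm (grad u x)
          nlinarith [norm_nonneg (grad u x)]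
        simp only [hf, hbound, Real.norm_eq_abs]
        rw [abs_mul, hder δ hδ x (hs hx)]
        refine mul_le_mul_of_nonneg_left ((abs_add_le _ _).trans (add_le_add ?_ ?_)) (abs_nonneg _)
        · rw [abs_mul, abs_of_nonneg (div_nonneg hg2 hq.le)]
          exact mul_le_of_le_one_left (abs_nonneg _) h1
        · rw [abs_mul, abs_mul, abs_of_nonneg (by positivity : 0 ≤ 2 * δ / (‖grad u x‖ ^ 2 + δ) ^ 2)]
          refine mul_le_mul_of_nonneg_left ?_ (abs_nonneg _)
          calc _ ≤ 2 * δ / (‖grad u x‖ ^ 2 + δ) ^ 2 * (‖fderiv ℝ (grad u) x‖ * ‖grad u x‖ ^ 2) :=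
                mul_le_mul_of_nonneg_left h2 (by positivity)
            _ = 2 * ‖fderiv ℝ (grad u) x‖ * (δ * ‖grad u x‖ ^ 2 / (‖grad u x‖ ^ 2 + δ) ^ 2) := by
                ring
            _ ≤ 2 * ‖fderiv ℝ (grad u) x‖ * 1 := by
                refine mul_le_mul_of_nonneg_left (div_le_one_of_le₀ ?_ (sq_nonneg _)) (by positivity)
                nlinarith [mul_nonneg hδ.le hg2, sq_nonneg (‖grad u x‖ ^ 2), sq_nonneg δ]
            _ = _ := mul_one _
      · rw [hf0 δ x hx, norm_zero]
        simp only [hbound]; positivity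
    · refine .of_forall fun x => ?_
      by_cases hx : x ∈ tsupport ξ
      · refine Tendsto.const_mul _ ?_
        have hev : (fun δ => ‖grad u x‖ ^ 2 / (‖grad u x‖ ^ 2 + δ) * fderiv ℝ ξ x (grad u x)
            + ξ x * (2 * δ / (‖grad u x‖ ^ 2 + δ) ^ 2
              * inner ℝ (grad u x) (fderiv ℝ (grad u) x (grad u x)))) =ᶠ[𝓝[>] 0]
            fun δ => fderiv ℝ (fun y => inner ℝ (grad u y)
              ((ξ y / (‖grad u y‖ ^ 2 + δ)) • grad u y)) x (grad u x) := by
          filter_upwards [self_mem_nhdsWithin] with δ hδ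
          exact (hder δ hδ x (hs hx)).symm
        refine Tendsto.congr' hev ?_
        by_cases h0 : grad u x = 0
        · simp [h0]
        · have hn : 0 < ‖grad u x‖ ^ 2 := by have := norm_pos_iff.2 h0; positivity
          have hc1 : ContinuousAt (fun δ : ℝ => ‖grad u x‖ ^ 2 / (‖grad u x‖ ^ 2 + δ)
              * fderiv ℝ ξ x (grad u x) + ξ x * (2 * δ / (‖grad u x‖ ^ 2 + δ) ^ 2
              * inner ℝ (grad u x) (fderiv ℝ (grad u) x (grad u x)))) 0 := by
            have h1 : ‖grad u x‖ ^ 2 + 0 ≠ 0 := by linarith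
            have h2 : (‖grad u x‖ ^ 2 + 0) ^ 2 ≠ 0 := pow_ne_zero 2 h1
            fun_prop (disch := assumption)
          have h3 := hc1.tendsto.mono_left (nhdsWithin_le_nhds (s := Ioi 0))
          simpa [hn.ne'] using h3
      · have e : fderiv ℝ ξ x (grad u x) = 0 := by simp [hout x hx]
        rw [e, mul_zero]
        exact tendsto_const_nhds.congr fun δ => (hf0 δ x hx).symm
  refine tendsto_nhds_unique hlim ?_
  refine tendsto_const_nhds.congr' ?_
  filter_upwards [self_mem_nhdsWithin] with δ hδ using (hzero δ hδ).symm

lemma exists_bound_dF₁ (hu : IsLocalSolution p ρ₀ g η c R C u) (he : IsExpansion p ρ₀ g η K)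
    {x : Plane} (hx : 0 < u x) :
    |dF₁ p ρ₀ g (‖grad u x‖ ^ 2) (x 1) - 1 / ρ₀| ≤ K * (C + 1) * max (x 1) 0 := by
  obtain ⟨h1, h2⟩ := hu.mem_box hx
  refine (he.dF₁_le _ h1 _ h2).trans ?_
  rw [mul_assoc]
  refine mul_le_mul_of_nonneg_left ?_ he.const_nonneg
  have := hu.grad_sq_le x
  rw [abs_of_nonneg (sq_nonneg _)]
  linarith [le_max_left (x 1) 0]

/-- Testing the equation with `η u`, through the truncations of `u`. -/
lemma integral_test_self (hu : IsLocalSolution p ρ₀ g η c R C u) (he : IsExpansion p ρ₀ g η K)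
    {ζ : Plane → ℝ} (hζ : ContDiff ℝ 1 ζ) (hc : HasCompactSupport ζ)
    (hs : tsupport ζ ⊆ ball c R) :
    ∫ x, dF₁ p ρ₀ g (‖grad u x‖ ^ 2) (x 1) *
      (ζ x * ‖grad u x‖ ^ 2 + u x * fderiv ℝ ζ x (grad u x)) = 0 := by
  have hp := hu.toIsProfile
  have ho := hp.isOpen_pos
  have hgc := hp.continuousOn_grad
  have hA := hu.continuousOn_dF₁ he
  have hDζ := hζ.continuous_fderiv (by norm_num)
  obtain ⟨M, hM0, hM⟩ := hp.exists_bound_grad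
  obtain ⟨U, hU0, hU⟩ := hp.exists_bound
  obtain ⟨Z, hZ⟩ := hζ.continuous.bounded_above_of_compact_support hc
  obtain ⟨Z', hZ'⟩ := hDζ.bounded_above_of_compact_support (hc.fderiv ℝ)
  have hZ0 : 0 ≤ Z := (norm_nonneg _).trans (hZ c)
  have hZ0' : 0 ≤ Z' := (norm_nonneg _).trans (hZ' c)
  set B : ℝ := 1 / ρ₀ + K * (C + 1) * max (c 1 + R) 0 with hB
  have hAb : ∀ x, 0 < u x → |dF₁ p ρ₀ g (‖grad u x‖ ^ 2) (x 1)| ≤ B := by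
    intro x hx
    have h1 := hu.exists_bound_dF₁ he hx
    have h2 : K * (C + 1) * max (x 1) 0 ≤ K * (C + 1) * max (c 1 + R) 0 :=
      mul_le_mul_of_nonneg_left (max_le_max_right 0 (hp.height_le hx))
        (mul_nonneg he.const_nonneg (by linarith [hp.const_nonneg]))
    have h3 : |dF₁ p ρ₀ g (‖grad u x‖ ^ 2) (x 1)| ≤
        |dF₁ p ρ₀ g (‖grad u x‖ ^ 2) (x 1) - 1 / ρ₀| + |1 / ρ₀| := by
      simpa using abs_add_le (dF₁ p ρ₀ g (‖grad u x‖ ^ 2) (x 1) - 1 / ρ₀) (1 / ρ₀)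
    rw [abs_of_pos (one_div_pos.2 he.rho_pos)] at h3
    linarith
  have hB0 : 0 ≤ B := by
    have := one_div_pos.2 he.rho_pos
    have := mul_nonneg (mul_nonneg he.const_nonneg (by linarith [hp.const_nonneg] : 0 ≤ C + 1))
      (le_max_right (c 1 + R) 0)
    linarith
  have hfd : ∀ x, |fderiv ℝ ζ x (grad u x)| ≤ Z' * M := fun x =>
    ((fderiv ℝ ζ x).le_opNorm _).trans (mul_le_mul (hZ' x) (hM x) (norm_nonneg _) hZ0')
  set f : ℝ → Plane → ℝ := fun ε x => dF₁ p ρ₀ g (‖grad u x‖ ^ 2) (x 1) *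
      (ζ x * (truncDeriv ε (u x) * ‖grad u x‖ ^ 2) + trunc ε (u x) * fderiv ℝ ζ x (grad u x)) with hf
  have hout : ∀ ε > 0, ∀ x, ¬ 0 < u x → f ε x = 0 := by
    intro ε hε x hx
    have h0 : u x ≤ ε := (not_lt.1 hx).trans hε.le
    simp [hf, grad_of_not_pos hx, trunc_of_le h0]
  have hfm : ∀ ε > 0, AEStronglyMeasurable (f ε) := by
    intro ε hε
    have h1 : ContinuousOn (f ε) {x | 0 < u x} := by
      refine hA.mul (ContinuousOn.add ?_ ?_)
      · exact hζ.continuous.continuousOn.mul (((continuous_truncDeriv hε).comp_continuousOn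
          hp.contDiffOn.continuousOn).mul (hgc.norm.pow 2))
      · exact ((contDiff_trunc hε).continuous.comp_continuousOn hp.contDiffOn.continuousOn).mul
          (hDζ.continuousOn.clm_apply hgc)
    have h2 : f ε = ({x | 0 < u x} : Set Plane).indicator (f ε) := by
      ext x
      by_cases hx : 0 < u x
      · simp [indicator, hx]
      · simp [indicator, hx, hout ε hε x hx]
    rw [h2, aestronglyMeasurable_indicator_iff hp.measurableSet_pos]
    exact h1.aestronglyMeasurable hp.measurableSet_pos
  have hzero : ∀ ε > 0, ∫ x, f ε x = 0 := by
    intro ε hε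
    set ξ : Plane → ℝ := fun x => ζ x * trunc ε (u x) with hξ
    have hsub : tsupport ξ ⊆ tsupport ζ := tsupport_mul_subset_left
    have hξc : ContDiff ℝ 1 ξ := contDiff_of_tsupport fun x hx =>
      hζ.contDiffAt.mul ((hp.contDiffOn_comp hε (contDiff_trunc hε)
        fun t ht => trunc_of_le ht).contDiffAt (isOpen_ball.mem_nhds (hs (hsub hx))))
    have hξs : tsupport ξ ⊆ {x | 0 < u x} := by
      intro x hx
      by_contra hn
      have hn' : u x < ε := (not_lt.1 hn).trans_lt hε
      have hev : ∀ᶠ y in 𝓝 x, u y < ε := (hp.continuousOn.continuousAt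
        (isOpen_ball.mem_nhds (hs (hsub hx)))).eventually (gt_mem_nhds hn')
      refine (notMem_tsupport_iff_eventuallyEq.2 ?_) hx
      filter_upwards [hev] with y hy
      simp [hξ, trunc_of_le hy.le]
    rw [← hu.integral_fderiv_grad he hξc (hc.mono' (subset_closure.trans hsub)) hξs]
    refine integral_congr_ae (.of_forall fun x => ?_)
    by_cases hx : 0 < u x
    · have h1 : HasFDerivAt ξ _ x := (hζ.differentiable (by norm_num) x).hasFDerivAt.mul
        (hp.hasFDerivAt_comp hε (hasDerivAt_trunc hε) (fun t ht => trunc_of_le ht) (hp.mem_ball hx))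
      simp only [hf]
      rw [h1.fderiv]
      simp
    · simp only [hout ε hε x hx, grad_of_not_pos hx, map_zero, mul_zero]
  have hlim : Tendsto (fun ε => ∫ x, f ε x) (𝓝[>] 0)
      (𝓝 (∫ x, dF₁ p ρ₀ g (‖grad u x‖ ^ 2) (x 1) *
        (ζ x * ‖grad u x‖ ^ 2 + u x * fderiv ℝ ζ x (grad u x)))) := by
    refine tendsto_integral_filter_of_dominated_convergence
      (({x | 0 < u x} : Set Plane).indicator fun _ => B * (Z * M ^ 2 + U * (Z' * M))) ?_ ?_ ?_ ?_
    · filter_upwards [self_mem_nhdsWithin] with ε hε using hfm ε hε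
    · filter_upwards [self_mem_nhdsWithin] with ε (hε : 0 < ε)
      refine .of_forall fun x => ?_
      by_cases hx : 0 < u x
      · rw [indicator_of_mem (show x ∈ {x | 0 < u x} from hx)]
        simp only [hf, Real.norm_eq_abs]
        rw [abs_mul]
        refine mul_le_mul (hAb x hx) ((abs_add_le _ _).trans (add_le_add ?_ ?_)) (abs_nonneg _) hB0
        · rw [abs_mul, abs_mul, abs_of_nonneg (truncDeriv_nonneg hε _),
            abs_of_nonneg (sq_nonneg ‖grad u x‖)]
          refine mul_le_mul (hZ x) ?_ (mul_nonneg (truncDeriv_nonneg hε _) (sq_nonneg _)) hZ0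
          calc _ ≤ 1 * ‖grad u x‖ ^ 2 :=
                mul_le_mul_of_nonneg_right (truncDeriv_le_one _ _) (sq_nonneg _)
            _ ≤ M ^ 2 := by rw [one_mul]; exact pow_le_pow_left₀ (norm_nonneg _) (hM x) 2
        · rw [abs_mul, abs_of_nonneg (trunc_nonneg hε _)]
          exact mul_le_mul ((trunc_le hε (hp.nonneg x)).trans (hU x)) (hfd x) (abs_nonneg _) hU0
      · rw [hout ε hε x hx, norm_zero, indicator_of_notMem (show x ∉ {x | 0 < u x} from hx)]
    · refine hp.integrable_of_bound (M := |B * (Z * M ^ 2 + U * (Z' * M))|)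
        (aestronglyMeasurable_const.indicator hp.measurableSet_pos) ?_ ?_
      · intro x hx
        rw [indicator_of_notMem (show x ∉ {x | 0 < u x} from hx)]
      · intro x hx
        rw [indicator_of_mem (show x ∈ {x | 0 < u x} from hx), Real.norm_eq_abs]
    · refine .of_forall fun x => ?_
      by_cases hx : 0 < u x
      · have h1 := tendsto_trunc (hp.nonneg x)
        have h2 := tendsto_truncDeriv hx
        have h3 := ((h2.mul_const (‖grad u x‖ ^ 2)).const_mul (ζ x)).add
          (h1.mul_const (fderiv ℝ ζ x (grad u x)))
        simpa [hf] using h3.const_mul (dF₁ p ρ₀ g (‖grad u x‖ ^ 2) (x 1))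
      · have h0 := hp.eq_zero_of_not_pos hx
        simp only [grad_of_not_pos hx, h0, map_zero, mul_zero, norm_zero, add_zero, ne_eq,
          OfNat.ofNat_ne_zero, not_false_eq_true, zero_pow]
        refine tendsto_const_nhds.congr' ?_
        filter_upwards [self_mem_nhdsWithin] with ε hε using (hout ε hε x hx).symm
  refine tendsto_nhds_unique hlim (tendsto_const_nhds.congr' ?_)
  filter_upwards [self_mem_nhdsWithin] with ε hε using (hzero ε hε).symm

end IsLocalSolution

/-! ### The incompressible problem with an error term -/

/-- The integrand of the first variation of `∫ |∇u|² + x₂ χ_{u > 0}`. -/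
def stress (u : Plane → ℝ) (φ : Plane → Plane) (x : Plane) : ℝ :=
  (‖grad u x‖ ^ 2 + x 1 * chi u x) * divergence φ x
    - 2 * inner ℝ (grad u x) (fderiv ℝ φ x (grad u x)) + chi u x * (φ x) 1

/-- A profile that solves the incompressible problem `Δu = 0` in `{u > 0}`, `|∇u|² = x₂` on
`∂{u > 0}`, both in the variational sense, up to errors of higher order in the depth `x₂`. The form of
the error is such that `κ` is multiplied by `r` under rescaling. -/
structure IsApproxSolution (c : Plane) (R C κ : ℝ) (u : Plane → ℝ) : Prop
    extends IsProfile c R C u where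
  error_nonneg : 0 ≤ κ
  variation_le : ∀ φ : Plane → Plane, ContDiff ℝ 1 φ → HasCompactSupport φ →
    tsupport φ ⊆ ball c R →
    |∫ x, stress u φ x| ≤
      κ * ∫ x : Plane, (max (x 1) 0 ^ 2 * ‖fderiv ℝ φ x‖ + max (x 1) 0 * ‖φ x‖)
  test_le : ∀ ζ : Plane → ℝ, ContDiff ℝ 1 ζ → HasCompactSupport ζ →
    tsupport ζ ⊆ ball c R →
    |∫ x, (ζ x * ‖grad u x‖ ^ 2 + u x * fderiv ℝ ζ x (grad u x))| ≤
      κ * ∫ x : Plane, max (x 1) 0 * (|ζ x| * ‖grad u x‖ ^ 2 + u x * ‖grad u x‖ * ‖fderiv ℝ ζ x‖)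

namespace IsProfile

variable {c : Plane} {R C : ℝ} {u : Plane → ℝ}

lemma integrable_of_continuousOn_pos (hu : IsProfile c R C u) {f : Plane → ℝ}
    (hf : ContinuousOn f {x | 0 < u x}) (h0 : ∀ x, ¬ 0 < u x → f x = 0) {M : ℝ}
    (hM : ∀ x, 0 < u x → |f x| ≤ M) : Integrable f := by
  refine hu.integrable_of_bound ?_ h0 hM
  have h2 : f = ({x | 0 < u x} : Set Plane).indicator f := by
    ext x
    by_cases hx : 0 < u x
    · simp [indicator, hx]
    · simp [indicator, hx, h0 x hx]
  rw [h2, aestronglyMeasurable_indicator_iff hu.measurableSet_pos]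
  exact hf.aestronglyMeasurable hu.measurableSet_pos

lemma abs_height_le (hu : IsProfile c R C u) {x : Plane} (hx : 0 < u x) :
    max (x 1) 0 = x 1 ∧ x 1 ≤ max (c 1 + R) 0 :=
  ⟨max_eq_left (hu.height_pos hx).le, (hu.height_le hx).trans (le_max_left _ _)⟩

end IsProfile

lemma _root_.MeasureTheory.Integrable.fun_sub {f g : Plane → ℝ} (hf : Integrable f)
    (hg : Integrable g) : Integrable fun x => f x - g x := hf.sub hg

lemma abs_inner_fderiv_le (φ : Plane → Plane) (x v : Plane) :
    |inner ℝ v (fderiv ℝ φ x v)| ≤ ‖v‖ ^ 2 * ‖fderiv ℝ φ x‖ := by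
  refine (abs_real_inner_le_norm _ _).trans ?_
  have := (fderiv ℝ φ x).le_opNorm v
  nlinarith [norm_nonneg v]

namespace IsLocalSolution

variable {p : ℝ → ℝ} {ρ₀ g η K : ℝ} {c : Plane} {R C : ℝ} {u : Plane → ℝ}

/-- Near the stagnation level a compressible solution solves the incompressible problem up to
errors of higher order. -/
theorem isApproxSolution (hu : IsLocalSolution p ρ₀ g η c R C u) (he : IsExpansion p ρ₀ g η K) :
    IsApproxSolution c R C (4 * ρ₀ * K * (C + 1) ^ 2) u := by
  have hp := hu.toIsProfile
  have hC := hp.const_nonneg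
  have hK := he.const_nonneg
  have hρ := he.rho_pos
  have hgc := hp.continuousOn_grad
  have hA := hu.continuousOn_dF₁ he
  set T := max (c 1 + R) 0 with hT
  have hT0 : 0 ≤ T := le_max_right _ _
  have hx2 : ∀ x, 0 < u x → 0 ≤ x 1 ∧ x 1 ≤ T := fun x hx =>
    ⟨(hp.height_pos hx).le, (hp.abs_height_le hx).2⟩
  -- the three errors; the last one is needed for both inequalities
  set e₁ : Plane → ℝ := fun x => ρ₀ * (F p ρ₀ g (‖grad u x‖ ^ 2) (x 1) + lam p ρ₀ g (x 1) * chi u x)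
    - (‖grad u x‖ ^ 2 + x 1 * chi u x) with he₁
  set e₃ : Plane → ℝ := fun x => ρ₀ * (deriv (lam p ρ₀ g) (x 1) * chi u x
    + dF₂ p ρ₀ g (‖grad u x‖ ^ 2) (x 1)) - chi u x with he₃
  set e₂ : Plane → ℝ := fun x => ρ₀ * dF₁ p ρ₀ g (‖grad u x‖ ^ 2) (x 1) - 1 with he₂
  have c₂ : ContinuousOn e₂ {x | 0 < u x} := (continuousOn_const.mul hA).sub continuousOn_const
  have b2 : ∀ x, 0 < u x → |e₂ x| ≤ ρ₀ * K * (C + 1) * x 1 := by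
    intro x hx
    have h1 := hu.exists_bound_dF₁ he hx
    rw [(hp.abs_height_le hx).1] at h1
    have e3 : e₂ x = ρ₀ * (dF₁ p ρ₀ g (‖grad u x‖ ^ 2) (x 1) - 1 / ρ₀) := by
      simp only [he₂]; field_simp
    rw [e3, abs_mul, abs_of_pos hρ, mul_assoc, mul_assoc, ← mul_assoc K]
    exact mul_le_mul_of_nonneg_left h1 hρ.le
  refine ⟨hp, by positivity, ?_, ?_⟩
  · intro φ hφ hc hs
    have hDφ := hφ.continuous_fderiv (by norm_num)
    obtain ⟨Z, hZ⟩ := hφ.continuous.bounded_above_of_compact_support hc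
    obtain ⟨Z', hZ'⟩ := hDφ.bounded_above_of_compact_support (hc.fderiv ℝ)
    have hZ0 : 0 ≤ Z := (norm_nonneg _).trans (hZ c)
    have hZ0' : 0 ≤ Z' := (norm_nonneg _).trans (hZ' c)
    have hgsq : ∀ x, 0 < u x → ‖grad u x‖ ^ 2 ≤ C * x 1 := fun x hx => by
      have := hp.grad_sq_le x
      rwa [(hp.abs_height_le hx).1] at this
    have hφ1 : ∀ x, |(φ x) 1| ≤ ‖φ x‖ := fun x => PiLp.norm_apply_le (φ x) 1
    set J : Plane → ℝ := fun x => inner ℝ (grad u x) (fderiv ℝ φ x (grad u x))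
    set w : Plane → ℝ := fun x => ‖grad u x‖ ^ 2 + x 1 * chi u x
    have b1 : ∀ x, 0 < u x → |e₁ x| ≤ ρ₀ * K * ((C + 1) * C + 1) * x 1 ^ 2 := by
      intro x hx
      obtain ⟨h1, h2⟩ := hu.mem_box hx
      have hx1 := h2.1
      have e1 := he.F_le _ h1 _ h2
      have e2 := he.lam_le _ h2
      rw [abs_of_nonneg (sq_nonneg ‖grad u x‖)] at e1
      have hg := hgsq x hx
      have hg0 := sq_nonneg ‖grad u x‖
      simp only [he₁, chi_of_pos hx]
      have e3 : ρ₀ * (F p ρ₀ g (‖grad u x‖ ^ 2) (x 1) + lam p ρ₀ g (x 1) * 1)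
          - (‖grad u x‖ ^ 2 + x 1 * 1) = ρ₀ * ((F p ρ₀ g (‖grad u x‖ ^ 2) (x 1)
          - ‖grad u x‖ ^ 2 / ρ₀) + (lam p ρ₀ g (x 1) - x 1 / ρ₀)) := by
        field_simp; ring
      rw [e3, abs_mul, abs_of_pos hρ, mul_assoc ρ₀, mul_assoc ρ₀]
      refine mul_le_mul_of_nonneg_left ((abs_add_le _ _).trans ?_) hρ.le
      have e4 : (‖grad u x‖ ^ 2 + x 1) * ‖grad u x‖ ^ 2 ≤ (C * x 1 + x 1) * (C * x 1) :=
        mul_le_mul (by linarith) hg hg0 (by positivity)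
      have e5 := mul_le_mul_of_nonneg_left e4 hK
      linarith
    have b3 : ∀ x, 0 < u x → |e₃ x| ≤ ρ₀ * K * (C + 1) * x 1 := by
      intro x hx
      obtain ⟨h1, h2⟩ := hu.mem_box hx
      have e1 := he.dF₂_le _ h1 _ h2
      have e2 := he.deriv_lam_le _ h2
      rw [abs_of_nonneg (sq_nonneg ‖grad u x‖)] at e1
      have hg := mul_le_mul_of_nonneg_left (hgsq x hx) hK
      simp only [he₃, chi_of_pos hx]
      have e3 : ρ₀ * (deriv (lam p ρ₀ g) (x 1) * 1 + dF₂ p ρ₀ g (‖grad u x‖ ^ 2) (x 1)) - 1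
          = ρ₀ * ((deriv (lam p ρ₀ g) (x 1) - 1 / ρ₀) + dF₂ p ρ₀ g (‖grad u x‖ ^ 2) (x 1)) := by
        field_simp; ring
      rw [e3, abs_mul, abs_of_pos hρ, mul_assoc ρ₀, mul_assoc ρ₀]
      refine mul_le_mul_of_nonneg_left ((abs_add_le _ _).trans ?_) hρ.le
      linarith
    have hdiv : ∀ x, |divergence φ x| ≤ 2 * Z' := fun x =>
      (abs_divergence_le φ x).trans (mul_le_mul_of_nonneg_left (hZ' x) two_pos.le)
    have hin : ∀ x, 0 < u x → |J x| ≤ C * x 1 * ‖fderiv ℝ φ x‖ :=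
      fun x hx => (abs_inner_fderiv_le φ x _).trans
        (mul_le_mul_of_nonneg_right (hgsq x hx) (norm_nonneg _))
    -- integrability
    have cχ := continuousOn_chi u
    have cφ1 : ContinuousOn (fun x => (φ x) 1) {x | 0 < u x} := by
      have := hφ.continuous; fun_prop
    have cx1 : ContinuousOn (fun x : Plane => x 1) {x | 0 < u x} := by fun_prop
    have cin : ContinuousOn J {x | 0 < u x} :=
      hgc.inner (𝕜 := ℝ) (hDφ.continuousOn.clm_apply hgc)
    have cdiv := continuousOn_divergence hφ {x | 0 < u x}
    have i1 : Integrable fun x => e₁ x * divergence φ x := by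
      refine hp.integrable_of_continuousOn_pos ((((continuousOn_const.mul ((hu.continuousOn_F he).add
        ((hu.continuousOn_lam he).mul cχ))).sub ((hgc.norm.pow 2).add (cx1.mul cχ))).mul cdiv))
        (fun x hx => by simp [he₁, grad_of_not_pos hx, chi_of_not_pos hx, F_zero])
        (M := ρ₀ * K * ((C + 1) * C + 1) * T ^ 2 * (2 * Z')) fun x hx => ?_
      rw [abs_mul]
      refine mul_le_mul ((b1 x hx).trans ?_) (hdiv x) (abs_nonneg _) (by positivity)
      exact mul_le_mul_of_nonneg_left (pow_le_pow_left₀ (hx2 x hx).1 (hx2 x hx).2 2) (by positivity)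
    have i2 : Integrable fun x => e₂ x * J x := by
      refine hp.integrable_of_continuousOn_pos (c₂.mul cin) (fun x hx => by simp [J, grad_of_not_pos hx])
        (M := ρ₀ * K * (C + 1) * T * (C * T * Z')) fun x hx => ?_
      rw [abs_mul]
      refine mul_le_mul ((b2 x hx).trans ?_) ((hin x hx).trans ?_) (abs_nonneg _) (by positivity)
      · exact mul_le_mul_of_nonneg_left (hx2 x hx).2 (by positivity)
      · exact mul_le_mul (mul_le_mul_of_nonneg_left (hx2 x hx).2 hC) (hZ' x) (norm_nonneg _)
          (by positivity)
    have i3 : Integrable fun x => e₃ x * (φ x) 1 := by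
      refine hp.integrable_of_continuousOn_pos (((continuousOn_const.mul
        (((hu.continuousOn_deriv_lam he).mul cχ).add (hu.continuousOn_dF₂ he))).sub cχ).mul cφ1)
        (fun x hx => by simp [he₃, grad_of_not_pos hx, chi_of_not_pos hx, dF₂_zero])
        (M := ρ₀ * K * (C + 1) * T * Z) fun x hx => ?_
      rw [abs_mul]
      refine mul_le_mul ((b3 x hx).trans ?_) ((hφ1 x).trans (hZ x)) (abs_nonneg _) (by positivity)
      exact mul_le_mul_of_nonneg_left (hx2 x hx).2 (by positivity)
    have j1 : Integrable fun x => w x * divergence φ x := by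
      refine hp.integrable_of_continuousOn_pos (((hgc.norm.pow 2).add (cx1.mul cχ)).mul cdiv)
        (fun x hx => by simp [w, grad_of_not_pos hx, chi_of_not_pos hx])
        (M := (C * T + T) * (2 * Z')) fun x hx => ?_
      rw [abs_mul]
      refine mul_le_mul ?_ (hdiv x) (abs_nonneg _) (by positivity)
      simp only [w]
      rw [chi_of_pos hx, mul_one, abs_of_nonneg (add_nonneg (sq_nonneg _) (hx2 x hx).1)]
      exact add_le_add ((hgsq x hx).trans (mul_le_mul_of_nonneg_left (hx2 x hx).2 hC)) (hx2 x hx).2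
    have j2 : Integrable J := by
      refine hp.integrable_of_continuousOn_pos cin (fun x hx => by simp [J, grad_of_not_pos hx])
        (M := C * T * Z') fun x hx => (hin x hx).trans ?_
      exact mul_le_mul (mul_le_mul_of_nonneg_left (hx2 x hx).2 hC) (hZ' x) (norm_nonneg _)
          (by positivity)
    have j3 : Integrable fun x => chi u x * (φ x) 1 := by
      refine hp.integrable_of_continuousOn_pos (cχ.mul cφ1)
        (fun x hx => by simp [chi_of_not_pos hx]) (M := Z) fun x hx => ?_
      rw [chi_of_pos hx, one_mul]
      exact (hφ1 x).trans (hZ x)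
    have hv := hu.variation_eq_zero φ hφ hc hs
    have hst : ∫ x, stress u φ x = (∫ x, w x * divergence φ x) - 2 * (∫ x, J x)
        + ∫ x, chi u x * (φ x) 1 := by
      rw [← integral_const_mul, ← integral_sub j1 (j2.const_mul 2),
        ← integral_add (j1.fun_sub (j2.const_mul 2)) j3]
      rfl
    have herr : ∫ x, (e₁ x * divergence φ x - 2 * (e₂ x * J x) + e₃ x * (φ x) 1)
        = (∫ x, e₁ x * divergence φ x) - 2 * (∫ x, e₂ x * J x) + ∫ x, e₃ x * (φ x) 1 := by
      rw [integral_add (i1.fun_sub (i2.const_mul 2)) i3, integral_sub i1 (i2.const_mul 2),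
        integral_const_mul]
    have heq : ∫ x, stress u φ x
        = -∫ x, (e₁ x * divergence φ x - 2 * (e₂ x * J x) + e₃ x * (φ x) 1) := by
      have k1 := integral_add i1 j1
      have k2 := integral_add i2 j2
      have k3 := integral_add i3 j3
      have hr : ∀ f f' : Plane → ℝ, (∀ x, f x = ρ₀ * f' x) → ∫ x, f x = ρ₀ * ∫ x, f' x :=
        fun f f' h => by rw [← integral_const_mul]; exact integral_congr_ae (.of_forall h)
      rw [hr _ (fun x => (F p ρ₀ g (‖grad u x‖ ^ 2) (x 1) + lam p ρ₀ g (x 1) * chi u x)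
        * divergence φ x) fun x => by simp only [he₁, w]; ring] at k1
      rw [hr _ (fun x => dF₁ p ρ₀ g (‖grad u x‖ ^ 2) (x 1) * J x)
        fun x => by simp only [he₂]; ring] at k2
      rw [hr _ (fun x => (deriv (lam p ρ₀ g) (x 1) * chi u x
        + dF₂ p ρ₀ g (‖grad u x‖ ^ 2) (x 1)) * (φ x) 1) fun x => by simp only [he₃]; ring] at k3
      rw [herr, hst]
      linear_combination ρ₀ * hv - k1 + 2 * k2 - k3
    rw [heq, abs_neg, ← integral_const_mul, ← Real.norm_eq_abs]
    refine norm_integral_le_of_norm_le ?_ (.of_forall fun x => ?_)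
    · refine Integrable.const_mul (Continuous.integrable_of_hasCompactSupport ?_ ?_) _
      · have := hφ.continuous
        fun_prop
      · refine HasCompactSupport.intro hc fun x hx => ?_
        have : fderiv ℝ φ x = 0 := fderiv_of_notMem_tsupport ℝ hx
        simp [this, image_eq_zero_of_notMem_tsupport hx]
    · by_cases hx : 0 < u x
      · rw [(hp.abs_height_le hx).1, Real.norm_eq_abs]
        have hx1 := (hx2 x hx).1
        have c1 : |e₁ x * divergence φ x| ≤ ρ₀ * K * ((C + 1) * C + 1) * x 1 ^ 2 * (2 * ‖fderiv ℝ φ x‖) := by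
          rw [abs_mul]
          exact mul_le_mul (b1 x hx) (abs_divergence_le φ x) (abs_nonneg _) (by positivity)
        have c2 : |2 * (e₂ x * J x)| ≤ 2 * (ρ₀ * K * (C + 1) * x 1 * (C * x 1 * ‖fderiv ℝ φ x‖)) := by
          rw [abs_mul, abs_mul, abs_two]
          exact mul_le_mul_of_nonneg_left (mul_le_mul (b2 x hx) (hin x hx) (abs_nonneg _)
            (by positivity)) two_pos.le
        have c3 : |e₃ x * (φ x) 1| ≤ ρ₀ * K * (C + 1) * x 1 * ‖φ x‖ := by
          rw [abs_mul]
          exact mul_le_mul (b3 x hx) (hφ1 x) (abs_nonneg _) (by positivity)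
        refine (abs_add_le _ _).trans ((add_le_add ((abs_sub _ _).trans (add_le_add c1 c2)) c3).trans
          ?_)
        have d1 : 0 ≤ ρ₀ * K * (x 1 ^ 2 * ‖fderiv ℝ φ x‖) := by positivity
        have d2 : 0 ≤ ρ₀ * K * (x 1 * ‖φ x‖) := by positivity
        nlinarith [mul_nonneg hC d1, mul_nonneg hC d2, mul_nonneg (mul_nonneg hC hC) d2]
      · simp only [he₁, he₃, J, grad_of_not_pos hx, chi_of_not_pos hx, norm_zero, ne_eq, OfNat.ofNat_ne_zero,
          not_false_eq_true, zero_pow, F_zero, dF₂_zero, mul_zero, add_zero, sub_zero, zero_mul,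
          map_zero, inner_zero_left]
        have := le_max_right (x 1) 0
        positivity
  · intro ζ hζ hc hs
    have hDζ := hζ.continuous_fderiv (by norm_num)
    obtain ⟨M, hM0, hM⟩ := hp.exists_bound_grad
    obtain ⟨U, hU0, hU⟩ := hp.exists_bound
    obtain ⟨Z, hZ⟩ := hζ.continuous.bounded_above_of_compact_support hc
    obtain ⟨Z', hZ'⟩ := hDζ.bounded_above_of_compact_support (hc.fderiv ℝ)
    have hZ0 : 0 ≤ Z := (norm_nonneg _).trans (hZ c)
    have hZ0' : 0 ≤ Z' := (norm_nonneg _).trans (hZ' c)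
    set q : Plane → ℝ := fun x => ζ x * ‖grad u x‖ ^ 2 + u x * fderiv ℝ ζ x (grad u x) with hqd
    set Q : Plane → ℝ := fun x => |ζ x| * ‖grad u x‖ ^ 2 + u x * ‖grad u x‖ * ‖fderiv ℝ ζ x‖ with hQ
    have hq : ∀ x, |q x| ≤ Q x := by
      intro x
      refine (abs_add_le _ _).trans (add_le_add ?_ ?_)
      · rw [abs_mul, abs_of_nonneg (sq_nonneg ‖grad u x‖)]
      · rw [abs_mul, abs_of_nonneg (hp.nonneg x), mul_assoc]
        refine mul_le_mul_of_nonneg_left ?_ (hp.nonneg x)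
        rw [mul_comm]
        exact (fderiv ℝ ζ x).le_opNorm _
    have hqM : ∀ x, Q x ≤ Z * M ^ 2 + U * M * Z' := by
      intro x
      refine add_le_add (mul_le_mul (hZ x) (pow_le_pow_left₀ (norm_nonneg _) (hM x) 2) (sq_nonneg _)
        hZ0) (mul_le_mul (mul_le_mul (hU x) (hM x) (norm_nonneg _) hU0) (hZ' x) (norm_nonneg _)
        (by positivity))
    have hq0 : ∀ x, 0 ≤ Q x := fun x => by
      simp only [hQ]; have := hp.nonneg x; positivity
    have cu := hp.contDiffOn.continuousOn
    have cint : ContinuousOn q {x | 0 < u x} := (hζ.continuous.continuousOn.mul (hgc.norm.pow 2)).add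
          (cu.mul (hDζ.continuousOn.clm_apply hgc))
    have j1 : Integrable q :=
      hp.integrable_of_continuousOn_pos cint (fun x hx => by simp [hqd, grad_of_not_pos hx])
        (fun x _ => (hq x).trans (hqM x))
    have hb : ∀ x, 0 < u x → |e₂ x| ≤ 4 * ρ₀ * K * (C + 1) ^ 2 * max (x 1) 0 := by
      intro x hx
      rw [(hp.abs_height_le hx).1]
      have : 0 ≤ ρ₀ * K * x 1 := mul_nonneg (mul_nonneg hρ.le hK) (hx2 x hx).1
      refine (b2 x hx).trans ?_
      nlinarith [mul_nonneg hC this, mul_nonneg (mul_nonneg hC hC) this]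
    have i1 : Integrable fun x => e₂ x * q x := by
      refine hp.integrable_of_continuousOn_pos (c₂.mul cint)
        (fun x hx => by simp [hqd, grad_of_not_pos hx])
        (M := 4 * ρ₀ * K * (C + 1) ^ 2 * T * (Z * M ^ 2 + U * M * Z')) fun x hx => ?_
      rw [abs_mul]
      refine mul_le_mul ((hb x hx).trans ?_) ((hq x).trans (hqM x)) (abs_nonneg _) (by positivity)
      rw [(hp.abs_height_le hx).1]
      exact mul_le_mul_of_nonneg_left (hp.abs_height_le hx).2 (by positivity)
    have h0 := hu.integral_test_self he hζ hc hs
    have heq : ∫ x, q x = - ∫ x, e₂ x * q x := by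
      have h1 := integral_add i1 j1
      have h2 : ∫ x, (e₂ x * q x + q x) = 0 := by
        rw [← mul_zero ρ₀, ← h0, ← integral_const_mul]
        refine integral_congr_ae (.of_forall fun x => ?_)
        simp only [he₂, hqd]; ring
      linarith
    rw [heq, abs_neg, ← integral_const_mul, ← Real.norm_eq_abs]
    refine norm_integral_le_of_norm_le ?_ (.of_forall fun x => ?_)
    · refine Integrable.const_mul (hp.integrable_of_continuousOn_pos (M := T * (Z * M ^ 2 + U * M * Z'))
        ?_ (fun x hx => by simp [grad_of_not_pos hx]) fun x hx => ?_) _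
      · have c1 : Continuous fun x : Plane => max (x 1) 0 := by fun_prop
        exact c1.continuousOn.mul ((hζ.continuous.abs.continuousOn.mul (hgc.norm.pow 2)).add
          ((cu.mul hgc.norm).mul hDζ.norm.continuousOn))
      · rw [abs_mul, (hp.abs_height_le hx).1, abs_of_nonneg (hp.height_pos hx).le,
          abs_of_nonneg (hq0 x)]
        exact mul_le_mul (hp.abs_height_le hx).2 (hqM x) (hq0 x) hT0
    · by_cases hx : 0 < u x
      · rw [Real.norm_eq_abs, abs_mul, ← mul_assoc]
        have := le_max_right (x 1) 0
        exact mul_le_mul (hb x hx) (hq x) (abs_nonneg _) (by positivity)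
      · simp [hqd, grad_of_not_pos hx]

end IsLocalSolution

/-! ### Rescaling -/

lemma integral_comp_affine (f : Plane → ℝ) (y : Plane) {r : ℝ} (hr : 0 < r) :
    ∫ x, f (y + r • x) = (r ^ 2)⁻¹ * ∫ x, f x := by
  have h := Measure.integral_comp_smul (volume : Measure Plane) (fun x => f (y + x)) r
  rw [h, integral_add_left_eq_self (fun x => f x) y, finrank_euclideanSpace, Fintype.card_fin,
    abs_of_pos (inv_pos.2 (pow_pos hr 2)), smul_eq_mul]

lemma rpow_three_halves_sq {r : ℝ} (hr : 0 < r) : (r ^ (3 / 2 : ℝ)) ^ 2 = r ^ 3 := by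
  rw [← Real.rpow_natCast, ← Real.rpow_mul hr.le, ← Real.rpow_natCast]
  norm_num

lemma rescale_pos_iff {u : Plane → ℝ} {y x : Plane} {r : ℝ} (hr : 0 < r) :
    0 < rescale u y r x ↔ 0 < u (y + r • x) := by
  unfold rescale
  exact div_pos_iff_of_pos_right (Real.rpow_pos_of_pos hr _)

lemma chi_rescale {u : Plane → ℝ} {y x : Plane} {r : ℝ} (hr : 0 < r) :
    chi (rescale u y r) x = chi u (y + r • x) := by
  unfold chi
  simp only [rescale_pos_iff hr]

lemma rescale_sq {u : Plane → ℝ} {y x : Plane} {r : ℝ} (hr : 0 < r) :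
    rescale u y r x ^ 2 = u (y + r • x) ^ 2 / r ^ 3 := by
  rw [rescale, div_pow, rpow_three_halves_sq hr]

/-- The gradient of the rescaled function is `rescaleGrad`. -/
lemma grad_rescale {u : Plane → ℝ} {y x : Plane} {r : ℝ} (hr : 0 < r)
    (hd : 0 < u (y + r • x) → DifferentiableAt ℝ u (y + r • x)) :
    grad (rescale u y r) x = rescaleGrad u y r x := by
  by_cases h : 0 < u (y + r • x)
  · rw [grad_of_pos ((rescale_pos_iff hr).2 h), rescaleGrad, grad_of_pos h]
    have h1 : HasFDerivAt (fun x : Plane => y + r • x) (r • ContinuousLinearMap.id ℝ Plane) x :=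
      ((hasFDerivAt_id x).const_smul r).const_add y
    have h2 : HasFDerivAt (rescale u y r) _ x :=
      ((hd h).hasFDerivAt.comp x h1).mul_const (r ^ (3 / 2 : ℝ))⁻¹
    refine ext_inner_right ℝ fun v => ?_
    rw [gradient, InnerProductSpace.toDual_symm_apply, h2.fderiv, real_inner_smul_left, gradient,
      InnerProductSpace.toDual_symm_apply]
    simp
    ring
  · rw [grad_of_not_pos (fun h' => h ((rescale_pos_iff hr).1 h')), rescaleGrad, grad_of_not_pos h,
      smul_zero]

lemma rescaleGrad_sq {u : Plane → ℝ} {y x : Plane} {r : ℝ} (hr : 0 < r) :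
    ‖rescaleGrad u y r x‖ ^ 2 = ‖grad u (y + r • x)‖ ^ 2 / r := by
  rw [rescaleGrad, norm_smul, mul_pow, Real.norm_eq_abs, sq_abs, div_pow, rpow_three_halves_sq hr]
  field_simp

/-- The map that undoes the rescaling. -/
lemma hasFDerivAt_unscale (y z : Plane) (r : ℝ) :
    HasFDerivAt (fun z : Plane => r⁻¹ • (z - y)) (r⁻¹ • ContinuousLinearMap.id ℝ Plane) z :=
  ((hasFDerivAt_id z).sub_const y).const_smul r⁻¹

section unscale

variable {E : Type*} [NormedAddCommGroup E] [NormedSpace ℝ E] {Φ : Plane → E} {y : Plane} {r : ℝ}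

lemma contDiff_unscale (hΦ : ContDiff ℝ 1 Φ) : ContDiff ℝ 1 (fun z => Φ (r⁻¹ • (z - y))) :=
  hΦ.comp ((contDiff_id.sub contDiff_const).const_smul r⁻¹)

lemma fderiv_unscale (hΦ : ContDiff ℝ 1 Φ) (hr : 0 < r) (x : Plane) :
    fderiv ℝ (fun z => Φ (r⁻¹ • (z - y))) (y + r • x) = r⁻¹ • fderiv ℝ Φ x := by
  have e : r⁻¹ • (y + r • x - y) = x := by rw [add_sub_cancel_left, smul_smul, inv_mul_cancel₀ hr.ne',
    one_smul]
  have h2 : HasFDerivAt (fun z => Φ (r⁻¹ • (z - y))) _ (y + r • x) :=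
    HasFDerivAt.comp (g := Φ) (f := fun z => r⁻¹ • (z - y)) (y + r • x)
      (hΦ.differentiable (by norm_num) (r⁻¹ • (y + r • x - y))).hasFDerivAt
      (hasFDerivAt_unscale y (y + r • x) r)
  rw [h2.fderiv, e]
  ext v
  simp

omit [NormedSpace ℝ E] in
lemma tsupport_unscale (hr : 0 < r) :
    tsupport (fun z => Φ (r⁻¹ • (z - y))) = (fun x => y + r • x) '' tsupport Φ := by
  let e : Plane ≃ₜ Plane := (Homeomorph.smulOfNeZero r hr.ne').trans (Homeomorph.addLeft y)
  have he : ∀ x, e x = y + r • x := fun x => rfl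
  have hs : ∀ z, e.symm z = r⁻¹ • (z - y) := by
    intro z
    rw [Homeomorph.symm_apply_eq, he, smul_smul, mul_inv_cancel₀ hr.ne', one_smul,
      add_sub_cancel]
  have h1 : (fun z => Φ (r⁻¹ • (z - y))) = Φ ∘ e.symm := by
    ext z; simp [hs]
  have h2 : (fun x => y + r • x) = e := by ext x; simp [he]
  rw [h1, h2, tsupport, tsupport, Function.support_comp_eq_preimage, e.image_closure,
    e.image_eq_preimage_symm]

omit [NormedSpace ℝ E] in
lemma hasCompactSupport_unscale (hr : 0 < r) (hc : HasCompactSupport Φ) :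
    HasCompactSupport (fun z => Φ (r⁻¹ • (z - y))) := by
  rw [HasCompactSupport, tsupport_unscale hr]
  exact hc.isCompact.image (by fun_prop)

end unscale

lemma divergence_unscale {Φ : Plane → Plane} {y : Plane} {r : ℝ} (hΦ : ContDiff ℝ 1 Φ) (hr : 0 < r)
    (x : Plane) :
    divergence (fun z => Φ (r⁻¹ • (z - y))) (y + r • x) = r⁻¹ * divergence Φ x := by
  unfold divergence
  rw [fderiv_unscale hΦ hr, Finset.mul_sum]
  simp

lemma mem_ball_rescale {c y x : Plane} {r R : ℝ} (hr : 0 < r) :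
    x ∈ ball (r⁻¹ • (c - y)) (R / r) ↔ y + r • x ∈ ball c R := by
  rw [mem_ball, mem_ball, dist_eq_norm, dist_eq_norm, lt_div_iff₀ hr]
  have : y + r • x - c = r • (x - r⁻¹ • (c - y)) := by
    rw [smul_sub, smul_smul, mul_inv_cancel₀ hr.ne', one_smul]; abel
  rw [this, norm_smul, Real.norm_eq_abs, abs_of_pos hr, mul_comm]

lemma max_height_affine {y x : Plane} {r : ℝ} (hy : y 1 = 0) (hr : 0 < r) :
    max ((y + r • x) 1) 0 = r * max (x 1) 0 := by
  rw [mul_max_of_nonneg _ _ hr.le, mul_zero]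
  simp [hy]

lemma IsProfile.rescale {c : Plane} {R C : ℝ} {u : Plane → ℝ} (hu : IsProfile c R C u) {y : Plane}
    (hy : y 1 = 0) {r : ℝ} (hr : 0 < r) :
    IsProfile (r⁻¹ • (c - y)) (R / r) C (rescale u y r) where
  const_nonneg := hu.const_nonneg
  nonneg x := div_nonneg (hu.nonneg _) (Real.rpow_nonneg hr.le _)
  eq_zero_of_le x hx := by
    rw [GravityWave.rescale, hu.eq_zero_of_le, zero_div]
    simp only [PiLp.add_apply, PiLp.smul_apply, hy, zero_add, smul_eq_mul]
    exact mul_nonpos_of_nonneg_of_nonpos hr.le hx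
  eq_zero_of_notMem x hx := by
    rw [GravityWave.rescale, hu.eq_zero_of_notMem, zero_div]
    rwa [← mem_ball_rescale hr]
  continuousOn := by
    refine ContinuousOn.div_const (hu.continuousOn.comp (f := fun x => y + r • x) (by fun_prop) ?_) _
    intro x hx
    exact (mem_ball_rescale hr).1 hx
  contDiffOn := by
    refine ContDiffOn.div_const (hu.contDiffOn.comp (f := fun x => y + r • x) (by fun_prop) ?_) _
    intro x hx
    exact (rescale_pos_iff hr).1 hx
  grad_sq_le x := by
    rw [grad_rescale hr fun h => hu.differentiableAt h, rescaleGrad_sq hr, div_le_iff₀ hr]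
    refine (hu.grad_sq_le _).trans (le_of_eq ?_)
    rw [max_height_affine hy hr]; ring

/-- Rescaling about a point of the axis preserves approximate solutions and improves the error. -/
lemma IsApproxSolution.rescale {c : Plane} {R C κ : ℝ} {u : Plane → ℝ}
    (hu : IsApproxSolution c R C κ u) {y : Plane} (hy : y 1 = 0) {r : ℝ} (hr : 0 < r) :
    IsApproxSolution (r⁻¹ • (c - y)) (R / r) C (κ * r) (rescale u y r) := by
  have hg : ∀ x, grad (GravityWave.rescale u y r) x = rescaleGrad u y r x := fun x =>
    grad_rescale hr fun h => hu.toIsProfile.differentiableAt h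
  have hback : ∀ x : Plane, r⁻¹ • (y + r • x - y) = x := fun x => by
    rw [add_sub_cancel_left, smul_smul, inv_mul_cancel₀ hr.ne', one_smul]
  set β : ℝ := r ^ (3 / 2 : ℝ) with hβ
  have hβ0 : 0 < β := Real.rpow_pos_of_pos hr _
  have hβ2 : β ^ 2 = r ^ 3 := rpow_three_halves_sq hr
  have hgs : ∀ x, grad u (y + r • x) = (β / r) • grad (GravityWave.rescale u y r) x := by
    intro x
    rw [hg, rescaleGrad, smul_smul]
    rw [show β / r * (r / r ^ (3 / 2 : ℝ)) = 1 by rw [← hβ]; field_simp, one_smul]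
  have hus : ∀ x, u (y + r • x) = β * GravityWave.rescale u y r x := by
    intro x
    rw [GravityWave.rescale, ← hβ]; field_simp
  have hbr : (β / r) ^ 2 = r := by rw [div_pow, hβ2]; field_simp
  refine ⟨hu.toIsProfile.rescale hy hr, mul_nonneg hu.error_nonneg hr.le, ?_, ?_⟩
  · intro Φ hΦ hc hs
    set φ : Plane → Plane := fun z => Φ (r⁻¹ • (z - y)) with hφ
    have hφs : tsupport φ ⊆ ball c R := by
      rw [hφ, tsupport_unscale hr]
      rintro _ ⟨x, hx, rfl⟩
      exact (mem_ball_rescale hr).1 (hs hx)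
    have h := hu.variation_le φ (contDiff_unscale hΦ) (hasCompactSupport_unscale hr hc) hφs
    have e1 : ∫ x, stress (GravityWave.rescale u y r) Φ x = (r ^ 2)⁻¹ * ∫ x, stress u φ x := by
      rw [← integral_comp_affine _ y hr]
      refine integral_congr_ae (.of_forall fun x => ?_)
      simp only [stress]
      rw [divergence_unscale hΦ hr, fderiv_unscale hΦ hr, chi_rescale hr, hgs x, norm_smul, mul_pow,
        Real.norm_eq_abs, sq_abs, hbr]
      have e2 : φ (y + r • x) = Φ x := by rw [hφ]; simp only [hback]
      rw [e2]
      have e3 : inner ℝ ((β / r) • grad (GravityWave.rescale u y r) x)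
          ((r⁻¹ • fderiv ℝ Φ x) ((β / r) • grad (GravityWave.rescale u y r) x))
          = (β / r) ^ 2 * r⁻¹ * inner ℝ (grad (GravityWave.rescale u y r) x)
            (fderiv ℝ Φ x (grad (GravityWave.rescale u y r) x)) := by
        simp only [smul_apply, map_smul, real_inner_smul_left,
          real_inner_smul_right]
        ring
      rw [e3, hbr]
      simp only [PiLp.add_apply, PiLp.smul_apply, hy, zero_add, smul_eq_mul]
      field_simp
    have e4 : ∫ x : Plane, (max (x 1) 0 ^ 2 * ‖fderiv ℝ Φ x‖ + max (x 1) 0 * ‖Φ x‖)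
        = r⁻¹ * ((r ^ 2)⁻¹ *
          ∫ x : Plane, (max (x 1) 0 ^ 2 * ‖fderiv ℝ φ x‖ + max (x 1) 0 * ‖φ x‖)) := by
      rw [← integral_comp_affine _ y hr, ← integral_const_mul]
      refine integral_congr_ae (.of_forall fun x => ?_)
      simp only
      have e2 : φ (y + r • x) = Φ x := by rw [hφ]; simp only [hback]
      rw [fderiv_unscale hΦ hr, max_height_affine hy hr, e2, norm_smul, Real.norm_eq_abs,
        abs_of_pos (inv_pos.2 hr)]
      field_simp
    rw [e1, e4, abs_mul, abs_of_pos (inv_pos.2 (pow_pos hr 2))]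
    refine (mul_le_mul_of_nonneg_left h (inv_pos.2 (pow_pos hr 2)).le).trans (le_of_eq ?_)
    field_simp
  · intro Z hZ hc hs
    set ζ : Plane → ℝ := fun z => Z (r⁻¹ • (z - y)) with hζ
    have hζs : tsupport ζ ⊆ ball c R := by
      rw [hζ, tsupport_unscale hr]
      rintro _ ⟨x, hx, rfl⟩
      exact (mem_ball_rescale hr).1 (hs hx)
    have h := hu.test_le ζ (contDiff_unscale hZ) (hasCompactSupport_unscale hr hc) hζs
    have e2 : ∀ x, ζ (y + r • x) = Z x := fun x => by rw [hζ]; simp only [hback]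
    have hb3 : β * (r⁻¹ * (β / r)) = r := by
      have : β * (r⁻¹ * (β / r)) = (β / r) ^ 2 := by ring
      rw [this, hbr]
    have e1 : ∫ x, (Z x * ‖grad (GravityWave.rescale u y r) x‖ ^ 2 + GravityWave.rescale u y r x *
        fderiv ℝ Z x (grad (GravityWave.rescale u y r) x)) = r⁻¹ * ((r ^ 2)⁻¹ *
        ∫ x, (ζ x * ‖grad u x‖ ^ 2 + u x * fderiv ℝ ζ x (grad u x))) := by
      rw [← integral_comp_affine _ y hr, ← integral_const_mul]
      refine integral_congr_ae (.of_forall fun x => ?_)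
      simp only
      rw [e2, fderiv_unscale hZ hr, hgs x, norm_smul, mul_pow, Real.norm_eq_abs, sq_abs, hbr, hus x]
      simp only [smul_apply, map_smul, smul_eq_mul]
      have h5 : ∀ a b : ℝ, β * a * (β / r * (r⁻¹ * b)) = r * (a * b) := by
        intro a b
        calc _ = (β * (r⁻¹ * (β / r))) * (a * b) := by ring
          _ = _ := by rw [hb3]
      rw [h5]
      field_simp
    have e4 : ∫ x : Plane, max (x 1) 0 * (|Z x| * ‖grad (GravityWave.rescale u y r) x‖ ^ 2
        + GravityWave.rescale u y r x * ‖grad (GravityWave.rescale u y r) x‖ * ‖fderiv ℝ Z x‖)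
        = r⁻¹ * (r⁻¹ * ((r ^ 2)⁻¹ * ∫ x : Plane, max (x 1) 0 *
          (|ζ x| * ‖grad u x‖ ^ 2 + u x * ‖grad u x‖ * ‖fderiv ℝ ζ x‖))) := by
      rw [← integral_comp_affine _ y hr, ← integral_const_mul, ← integral_const_mul]
      refine integral_congr_ae (.of_forall fun x => ?_)
      simp only
      rw [e2, fderiv_unscale hZ hr, max_height_affine hy hr, hgs x, norm_smul, norm_smul, mul_pow,
        Real.norm_eq_abs, Real.norm_eq_abs, sq_abs, hbr, hus x, abs_of_pos (inv_pos.2 hr),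
        abs_of_pos (div_pos hβ0 hr)]
      have h5 : ∀ a b d : ℝ, β * a * (β / r * b) * (r⁻¹ * d) = r * (a * b * d) := by
        intro a b d
        calc _ = (β * (r⁻¹ * (β / r))) * (a * b * d) := by ring
          _ = _ := by rw [hb3]
      rw [h5]
      field_simp
    rw [e1, e4, abs_mul, abs_mul, abs_of_pos (inv_pos.2 (pow_pos hr 2)), abs_of_pos (inv_pos.2 hr)]
    refine (mul_le_mul_of_nonneg_left (mul_le_mul_of_nonneg_left h (inv_pos.2 (pow_pos hr 2)).le)
      (inv_pos.2 hr).le).trans (le_of_eq ?_)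
    field_simp

/-! ### The monotonicity formula -/

/-- The radial weight `(r² - |x|²)⁺`. -/
def cutoff (r : ℝ) (x : Plane) : ℝ := max (r ^ 2 - ‖x‖ ^ 2) 0

lemma cutoff_nonneg (r : ℝ) (x : Plane) : 0 ≤ cutoff r x := le_max_right _ _

lemma cutoff_le (r : ℝ) (x : Plane) : cutoff r x ≤ r ^ 2 :=
  max_le (by nlinarith [sq_nonneg ‖x‖]) (sq_nonneg r)

lemma cutoff_eq_zero {r : ℝ} {x : Plane} (hr : 0 ≤ r) (h : r ≤ ‖x‖) : cutoff r x = 0 :=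
  max_eq_right (by nlinarith)

lemma continuous_cutoff (r : ℝ) : Continuous (cutoff r) := by unfold cutoff; fun_prop

lemma cutoff_mono {r s : ℝ} (hr : 0 ≤ r) (h : r ≤ s) (x : Plane) : cutoff r x ≤ cutoff s x :=
  max_le_max_right _ (by nlinarith)

/-- Where the weight does not vanish, `|x|² = r² - (r² - |x|²)⁺`. -/
lemma cutoff_mul_norm_sq (r : ℝ) (x : Plane) :
    cutoff r x * ‖x‖ ^ 2 = cutoff r x * (r ^ 2 - cutoff r x) := by
  unfold cutoff
  rcases le_total (r ^ 2 - ‖x‖ ^ 2) 0 with h | h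
  · simp [max_eq_right h]
  · rw [max_eq_left h]; ring

lemma hasFDerivAt_cutoff_pow (r : ℝ) (n : ℕ) (x : Plane) :
    HasFDerivAt (fun x => cutoff r x ^ (n + 2))
      ((-(2 * (n + 2)) * cutoff r x ^ (n + 1)) • innerSL ℝ x) x := by
  have h1 : HasFDerivAt (fun x : Plane => r ^ 2 - ‖x‖ ^ 2) (-(2 • innerSL ℝ x)) x := by
    have := (hasStrictFDerivAt_norm_sq (F := Plane) x).hasFDerivAt.const_sub (r ^ 2)
    simpa using this
  have h2 := (hasDerivAt_max_pow n (r ^ 2 - ‖x‖ ^ 2)).comp_hasFDerivAt x h1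
  refine h2.congr_fderiv ?_
  ext v
  simp [cutoff]
  ring

lemma contDiff_cutoff_pow (r : ℝ) (n : ℕ) : ContDiff ℝ 1 (fun x => cutoff r x ^ (n + 2)) :=
  (contDiff_max_pow n).comp (contDiff_const.sub (contDiff_norm_sq ℝ))

lemma tsupport_subset_closedBall {E : Type*} [Zero E] {f : Plane → E} {r : ℝ}
    (h : ∀ x : Plane, r ≤ ‖x‖ → f x = 0) : tsupport f ⊆ closedBall 0 r := by
  refine closure_minimal (fun x hx => ?_) isClosed_closedBall
  rw [mem_closedBall_zero_iff]
  by_contra h2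
  exact hx (h x (not_le.1 h2).le)

lemma hasCompactSupport_of_norm {E : Type*} [Zero E] {f : Plane → E} {r : ℝ}
    (h : ∀ x : Plane, r ≤ ‖x‖ → f x = 0) : HasCompactSupport f :=
  (isCompact_closedBall 0 r).of_isClosed_subset (isClosed_tsupport f) (tsupport_subset_closedBall h)

/-- The radial test field `((r² - |x|²)⁺)^(n+2) x`. -/
def radialField (r : ℝ) (n : ℕ) (x : Plane) : Plane := cutoff r x ^ (n + 2) • x

section radialField

variable (r : ℝ) (n : ℕ)

lemma contDiff_radialField : ContDiff ℝ 1 (radialField r n) :=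
  (contDiff_cutoff_pow r n).smul contDiff_id

lemma fderiv_radialField (x v : Plane) : fderiv ℝ (radialField r n) x v =
    cutoff r x ^ (n + 2) • v - (2 * (n + 2) * cutoff r x ^ (n + 1) * inner ℝ x v) • x := by
  have h : HasFDerivAt (radialField r n) _ x :=
    (hasFDerivAt_cutoff_pow r n x).smul (hasFDerivAt_id x)
  rw [h.fderiv]
  simp [sub_eq_add_neg, ← neg_smul]

lemma divergence_radialField (x : Plane) : divergence (radialField r n) x =
    2 * cutoff r x ^ (n + 2) - 2 * (n + 2) * cutoff r x ^ (n + 1) * ‖x‖ ^ 2 := by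
  have h := divergence_smul (hasFDerivAt_cutoff_pow r n x).differentiableAt
    (differentiableAt_id (𝕜 := ℝ) (x := x))
  unfold radialField
  simp only [id] at h
  rw [h, (hasFDerivAt_cutoff_pow r n x).fderiv]
  have h2 : divergence (id : Plane → Plane) x = 2 := by
    simp [divergence]
  rw [h2]
  simp
  ring

lemma radialField_eq_zero {r : ℝ} (hr : 0 ≤ r) {x : Plane} (hx : r ≤ ‖x‖) :
    radialField r n x = 0 := by
  rw [radialField, cutoff_eq_zero hr hx, zero_pow (by omega), zero_smul]

end radialField

lemma integrable_cutoff_pow_mul {f : Plane → ℝ} (hf : Integrable f) (r : ℝ) (n : ℕ) :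
    Integrable fun x => cutoff r x ^ n * f x :=
  hf.bdd_mul (c := (r ^ 2) ^ n) ((continuous_cutoff r).pow n).aestronglyMeasurable
    (.of_forall fun x => by
      rw [norm_pow, Real.norm_of_nonneg (cutoff_nonneg _ _)]
      exact pow_le_pow_left₀ (cutoff_nonneg _ _) (cutoff_le _ _) _)

/-- Differentiation of weighted integrals with respect to the radius. -/
lemma hasDerivAt_integral_cutoff_pow {f : Plane → ℝ} (hf : Integrable f) (n : ℕ) (r : ℝ) :
    HasDerivAt (fun r => ∫ x, cutoff r x ^ (n + 2) * f x)
      (2 * (n + 2) * r * ∫ x, cutoff r x ^ (n + 1) * f x) r := by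
  rw [← integral_const_mul]
  have hder : ∀ s x, HasDerivAt (fun s => cutoff s x ^ (n + 2) * f x)
      (2 * (n + 2) * s * (cutoff s x ^ (n + 1) * f x)) s := by
    intro s x
    have h1 : HasDerivAt (fun s : ℝ => s ^ 2 - ‖x‖ ^ 2) (2 * s) s := by
      simpa using (hasDerivAt_pow 2 s).sub_const (‖x‖ ^ 2)
    have h2 := ((hasDerivAt_max_pow n (s ^ 2 - ‖x‖ ^ 2)).comp s h1).mul_const (f x)
    refine h2.congr_deriv ?_
    simp [cutoff]
    ring
  refine (hasDerivAt_integral_of_dominated_loc_of_deriv_le (ball_mem_nhds r one_pos)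
    (bound := fun x => 2 * (n + 2) * (|r| + 1) * (((|r| + 1) ^ 2) ^ (n + 1) * ‖f x‖))
    (.of_forall fun s => (integrable_cutoff_pow_mul hf s _).1) (integrable_cutoff_pow_mul hf r _) ((integrable_cutoff_pow_mul hf r _).1.const_mul _)
    (.of_forall fun x s hs => ?_) ((hf.norm.const_mul _).const_mul _)
    (.of_forall fun x s _ => hder s x)).2
  have hs2 : |s| ≤ |r| + 1 := by
    rw [mem_ball, Real.dist_eq] at hs
    linarith [abs_sub_abs_le_abs_sub s r]
  have h1 : cutoff s x ≤ (|r| + 1) ^ 2 := by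
    refine (cutoff_le s x).trans ?_
    rw [← sq_abs s]
    exact pow_le_pow_left₀ (abs_nonneg _) hs2 2
  rw [norm_mul, norm_mul _ s, norm_mul (cutoff s x ^ (n + 1)), norm_pow,
    Real.norm_of_nonneg (cutoff_nonneg s x), Real.norm_eq_abs s, Real.norm_of_nonneg (by positivity : (0 : ℝ) ≤ 2 * (n + 2))]
  have := cutoff_nonneg s x
  gcongr

/-- The integrand of the incompressible energy. -/
def energyDensity (u : Plane → ℝ) (x : Plane) : ℝ := ‖grad u x‖ ^ 2 + x 1 * chi u x

/-- The monotone quantity: an energy with a radial weight that makes it differentiable in the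
radius, minus the corresponding boundary term. -/
def weissEnergy (u : Plane → ℝ) (r : ℝ) : ℝ :=
  ((∫ x, cutoff r x ^ 3 * energyDensity u x) - 9 * ∫ x, cutoff r x ^ 2 * u x ^ 2) / r ^ 9

/-- The weighted distance of `u` from being homogeneous of degree `3/2`. -/
def defect (u : Plane → ℝ) (r : ℝ) : ℝ :=
  ∫ x, cutoff r x ^ 2 * (inner ℝ x (grad u x) - 3 / 2 * u x) ^ 2

namespace IsProfile

variable {c : Plane} {R C : ℝ} {u : Plane → ℝ}

lemma continuousOn_chi_pos : ContinuousOn (chi u) {x | 0 < u x} :=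
  continuousOn_const.congr fun _ hx => chi_of_pos hx

lemma continuousOn_pos (hu : IsProfile c R C u) : ContinuousOn u {x | 0 < u x} :=
  hu.contDiffOn.continuousOn

lemma exists_bounds (hu : IsProfile c R C u) : ∃ M, 0 ≤ M ∧ ∀ x, 0 < u x →
    ‖grad u x‖ ≤ M ∧ |u x| ≤ M ∧ |x 1| ≤ M ∧ ‖x‖ ≤ M := by
  obtain ⟨M1, h1, hM1⟩ := hu.exists_bound_grad
  obtain ⟨M2, h2, hM2⟩ := hu.exists_bound
  refine ⟨M1 + M2 + (‖c‖ + |R|), by positivity, fun x hx => ?_⟩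
  have h3 : ‖x‖ ≤ ‖c‖ + |R| := by
    have := hu.mem_ball hx
    rw [mem_ball_iff_norm] at this
    linarith [norm_le_norm_add_norm_sub' x c, le_abs_self R]
  have h4 : |x 1| ≤ ‖x‖ := PiLp.norm_apply_le x 1
  have h5 := hM1 x
  have h6 := hM2 x
  rw [abs_of_pos hx]
  refine ⟨?_, ?_, ?_, ?_⟩ <;> linarith [norm_nonneg c, abs_nonneg R]


section integrable

variable (hu : IsProfile c R C u)
include hu

lemma integrable_grad_sq : Integrable fun x => ‖grad u x‖ ^ 2 := by
  obtain ⟨M, hM0, hM⟩ := hu.exists_bounds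
  refine hu.integrable_of_continuousOn_pos (hu.continuousOn_grad.norm.pow 2)
    (fun x hx => by simp [grad_of_not_pos hx]) (M := M ^ 2) fun x hx => ?_
  rw [abs_of_nonneg (sq_nonneg _)]
  exact pow_le_pow_left₀ (norm_nonneg _) (hM x hx).1 2

lemma integrable_height_mul_chi : Integrable fun x => x 1 * chi u x := by
  obtain ⟨M, hM0, hM⟩ := hu.exists_bounds
  refine hu.integrable_of_continuousOn_pos
    ((by fun_prop : Continuous fun x : Plane => x 1).continuousOn.mul continuousOn_chi_pos)
    (fun x hx => by simp [chi_of_not_pos hx]) (M := M) fun x hx => ?_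
  rw [chi_of_pos hx, mul_one]
  exact (hM x hx).2.2.1

lemma integrable_energyDensity : Integrable (energyDensity u) :=
  hu.integrable_grad_sq.add hu.integrable_height_mul_chi

lemma integrable_sq : Integrable fun x => u x ^ 2 := by
  obtain ⟨M, hM0, hM⟩ := hu.exists_bounds
  refine hu.integrable_of_continuousOn_pos (hu.continuousOn_pos.pow 2)
    (fun x hx => by simp [hu.eq_zero_of_not_pos hx]) (M := M ^ 2) fun x hx => ?_
  rw [abs_pow]
  exact pow_le_pow_left₀ (abs_nonneg _) (hM x hx).2.1 2

lemma continuousOn_inner_grad : ContinuousOn (fun x => inner ℝ x (grad u x)) {x | 0 < u x} :=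
  continuousOn_id.inner hu.continuousOn_grad

lemma integrable_mul_inner_grad : Integrable fun x => u x * inner ℝ x (grad u x) := by
  obtain ⟨M, hM0, hM⟩ := hu.exists_bounds
  refine hu.integrable_of_continuousOn_pos (hu.continuousOn_pos.mul hu.continuousOn_inner_grad)
    (fun x hx => by simp [grad_of_not_pos hx]) (M := M * (M * M)) fun x hx => ?_
  obtain ⟨h1, h2, -, h3⟩ := hM x hx
  rw [abs_mul]
  exact mul_le_mul h2 ((abs_real_inner_le_norm _ _).trans
    (mul_le_mul h3 h1 (norm_nonneg _) hM0)) (abs_nonneg _) hM0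

lemma integrable_inner_grad_sq : Integrable fun x => inner ℝ x (grad u x) ^ 2 := by
  obtain ⟨M, hM0, hM⟩ := hu.exists_bounds
  refine hu.integrable_of_continuousOn_pos (hu.continuousOn_inner_grad.pow 2)
    (fun x hx => by simp [grad_of_not_pos hx]) (M := (M * M) ^ 2) fun x hx => ?_
  obtain ⟨h1, h2, -, h3⟩ := hM x hx
  rw [abs_pow]
  exact pow_le_pow_left₀ (abs_nonneg _) ((abs_real_inner_le_norm _ _).trans
    (mul_le_mul h3 h1 (norm_nonneg _) hM0)) 2

lemma integrable_defect : Integrable fun x => (inner ℝ x (grad u x) - 3 / 2 * u x) ^ 2 := by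
  refine ((hu.integrable_inner_grad_sq.sub (hu.integrable_mul_inner_grad.const_mul 3)).add
    (hu.integrable_sq.const_mul (9 / 4))).congr (.of_forall fun x => ?_)
  simp only [Pi.add_apply, Pi.sub_apply]
  ring

end integrable

end IsProfile

lemma norm_radialField_le {r : ℝ} (hr : 0 ≤ r) (n : ℕ) (x : Plane) :
    ‖radialField r n x‖ ≤ (r ^ 2) ^ (n + 2) * r := by
  by_cases hx : r ≤ ‖x‖
  · rw [radialField_eq_zero n hr hx, norm_zero]; positivity
  · rw [radialField, norm_smul, norm_pow, Real.norm_of_nonneg (cutoff_nonneg _ _)]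
    exact mul_le_mul (pow_le_pow_left₀ (cutoff_nonneg _ _) (cutoff_le _ _) _) (not_le.1 hx).le
      (norm_nonneg _) (by positivity)

lemma norm_fderiv_radialField_le (r : ℝ) (n : ℕ) (x : Plane) :
    ‖fderiv ℝ (radialField r n) x‖ ≤ (2 * n + 5) * (r ^ 2) ^ (n + 2) := by
  have h1 : cutoff r x ^ (n + 2) ≤ (r ^ 2) ^ (n + 2) :=
    pow_le_pow_left₀ (cutoff_nonneg _ _) (cutoff_le _ _) _
  have h2 : cutoff r x ^ (n + 1) * ‖x‖ ^ 2 ≤ (r ^ 2) ^ (n + 2) := by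
    rw [pow_succ, mul_assoc, cutoff_mul_norm_sq, ← mul_assoc, ← pow_succ, pow_succ (r ^ 2)]
    exact mul_le_mul (pow_le_pow_left₀ (cutoff_nonneg _ _) (cutoff_le _ _) _)
      (by linarith [cutoff_nonneg r x]) (by linarith [cutoff_le r x]) (by positivity)
  refine ContinuousLinearMap.opNorm_le_bound _ (by positivity) fun v => ?_
  rw [fderiv_radialField]
  refine (norm_sub_le _ _).trans ?_
  rw [norm_smul, norm_smul, norm_mul, norm_pow, Real.norm_of_nonneg (cutoff_nonneg _ _), norm_mul,
    norm_pow, Real.norm_of_nonneg (cutoff_nonneg _ _),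
    Real.norm_of_nonneg (by positivity : (0 : ℝ) ≤ 2 * (n + 2))]
  have h3 : ‖(inner ℝ x v : ℝ)‖ ≤ ‖x‖ * ‖v‖ := norm_inner_le_norm x v
  calc _ ≤ (r ^ 2) ^ (n + 2) * ‖v‖
        + 2 * (n + 2) * cutoff r x ^ (n + 1) * (‖x‖ * ‖v‖) * ‖x‖ := by
        have := cutoff_nonneg r x
        gcongr
    _ = (r ^ 2) ^ (n + 2) * ‖v‖ + 2 * (n + 2) * (cutoff r x ^ (n + 1) * ‖x‖ ^ 2) * ‖v‖ := by ring
    _ ≤ (r ^ 2) ^ (n + 2) * ‖v‖ + 2 * (n + 2) * (r ^ 2) ^ (n + 2) * ‖v‖ := by gcongr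
    _ = _ := by ring

/-- Integrals over a ball about the origin of a function that is bounded there. -/
lemma integral_le_of_ball {f : Plane → ℝ} {r M : ℝ} (hr : 0 ≤ r) (hM : 0 ≤ M)
    (h0 : ∀ x, r ≤ ‖x‖ → f x = 0) (h : ∀ x, ‖x‖ < r → f x ≤ M) :
    ∫ x, f x ≤ M * (volume.real (ball (0 : Plane) 1) * r ^ 2) := by
  have h1 : volume.real (ball (0 : Plane) r) = volume.real (ball (0 : Plane) 1) * r ^ 2 := by
    rw [Measure.real, Measure.addHaar_ball volume (0 : Plane) hr, finrank_euclideanSpace,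
      Fintype.card_fin, ENNReal.toReal_mul, ENNReal.toReal_ofReal (by positivity), Measure.real,
      mul_comm]
  have h2 : ∫ x, (ball (0 : Plane) r).indicator (fun _ => M) x
      = M * (volume.real (ball (0 : Plane) 1) * r ^ 2) := by
    rw [integral_indicator isOpen_ball.measurableSet, setIntegral_const, smul_eq_mul, h1,
      mul_comm]
  rw [← h2]
  by_cases hf : Integrable f
  · refine integral_mono hf ((integrable_indicator_iff isOpen_ball.measurableSet).2
      (integrableOn_const (by finiteness))) fun x => ?_
    by_cases hx : ‖x‖ < r
    · rw [indicator_of_mem (mem_ball_zero_iff.2 hx)]; exact h x hx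
    · rw [indicator_of_notMem (fun h' => hx (mem_ball_zero_iff.1 h')), h0 x (not_lt.1 hx)]
  · rw [integral_undef hf]
    exact integral_nonneg fun x => indicator_nonneg (fun _ _ => hM) x

/-- The constant in the error term of the monotonicity formula. -/
def errorConst (C : ℝ) : ℝ := volume.real (ball (0 : Plane) 1) * (8 + 21 * C)

lemma height_le_norm (x : Plane) : max (x 1) 0 ≤ ‖x‖ :=
  max_le ((le_abs_self _).trans (PiLp.norm_apply_le x 1)) (norm_nonneg _)

namespace IsApproxSolution

variable {c : Plane} {R C κ : ℝ} {u : Plane → ℝ} {r : ℝ}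

lemma abs_integral_stress_radial_le (hu : IsApproxSolution c R C κ u) (hr : 0 < r)
    (hs : closedBall 0 r ⊆ ball c R) :
    |∫ x, stress u (radialField r 1) x|
      ≤ κ * (8 * r ^ 8 * (volume.real (ball (0 : Plane) 1) * r ^ 2)) := by
  have h0 : ∀ x : Plane, r ≤ ‖x‖ → radialField r 1 x = 0 := fun x hx =>
    radialField_eq_zero 1 hr.le hx
  refine (hu.variation_le _ (contDiff_radialField r 1) (hasCompactSupport_of_norm h0)
    ((tsupport_subset_closedBall h0).trans hs)).trans ?_
  refine mul_le_mul_of_nonneg_left (integral_le_of_ball hr.le (by positivity) ?_ ?_) hu.error_nonneg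
  · intro x hx
    have h2 : fderiv ℝ (radialField r 1) x = 0 := by
      ext1 v
      rw [fderiv_radialField, cutoff_eq_zero hr.le hx]; simp
    rw [h2, h0 x hx]; simp
  · intro x hx
    have h1 := norm_fderiv_radialField_le r 1 x
    have h2 := norm_radialField_le hr.le 1 x
    have h3 : max (x 1) 0 ≤ r := (height_le_norm x).trans hx.le
    have h4 : 0 ≤ max (x 1) 0 := le_max_right _ _
    norm_num at h1
    calc _ ≤ r ^ 2 * (7 * (r ^ 2) ^ 3) + r * ((r ^ 2) ^ 3 * r) := by gcongr
      _ = _ := by ring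

lemma abs_integral_test_radial_le (hu : IsApproxSolution c R C κ u) (hr : 0 < r)
    (hs : closedBall 0 r ⊆ ball c R) :
    |∫ x, (cutoff r x ^ 3 * ‖grad u x‖ ^ 2
        + u x * fderiv ℝ (fun x => cutoff r x ^ 3) x (grad u x))|
      ≤ κ * (7 * C * r ^ 8 * (volume.real (ball (0 : Plane) 1) * r ^ 2)) := by
  have hC := hu.toIsProfile.const_nonneg
  have h0 : ∀ x : Plane, r ≤ ‖x‖ → cutoff r x ^ 3 = 0 := fun x hx => by
    rw [cutoff_eq_zero hr.le hx]; norm_num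
  have hd : ∀ x : Plane, fderiv ℝ (fun x => cutoff r x ^ 3) x
      = (-6 * cutoff r x ^ 2) • innerSL ℝ x := fun x => by
    rw [(hasFDerivAt_cutoff_pow r 1 x).fderiv]; norm_num
  refine (hu.test_le _ (contDiff_cutoff_pow r 1) (hasCompactSupport_of_norm h0)
    ((tsupport_subset_closedBall h0).trans hs)).trans ?_
  refine mul_le_mul_of_nonneg_left (integral_le_of_ball hr.le (by positivity) ?_ ?_) hu.error_nonneg
  · intro x hx
    rw [hd, h0 x hx, cutoff_eq_zero hr.le hx]; simp
  · intro x hx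
    have h3 : max (x 1) 0 ≤ r := (height_le_norm x).trans hx.le
    have h4 : 0 ≤ max (x 1) 0 := le_max_right _ _
    obtain ⟨h5, h6⟩ := hu.toIsProfile.sq_le_of_center (y := 0) (by simp) hr
      (ball_subset_closedBall.trans hs) (mem_ball_zero_iff.2 hx)
    have h7 : u x * ‖grad u x‖ ≤ C * r ^ 2 := by
      refine abs_le_of_sq_le_sq' ?_ (by positivity) |>.2
      calc _ = u x ^ 2 * ‖grad u x‖ ^ 2 := by ring
        _ ≤ (C * r ^ 3) * (C * r) := by gcongr
        _ = _ := by ring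
    have h8 : cutoff r x ≤ r ^ 2 := cutoff_le r x
    have h9 := cutoff_nonneg r x
    have h10 : ‖fderiv ℝ (fun x => cutoff r x ^ 3) x‖ ≤ 6 * (r ^ 2) ^ 2 * r := by
      rw [hd, norm_smul, innerSL_apply_norm, norm_mul, norm_pow, Real.norm_of_nonneg h9]
      norm_num
      gcongr
    have hn := hu.toIsProfile.nonneg x
    rw [abs_of_nonneg (pow_nonneg h9 3)]
    calc _ ≤ r * ((r ^ 2) ^ 3 * (C * r) + C * r ^ 2 * (6 * (r ^ 2) ^ 2 * r)) := by gcongr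
      _ = _ := by ring

/-- The monotonicity formula: up to an error, the derivative of the monotone quantity measures the
distance from homogeneity. It combines the domain variation along `w(x) x` and the weak equation
tested with `w`, `w(x) = ((r² - |x|²)⁺)³`. -/
theorem exists_hasDerivAt_weissEnergy (hu : IsApproxSolution c R C κ u) (hr : 0 < r)
    (hs : closedBall 0 r ⊆ ball c R) :
    ∃ E, |E| ≤ errorConst C * κ * r ^ 10 ∧
      HasDerivAt (weissEnergy u) ((12 * defect u r - E) / r ^ 10) r := by
  have hp := hu.toIsProfile
  have i1 := integrable_cutoff_pow_mul hp.integrable_energyDensity r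
  have i2 := integrable_cutoff_pow_mul hp.integrable_sq r
  have i3 := integrable_cutoff_pow_mul hp.integrable_defect r
  have i4 := integrable_cutoff_pow_mul hp.integrable_grad_sq r
  have i5 := integrable_cutoff_pow_mul hp.integrable_mul_inner_grad r
  have i6 := integrable_cutoff_pow_mul hp.integrable_inner_grad_sq r
  have i7 := integrable_cutoff_pow_mul hp.integrable_height_mul_chi r
  -- the three identities, pointwise
  have hm := fun x : Plane => cutoff_mul_norm_sq r x
  have e1 : ∀ x, stress u (radialField r 1) x = 9 * (cutoff r x ^ 3 * (x 1 * chi u x))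
      + 6 * (cutoff r x ^ 3 * ‖grad u x‖ ^ 2) - 6 * r ^ 2 * (cutoff r x ^ 2 * energyDensity u x)
      + 12 * (cutoff r x ^ 2 * inner ℝ x (grad u x) ^ 2) := by
    intro x
    simp only [stress, divergence_radialField, fderiv_radialField, inner_sub_right,
      real_inner_smul_right, real_inner_self_eq_norm_sq, energyDensity]
    rw [real_inner_comm x (grad u x)]
    simp only [radialField, PiLp.smul_apply, smul_eq_mul]
    norm_num
    linear_combination (-6 * cutoff r x * (‖grad u x‖ ^ 2 + x 1 * chi u x)) * hm x
  have e2 : ∀ x, cutoff r x ^ 3 * ‖grad u x‖ ^ 2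
        + u x * fderiv ℝ (fun x => cutoff r x ^ 3) x (grad u x)
      = cutoff r x ^ 3 * ‖grad u x‖ ^ 2 - 6 * (cutoff r x ^ 2 * (u x * inner ℝ x (grad u x))) := by
    intro x
    rw [(hasFDerivAt_cutoff_pow r 1 x).fderiv]
    simp
    ring
  have e3 : ∀ x, u x ^ 2 * divergence (radialField r 0) x
        + 2 * u x * inner ℝ (grad u x) (radialField r 0 x)
      = 6 * (cutoff r x ^ 2 * u x ^ 2) - 4 * r ^ 2 * (cutoff r x ^ 1 * u x ^ 2)
        + 2 * (cutoff r x ^ 2 * (u x * inner ℝ x (grad u x))) := by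
    intro x
    rw [divergence_radialField, radialField, real_inner_smul_right, real_inner_comm x (grad u x)]
    norm_num
    linear_combination (-4 * u x ^ 2) * hm x
  have j1 : Integrable (stress u (radialField r 1)) := by
    refine ((((i7 3).const_mul 9).add ((i4 3).const_mul 6)).sub
      ((i1 2).const_mul (6 * r ^ 2))).add ((i6 2).const_mul 12) |>.congr
      (.of_forall fun x => (e1 x).symm)
  have j2 : Integrable fun x => cutoff r x ^ 3 * ‖grad u x‖ ^ 2
        + u x * fderiv ℝ (fun x => cutoff r x ^ 3) x (grad u x) :=
    ((i4 3).sub ((i5 2).const_mul 6)).congr (.of_forall fun x => (e2 x).symm)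
  have j3 : Integrable fun x => u x ^ 2 * divergence (radialField r 0) x
        + 2 * u x * inner ℝ (grad u x) (radialField r 0 x) :=
    (((i2 2).const_mul 6).sub ((i2 1).const_mul (4 * r ^ 2))).add ((i5 2).const_mul 2) |>.congr
      (.of_forall fun x => (e3 x).symm)
  have h0 : ∀ x : Plane, r ≤ ‖x‖ → radialField r 0 x = 0 := fun x hx =>
    radialField_eq_zero 0 hr.le hx
  have hibp := hp.integral_sq_mul_divergence (contDiff_radialField r 0)
    (hasCompactSupport_of_norm h0) ((tsupport_subset_closedBall h0).trans hs)
  set A := ∫ x, stress u (radialField r 1) x with hA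
  set B := ∫ x, (cutoff r x ^ 3 * ‖grad u x‖ ^ 2
        + u x * fderiv ℝ (fun x => cutoff r x ^ 3) x (grad u x)) with hB
  set D3 := ∫ x, cutoff r x ^ 3 * energyDensity u x with hD3
  set D2 := ∫ x, cutoff r x ^ 2 * energyDensity u x with hD2
  set N2 := ∫ x, cutoff r x ^ 2 * u x ^ 2 with hN2
  set N1 := ∫ x, cutoff r x ^ 1 * u x ^ 2 with hN1
  have key : A + 3 * B = 9 * D3 - 6 * r ^ 2 * D2 + 12 * defect u r + 36 * r ^ 2 * N1 - 81 * N2 := by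
    have s1 : A + 3 * B = ∫ x, (stress u (radialField r 1) x + 3 * (cutoff r x ^ 3 * ‖grad u x‖ ^ 2
        + u x * fderiv ℝ (fun x => cutoff r x ^ 3) x (grad u x))
        - 9 * (u x ^ 2 * divergence (radialField r 0) x
          + 2 * u x * inner ℝ (grad u x) (radialField r 0 x))) := by
      rw [integral_sub (j1.fun_add (j2.const_mul 3)) (j3.const_mul 9), integral_add j1 (j2.const_mul 3),
        integral_const_mul, integral_const_mul, hibp, ← hA, ← hB]
      ring
    have s2 : 9 * D3 - 6 * r ^ 2 * D2 + 12 * defect u r + 36 * r ^ 2 * N1 - 81 * N2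
        = ∫ x, (9 * (cutoff r x ^ 3 * energyDensity u x)
          - 6 * r ^ 2 * (cutoff r x ^ 2 * energyDensity u x)
          + 12 * (cutoff r x ^ 2 * (inner ℝ x (grad u x) - 3 / 2 * u x) ^ 2)
          + 36 * r ^ 2 * (cutoff r x ^ 1 * u x ^ 2) - 81 * (cutoff r x ^ 2 * u x ^ 2)) := by
      rw [integral_sub (((((i1 3).const_mul 9).fun_sub ((i1 2).const_mul (6 * r ^ 2))).fun_add
          ((i3 2).const_mul 12)).fun_add ((i2 1).const_mul (36 * r ^ 2))) ((i2 2).const_mul 81),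
        integral_add ((((i1 3).const_mul 9).fun_sub ((i1 2).const_mul (6 * r ^ 2))).fun_add
          ((i3 2).const_mul 12)) ((i2 1).const_mul (36 * r ^ 2)),
        integral_add (((i1 3).const_mul 9).fun_sub ((i1 2).const_mul (6 * r ^ 2))) ((i3 2).const_mul 12),
        integral_sub ((i1 3).const_mul 9) ((i1 2).const_mul (6 * r ^ 2))]
      simp only [integral_const_mul]
      rfl
    rw [s1, s2]
    refine integral_congr_ae (.of_forall fun x => ?_)
    simp only
    rw [e1, e2, e3]
    simp only [energyDensity]
    ring
  refine ⟨A + 3 * B, ?_, ?_⟩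
  · have b1 := hu.abs_integral_stress_radial_le hr hs
    have b2 := hu.abs_integral_test_radial_le hr hs
    have b3 := abs_add_le A (3 * B)
    rw [abs_mul, abs_of_pos (by norm_num : (0 : ℝ) < 3)] at b3
    calc _ ≤ _ := b3
      _ ≤ _ := add_le_add b1 (mul_le_mul_of_nonneg_left b2 (by norm_num))
      _ = _ := by rw [errorConst]; ring
  · have d1 := hasDerivAt_integral_cutoff_pow hp.integrable_energyDensity 1 r
    have d2 := hasDerivAt_integral_cutoff_pow hp.integrable_sq 0 r
    have d3 : HasDerivAt (weissEnergy u) _ r :=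
      (d1.sub (d2.const_mul 9)).div (hasDerivAt_pow 9 r) (pow_ne_zero 9 hr.ne')
    refine d3.congr_deriv ?_
    simp only [Pi.sub_apply, Nat.cast_one, Nat.cast_zero]
    norm_num only
    rw [key]
    simp only [← hD3, ← hD2, ← hN2, ← hN1]
    field_simp
    ring

end IsApproxSolution

lemma rescale_rescale {u : Plane → ℝ} {y z : Plane} {r s : ℝ} (hr : 0 < r) (hs : 0 < s) :
    rescale (rescale u y r) z s = rescale u (y + r • z) (r * s) := by
  ext x
  simp only [rescale]
  rw [Real.mul_rpow hr.le hs.le, div_div, smul_add, smul_smul, ← add_assoc,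
    mul_comm (r ^ (3 / 2 : ℝ))]

lemma rescale_one_rescale {u : Plane → ℝ} {y : Plane} {s : ℝ} (hs : 0 < s) :
    rescale (rescale u y 1) 0 s = rescale u y s := by
  rw [rescale_rescale one_pos hs, smul_zero, add_zero, one_mul]

lemma cutoff_mul {s : ℝ} (hs : 0 < s) (r : ℝ) (x : Plane) :
    cutoff (s * r) (s • x) = s ^ 2 * cutoff r x := by
  unfold cutoff
  rw [mul_max_of_nonneg _ _ (sq_nonneg s), norm_smul, Real.norm_of_nonneg hs.le]
  congr 1 <;> ring

namespace IsProfile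

variable {c : Plane} {R C : ℝ} {u : Plane → ℝ}

lemma energyDensity_rescale (hu : IsProfile c R C u) {y : Plane} (hy : y 1 = 0) {s : ℝ}
    (hs : 0 < s) (x : Plane) :
    energyDensity (GravityWave.rescale u y s) x = energyDensity u (y + s • x) / s := by
  simp only [energyDensity]
  rw [grad_rescale hs fun h => hu.differentiableAt h, rescaleGrad_sq hs, chi_rescale hs]
  simp [hy]
  field_simp

lemma weissEnergy_rescale (hu : IsProfile c R C u) {s : ℝ} (hs : 0 < s) (r : ℝ) :
    weissEnergy (GravityWave.rescale u 0 s) r = weissEnergy u (s * r) := by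
  have h1 : ∫ x, cutoff r x ^ 3 * energyDensity (GravityWave.rescale u 0 s) x
      = (s ^ 9)⁻¹ * ∫ x, cutoff (s * r) x ^ 3 * energyDensity u x := by
    have h := integral_comp_affine (fun x => cutoff (s * r) x ^ 3 * energyDensity u x) 0 hs
    rw [show (s ^ 9)⁻¹ = (s ^ 7)⁻¹ * (s ^ 2)⁻¹ by rw [← mul_inv, ← pow_add], mul_assoc, ← h,
      ← integral_const_mul]
    refine integral_congr_ae (.of_forall fun x => ?_)
    simp only
    rw [hu.energyDensity_rescale (by simp) hs, zero_add, cutoff_mul hs]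
    field_simp
  have h2 : ∫ x, cutoff r x ^ 2 * GravityWave.rescale u 0 s x ^ 2
      = (s ^ 9)⁻¹ * ∫ x, cutoff (s * r) x ^ 2 * u x ^ 2 := by
    have h := integral_comp_affine (fun x => cutoff (s * r) x ^ 2 * u x ^ 2) 0 hs
    rw [show (s ^ 9)⁻¹ = (s ^ 7)⁻¹ * (s ^ 2)⁻¹ by rw [← mul_inv, ← pow_add], mul_assoc, ← h,
      ← integral_const_mul]
    refine integral_congr_ae (.of_forall fun x => ?_)
    simp only
    rw [rescale_sq hs, zero_add, cutoff_mul hs]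
    field_simp
  rw [weissEnergy, weissEnergy, h1, h2, mul_pow]
  field_simp

lemma energyDensity_nonneg (hu : IsProfile c R C u) (x : Plane) : 0 ≤ energyDensity u x := by
  unfold energyDensity
  by_cases hx : 0 < u x
  · rw [chi_of_pos hx]; nlinarith [hu.height_pos hx, sq_nonneg ‖grad u x‖]
  · rw [chi_of_not_pos hx]; simp

lemma defect_nonneg (u : Plane → ℝ) (r : ℝ) : 0 ≤ defect u r :=
  integral_nonneg fun x => mul_nonneg (pow_nonneg (cutoff_nonneg r x) 2) (sq_nonneg _)

lemma defect_mono (hu : IsProfile c R C u) {r s : ℝ} (hr : 0 ≤ r) (h : r ≤ s) :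
    defect u r ≤ defect u s := by
  refine integral_mono (integrable_cutoff_pow_mul hu.integrable_defect r 2)
    (integrable_cutoff_pow_mul hu.integrable_defect s 2) fun x => ?_
  exact mul_le_mul_of_nonneg_right
    (pow_le_pow_left₀ (cutoff_nonneg r x) (cutoff_mono hr h x) 2) (sq_nonneg _)

/-- The monotone quantity is bounded below, because `u` grows at most like `r^{3/2}`. -/
lemma le_weissEnergy (hu : IsProfile c R C u) {r : ℝ} (hr : 0 < r)
    (hs : ball 0 r ⊆ ball c R) :
    -(9 * C * volume.real (ball (0 : Plane) 1)) ≤ weissEnergy u r := by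
  have hC := hu.const_nonneg
  have h1 : 0 ≤ ∫ x, cutoff r x ^ 3 * energyDensity u x := integral_nonneg fun x =>
    mul_nonneg (pow_nonneg (cutoff_nonneg r x) 3) (hu.energyDensity_nonneg x)
  have h2 : ∫ x, cutoff r x ^ 2 * u x ^ 2
      ≤ (r ^ 2) ^ 2 * (C * r ^ 3) * (volume.real (ball (0 : Plane) 1) * r ^ 2) := by
    refine integral_le_of_ball hr.le (by positivity) (fun x hx => ?_) fun x hx => ?_
    · rw [cutoff_eq_zero hr.le hx]; simp
    · have := (hu.sq_le_of_center (y := 0) (by simp) hr hs (mem_ball_zero_iff.2 hx)).2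
      exact mul_le_mul (pow_le_pow_left₀ (cutoff_nonneg _ _) (cutoff_le _ _) _) this
        (sq_nonneg _) (by positivity)
  rw [weissEnergy, le_div_iff₀ (by positivity)]
  nlinarith

end IsProfile

namespace IsApproxSolution

variable {c : Plane} {R C κ : ℝ} {u : Plane → ℝ} {ρ : ℝ}

lemma errorConst_nonneg (hC : 0 ≤ C) : 0 ≤ errorConst C := by
  unfold errorConst; positivity

lemma exists_deriv_weissEnergy (hu : IsApproxSolution c R C κ u)
    (hs : ball 0 ρ ⊆ ball c R) {r : ℝ} (hr : r ∈ Ioo 0 ρ) :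
    ∃ d, HasDerivAt (weissEnergy u) d r ∧ 12 * defect u r / r ^ 10 - errorConst C * κ ≤ d := by
  obtain ⟨E, h1, h2⟩ := hu.exists_hasDerivAt_weissEnergy hr.1
    ((closedBall_subset_ball hr.2).trans hs)
  refine ⟨_, h2, ?_⟩
  have h3 : 0 < r ^ 10 := pow_pos hr.1 10
  rw [sub_div]
  refine sub_le_sub_left ?_ _
  rw [div_le_iff₀ h3]
  exact (le_abs_self E).trans h1

lemma monotoneOn_weissEnergy (hu : IsApproxSolution c R C κ u)
    (hs : ball 0 ρ ⊆ ball c R) :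
    MonotoneOn (fun r => weissEnergy u r + errorConst C * κ * r) (Ioo 0 ρ) := by
  choose! d hd hle using fun r (hr : r ∈ Ioo 0 ρ) => hu.exists_deriv_weissEnergy hs hr
  have hd2 : ∀ r ∈ Ioo 0 ρ, HasDerivAt (fun r => weissEnergy u r + errorConst C * κ * r)
      (d r + errorConst C * κ) r := fun r hr => by
    have h := (hd r hr).add ((hasDerivAt_id r).const_mul (errorConst C * κ))
    rw [mul_one] at h
    exact h
  refine monotoneOn_of_deriv_nonneg (convex_Ioo 0 ρ)
    (fun r hr => (hd2 r hr).continuousAt.continuousWithinAt) ?_ ?_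
  · rw [interior_Ioo]
    exact fun r hr => (hd2 r hr).differentiableAt.differentiableWithinAt
  · rw [interior_Ioo]
    intro r hr
    rw [(hd2 r hr).deriv]
    have := hle r hr
    have h0 : 0 ≤ 12 * defect u r / r ^ 10 :=
      div_nonneg (mul_nonneg (by norm_num) (IsProfile.defect_nonneg u r)) (pow_nonneg hr.1.le 10)
    linarith

/-- The increment of the monotone quantity between two radii controls the defect. -/
lemma defect_le (hu : IsApproxSolution c R C κ u) (hs : ball 0 ρ ⊆ ball c R)
    (hρ : 2 < ρ) :
    defect u 1 ≤ 2 ^ 10 * (weissEnergy u 2 - weissEnergy u 1 + errorConst C * κ) := by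
  choose! d hd hle using fun r (hr : r ∈ Ioo 0 ρ) => hu.exists_deriv_weissEnergy hs hr
  have hsub : ∀ r ∈ Icc (1 : ℝ) 2, r ∈ Ioo 0 ρ := fun r hr =>
    ⟨by linarith [hr.1], by linarith [hr.2]⟩
  obtain ⟨r, hr, h⟩ := exists_hasDerivAt_eq_slope (weissEnergy u) d (by norm_num : (1 : ℝ) < 2)
    (fun r hr => (hd r (hsub r hr)).continuousAt.continuousWithinAt)
    (fun r hr => hd r (hsub r (Ioo_subset_Icc_self hr)))
  have h1 := hle r (hsub r (Ioo_subset_Icc_self hr))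
  have h2 := hu.toIsProfile.defect_mono zero_le_one hr.1.le
  have h3 : r ^ 10 ≤ 2 ^ 10 := pow_le_pow_left₀ (by linarith [hr.1]) hr.2.le 10
  have h4 : 0 < r ^ 10 := pow_pos (by linarith [hr.1]) 10
  have h5 := IsProfile.defect_nonneg u 1
  have h6 : defect u 1 / 2 ^ 10 ≤ 12 * defect u r / r ^ 10 := by
    exact div_le_div₀ (by linarith [IsProfile.defect_nonneg u r]) (by linarith) h4 h3
  rw [h] at h1
  rw [div_le_iff₀ (by norm_num)] at h6
  norm_num at h1 h6 ⊢
  linarith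

/-- The monotone quantity has a limit at the origin, and almost bounds it from above. -/
theorem exists_tendsto_weissEnergy (hu : IsApproxSolution c R C κ u) (hρ : 0 < ρ)
    (hs : ball 0 ρ ⊆ ball c R) :
    ∃ L, Tendsto (weissEnergy u) (𝓝[>] 0) (𝓝 L) ∧
      ∀ r ∈ Ioo 0 ρ, L ≤ weissEnergy u r + errorConst C * κ * r := by
  have hmono := hu.monotoneOn_weissEnergy hs
  have hC := hu.toIsProfile.const_nonneg
  have hκ := hu.error_nonneg
  have hE := errorConst_nonneg hC
  have hbdd : BddBelow ((fun r => weissEnergy u r + errorConst C * κ * r) '' Ioo 0 ρ) := by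
    refine ⟨-(9 * C * volume.real (ball (0 : Plane) 1)), ?_⟩
    rintro _ ⟨r, hr, rfl⟩
    have := hu.toIsProfile.le_weissEnergy hr.1 ((ball_subset_ball hr.2.le).trans hs)
    have h2 : 0 ≤ errorConst C * κ * r := mul_nonneg (mul_nonneg hE hκ) hr.1.le
    simp only
    linarith
  have hlim := hmono.tendsto_nhdsWithin_Ioo_right (nonempty_Ioo.2 hρ) hbdd
  refine ⟨_, ?_, fun r hr => csInf_le hbdd ⟨r, hr, rfl⟩⟩
  have h0 : Tendsto (fun r : ℝ => errorConst C * κ * r) (𝓝[>] 0) (𝓝 0) := by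
    have : Tendsto (fun r : ℝ => errorConst C * κ * r) (𝓝 0) (𝓝 (errorConst C * κ * 0)) :=
      tendsto_id.const_mul _
    rw [mul_zero] at this
    exact this.mono_left nhdsWithin_le_nhds
  have := hlim.sub h0
  simpa using this

end IsApproxSolution

/-! ### Compactness of blow-up sequences -/

/-- A sequence of rescaled solutions: the errors and the distances from homogeneity tend to zero, and
the perimeters of the fluid sets are bounded away from the axis. -/
structure IsBlowUpSequence (C : ℝ) (P : ℝ → ℝ) (V : ℕ → Plane → ℝ) : Prop where
  approx : ∃ (c : ℕ → Plane) (R κ : ℕ → ℝ), Tendsto κ atTop (𝓝 0) ∧ ∀ m,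
    IsApproxSolution (c m) (R m) C (κ m) (V m) ∧ ball 0 3 ⊆ ball (c m) (R m)
  defect : Tendsto (fun m => defect (V m) 1) atTop (𝓝 0)
  perimeter : ∀ m δ, 0 < δ → ∀ φ : Plane → Plane, ContDiff ℝ 1 φ → HasCompactSupport φ →
    tsupport φ ⊆ ball 0 1 ∩ {x | δ < x 1} → (∀ x, ‖φ x‖ ≤ 1) →
    ∫ x, chi (V m) x * divergence φ x ≤ P δ

/-- The convergence in which blow-up limits are taken: uniform convergence of the functions and weak
convergence of the characteristic functions, in the unit ball. -/
structure IsBlowUpLimit (V : ℕ → Plane → ℝ) (v : Plane → ℝ) (χ : Plane → ℝ) : Prop where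
  uniform : TendstoUniformlyOn V v atTop (closedBall 0 1)
  eq_zero : ∀ x, x ∉ closedBall (0 : Plane) 1 → v x = 0
  measurable : Measurable χ
  nonneg : ∀ x, 0 ≤ χ x
  le_one : ∀ x, χ x ≤ 1
  weak : ∀ f : Plane → ℝ, AEStronglyMeasurable f → (∃ M, ∀ x, |f x| ≤ M) →
    (∀ x, 1 ≤ ‖x‖ → f x = 0) →
    Tendsto (fun m => ∫ x, f x * chi (V m) x) atTop (𝓝 (∫ x, f x * χ x))

/-- Weak sequential compactness of measurable functions with values in `[0, 1]`. -/
lemma exists_weak_limit {X : ℕ → Plane → ℝ} (hX : ∀ m, Measurable (X m)) (h0 : ∀ m x, 0 ≤ X m x)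
    (h1 : ∀ m x, X m x ≤ 1) :
    ∃ χ : Plane → ℝ, Measurable χ ∧ (∀ x, 0 ≤ χ x) ∧ (∀ x, χ x ≤ 1) ∧ ∃ φ : ℕ → ℕ, StrictMono φ ∧
      ∀ f : Plane → ℝ, AEStronglyMeasurable f → (∃ M, ∀ x, |f x| ≤ M) →
        (∀ x, 1 ≤ ‖x‖ → f x = 0) →
        Tendsto (fun m => ∫ x, f x * X (φ m) x) atTop (𝓝 (∫ x, f x * χ x)) := by
  set μ : Measure Plane := volume.restrict (ball 0 1) with hμ
  have hfin : IsFiniteMeasure μ := ⟨by rw [hμ, Measure.restrict_apply_univ]; exact measure_ball_lt_top⟩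
  have hb : ∀ m x, ‖X m x‖ ≤ 1 := fun m x => by
    rw [Real.norm_of_nonneg (h0 m x)]; exact h1 m x
  have hm : ∀ m, MemLp (X m) 2 μ := fun m =>
    MemLp.of_bound (hX m).aestronglyMeasurable 1 (.of_forall (hb m))
  let T : ℕ → WeakDual ℝ (Lp ℝ 2 μ) := fun m =>
    StrongDual.toWeakDual (InnerProductSpace.toDual ℝ (Lp ℝ 2 μ) ((hm m).toLp (X m)))
  set B : ℝ := (μ univ).toReal ^ (1 / 2 : ℝ) with hB
  have hT : ∀ m, T m ∈ WeakDual.toStrongDual ⁻¹' closedBall (0 : StrongDual ℝ (Lp ℝ 2 μ)) B := by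
    intro m
    simp only [T, mem_preimage, mem_closedBall_zero_iff]
    change ‖InnerProductSpace.toDual ℝ (Lp ℝ 2 μ) ((hm m).toLp (X m))‖ ≤ B
    rw [LinearIsometryEquiv.norm_map, Lp.norm_toLp]
    have h := eLpNorm_le_of_ae_bound (p := 2) (μ := μ) (f := X m) (C := 1)
      (.of_forall (hb m))
    have h2 := ENNReal.toReal_mono (by finiteness) h
    refine h2.trans (le_of_eq ?_)
    simp [hB, ENNReal.toReal_rpow]
  have : Fact ((2 : ENNReal) ≠ ⊤) := ⟨by norm_num⟩
  obtain ⟨ℓ, -, φ, hφ, hlim⟩ := WeakDual.isSeqCompact_closedBall ℝ (Lp ℝ 2 μ)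
    (0 : StrongDual ℝ (Lp ℝ 2 μ)) B hT
  set w : Lp ℝ 2 μ := (InnerProductSpace.toDual ℝ (Lp ℝ 2 μ)).symm (WeakDual.toStrongDual ℓ) with hw
  have hweak : ∀ f : Plane → ℝ, MemLp f 2 μ →
      Tendsto (fun m => ∫ x, f x * X (φ m) x ∂μ) atTop (𝓝 (∫ x, f x * w x ∂μ)) := by
    intro f hf
    have h2 := (WeakDual.eval_continuous (hf.toLp f)).tendsto ℓ |>.comp hlim
    have e1 : ∀ m, T m (hf.toLp f) = ∫ x, f x * X m x ∂μ := by
      intro m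
      change InnerProductSpace.toDual ℝ (Lp ℝ 2 μ) ((hm m).toLp (X m)) (hf.toLp f) = _
      rw [InnerProductSpace.toDual_apply_apply, L2.inner_def]
      refine integral_congr_ae ?_
      filter_upwards [hf.coeFn_toLp, (hm m).coeFn_toLp] with x hx hy
      rw [hx, hy]; simp
    have e2 : ℓ (hf.toLp f) = ∫ x, f x * w x ∂μ := by
      have : ℓ (hf.toLp f) = InnerProductSpace.toDual ℝ (Lp ℝ 2 μ) w (hf.toLp f) := by
        rw [hw, LinearIsometryEquiv.apply_symm_apply]; rfl
      rw [this, InnerProductSpace.toDual_apply_apply, L2.inner_def]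
      refine integral_congr_ae ?_
      filter_upwards [hf.coeFn_toLp] with x hx
      rw [hx]; simp
    rw [← e2]
    refine h2.congr fun m => ?_
    exact e1 (φ m)
  have hwi : Integrable w μ := (Lp.memLp w).integrable (by norm_num)
  have hind : ∀ s : Set Plane, MeasurableSet s →
      Tendsto (fun m => ∫ x in s, X (φ m) x ∂μ) atTop (𝓝 (∫ x in s, w x ∂μ)) := by
    intro s hs
    have h := hweak (s.indicator fun _ => (1 : ℝ)) ((memLp_const 1).indicator hs)
    have e : ∀ f : Plane → ℝ, ∫ x, s.indicator (fun _ => (1 : ℝ)) x * f x ∂μ = ∫ x in s, f x ∂μ := by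
      intro f
      rw [← integral_indicator hs]
      refine integral_congr_ae (.of_forall fun x => ?_)
      by_cases hx : x ∈ s <;> simp [hx]
    simpa only [e] using h
  have hXi : ∀ m, Integrable (X m) μ := fun m => (hm m).integrable (by norm_num)
  have hw0 : 0 ≤ᵐ[μ] w := by
    refine ae_nonneg_of_forall_setIntegral_nonneg hwi fun s hs _ => ?_
    exact ge_of_tendsto' (hind s hs) fun m => integral_nonneg fun x => h0 _ x
  have hw1 : w ≤ᵐ[μ] fun _ => (1 : ℝ) := by
    refine ae_le_of_forall_setIntegral_le hwi (integrable_const 1) fun s hs _ => ?_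
    exact le_of_tendsto' (hind s hs) fun m => integral_mono (hXi _).integrableOn
      (integrable_const 1) fun x => h1 _ x
  have hwm := (Lp.aestronglyMeasurable w).aemeasurable
  refine ⟨fun x => max (min (hwm.mk w x) 1) 0, (hwm.measurable_mk.min measurable_const).max
    measurable_const, fun x => le_max_right _ _, fun x => max_le (min_le_right _ _) zero_le_one, φ,
    hφ, ?_⟩
  intro f hf ⟨M, hM⟩ hf0
  have hfm : MemLp f 2 μ := MemLp.of_bound hf.restrict M (.of_forall hM)
  have e : ∀ g : Plane → ℝ, ∫ x, f x * g x = ∫ x, f x * g x ∂μ := by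
    intro g
    rw [hμ, setIntegral_eq_integral_of_forall_compl_eq_zero]
    intro x hx
    rw [hf0 x (not_lt.1 fun h => hx (mem_ball_zero_iff.2 h)), zero_mul]
  simp only [e]
  have e2 : ∫ x, f x * w x ∂μ = ∫ x, f x * max (min (hwm.mk w x) 1) 0 ∂μ := by
    refine integral_congr_ae ?_
    filter_upwards [hw0, hw1, hwm.ae_eq_mk] with x h2 h3 h4
    simp only
    rw [← h4, min_eq_left h3, max_eq_left (show (0 : ℝ) ≤ w x from h2)]
  rw [← e2]
  exact hweak f hfm

/-- The Arzelà–Ascoli theorem on the closed unit ball. -/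
lemma exists_uniform_limit {V : ℕ → Plane → ℝ} {M L : ℝ} (hL : 0 ≤ L)
    (hb : ∀ m, ∀ x ∈ closedBall (0 : Plane) 1, |V m x| ≤ M)
    (hl : ∀ m, ∀ x ∈ closedBall (0 : Plane) 1, ∀ y ∈ closedBall (0 : Plane) 1,
      |V m x - V m y| ≤ L * ‖x - y‖) :
    ∃ v : Plane → ℝ, (∀ x, x ∉ closedBall (0 : Plane) 1 → v x = 0) ∧
      ∃ φ : ℕ → ℕ, StrictMono φ ∧
        TendstoUniformlyOn (fun m => V (φ m)) v atTop (closedBall 0 1) := by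
  set K : Set Plane := closedBall 0 1 with hK
  have : CompactSpace K := isCompact_iff_compactSpace.1 (isCompact_closedBall 0 1)
  have hlip : ∀ m, LipschitzWith ⟨L, hL⟩ (fun x : K => V m x) := fun m =>
    LipschitzWith.of_dist_le_mul fun x y => by
      rw [Real.dist_eq, Subtype.dist_eq, dist_eq_norm]
      exact hl m x x.2 y y.2
  let f : ℕ → BoundedContinuousFunction K ℝ := fun m =>
    BoundedContinuousFunction.mkOfCompact ⟨fun x : K => V m x, (hlip m).continuous⟩
  have hA := BoundedContinuousFunction.arzela_ascoli (Icc (-M) M) isCompact_Icc (range f)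
    (by
      rintro _ x ⟨m, rfl⟩
      exact abs_le.1 (hb m x x.2))
    (by
      refine (LipschitzWith.uniformEquicontinuous _ ⟨L, hL⟩ ?_).equicontinuous
      rintro ⟨_, m, rfl⟩
      exact hlip m)
  obtain ⟨w, -, φ, hφ, hlim⟩ := hA.tendsto_subseq (fun m => subset_closure (mem_range_self m))
  classical
  refine ⟨fun x => if h : x ∈ K then w ⟨x, h⟩ else 0, fun x hx => dif_neg hx, φ, hφ, ?_⟩
  rw [BoundedContinuousFunction.tendsto_iff_tendstoUniformly] at hlim
  rw [Metric.tendstoUniformly_iff] at hlim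
  rw [Metric.tendstoUniformlyOn_iff]
  intro ε hε
  filter_upwards [hlim ε hε] with m hm x hx
  rw [dif_pos hx]
  exact hm ⟨x, hx⟩

namespace IsBlowUpSequence

variable {C : ℝ} {P : ℝ → ℝ} {V : ℕ → Plane → ℝ}

lemma subseq (hV : IsBlowUpSequence C P V) {φ : ℕ → ℕ} (hφ : StrictMono φ) :
    IsBlowUpSequence C P (fun m => V (φ m)) := by
  obtain ⟨c, R, κ, hκ, h⟩ := hV.approx
  exact ⟨⟨c ∘ φ, R ∘ φ, κ ∘ φ, hκ.comp hφ.tendsto_atTop, fun m => h (φ m)⟩,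
    hV.defect.comp hφ.tendsto_atTop, fun m => hV.perimeter (φ m)⟩

lemma const_nonneg (hV : IsBlowUpSequence C P V) : 0 ≤ C := by
  obtain ⟨c, R, κ, -, h⟩ := hV.approx
  exact (h 0).1.toIsProfile.const_nonneg

lemma exists_profile (hV : IsBlowUpSequence C P V) (m : ℕ) :
    ∃ c R, IsProfile c R C (V m) ∧ ball 0 3 ⊆ ball c R := by
  obtain ⟨c, R, κ, -, h⟩ := hV.approx
  exact ⟨c m, R m, (h m).1.toIsProfile, (h m).2⟩

/-- Bounds for the sequence that do not depend on the index. -/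
lemma bounds (hV : IsBlowUpSequence C P V) (m : ℕ) {x : Plane} (hx : x ∈ ball 0 3) :
    ‖grad (V m) x‖ ≤ 3 * (C + 1) ∧ |V m x| ≤ 9 * (C + 1) := by
  obtain ⟨c, R, hp, hs⟩ := hV.exists_profile m
  have hC := hV.const_nonneg
  obtain ⟨h1, h2⟩ := hp.sq_le_of_center (y := 0) (by simp) (by norm_num : (0 : ℝ) < 3) hs hx
  constructor
  · exact le_of_sq_le_sq (h1.trans (by nlinarith)) (by positivity)
  · refine abs_le_of_sq_le_sq (h2.trans (by nlinarith)) (by positivity)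

lemma lipschitz (hV : IsBlowUpSequence C P V) (m : ℕ) {x y : Plane} (hx : x ∈ ball 0 3)
    (hy : y ∈ ball 0 3) : |V m x - V m y| ≤ 3 * (C + 1) * ‖x - y‖ := by
  obtain ⟨c, R, hp, hs⟩ := hV.exists_profile m
  exact hp.abs_sub_le (convex_ball _ _) hs (fun z hz => (hV.bounds m hz).1) hx hy

lemma closedBall_subset : closedBall (0 : Plane) 1 ⊆ ball 0 3 :=
  closedBall_subset_ball (by norm_num)

/-- Every blow-up sequence has a subsequence that converges to a blow-up limit. -/
theorem exists_isBlowUpLimit (hV : IsBlowUpSequence C P V) :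
    ∃ φ : ℕ → ℕ, StrictMono φ ∧ ∃ v χ, IsBlowUpLimit (fun m => V (φ m)) v χ := by
  have hC := hV.const_nonneg
  obtain ⟨v, hv, φ, hφ, hu⟩ := exists_uniform_limit (V := V) (M := 9 * (C + 1))
    (L := 3 * (C + 1)) (by positivity) (fun m x hx => (hV.bounds m (closedBall_subset hx)).2)
    (fun m x hx y hy => hV.lipschitz m (closedBall_subset hx) (closedBall_subset hy))
  obtain ⟨χ, h1, h2, h3, ψ, hψ, hw⟩ := exists_weak_limit (X := fun m => chi (V (φ m)))
    (fun m => by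
      obtain ⟨c, R, hp, -⟩ := hV.exists_profile (φ m)
      exact hp.measurable_chi)
    (fun m x => chi_nonneg _ _) (fun m x => chi_le_one _ _)
  refine ⟨φ ∘ ψ, hφ.comp hψ, v, χ, ⟨?_, hv, h1, h2, h3, hw⟩⟩
  intro U hU
  exact hψ.tendsto_atTop.eventually (hu U hU)

end IsBlowUpSequence

namespace IsBlowUpLimit

variable {C : ℝ} {P : ℝ → ℝ} {V : ℕ → Plane → ℝ} {v χ : Plane → ℝ}

lemma tendsto_apply (hL : IsBlowUpLimit V v χ) {x : Plane} (hx : x ∈ closedBall 0 1) :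
    Tendsto (fun m => V m x) atTop (𝓝 (v x)) :=
  hL.uniform.tendsto_at hx

section

variable (hL : IsBlowUpLimit V v χ) (hV : IsBlowUpSequence C P V)
include hL hV

lemma nonneg_fun (x : Plane) : 0 ≤ v x := by
  by_cases hx : x ∈ closedBall (0 : Plane) 1
  · refine ge_of_tendsto' (hL.tendsto_apply hx) fun m => ?_
    obtain ⟨c, R, hp, -⟩ := hV.exists_profile m
    exact hp.nonneg x
  · rw [hL.eq_zero x hx]

lemma eq_zero_of_le {x : Plane} (hx : x 1 ≤ 0) : v x = 0 := by
  by_cases hx1 : x ∈ closedBall (0 : Plane) 1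
  · refine tendsto_nhds_unique (hL.tendsto_apply hx1) ?_
    refine tendsto_const_nhds.congr fun m => ?_
    obtain ⟨c, R, hp, -⟩ := hV.exists_profile m
    exact (hp.eq_zero_of_le x hx).symm
  · exact hL.eq_zero x hx1

lemma lipschitz {x y : Plane} (hx : x ∈ closedBall 0 1) (hy : y ∈ closedBall 0 1) :
    |v x - v y| ≤ 3 * (C + 1) * ‖x - y‖ :=
  le_of_tendsto' ((hL.tendsto_apply hx).sub (hL.tendsto_apply hy)).abs fun m =>
    hV.lipschitz m (IsBlowUpSequence.closedBall_subset hx) (IsBlowUpSequence.closedBall_subset hy)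

lemma abs_le (x : Plane) : |v x| ≤ 9 * (C + 1) := by
  have hC := hV.const_nonneg
  by_cases hx : x ∈ closedBall (0 : Plane) 1
  · exact le_of_tendsto' (hL.tendsto_apply hx).abs fun m =>
      (hV.bounds m (IsBlowUpSequence.closedBall_subset hx)).2
  · rw [hL.eq_zero x hx, abs_zero]; positivity

lemma continuousOn : ContinuousOn v (closedBall 0 1) := by
  have hC := hV.const_nonneg
  refine LipschitzOnWith.continuousOn (K := ⟨3 * (C + 1), by positivity⟩)
    (LipschitzOnWith.of_dist_le_mul fun x hx y hy => ?_)
  rw [Real.dist_eq, dist_eq_norm]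
  exact hL.lipschitz hV hx hy

open Classical in
lemma measurable_fun : Measurable v := by
  have h : v = (closedBall (0 : Plane) 1).indicator v := by
    ext x
    by_cases hx : x ∈ closedBall (0 : Plane) 1
    · rw [indicator_of_mem hx]
    · rw [indicator_of_notMem hx, hL.eq_zero x hx]
  rw [h, ← piecewise_eq_indicator]
  exact (hL.continuousOn hV).measurable_piecewise continuousOn_const
    isClosed_closedBall.measurableSet

end

end IsBlowUpLimit

/-- Dominated convergence in the unit ball. -/
lemma tendsto_integral_of_ball {F : ℕ → Plane → ℝ} {f : Plane → ℝ} {M : ℝ}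
    (hF : ∀ m, AEStronglyMeasurable (F m)) (hM : ∀ m x, ‖x‖ < 1 → |F m x| ≤ M)
    (h0 : ∀ m x, 1 ≤ ‖x‖ → F m x = 0) (hf0 : ∀ x, 1 ≤ ‖x‖ → f x = 0)
    (hlim : ∀ x, ‖x‖ < 1 → Tendsto (fun m => F m x) atTop (𝓝 (f x))) :
    Tendsto (fun m => ∫ x, F m x) atTop (𝓝 (∫ x, f x)) := by
  refine tendsto_integral_of_dominated_convergence
    ((ball (0 : Plane) 1).indicator fun _ => M) hF
    ((integrable_indicator_iff isOpen_ball.measurableSet).2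
      (integrableOn_const (by finiteness))) (fun m => .of_forall fun x => ?_)
    (.of_forall fun x => ?_)
  · by_cases hx : ‖x‖ < 1
    · rw [indicator_of_mem (mem_ball_zero_iff.2 hx)]; exact hM m x hx
    · rw [indicator_of_notMem (fun h => hx (mem_ball_zero_iff.1 h)), h0 m x (not_lt.1 hx), norm_zero]
  · by_cases hx : ‖x‖ < 1
    · exact hlim x hx
    · rw [hf0 x (not_lt.1 hx)]
      exact tendsto_const_nhds.congr fun m => (h0 m x (not_lt.1 hx)).symm

lemma integrable_of_ball {f : Plane → ℝ} {M : ℝ} (hf : AEStronglyMeasurable f)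
    (hM : ∀ x, ‖x‖ < 1 → |f x| ≤ M) (h0 : ∀ x, 1 ≤ ‖x‖ → f x = 0) : Integrable f := by
  rw [← integrableOn_iff_integrable_of_support_subset (s := ball 0 1)]
  · refine IntegrableOn.of_bound measure_ball_lt_top hf.restrict M ?_
    exact (ae_restrict_iff' isOpen_ball.measurableSet).2
      (.of_forall fun x hx => hM x (mem_ball_zero_iff.1 hx))
  · intro x hx
    rw [mem_ball_zero_iff]
    by_contra h
    exact hx (h0 x (not_lt.1 h))

namespace IsBlowUpLimit

variable {C : ℝ} {P : ℝ → ℝ} {V : ℕ → Plane → ℝ} {v χ : Plane → ℝ}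
variable (hL : IsBlowUpLimit V v χ) (hV : IsBlowUpSequence C P V)
include hL hV

lemma tendsto_integral_sq {f : Plane → ℝ} (hf : AEStronglyMeasurable f) {M : ℝ}
    (hM : ∀ x, |f x| ≤ M) (h0 : ∀ x, 1 ≤ ‖x‖ → f x = 0) :
    Tendsto (fun m => ∫ x, V m x ^ 2 * f x) atTop (𝓝 (∫ x, v x ^ 2 * f x)) := by
  refine tendsto_integral_of_ball (M := (9 * (C + 1)) ^ 2 * M) (fun m => ?_) (fun m x hx => ?_)
    (fun m x hx => by rw [h0 x hx, mul_zero]) (fun x hx => by rw [h0 x hx, mul_zero])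
    fun x hx => ?_
  · obtain ⟨c, R, hp, -⟩ := hV.exists_profile m
    exact (hp.measurable.pow_const 2).aestronglyMeasurable.mul hf
  · rw [abs_mul, abs_pow]
    exact mul_le_mul (pow_le_pow_left₀ (abs_nonneg _)
      (hV.bounds m (ball_subset_ball (by norm_num) (mem_ball_zero_iff.2 hx))).2 2) (hM x)
      (abs_nonneg _) (by positivity)
  · exact ((hL.tendsto_apply (mem_closedBall_zero_iff.2 hx.le)).pow 2).mul_const _

/-- The limit of the characteristic functions is one where the limit function is positive. -/
lemma chi_eq_one : ∀ᵐ x : Plane, x ∈ ball (0 : Plane) 1 → 0 < v x → χ x = 1 := by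
  set S : Set Plane := {x | ‖x‖ < 1 ∧ 0 < v x} with hS
  have hSm : MeasurableSet S := (measurableSet_lt measurable_norm measurable_const).inter
    (measurableSet_lt measurable_const (hL.measurable_fun hV))
  set f : Plane → ℝ := S.indicator fun _ => 1 with hf
  have hfm : Measurable f := measurable_const.indicator hSm
  have hf1 : ∀ x, |f x| ≤ 1 := fun x => by
    by_cases hx : x ∈ S <;> simp [hf, hx]
  have hf0 : ∀ x : Plane, 1 ≤ ‖x‖ → f x = 0 := fun x hx =>
    indicator_of_notMem (fun h => absurd h.1 (not_lt.2 hx)) _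
  have h1 := hL.weak f hfm.aestronglyMeasurable ⟨1, hf1⟩ hf0
  have h2 : Tendsto (fun m => ∫ x, f x * chi (V m) x) atTop (𝓝 (∫ x, f x)) := by
    refine tendsto_integral_of_ball (M := 1) (fun m => ?_) (fun m x _ => ?_)
      (fun m x hx => by rw [hf0 x hx, zero_mul]) hf0 fun x hx => ?_
    · obtain ⟨c, R, hp, -⟩ := hV.exists_profile m
      exact (hfm.mul hp.measurable_chi).aestronglyMeasurable
    · rw [abs_mul, abs_of_nonneg (chi_nonneg _ _)]
      exact mul_le_one₀ (hf1 x) (chi_nonneg _ _) (chi_le_one _ _)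
    · by_cases hxS : x ∈ S
      · refine tendsto_const_nhds.congr' ?_
        filter_upwards [(hL.tendsto_apply (mem_closedBall_zero_iff.2 hx.le)).eventually
          (lt_mem_nhds hxS.2)] with m hm
        rw [chi_of_pos hm, mul_one]
      · have : f x = 0 := indicator_of_notMem hxS _
        simp [this]
  have h3 := tendsto_nhds_unique h1 h2
  have i1 : Integrable f := integrable_of_ball hfm.aestronglyMeasurable (fun x _ => hf1 x) hf0
  have i2 : Integrable fun x => f x * χ x := integrable_of_ball (M := 1)
    (hfm.mul hL.measurable).aestronglyMeasurable (fun x _ => by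
      rw [abs_mul, abs_of_nonneg (hL.nonneg x)]
      exact mul_le_one₀ (hf1 x) (hL.nonneg x) (hL.le_one x)) fun x hx => by rw [hf0 x hx, zero_mul]
  have h4 : ∫ x, (f x - f x * χ x) = 0 := by rw [integral_sub i1 i2, h3, sub_self]
  have h5 : 0 ≤ fun x => f x - f x * χ x := fun x => by
    have : 0 ≤ f x := indicator_nonneg (fun _ _ => zero_le_one) x
    simp only [Pi.zero_apply]
    nlinarith [hL.le_one x]
  rw [integral_eq_zero_iff_of_nonneg h5 (i1.sub i2)] at h4
  filter_upwards [h4] with x hx hx1 hx2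
  have : f x = 1 := indicator_of_mem (show x ∈ S from ⟨mem_ball_zero_iff.1 hx1, hx2⟩) _
  simp only [this, Pi.zero_apply] at hx
  linarith

end IsBlowUpLimit

namespace IsBlowUpSequence

variable {C : ℝ} {P : ℝ → ℝ} {V : ℕ → Plane → ℝ}

/-- Terms that contain the deviation from homogeneity as a factor vanish in the limit. -/
lemma tendsto_integral_mul_defect (hV : IsBlowUpSequence C P V) {a : ℕ → Plane → ℝ} {K : ℝ}
    (ha : ∀ m x, |a m x| ≤ K * cutoff 1 x) :
    Tendsto (fun m => ∫ x, a m x * (inner ℝ x (grad (V m) x) - 3 / 2 * V m x)) atTop (𝓝 0) := by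
  set A := volume.real (ball (0 : Plane) 1) with hA
  have hA0 : 0 ≤ A := measureReal_nonneg
  have hK : 0 ≤ K := by
    have := (abs_nonneg _).trans (ha 0 0)
    simpa [cutoff] using this
  have key : ∀ δ > 0, ∀ m, |∫ x, a m x * (inner ℝ x (grad (V m) x) - 3 / 2 * V m x)|
      ≤ K * (δ * A) + K * (1 / (4 * δ)) * GravityWave.defect (V m) 1 := by
    intro δ hδ m
    obtain ⟨c, R, hp, -⟩ := hV.exists_profile m
    have i1 : Integrable ((ball (0 : Plane) 1).indicator fun _ => K * δ) :=
      (integrable_indicator_iff isOpen_ball.measurableSet).2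
        (integrableOn_const (by finiteness))
    have i2 := (integrable_cutoff_pow_mul hp.integrable_defect 1 2).const_mul (K * (1 / (4 * δ)))
    have h1 : ∫ x, ((ball (0 : Plane) 1).indicator (fun _ => K * δ) x
        + K * (1 / (4 * δ)) * (cutoff 1 x ^ 2 * (inner ℝ x (grad (V m) x) - 3 / 2 * V m x) ^ 2))
        = K * (δ * A) + K * (1 / (4 * δ)) * GravityWave.defect (V m) 1 := by
      rw [integral_add i1 i2, integral_indicator isOpen_ball.measurableSet,
        setIntegral_const, integral_const_mul, smul_eq_mul, ← hA, GravityWave.defect]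
      ring
    rw [← h1, ← Real.norm_eq_abs]
    refine norm_integral_le_of_norm_le (i1.add i2) (.of_forall fun x => ?_)
    rw [Real.norm_eq_abs, abs_mul]
    set w := inner ℝ x (grad (V m) x) - 3 / 2 * V m x
    by_cases hx : ‖x‖ < 1
    · rw [indicator_of_mem (mem_ball_zero_iff.2 hx)]
      have h2 : cutoff 1 x * |w| ≤ δ + 1 / (4 * δ) * (cutoff 1 x ^ 2 * w ^ 2) := by
        have h3 : 0 ≤ (2 * δ - cutoff 1 x * |w|) ^ 2 / (4 * δ) := by positivity
        have h4 : (2 * δ - cutoff 1 x * |w|) ^ 2 / (4 * δ)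
            = δ + 1 / (4 * δ) * (cutoff 1 x ^ 2 * w ^ 2) - cutoff 1 x * |w| := by
          rw [← sq_abs w]; field_simp; ring
        linarith
      calc _ ≤ K * cutoff 1 x * |w| := mul_le_mul_of_nonneg_right (ha m x) (abs_nonneg _)
        _ ≤ K * (δ + 1 / (4 * δ) * (cutoff 1 x ^ 2 * w ^ 2)) := by
          rw [mul_assoc]; exact mul_le_mul_of_nonneg_left h2 hK
        _ = _ := by ring
    · have h2 := ha m x
      rw [cutoff_eq_zero zero_le_one (not_lt.1 hx), mul_zero] at h2
      rw [le_antisymm h2 (abs_nonneg _), zero_mul,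
        indicator_of_notMem (fun h => hx (mem_ball_zero_iff.1 h))]
      positivity
  rw [Metric.tendsto_atTop]
  intro ε hε
  set δ := ε / (2 * (K * A + 1)) with hδ
  have hδ0 : 0 < δ := by positivity
  have h1 := hV.defect.const_mul (K * (1 / (4 * δ)))
  rw [mul_zero] at h1
  obtain ⟨N, hN⟩ := eventually_atTop.1 (h1.eventually (gt_mem_nhds (half_pos hε)))
  refine ⟨N, fun m hm => ?_⟩
  rw [dist_zero_right, Real.norm_eq_abs]
  have h2 : K * (δ * A) ≤ ε / 2 := by
    rw [hδ]
    rw [show K * (ε / (2 * (K * A + 1)) * A) = ε / 2 * (K * A / (K * A + 1)) by field_simp]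
    refine mul_le_of_le_one_right (by positivity) ?_
    rw [div_le_one (by positivity)]; linarith
  linarith [key δ hδ0 m, hN m hm]

end IsBlowUpSequence

/-! ### Passage to the limit in the two weak equations -/

lemma exists_le_mul_cutoff {f : Plane → ℝ} (hf : Continuous f)
    (hs : tsupport f ⊆ ball 0 1) : ∃ K, ∀ x, |f x| ≤ K * cutoff 1 x := by
  have hc : IsCompact (tsupport f) := (isCompact_closedBall 0 1).of_isClosed_subset
    (isClosed_tsupport f) (hs.trans ball_subset_closedBall)
  have hpos : ∀ x ∈ tsupport f, 0 < cutoff 1 x := fun x hx => by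
    have h := mem_ball_zero_iff.1 (hs hx)
    refine lt_max_of_lt_left ?_
    nlinarith [norm_nonneg x]
  obtain ⟨K, hK⟩ := hc.exists_bound_of_continuousOn (f := fun x => f x / cutoff 1 x)
    (hf.continuousOn.div (continuous_cutoff 1).continuousOn fun x hx => (hpos x hx).ne')
  refine ⟨max K 0, fun x => ?_⟩
  by_cases hx : x ∈ tsupport f
  · have h := hK x hx
    rw [Real.norm_eq_abs, abs_div, abs_of_pos (hpos x hx), div_le_iff₀ (hpos x hx)] at h
    exact h.trans (mul_le_mul_of_nonneg_right (le_max_left _ _) (hpos x hx).le)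
  · rw [image_eq_zero_of_notMem_tsupport hx, abs_zero]
    exact mul_nonneg (le_max_right _ _) (cutoff_nonneg 1 x)

lemma eq_zero_of_tsupport {E : Type*} [Zero E] {f : Plane → E} {r : ℝ}
    (hs : tsupport f ⊆ ball 0 r)
    {x : Plane} (hx : r ≤ ‖x‖) : f x = 0 :=
  image_eq_zero_of_notMem_tsupport fun h => absurd (mem_ball_zero_iff.1 (hs h)) (not_lt.2 hx)

lemma hasCompactSupport_of_tsupport {E : Type*} [Zero E] {f : Plane → E} {r : ℝ}
    (hs : tsupport f ⊆ ball 0 r) : HasCompactSupport f :=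
  (isCompact_closedBall 0 r).of_isClosed_subset (isClosed_tsupport f)
    (hs.trans ball_subset_closedBall)

lemma fderiv_eq_zero_of_tsupport {E : Type*} [NormedAddCommGroup E] [NormedSpace ℝ E]
    {f : Plane → E} {r : ℝ} (hs : tsupport f ⊆ ball 0 r) {x : Plane} (hx : r ≤ ‖x‖) :
    fderiv ℝ f x = 0 := by
  by_contra h
  exact absurd (mem_ball_zero_iff.1 (hs (support_fderiv_subset ℝ h))) (not_lt.2 hx)

namespace IsBlowUpSequence

variable {C : ℝ} {P : ℝ → ℝ} {V : ℕ → Plane → ℝ} (hV : IsBlowUpSequence C P V)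
include hV

lemma tendsto_stress {φ : Plane → Plane} (hφ : ContDiff ℝ 1 φ)
    (hs : tsupport φ ⊆ ball 0 3) :
    Tendsto (fun m => ∫ x, stress (V m) φ x) atTop (𝓝 0) := by
  obtain ⟨c, R, κ, hκ, h⟩ := hV.approx
  refine squeeze_zero_norm (fun m => ?_) (a := fun m => κ m *
    ∫ x : Plane, (max (x 1) 0 ^ 2 * ‖fderiv ℝ φ x‖ + max (x 1) 0 * ‖φ x‖)) ?_
  · exact (h m).1.variation_le φ hφ (hasCompactSupport_of_tsupport hs) (hs.trans (h m).2)
  · simpa using hκ.mul_const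
      (∫ x : Plane, (max (x 1) 0 ^ 2 * ‖fderiv ℝ φ x‖ + max (x 1) 0 * ‖φ x‖))

lemma tendsto_test {ζ : Plane → ℝ} (hζ : ContDiff ℝ 1 ζ) (hs : tsupport ζ ⊆ ball 0 3) :
    Tendsto (fun m => ∫ x, (ζ x * ‖grad (V m) x‖ ^ 2 + V m x * fderiv ℝ ζ x (grad (V m) x)))
      atTop (𝓝 0) := by
  have hC := hV.const_nonneg
  obtain ⟨c, R, κ, hκ, h⟩ := hV.approx
  have hc := hasCompactSupport_of_tsupport hs
  obtain ⟨Z, hZ⟩ := hζ.continuous.bounded_above_of_compact_support hc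
  obtain ⟨Z', hZ'⟩ := (hζ.continuous_fderiv (by norm_num)).bounded_above_of_compact_support
    (hc.fderiv ℝ)
  have hZ0 : 0 ≤ Z := (norm_nonneg _).trans (hZ 0)
  have hZ0' : 0 ≤ Z' := (norm_nonneg _).trans (hZ' 0)
  set T := 3 * (Z * (3 * (C + 1)) ^ 2 + 9 * (C + 1) * (3 * (C + 1)) * Z') *
    (volume.real (ball (0 : Plane) 1) * 3 ^ 2) with hT
  refine squeeze_zero_norm (fun m => ?_) (a := fun m => κ m * T) (by simpa using hκ.mul_const T)
  refine ((h m).1.test_le ζ hζ hc (hs.trans (h m).2)).trans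
    (mul_le_mul_of_nonneg_left ?_ (h m).1.error_nonneg)
  refine integral_le_of_ball (by norm_num) (by positivity) (fun x hx => ?_) fun x hx => ?_
  · rw [eq_zero_of_tsupport hs hx, fderiv_eq_zero_of_tsupport hs hx]; simp
  · obtain ⟨h1, h2⟩ := hV.bounds m (mem_ball_zero_iff.2 hx)
    have h3 : max (x 1) 0 ≤ 3 := (height_le_norm x).trans hx.le
    have h4 : 0 ≤ max (x 1) 0 := le_max_right _ _
    have h5 := (h m).1.toIsProfile.nonneg x
    rw [abs_of_nonneg h5] at h2
    have h6 := hZ x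
    rw [Real.norm_eq_abs] at h6
    have h7 := hZ' x
    gcongr

lemma measurable_grad (m : ℕ) : Measurable (grad (V m)) := by
  obtain ⟨c, R, hp, -⟩ := hV.exists_profile m
  exact hp.measurable_grad

lemma measurable_fun (m : ℕ) : Measurable (V m) := by
  obtain ⟨c, R, hp, -⟩ := hV.exists_profile m
  exact hp.measurable

lemma measurable_chi (m : ℕ) : Measurable (chi (V m)) := by
  obtain ⟨c, R, hp, -⟩ := hV.exists_profile m
  exact hp.measurable_chi

lemma bounds' (m : ℕ) {x : Plane} (hx : ‖x‖ < 1) :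
    ‖grad (V m) x‖ ≤ 3 * (C + 1) ∧ |V m x| ≤ 9 * (C + 1) :=
  hV.bounds m (ball_subset_ball (by norm_num) (mem_ball_zero_iff.2 hx))

end IsBlowUpSequence

namespace IsBlowUpLimit

variable {C : ℝ} {P : ℝ → ℝ} {V : ℕ → Plane → ℝ} {v χ : Plane → ℝ}
variable (hL : IsBlowUpLimit V v χ) (hV : IsBlowUpSequence C P V)
include hL hV

lemma tendsto_integral_sq_of_continuous {f : Plane → ℝ} (hf : Continuous f)
    (h0 : ∀ x, 1 ≤ ‖x‖ → f x = 0) :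
    Tendsto (fun m => ∫ x, V m x ^ 2 * f x) atTop (𝓝 (∫ x, v x ^ 2 * f x)) := by
  obtain ⟨M, hM⟩ := hf.bounded_above_of_compact_support (hasCompactSupport_of_norm h0)
  exact hL.tendsto_integral_sq hV hf.aestronglyMeasurable hM h0

omit hV in
lemma tendsto_integral_chi {f : Plane → ℝ} (hf : Continuous f) (h0 : ∀ x, 1 ≤ ‖x‖ → f x = 0) :
    Tendsto (fun m => ∫ x, f x * chi (V m) x) atTop (𝓝 (∫ x, f x * χ x)) := by
  obtain ⟨M, hM⟩ := hf.bounded_above_of_compact_support (hasCompactSupport_of_norm h0)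
  exact hL.weak f hf.aestronglyMeasurable ⟨M, hM⟩ h0

/-- The square of a blow-up limit is homogeneous of degree three, in the weak sense. -/
theorem euler {η : Plane → ℝ} (hη : ContDiff ℝ 1 η) (hs : tsupport η ⊆ ball 0 1) :
    ∫ x, v x ^ 2 * (5 * η x + fderiv ℝ η x x) = 0 := by
  have hC := hV.const_nonneg
  have hD := hη.continuous_fderiv (by norm_num)
  have h1 := hL.tendsto_integral_sq_of_continuous hV (f := fun x => 5 * η x + fderiv ℝ η x x)
    (by have := hη.continuous; fun_prop) fun x hx => by
      rw [eq_zero_of_tsupport hs hx, fderiv_eq_zero_of_tsupport hs hx]; simp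
  obtain ⟨K, hK⟩ := exists_le_mul_cutoff hη.continuous hs
  have h2 := hV.tendsto_integral_mul_defect (a := fun m x => -2 * η x * V m x)
    (K := 2 * (9 * (C + 1)) * K) fun m x => by
      by_cases hx : ‖x‖ < 1
      · rw [abs_mul, abs_mul]
        have h3 := (hV.bounds' m hx).2
        calc _ = 2 * |V m x| * |η x| := by norm_num; ring
          _ ≤ 2 * (9 * (C + 1)) * (K * cutoff 1 x) := by
            gcongr
            exact hK x
          _ = _ := by ring
      · rw [eq_zero_of_tsupport hs (not_lt.1 hx), cutoff_eq_zero zero_le_one (not_lt.1 hx)]; simp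
  refine tendsto_nhds_unique h1 (h2.congr fun m => ?_)
  obtain ⟨c, R, hp, hsub⟩ := hV.exists_profile m
  have h3 := hp.integral_sq_mul_divergence (φ := fun x => η x • x) (hη.smul contDiff_id)
    (hasCompactSupport_of_tsupport ((tsupport_smul_subset_left η id).trans hs))
    ((tsupport_smul_subset_left η id).trans
      (hs.trans ((ball_subset_ball (by norm_num)).trans hsub)))
  have h4 : ∀ x, V m x ^ 2 * divergence (fun x => η x • x) x
      + 2 * V m x * inner ℝ (grad (V m) x) (η x • x) = V m x ^ 2 * (5 * η x + fderiv ℝ η x x)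
      - -2 * η x * V m x * (inner ℝ x (grad (V m) x) - 3 / 2 * V m x) := by
    intro x
    have h5 := divergence_smul (hη.differentiable (by norm_num) x)
      (differentiableAt_id (𝕜 := ℝ) (x := x))
    have h6 : divergence (id : Plane → Plane) x = 2 := by simp [divergence]
    simp only [h6, id] at h5
    rw [h5, real_inner_smul_right, real_inner_comm]
    ring
  simp only [h4] at h3
  rw [integral_sub] at h3
  · linarith
  · obtain ⟨M, hM⟩ := (by have := hη.continuous; fun_prop :
        Continuous fun x => 5 * η x + fderiv ℝ η x x).bounded_above_of_compact_support
        (hasCompactSupport_of_norm (r := 1) fun x hx => by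
          rw [eq_zero_of_tsupport hs hx, fderiv_eq_zero_of_tsupport hs hx]; simp)
    exact hp.integrable_sq.mul_bdd (c := M) (by
      have := hη.continuous
      exact (by fun_prop : Continuous fun x => 5 * η x + fderiv ℝ η x x).aestronglyMeasurable)
      (.of_forall hM)
  · obtain ⟨M, hM⟩ := hη.continuous.bounded_above_of_compact_support
      (hasCompactSupport_of_tsupport hs)
    refine (((hp.integrable_mul_inner_grad.const_mul (-2)).add (hp.integrable_sq.const_mul 3)).mul_bdd
      (c := M) hη.continuous.aestronglyMeasurable (.of_forall hM)).congr
      (.of_forall fun x => ?_)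
    simp only [Pi.add_apply]
    ring

/-- In the limit only the potential part of the energy remains. -/
theorem tendsto_weissEnergy :
    Tendsto (fun m => weissEnergy (V m) 1) atTop (𝓝 (∫ x, cutoff 1 x ^ 3 * x 1 * χ x)) := by
  have hC := hV.const_nonneg
  have h0 : ∀ x : Plane, 1 ≤ ‖x‖ → cutoff 1 x = 0 := fun x hx => cutoff_eq_zero zero_le_one hx
  have hcut := continuous_cutoff 1
  have h1 := hL.tendsto_integral_chi (f := fun x => cutoff 1 x ^ 3 * x 1) (by fun_prop)
    fun x hx => by rw [h0 x hx]; simp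
  have h2 := hV.tendsto_test (contDiff_cutoff_pow 1 1)
    ((tsupport_subset_closedBall (r := 1) fun x hx => by rw [h0 x hx]; simp).trans
      IsBlowUpSequence.closedBall_subset)
  have h3 := hV.tendsto_integral_mul_defect (a := fun m x => 6 * cutoff 1 x ^ 2 * V m x)
    (K := 6 * (9 * (C + 1))) fun m x => by
      by_cases hx : ‖x‖ < 1
      · have h3 := (hV.bounds' m hx).2
        have h4 : cutoff 1 x ≤ 1 := by simpa using cutoff_le 1 x
        have h5 := cutoff_nonneg 1 x
        rw [abs_mul, abs_of_nonneg (by positivity)]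
        calc _ = 6 * |V m x| * cutoff 1 x * cutoff 1 x := by ring
          _ ≤ 6 * (9 * (C + 1)) * cutoff 1 x * 1 := by gcongr
          _ = _ := by ring
      · rw [h0 x (not_lt.1 hx)]; simp
  have h4 := (h2.add h3).add h1
  simp only [zero_add] at h4
  refine h4.congr fun m => ?_
  obtain ⟨c, R, hp, -⟩ := hV.exists_profile m
  have i1 := integrable_cutoff_pow_mul hp.integrable_energyDensity 1
  have i2 := integrable_cutoff_pow_mul hp.integrable_sq 1
  have i4 := integrable_cutoff_pow_mul hp.integrable_grad_sq 1
  have i5 := integrable_cutoff_pow_mul hp.integrable_mul_inner_grad 1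
  have i7 := integrable_cutoff_pow_mul hp.integrable_height_mul_chi 1
  have e2 : ∀ x, cutoff 1 x ^ 3 * ‖grad (V m) x‖ ^ 2
        + V m x * fderiv ℝ (fun x => cutoff 1 x ^ 3) x (grad (V m) x)
      = cutoff 1 x ^ 3 * ‖grad (V m) x‖ ^ 2
        - 6 * (cutoff 1 x ^ 2 * (V m x * inner ℝ x (grad (V m) x))) := by
    intro x
    rw [(hasFDerivAt_cutoff_pow 1 1 x).fderiv]
    simp
    ring
  have e3 : ∀ x, 6 * cutoff 1 x ^ 2 * V m x * (inner ℝ x (grad (V m) x) - 3 / 2 * V m x)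
      = 6 * (cutoff 1 x ^ 2 * (V m x * inner ℝ x (grad (V m) x)))
        - 9 * (cutoff 1 x ^ 2 * V m x ^ 2) := fun x => by ring
  have e4 : ∀ x, cutoff 1 x ^ 3 * x 1 * chi (V m) x = cutoff 1 x ^ 3 * (x 1 * chi (V m) x) :=
    fun x => by ring
  have e5 : ∀ x, cutoff 1 x ^ 3 * energyDensity (V m) x = cutoff 1 x ^ 3 * ‖grad (V m) x‖ ^ 2
      + cutoff 1 x ^ 3 * (x 1 * chi (V m) x) := fun x => by simp only [energyDensity]; ring
  simp only [Nat.reduceAdd, e2, e3, e4, weissEnergy, e5]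
  rw [integral_sub (i4 3) ((i5 2).const_mul 6), integral_sub ((i5 2).const_mul 6)
    ((i2 2).const_mul 9), integral_add (i4 3) (i7 3), integral_const_mul, integral_const_mul]
  ring

end IsBlowUpLimit

/-! ### Angular variations -/

/-- The rotation by a right angle. -/
def rot : Plane →L[ℝ] Plane :=
  LinearMap.toContinuousLinearMap
    { toFun := fun x => !₂[-x 1, x 0]
      map_add' := fun x y => by ext i; fin_cases i <;> simp [add_comm]
      map_smul' := fun a x => by ext i; fin_cases i <;> simp }

@[simp] lemma rot_zero (x : Plane) : rot x 0 = -x 1 := rfl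
@[simp] lemma rot_one (x : Plane) : rot x 1 = x 0 := rfl

lemma inner_plane (x y : Plane) : (inner ℝ x y : ℝ) = x 0 * y 0 + x 1 * y 1 := by
  simp [PiLp.inner_apply, Fin.sum_univ_two, mul_comm]

lemma norm_sq_plane (x : Plane) : ‖x‖ ^ 2 = x 0 ^ 2 + x 1 ^ 2 := by
  rw [← real_inner_self_eq_norm_sq, inner_plane]; ring

lemma norm_sq_smul (x v : Plane) :
    ‖x‖ ^ 2 • v = (inner ℝ x v : ℝ) • x + (inner ℝ (rot x) v : ℝ) • rot x := by
  rw [norm_sq_plane, inner_plane, inner_plane]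
  ext i
  fin_cases i <;> simp <;> ring

lemma norm_rot (x : Plane) : ‖rot x‖ = ‖x‖ := by
  rw [← sq_eq_sq₀ (norm_nonneg _) (norm_nonneg _), norm_sq_plane, norm_sq_plane]
  simp [add_comm]

/-- The angular derivative `x₁ ∂₂ b - x₂ ∂₁ b`. -/
def angular (b : Plane → ℝ) (x : Plane) : ℝ := fderiv ℝ b x (rot x)

/-- The radial derivative `x · ∇b`. -/
def radial (b : Plane → ℝ) (x : Plane) : ℝ := fderiv ℝ b x x

section derivatives

variable {b : Plane → ℝ}

lemma contDiff_angular (hb : ContDiff ℝ ∞ b) : ContDiff ℝ ∞ (angular b) :=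
  (hb.fderiv_right (m := ∞) (by simp)).clm_apply rot.contDiff

lemma contDiff_radial (hb : ContDiff ℝ ∞ b) : ContDiff ℝ ∞ (radial b) :=
  (hb.fderiv_right (m := ∞) (by simp)).clm_apply contDiff_id

lemma tsupport_angular : tsupport (angular b) ⊆ tsupport b :=
  closure_minimal (fun x hx => support_fderiv_subset ℝ fun h => hx (by simp [angular, h]))
    (isClosed_tsupport b)

lemma tsupport_radial : tsupport (radial b) ⊆ tsupport b :=
  closure_minimal (fun x hx => support_fderiv_subset ℝ fun h => hx (by simp [radial, h]))
    (isClosed_tsupport b)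

lemma norm_sq_mul_fderiv (b : Plane → ℝ) (x v : Plane) : ‖x‖ ^ 2 * fderiv ℝ b x v =
    inner ℝ x v * radial b x + inner ℝ (rot x) v * angular b x := by
  have h := congrArg (fderiv ℝ b x) (norm_sq_smul x v)
  simpa [radial, angular] using h

lemma angular_radial (hb : ContDiff ℝ ∞ b) (x : Plane) :
    angular (radial b) x = radial (angular b) x := by
  have hd : DifferentiableAt ℝ (fderiv ℝ b) x :=
    (hb.fderiv_right (m := ∞) (by simp)).differentiable (by simp) x
  have h1 : HasFDerivAt (radial b) _ x := hd.hasFDerivAt.clm_apply (hasFDerivAt_id x)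
  have h2 : HasFDerivAt (angular b) _ x := hd.hasFDerivAt.clm_apply rot.hasFDerivAt
  have hsymm : IsSymmSndFDerivAt ℝ b x := hb.contDiffAt.isSymmSndFDerivAt (by
    rw [minSmoothness_of_isRCLikeNormedField]; exact WithTop.coe_le_coe.2 (le_top : (2 : ℕ∞) ≤ ⊤))
  rw [angular, radial, h1.fderiv, h2.fderiv]
  have := hsymm (rot x) x
  simp [this]

lemma hasFDerivAt_norm_sq_mul (hb : Differentiable ℝ b) (x : Plane) :
    HasFDerivAt (fun x => ‖x‖ ^ 2 * b x) (‖x‖ ^ 2 • fderiv ℝ b x + b x • (2 • innerSL ℝ x)) x :=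
  (hasStrictFDerivAt_norm_sq x).hasFDerivAt.mul (hb x).hasFDerivAt

end derivatives

lemma inner_rot_self (x : Plane) : (inner ℝ x (rot x) : ℝ) = 0 := by
  rw [inner_plane]; simp; ring

lemma divergence_smul_rot {b : Plane → ℝ} {x : Plane} (hb : DifferentiableAt ℝ b x) :
    divergence (fun x => b x • rot x) x = angular b x := by
  rw [divergence_smul hb rot.differentiableAt]
  have : divergence rot x = 0 := by
    simp [divergence, Fin.sum_univ_two, rot.fderiv]
  rw [this, mul_zero, zero_add, angular]

namespace IsProfile

variable {c : Plane} {R C : ℝ} {u : Plane → ℝ} (hu : IsProfile c R C u)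
include hu

lemma integrable_inner_fderiv {φ : Plane → Plane} (hφ : ContDiff ℝ 1 φ)
    (hc : HasCompactSupport φ) :
    Integrable fun x => inner ℝ (grad u x) (fderiv ℝ φ x (grad u x)) := by
  obtain ⟨M, hM0, hM⟩ := hu.exists_bounds
  have hD := hφ.continuous_fderiv (by norm_num)
  obtain ⟨Z, hZ⟩ := hD.bounded_above_of_compact_support (hc.fderiv ℝ)
  have hg := hu.continuousOn_grad
  refine hu.integrable_of_continuousOn_pos (hg.inner (hD.continuousOn.clm_apply hg))
    (fun x hx => by simp [grad_of_not_pos hx]) (M := M ^ 2 * Z) fun x hx => ?_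
  refine (abs_inner_fderiv_le φ x _).trans ?_
  have := (hM x hx).1
  have h2 := hZ x
  gcongr

lemma integrable_chi_mul {f : Plane → ℝ} (hf : Continuous f) (hc : HasCompactSupport f) :
    Integrable fun x => f x * chi u x :=
  (hf.integrable_of_hasCompactSupport hc).mul_bdd (c := 1) hu.measurable_chi.aestronglyMeasurable
    (.of_forall fun x => by
      rw [Real.norm_of_nonneg (chi_nonneg u x)]; exact chi_le_one u x)

lemma integrable_stress {φ : Plane → Plane} (hφ : ContDiff ℝ 1 φ) (hc : HasCompactSupport φ) :
    Integrable (stress u φ) := by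
  have hd := continuous_divergence hφ
  obtain ⟨Z, hZ⟩ := hd.bounded_above_of_compact_support (hasCompactSupport_divergence hc)
  have hφ1 : Continuous fun x => φ x 1 := by have := hφ.continuous; fun_prop
  exact ((hu.integrable_energyDensity.mul_bdd (c := Z) hd.aestronglyMeasurable
    (.of_forall hZ)).sub ((hu.integrable_inner_fderiv hφ hc).const_mul 2)).add
    ((hu.integrable_chi_mul hφ1 (hc.comp_left (g := fun y : Plane => y 1) rfl)).congr
      (.of_forall fun x => mul_comm _ _))

lemma integrable_mul_fderiv {ζ : Plane → ℝ} (hζ : ContDiff ℝ 1 ζ) (hc : HasCompactSupport ζ) :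
    Integrable fun x => u x * fderiv ℝ ζ x (grad u x) := by
  obtain ⟨M, hM0, hM⟩ := hu.exists_bounds
  have hD := hζ.continuous_fderiv (by norm_num)
  obtain ⟨Z, hZ⟩ := hD.bounded_above_of_compact_support (hc.fderiv ℝ)
  have hg := hu.continuousOn_grad
  refine hu.integrable_of_continuousOn_pos (hu.continuousOn_pos.mul (hD.continuousOn.clm_apply hg))
    (fun x hx => by simp [grad_of_not_pos hx]) (M := M * (Z * M)) fun x hx => ?_
  rw [abs_mul]
  obtain ⟨h1, h2, -, -⟩ := hM x hx
  refine mul_le_mul h2 (((fderiv ℝ ζ x).le_opNorm _).trans ?_) (abs_nonneg _) hM0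
  exact mul_le_mul (hZ x) h1 (norm_nonneg _) ((norm_nonneg _).trans (hZ x))

lemma integrable_test {ζ : Plane → ℝ} (hζ : ContDiff ℝ 1 ζ) (hc : HasCompactSupport ζ) :
    Integrable fun x => ζ x * ‖grad u x‖ ^ 2 + u x * fderiv ℝ ζ x (grad u x) := by
  obtain ⟨Z, hZ⟩ := hζ.continuous.bounded_above_of_compact_support hc
  exact (hu.integrable_grad_sq.bdd_mul (c := Z) hζ.continuous.aestronglyMeasurable
    (.of_forall hZ)).add (hu.integrable_mul_fderiv hζ hc)

lemma integrable_sq_mul {f : Plane → ℝ} (hf : Continuous f) (hc : HasCompactSupport f) :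
    Integrable fun x => u x ^ 2 * f x := by
  obtain ⟨Z, hZ⟩ := hf.bounded_above_of_compact_support hc
  exact hu.integrable_sq.mul_bdd (c := Z) hf.aestronglyMeasurable (.of_forall hZ)

lemma integrable_mul_inner {φ : Plane → Plane} (hφ : Continuous φ) (hc : HasCompactSupport φ) :
    Integrable fun x => u x * inner ℝ (grad u x) (φ x) := by
  obtain ⟨M, hM0, hM⟩ := hu.exists_bounds
  obtain ⟨Z, hZ⟩ := hφ.bounded_above_of_compact_support hc
  refine hu.integrable_of_continuousOn_pos (hu.continuousOn_pos.mul
    (hu.continuousOn_grad.inner hφ.continuousOn))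
    (fun x hx => by simp [grad_of_not_pos hx]) (M := M * (M * Z)) fun x hx => ?_
  rw [abs_mul]
  obtain ⟨h1, h2, -, -⟩ := hM x hx
  exact mul_le_mul h2 ((abs_real_inner_le_norm _ _).trans
    (mul_le_mul h1 (hZ x) (norm_nonneg _) hM0)) (abs_nonneg _) hM0

end IsProfile

namespace IsBlowUpLimit

variable {C : ℝ} {P : ℝ → ℝ} {V : ℕ → Plane → ℝ} {v χ : Plane → ℝ}

/-- The identity behind the classification of blow-up limits. In the stress tensor of a function that
is homogeneous of degree `3/2` only `|∇u|²` and `u²` occur when the variation is angular, and the weak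
equation expresses the former by the latter. -/
theorem angular_identity (hL : IsBlowUpLimit V v χ) (hV : IsBlowUpSequence C P V) {β : Plane → ℝ}
    (hβ : ContDiff ℝ ∞ β) (hs : tsupport β ⊆ ball 0 1) :
    ∫ x, v x ^ 2 * (angular (angular (angular β)) x + 9 * angular β x) =
      2 * ∫ x, ‖x‖ ^ 2 * (x 1 * angular β x + x 0 * β x) * χ x := by
  have hC := hV.const_nonneg
  set A := angular β with hAdef
  set E : Plane → ℝ := fun x => 2 * β x + radial β x with hE
  set B : Plane → ℝ := fun x => 2 * A x + radial A x with hB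
  set D := angular A with hD
  have cA : ContDiff ℝ ∞ A := contDiff_angular hβ
  have cD : ContDiff ℝ ∞ D := contDiff_angular cA
  have cE : ContDiff ℝ ∞ E := (contDiff_const.mul hβ).add (contDiff_radial hβ)
  have cB : ContDiff ℝ ∞ B := (contDiff_const.mul cA).add (contDiff_radial cA)
  have sA : tsupport A ⊆ ball 0 1 := tsupport_angular.trans hs
  have sD : tsupport D ⊆ ball 0 1 := tsupport_angular.trans sA
  have sE : tsupport E ⊆ ball 0 1 := by
    refine (closure_minimal (fun x hx => ?_) (isClosed_tsupport β)).trans hs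
    by_contra h
    have h1 := image_eq_zero_of_notMem_tsupport h
    have h2 := image_eq_zero_of_notMem_tsupport fun h' => h (tsupport_radial h')
    exact hx (by simp [hE, h1, h2])
  have one_le : (1 : WithTop ℕ∞) ≤ ∞ := by simp
  have top_ne : ∞ ≠ 0 := by simp
  -- the test field, the test function and the field for the integration by parts
  set φ : Plane → Plane := fun x => (‖x‖ ^ 2 * β x) • rot x with hφ
  set ζ : Plane → ℝ := fun x => ‖x‖ ^ 2 * A x with hζ
  set ψ : Plane → ℝ := fun x => D x - 3 * E x with hψ
  have cφ : ContDiff ℝ 1 φ := (((contDiff_norm_sq ℝ).mul hβ).smul rot.contDiff).of_le one_le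
  have cζ : ContDiff ℝ 1 ζ := ((contDiff_norm_sq ℝ).mul cA).of_le one_le
  have cψ : ContDiff ℝ ∞ ψ := cD.sub (contDiff_const.mul cE)
  have sφ : tsupport φ ⊆ ball 0 1 :=
    (tsupport_smul_subset_left _ _).trans ((tsupport_mul_subset_right).trans hs)
  have sζ : tsupport ζ ⊆ ball 0 1 := tsupport_mul_subset_right.trans sA
  have sψ : tsupport ψ ⊆ ball 0 1 := by
    refine (closure_minimal (t := tsupport D ∪ tsupport E) (fun x hx => ?_)
      ((isClosed_tsupport D).union (isClosed_tsupport E))).trans (union_subset sD sE)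
    by_contra h
    rw [mem_union, not_or] at h
    exact hx (by simp [hψ, image_eq_zero_of_notMem_tsupport h.1,
      image_eq_zero_of_notMem_tsupport h.2])
  have cψr : ContDiff ℝ 1 (fun x => ψ x • rot x) := (cψ.smul rot.contDiff).of_le one_le
  have sψr : tsupport (fun x => ψ x • rot x) ⊆ ball 0 1 :=
    (tsupport_smul_subset_left ψ _).trans sψ
  have h13 : ball (0 : Plane) 1 ⊆ ball 0 3 := ball_subset_ball (by norm_num)
  -- the part of the sum of the identities that involves `u²` only, and the part with `χ` only
  set G : Plane → ℝ := fun x => 9 / 2 * A x + 3 / 2 * B x - 1 / 2 * angular ψ x with hG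
  set T : Plane → ℝ := fun x => ‖x‖ ^ 2 * (x 1 * A x + x 0 * β x) with hT
  have cG : Continuous G := by
    have h1 := cA.continuous
    have h2 := cB.continuous
    have h3 := (contDiff_angular cψ).continuous
    fun_prop
  have cT : Continuous T := by
    have h1 := cA.continuous
    have h2 := hβ.continuous
    fun_prop
  have zβ : ∀ x : Plane, 1 ≤ ‖x‖ → β x = 0 := fun x hx => eq_zero_of_tsupport hs hx
  have zA : ∀ x : Plane, 1 ≤ ‖x‖ → A x = 0 := fun x hx => eq_zero_of_tsupport sA hx
  have zG : ∀ x : Plane, 1 ≤ ‖x‖ → G x = 0 := fun x hx => by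
    have h1 := eq_zero_of_tsupport (tsupport_radial.trans sA) hx
    have h2 := eq_zero_of_tsupport (tsupport_angular.trans sψ) hx
    simp [hG, hB, zA x hx, h1, h2]
  have zT : ∀ x : Plane, 1 ≤ ‖x‖ → T x = 0 := fun x hx => by simp [hT, zA x hx, zβ x hx]
  -- the factor of the deviation from homogeneity
  set a : ℕ → Plane → ℝ := fun m x => (3 * V m x + 2 * inner ℝ x (grad (V m) x)) * A x
    + V m x * B x - 2 * inner ℝ (rot x) (grad (V m) x) * E x with ha
  have hpt : ∀ m, ∀ x, stress (V m) φ x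
      + (ζ x * ‖grad (V m) x‖ ^ 2 + V m x * fderiv ℝ ζ x (grad (V m) x))
      - 1 / 2 * (V m x ^ 2 * divergence (fun x => ψ x • rot x) x
        + 2 * V m x * inner ℝ (grad (V m) x) (ψ x • rot x)) - V m x ^ 2 * G x - T x * chi (V m) x
      = a m x * (inner ℝ x (grad (V m) x) - 3 / 2 * V m x) := by
    intro m x
    set u := V m
    set γ := grad u x
    set α : ℝ := inner ℝ x γ with hα
    set τ : ℝ := inner ℝ (rot x) γ with hτ
    have d1 := hasFDerivAt_norm_sq_mul (hβ.differentiable top_ne) x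
    have d2 := hasFDerivAt_norm_sq_mul (cA.differentiable top_ne) x
    have e1 : divergence φ x = ‖x‖ ^ 2 * A x := by
      rw [hφ, divergence_smul_rot d1.differentiableAt, angular, d1.fderiv]
      have : (x 0 * rot x 0 + x 1 * rot x 1 : ℝ) = 0 := by simp; ring
      simp [inner_plane, hAdef, angular]
      right; ring
    have e2 : fderiv ℝ φ x γ = (‖x‖ ^ 2 * β x) • rot γ
        + (‖x‖ ^ 2 * fderiv ℝ β x γ + 2 * α * β x) • rot x := by
      have : HasFDerivAt φ _ x := d1.smul rot.hasFDerivAt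
      rw [this.fderiv]
      simp only [add_apply, smul_apply, ContinuousLinearMap.smulRight_apply, innerSL_apply_apply,
        smul_eq_mul, nsmul_eq_mul, Nat.cast_ofNat, ← hα]
      ring_nf
    have e3 : fderiv ℝ ζ x γ = ‖x‖ ^ 2 * fderiv ℝ A x γ + 2 * α * A x := by
      rw [hζ, d2.fderiv]
      simp
      ring
    have e4 : divergence (fun x => ψ x • rot x) x = angular ψ x :=
      divergence_smul_rot (cψ.differentiable top_ne x)
    have e5 : (inner ℝ γ (rot x) : ℝ) = τ := real_inner_comm _ _
    have n1 := norm_sq_mul_fderiv β x γ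
    have n2 := norm_sq_mul_fderiv A x γ
    have n3 : ‖x‖ ^ 2 * ‖γ‖ ^ 2 = α ^ 2 + τ ^ 2 := by
      have := congrArg (inner ℝ γ) (norm_sq_smul x γ)
      rw [inner_add_right, real_inner_smul_right, real_inner_smul_right, real_inner_smul_right,
        real_inner_self_eq_norm_sq, e5, real_inner_comm x γ] at this
      rw [this]; ring
    have e6 : φ x 1 = ‖x‖ ^ 2 * β x * x 0 := by simp [hφ]
    simp only [stress]
    rw [e1, e2, e3, e4, e6, inner_add_right, real_inner_smul_right, real_inner_smul_right,
      inner_rot_self, real_inner_smul_right, e5, n1, n2]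
    simp only [hG, hT, ha, hψ, hE, hB, hζ]
    linear_combination (2 * A x) * n3
  have hlim1 := hV.tendsto_stress cφ (sφ.trans h13)
  have hlim2 := hV.tendsto_test cζ (sζ.trans h13)
  have hlim3 := hL.tendsto_integral_sq_of_continuous hV cG zG
  have hlim4 := hL.tendsto_integral_chi cT zT
  have hlim5 : Tendsto (fun m => ∫ x, a m x * (inner ℝ x (grad (V m) x) - 3 / 2 * V m x)) atTop
      (𝓝 0) := by
    obtain ⟨K1, hK1⟩ := exists_le_mul_cutoff cA.continuous sA
    obtain ⟨K2, hK2⟩ := exists_le_mul_cutoff cB.continuous (by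
      refine (closure_minimal (fun x hx => ?_) (isClosed_tsupport A)).trans sA
      by_contra h
      have h1 := image_eq_zero_of_notMem_tsupport h
      have h2 := image_eq_zero_of_notMem_tsupport fun h' => h (tsupport_radial h')
      exact hx (by simp [hB, h1, h2]))
    obtain ⟨K3, hK3⟩ := exists_le_mul_cutoff cE.continuous sE
    refine hV.tendsto_integral_mul_defect (K := (3 * (9 * (C + 1)) + 2 * (3 * (C + 1))) * K1
      + 9 * (C + 1) * K2 + 2 * (3 * (C + 1)) * K3) fun m x => ?_
    by_cases hx : ‖x‖ < 1
    · obtain ⟨h1, h2⟩ := hV.bounds' m hx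
      have h3 : |(inner ℝ x (grad (V m) x) : ℝ)| ≤ 3 * (C + 1) :=
        (abs_real_inner_le_norm _ _).trans (by nlinarith [norm_nonneg x, norm_nonneg (grad (V m) x)])
      have h4 : |(inner ℝ (rot x) (grad (V m) x) : ℝ)| ≤ 3 * (C + 1) :=
        (abs_real_inner_le_norm _ _).trans (by
          rw [norm_rot]; nlinarith [norm_nonneg x, norm_nonneg (grad (V m) x)])
      have t1 : |(3 * V m x + 2 * inner ℝ x (grad (V m) x)) * A x|
          ≤ (3 * (9 * (C + 1)) + 2 * (3 * (C + 1))) * (K1 * cutoff 1 x) := by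
        rw [abs_mul]
        refine mul_le_mul ((abs_add_le _ _).trans ?_) (hK1 x) (abs_nonneg _) (by positivity)
        rw [abs_mul, abs_mul, abs_of_pos (by norm_num : (0 : ℝ) < 3),
          abs_of_pos (by norm_num : (0 : ℝ) < 2)]
        linarith
      have t2 : |V m x * B x| ≤ 9 * (C + 1) * (K2 * cutoff 1 x) := by
        rw [abs_mul]
        exact mul_le_mul h2 (hK2 x) (abs_nonneg _) (by positivity)
      have t3 : |2 * inner ℝ (rot x) (grad (V m) x) * E x|
          ≤ 2 * (3 * (C + 1)) * (K3 * cutoff 1 x) := by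
        rw [abs_mul, abs_mul, abs_of_pos (by norm_num : (0 : ℝ) < 2)]
        exact mul_le_mul (by linarith) (hK3 x) (abs_nonneg _) (by positivity)
      calc |a m x| ≤ _ := (abs_sub _ _).trans (add_le_add_left (abs_add_le _ _) _)
        _ ≤ _ := add_le_add (add_le_add t1 t2) t3
        _ = _ := by ring
    · have hx := not_lt.1 hx
      have h1 := eq_zero_of_tsupport (tsupport_radial.trans sA) hx
      have h2 := eq_zero_of_tsupport sE hx
      simp only [ha, hB, zA x hx, h1, h2, cutoff_eq_zero zero_le_one hx]
      simp
  have hint : ∀ m, ∫ x, a m x * (inner ℝ x (grad (V m) x) - 3 / 2 * V m x)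
      = (∫ x, stress (V m) φ x)
        + (∫ x, (ζ x * ‖grad (V m) x‖ ^ 2 + V m x * fderiv ℝ ζ x (grad (V m) x)))
        - (∫ x, V m x ^ 2 * G x) - ∫ x, T x * chi (V m) x := by
    intro m
    obtain ⟨c, R, hp, hsub⟩ := hV.exists_profile m
    have h3 := hp.integral_sq_mul_divergence cψr (hasCompactSupport_of_tsupport sψr)
      (sψr.trans (h13.trans hsub))
    have i1 := hp.integrable_stress cφ (hasCompactSupport_of_tsupport sφ)
    have i2 := hp.integrable_test cζ (hasCompactSupport_of_tsupport sζ)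
    have i3 : Integrable fun x => V m x ^ 2 * divergence (fun x => ψ x • rot x) x
        + 2 * V m x * inner ℝ (grad (V m) x) (ψ x • rot x) := by
      refine (hp.integrable_sq_mul (continuous_divergence cψr) (hasCompactSupport_divergence
        (hasCompactSupport_of_tsupport sψr))).add ((((hp.integrable_mul_inner cψr.continuous
        (hasCompactSupport_of_tsupport sψr))).const_mul 2).congr
        (.of_forall fun x => ?_))
      simp only
      ring
    have i4 := hp.integrable_sq_mul cG (hasCompactSupport_of_norm zG)
    have i5 := hp.integrable_chi_mul cT (hasCompactSupport_of_norm zT)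
    simp only [← hpt]
    rw [integral_sub (((i1.fun_add i2).fun_sub (i3.const_mul (1 / 2))).fun_sub i4) i5,
      integral_sub ((i1.fun_add i2).fun_sub (i3.const_mul (1 / 2))) i4,
      integral_sub (i1.fun_add i2) (i3.const_mul (1 / 2)), integral_add i1 i2, integral_const_mul,
      h3]
    ring
  simp only [hint] at hlim5
  have hz := tendsto_nhds_unique hlim5 (((hlim1.add hlim2).sub hlim3).sub hlim4)
  have heuler := hL.euler hV (cA.of_le one_le) sA
  have hvm := hL.measurable_fun hV
  have ivq : ∀ f : Plane → ℝ, Continuous f → (∀ x, 1 ≤ ‖x‖ → f x = 0) →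
      Integrable fun x => v x ^ 2 * f x := by
    intro f hf h0
    refine (hf.integrable_of_hasCompactSupport (hasCompactSupport_of_norm h0)).bdd_mul
      (c := (9 * (C + 1)) ^ 2) (hvm.pow_const 2).aestronglyMeasurable
      (.of_forall fun x => ?_)
    rw [norm_pow]
    exact pow_le_pow_left₀ (norm_nonneg _) (hL.abs_le hV x) 2
  have hG2 : ∀ x, v x ^ 2 * (angular (angular (angular β)) x + 9 * angular β x)
      = 6 * (v x ^ 2 * (5 * A x + fderiv ℝ A x x)) - 2 * (v x ^ 2 * G x) := by
    intro x
    have h1 : angular E x = B x := by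
      have d : HasFDerivAt E (2 • fderiv ℝ β x + fderiv ℝ (radial β) x) x := by
        have := ((hβ.differentiable top_ne x).hasFDerivAt.const_mul 2).add
          ((contDiff_radial hβ).differentiable top_ne x).hasFDerivAt
        refine this.congr_fderiv ?_
        ext v; simp
      have h3 : angular E x = 2 * angular β x + angular (radial β) x := by
        simp [angular, d.fderiv]
      rw [h3, angular_radial hβ x]
    have h2 : angular ψ x = angular D x - 3 * angular E x := by
      have d : HasFDerivAt ψ (fderiv ℝ D x - (3 : ℝ) • fderiv ℝ E x) x :=
        (cD.differentiable top_ne x).hasFDerivAt.sub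
          ((cE.differentiable top_ne x).hasFDerivAt.const_mul 3)
      rw [angular, d.fderiv]
      simp [angular]
    simp only [hG, h2, h1, hB, radial]
    ring
  have hG3 := integral_congr_ae (μ := volume) (.of_forall hG2)
  rw [integral_sub ((ivq _ (by
      have h1 := cA.continuous
      have h2 := (contDiff_radial cA).continuous
      exact (continuous_const.mul h1).add h2) fun x hx => by
        have h1 := eq_zero_of_tsupport (tsupport_radial.trans sA) hx
        simp only [radial] at h1
        rw [zA x hx, h1]; simp).const_mul 6) ((ivq G cG zG).const_mul 2), integral_const_mul,
    integral_const_mul, heuler] at hG3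
  refine hG3.trans ?_
  simp only [hT] at hz
  linarith

end IsBlowUpLimit

/-! ### Rigidity of the limit of the characteristic functions in the air -/

lemma divergence_smul_const {η : Plane → ℝ} {x : Plane} (hη : DifferentiableAt ℝ η x) (h : Plane) :
    divergence (fun y => η y • h) x = fderiv ℝ η x h := by
  have h1 : divergence (fun _ : Plane => h) x = 0 := by simp [divergence]
  have h2 := divergence_smul (φ := fun _ => h) hη (differentiableAt_const h)
  rw [h2, h1, mul_zero, zero_add]

lemma contDiff_translate {η : Plane → ℝ} (hη : ContDiff ℝ 1 η) (h : Plane) :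
    ContDiff ℝ 1 (fun y => η (y - h)) := hη.comp (contDiff_id.sub contDiff_const)

lemma hasCompactSupport_translate {η : Plane → ℝ} (hc : HasCompactSupport η) (h : Plane) :
    HasCompactSupport (fun y => η (y - h)) := by
  have := hc.comp_homeomorph (Homeomorph.subRight h)
  exact this

lemma tsupport_translate (η : Plane → ℝ) (h : Plane) :
    tsupport (fun y => η (y - h)) = (fun y => y - h) ⁻¹' tsupport η :=
  tsupport_comp_eq_preimage η (Homeomorph.subRight h)

/-- The change of `∫ χ η` under a translation of `η` is controlled by the variation of `χ` along the
path of the translation. -/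
lemma abs_integral_translate_le {χ η : Plane → ℝ} (hχ : Measurable χ) (hχ1 : ∀ x, |χ x| ≤ 1)
    (hη : ContDiff ℝ 1 η) (hc : HasCompactSupport η) (h : Plane) {B : ℝ}
    (hB : ∀ s ∈ Icc (0 : ℝ) 1, |∫ x, χ x * divergence (fun y => η (y - s • h) • h) x| ≤ B) :
    |∫ x, χ x * (η (x - h) - η x)| ≤ B := by
  have hD := hη.continuous_fderiv (by norm_num)
  obtain ⟨Z, hZ⟩ := hD.bounded_above_of_compact_support (hc.fderiv ℝ)
  obtain ⟨r, hr⟩ := hc.isCompact.isBounded.subset_closedBall (0 : Plane)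
  have hcont : ∀ s : ℝ, Continuous fun y => η (y - s • h) := fun s =>
    (contDiff_translate hη (s • h)).continuous
  have hint : ∀ s : ℝ, Integrable fun x => χ x * η (x - s • h) := fun s =>
    ((hcont s).integrable_of_hasCompactSupport (hasCompactSupport_translate hc _)).bdd_mul (c := 1)
      hχ.aestronglyMeasurable (.of_forall hχ1)
  have hdiff : ∀ x, ∀ s : ℝ, HasDerivAt (fun s => χ x * η (x - s • h))
      (χ x * -(fderiv ℝ η (x - s • h) h)) s := by
    intro x s
    have h1 : HasDerivAt (fun s : ℝ => x - s • h) (-h) s := by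
      simpa using ((hasDerivAt_id s).smul_const h).const_sub x
    have h2 := (hη.differentiable (by norm_num) (x - s • h)).hasFDerivAt.comp_hasDerivAt s h1
    have h3 := h2.const_mul (χ x)
    rw [map_neg] at h3
    exact h3
  have hder : ∀ s : ℝ, s ∈ Icc (0 : ℝ) 1 → HasDerivAt (fun s => ∫ x, χ x * η (x - s • h))
      (∫ x, χ x * -(fderiv ℝ η (x - s • h) h)) s := by
    intro s hs
    refine (hasDerivAt_integral_of_dominated_loc_of_deriv_le (ball_mem_nhds s one_pos)
      (bound := (closedBall (0 : Plane) (r + 2 * ‖h‖)).indicator fun _ => Z * ‖h‖)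
      (.of_forall fun s => (hint s).1) (hint s) ?_
      (.of_forall fun x t ht => ?_) ?_ (.of_forall fun x t _ => hdiff x t)).2
    · refine hχ.aestronglyMeasurable.mul (Continuous.aestronglyMeasurable ?_)
      fun_prop
    · have ht2 : |t| ≤ 2 := by
        rw [mem_ball, Real.dist_eq] at ht
        have := abs_sub_abs_le_abs_sub t s
        rw [abs_of_nonneg hs.1] at this
        linarith [hs.2]
      by_cases hx : x ∈ closedBall (0 : Plane) (r + 2 * ‖h‖)
      · rw [indicator_of_mem hx, norm_mul, norm_neg]
        calc _ ≤ 1 * (‖fderiv ℝ η (x - t • h)‖ * ‖h‖) :=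
              mul_le_mul (hχ1 x) ((fderiv ℝ η _).le_opNorm h) (norm_nonneg _) zero_le_one
          _ ≤ _ := by rw [one_mul]; exact mul_le_mul_of_nonneg_right (hZ _) (norm_nonneg _)
      · rw [indicator_of_notMem hx]
        have : x - t • h ∉ tsupport η := fun h' => by
          have h1 := mem_closedBall_zero_iff.1 (hr h')
          refine hx (mem_closedBall_zero_iff.2 ?_)
          have h2 : ‖t • h‖ ≤ 2 * ‖h‖ := by
            rw [norm_smul]; exact mul_le_mul_of_nonneg_right ht2 (norm_nonneg _)
          have h3 := norm_add_le (x - t • h) (t • h)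
          rw [sub_add_cancel] at h3
          linarith
        have h0 : fderiv ℝ η (x - t • h) = 0 := fderiv_of_notMem_tsupport ℝ this
        simp [h0]
    · exact (integrable_indicator_iff isClosed_closedBall.measurableSet).2
        (integrableOn_const measure_closedBall_lt_top.ne)
  have hb : ∀ s ∈ Icc (0 : ℝ) 1, ‖∫ x, χ x * -(fderiv ℝ η (x - s • h) h)‖ ≤ B := by
    intro s hs
    refine le_trans (le_of_eq ?_) (hB s hs)
    rw [← abs_neg, ← integral_neg, Real.norm_eq_abs]
    congr 1
    refine integral_congr_ae (.of_forall fun x => ?_)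
    simp only
    have hd := contDiff_translate hη (s • h)
    rw [divergence_smul_const (hd.differentiable (by norm_num) x), fderiv_comp_sub]
    ring
  have h := (convex_Icc (0 : ℝ) 1).norm_image_sub_le_of_norm_hasDerivWithin_le
    (fun s hs => (hder s hs).hasDerivWithinAt) hb (left_mem_Icc.2 zero_le_one)
    (right_mem_Icc.2 zero_le_one)
  simp only [one_smul, zero_smul, sub_zero, norm_one, mul_one] at h
  rw [← integral_sub (by simpa using hint 1) (by simpa using hint 0), Real.norm_eq_abs] at h
  simpa only [mul_sub] using h

namespace IsBlowUpLimit

variable {C : ℝ} {P : ℝ → ℝ} {V : ℕ → Plane → ℝ} {v χ : Plane → ℝ}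
variable (hL : IsBlowUpLimit V v χ) (hV : IsBlowUpSequence C P V)
include hL hV

omit hL in
/-- Where the limit function vanishes, the Dirichlet energies tend to zero. -/
lemma tendsto_integral_mul_grad_sq {ζ : Plane → ℝ} (hζ : ContDiff ℝ 1 ζ)
    (hs : tsupport ζ ⊆ ball 0 1)
    (hz : ∀ x ∈ tsupport ζ, Tendsto (fun m => V m x) atTop (𝓝 0)) :
    Tendsto (fun m => ∫ x, ζ x * ‖grad (V m) x‖ ^ 2) atTop (𝓝 0) := by
  have hC := hV.const_nonneg
  have hD := hζ.continuous_fderiv (by norm_num)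
  have hc := hasCompactSupport_of_tsupport hs
  obtain ⟨Z, hZ⟩ := hD.bounded_above_of_compact_support (hc.fderiv ℝ)
  have hZ0 : 0 ≤ Z := (norm_nonneg _).trans (hZ 0)
  have h1 := hV.tendsto_test hζ (hs.trans (ball_subset_ball (by norm_num)))
  have hle : ∀ m x, ‖x‖ < 1 → |fderiv ℝ ζ x (grad (V m) x)| ≤ Z * (3 * (C + 1)) := fun m x hx =>
    ((fderiv ℝ ζ x).le_opNorm _).trans
      (mul_le_mul (hZ x) (hV.bounds' m hx).1 (norm_nonneg _) hZ0)
  have h2 : Tendsto (fun m => ∫ x, V m x * fderiv ℝ ζ x (grad (V m) x)) atTop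
      (𝓝 (∫ _ : Plane, (0 : ℝ))) := by
    refine tendsto_integral_of_ball (M := 9 * (C + 1) * (Z * (3 * (C + 1)))) (fun m => ?_)
      (fun m x hx => ?_) (fun m x hx => ?_) (fun _ _ => rfl) fun x hx => ?_
    · exact ((hV.measurable_fun m).mul (isBoundedBilinearMap_apply.continuous.measurable.comp
        (hD.measurable.prodMk (hV.measurable_grad m)))).aestronglyMeasurable
    · rw [abs_mul]
      exact mul_le_mul (hV.bounds' m hx).2 (hle m x hx) (abs_nonneg _) (by positivity)
    · rw [fderiv_eq_zero_of_tsupport hs hx]; simp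
    · by_cases hxs : x ∈ tsupport ζ
      · refine squeeze_zero_norm (a := fun m => |V m x| * (Z * (3 * (C + 1)))) (fun m => ?_) ?_
        · rw [norm_mul]
          exact mul_le_mul_of_nonneg_left (hle m x hx) (abs_nonneg _)
        · simpa using (hz x hxs).abs.mul_const (Z * (3 * (C + 1)))
      · have : fderiv ℝ ζ x = 0 := fderiv_of_notMem_tsupport ℝ hxs
        simp [this]
  have h3 := h1.sub h2
  simp only [integral_zero, sub_zero] at h3
  refine h3.congr fun m => ?_
  obtain ⟨c, R, hp, -⟩ := hV.exists_profile m
  rw [← integral_sub (hp.integrable_test hζ hc) (hp.integrable_mul_fderiv hζ hc)]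
  refine integral_congr_ae (.of_forall fun x => ?_)
  simp

/-- In the air, the limit of the characteristic functions has no gradient in the sense of
distributions. -/
lemma integral_chi_mul_divergence_eq_zero {z : Plane} {ε₁ ε₂ : ℝ} (h1 : 0 < ε₁) (h12 : ε₁ < ε₂)
    (hball : closedBall z ε₂ ⊆ ball 0 1)
    (hpos : ∀ x ∈ closedBall z ε₂, 0 < x 1) (hzero : ∀ x ∈ closedBall z ε₂, v x = 0)
    {ψ : Plane → Plane} (hψ : ContDiff ℝ 1 ψ) (hs : tsupport ψ ⊆ closedBall z ε₁) :
    ∫ x, χ x * divergence ψ x = 0 := by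
  let f : ContDiffBump z := ⟨ε₁, ε₂, h1, h12⟩
  have hf : tsupport f ⊆ closedBall z ε₂ := f.tsupport_eq.subset
  have hf1 : ∀ x ∈ closedBall z ε₁, f x = 1 := fun x hx => f.one_of_mem_closedBall hx
  have hs2 : tsupport ψ ⊆ closedBall z ε₂ :=
    hs.trans (closedBall_subset_closedBall h12.le)
  set φ : Plane → Plane := fun x => (x 1)⁻¹ • ψ x with hφ
  have sφ : tsupport φ ⊆ tsupport ψ := tsupport_smul_subset_right _ ψ
  have cφ : ContDiff ℝ 1 φ := contDiff_of_tsupport fun x hx => by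
    have h3 : ContDiffAt ℝ 1 (fun x : Plane => x 1) x := by fun_prop
    exact (h3.inv (hpos x (hs2 (sφ hx))).ne').smul hψ.contDiffAt
  have hc := (isCompact_closedBall z ε₁).of_isClosed_subset (isClosed_tsupport _) (sφ.trans hs)
  -- the terms with `χ` are the divergence of `x₂ φ`
  have hdiv : ∀ x, x 1 * divergence φ x + φ x 1 = divergence ψ x := by
    intro x
    by_cases hx : x ∈ tsupport ψ
    · have hx1 : (x 1) ≠ 0 := (hpos x (hs2 hx)).ne'
      have hpr : HasFDerivAt (fun x : Plane => x 1) (EuclideanSpace.proj 1 : Plane →L[ℝ] ℝ) x :=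
        (EuclideanSpace.proj 1 : Plane →L[ℝ] ℝ).hasFDerivAt
      have h4 := divergence_smul (x := x) hpr.differentiableAt
        (cφ.differentiable (by norm_num) x)
      rw [hpr.fderiv] at h4
      have h5 : (fun y : Plane => y 1 • φ y) =ᶠ[𝓝 x] ψ := by
        have : ∀ᶠ y : Plane in 𝓝 x, y 1 ≠ 0 :=
          (by fun_prop : Continuous fun y : Plane => y 1).continuousAt.eventually_ne hx1
        filter_upwards [this] with y hy
        simp only [hφ]
        rw [smul_smul, mul_inv_cancel₀ hy, one_smul]
      have h6 : divergence (fun y : Plane => y 1 • φ y) x = divergence ψ x := by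
        simp only [divergence, h5.fderiv_eq]
      rw [← h6, h4]
      rfl
    · rw [divergence_eq_zero_of_notMem hx, divergence_eq_zero_of_notMem (fun h => hx (sφ h)),
        image_eq_zero_of_notMem_tsupport (fun h => hx (sφ h))]
      simp
  have cdψ := continuous_divergence hψ
  have zdψ : ∀ x : Plane, 1 ≤ ‖x‖ → divergence ψ x = 0 := fun x hx =>
    divergence_eq_zero_of_notMem fun h => absurd (mem_ball_zero_iff.1 (hball (hs2 h)))
      (not_lt.2 hx)
  have l1 := hL.tendsto_integral_chi cdψ zdψ
  have hφ3 : tsupport φ ⊆ ball 0 3 := (sφ.trans (hs2.trans hball)).trans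
    (ball_subset_ball (by norm_num))
  have l2 := hV.tendsto_stress cφ hφ3
  have l3 := tendsto_integral_mul_grad_sq hV (f.contDiff (n := 1)) (hf.trans hball)
    fun x hx => by
      have := hL.tendsto_apply (ball_subset_closedBall (hball (hf hx)))
      rwa [hzero x (hf hx)] at this
  obtain ⟨Z, hZ⟩ := (cφ.continuous_fderiv (by norm_num)).bounded_above_of_compact_support
    (HasCompactSupport.fderiv ℝ hc)
  have hZ0 : 0 ≤ Z := (norm_nonneg _).trans (hZ 0)
  have l4 : Tendsto (fun m => ∫ x, (‖grad (V m) x‖ ^ 2 * divergence φ x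
      - 2 * inner ℝ (grad (V m) x) (fderiv ℝ φ x (grad (V m) x)))) atTop (𝓝 0) := by
    refine squeeze_zero_norm (fun m => ?_) (a := fun m => 4 * Z * ∫ x, f x * ‖grad (V m) x‖ ^ 2)
      (by simpa using l3.const_mul (4 * Z))
    obtain ⟨c, R, hp, -⟩ := hV.exists_profile m
    rw [← integral_const_mul]
    have hfi : Integrable fun x => f x * ‖grad (V m) x‖ ^ 2 :=
      hp.integrable_grad_sq.bdd_mul (c := 1) f.continuous.aestronglyMeasurable
        (.of_forall fun x => by rw [Real.norm_of_nonneg f.nonneg]; exact f.le_one)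
    refine norm_integral_le_of_norm_le (hfi.const_mul _) (.of_forall fun x => ?_)
    by_cases hx : x ∈ tsupport φ
    · rw [hf1 x (hs (sφ hx)), one_mul, Real.norm_eq_abs]
      have t1 := abs_inner_fderiv_le φ x (grad (V m) x)
      have t2 := abs_divergence_le φ x
      have t3 := hZ x
      calc _ ≤ |‖grad (V m) x‖ ^ 2 * divergence φ x|
            + |2 * inner ℝ (grad (V m) x) (fderiv ℝ φ x (grad (V m) x))| := abs_sub _ _
        _ ≤ ‖grad (V m) x‖ ^ 2 * (2 * Z) + 2 * (‖grad (V m) x‖ ^ 2 * Z) := by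
          rw [abs_mul, abs_mul, abs_of_nonneg (sq_nonneg ‖grad (V m) x‖),
            abs_of_pos (by norm_num : (0 : ℝ) < 2)]
          have t4 : |divergence φ x| ≤ 2 * Z := t2.trans (by linarith)
          have t5 : |(inner ℝ (grad (V m) x) (fderiv ℝ φ x (grad (V m) x)) : ℝ)|
              ≤ ‖grad (V m) x‖ ^ 2 * Z :=
            t1.trans (mul_le_mul_of_nonneg_left t3 (sq_nonneg _))
          gcongr
        _ = _ := by ring
    · have h6 : fderiv ℝ φ x = 0 := fderiv_of_notMem_tsupport ℝ hx
      rw [divergence_eq_zero_of_notMem hx, h6]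
      simp only [mul_zero, zero_apply, inner_zero_right, sub_zero, norm_zero]
      exact mul_nonneg (by positivity) (mul_nonneg f.nonneg (sq_nonneg _))
  have l5 := l2.sub l4
  rw [sub_zero] at l5
  have l6 := tendsto_nhds_unique (l1.congr fun m => ?_) l5
  · rw [← l6]
    exact integral_congr_ae (.of_forall fun x => mul_comm _ _)
  · obtain ⟨c, R, hp, -⟩ := hV.exists_profile m
    obtain ⟨Z2, hZ2⟩ := (continuous_divergence cφ).bounded_above_of_compact_support
      (hasCompactSupport_divergence hc)
    have i1 : Integrable fun x => ‖grad (V m) x‖ ^ 2 * divergence φ x :=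
      hp.integrable_grad_sq.mul_bdd (c := Z2) (continuous_divergence cφ).aestronglyMeasurable
        (.of_forall hZ2)
    rw [← integral_sub (hp.integrable_stress cφ hc)
      (i1.fun_sub ((hp.integrable_inner_fderiv cφ hc).const_mul 2))]
    refine integral_congr_ae (.of_forall fun x => ?_)
    simp only [stress, ← hdiv]
    ring

/-- In a convex part of the air, the limit of the characteristic functions is constant. -/
lemma exists_chi_eq_const {U : Set Plane} (hU : IsOpen U) (hconv : Convex ℝ U)
    (hball : U ⊆ ball 0 1) (hpos : ∀ x ∈ U, 0 < x 1) (hzero : ∀ x ∈ U, v x = 0) :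
    ∃ c, ∀ᵐ x : Plane, x ∈ U → χ x = c := by
  rcases U.eq_empty_or_nonempty with rfl | hne
  · exact ⟨0, by simp⟩
  let f : ℕ → ContDiffBump (0 : Plane) := fun n =>
    ⟨(1 / ((n : ℝ) + 1)) / 2, 1 / ((n : ℝ) + 1), by positivity, by
      have : (0 : ℝ) < 1 / ((n : ℝ) + 1) := by positivity
      linarith⟩
  have hloc : LocallyIntegrable χ volume := by
    refine (locallyIntegrable_const (1 : ℝ)).mono hL.measurable.aestronglyMeasurable
      (.of_forall fun x => ?_)
    rw [Real.norm_of_nonneg (hL.nonneg x), norm_one]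
    exact hL.le_one x
  have hr : Tendsto (fun n => (f n).rOut) atTop (𝓝 0) := tendsto_one_div_add_atTop_nhds_zero_nat
  have hae := ContDiffBump.ae_convolution_tendsto_right_of_locallyIntegrable (μ := volume)
    (φ := f) (K := 2) hr (.of_forall fun n => by simp only [f]; linarith) hloc
  -- the mollified function at a point is an integral against a translated kernel
  set κ : ℕ → Plane → ℝ := fun n => (f n).normed volume with hκ
  have hconvol : ∀ n x, convolution ((f n).normed volume) χ (ContinuousLinearMap.lsmul ℝ ℝ) volume x
      = ∫ y, χ y * κ n (y - x) := by
    intro n x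
    rw [convolution_def]
    have h1 := integral_sub_left_eq_self (fun t => κ n t * χ (x - t)) volume x
    simp only [ContinuousLinearMap.lsmul_apply, smul_eq_mul]
    rw [← h1]
    refine integral_congr_ae (.of_forall fun y => ?_)
    simp only [hκ]
    rw [sub_sub_cancel, mul_comm, ← (f n).normed_neg (y - x), neg_sub]
  have hconst : ∀ x ∈ U, ∀ y ∈ U, ∀ᶠ n in atTop,
      ∫ z, χ z * κ n (z - x) = ∫ z, χ z * κ n (z - y) := by
    intro x hx y hy
    have hseg : ∀ s ∈ Icc (0 : ℝ) 1, y + s • (x - y) ∈ U := fun s hs =>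
      hconv.add_smul_sub_mem hy hx hs
    have hcomp : IsCompact ((fun s : ℝ => y + s • (x - y)) '' Icc 0 1) :=
      isCompact_Icc.image (by fun_prop)
    obtain ⟨δ, hδ, hδU⟩ := hcomp.exists_cthickening_subset_open hU (by
      rintro _ ⟨s, hs, rfl⟩; exact hseg s hs)
    filter_upwards [hr.eventually (gt_mem_nhds hδ)] with n hn
    have hη : ContDiff ℝ 1 (fun z => κ n (z - y)) :=
      contDiff_translate ((f n).contDiff_normed (n := 1)) y
    have hηc : HasCompactSupport (fun z => κ n (z - y)) :=
      hasCompactSupport_translate (f n).hasCompactSupport_normed y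
    have hχ1 : ∀ z, |χ z| ≤ 1 := fun z => by rw [abs_of_nonneg (hL.nonneg z)]; exact hL.le_one z
    have hmain := abs_integral_translate_le hL.measurable hχ1 hη hηc (x - y) (B := 0)
      fun s hs => by
        rw [abs_nonpos_iff]
        have hsub : closedBall (y + s • (x - y)) δ ⊆ U := by
          refine (Metric.closedBall_subset_cthickening ?_ δ).trans hδU
          exact ⟨s, hs, rfl⟩
        refine hL.integral_chi_mul_divergence_eq_zero hV (z := y + s • (x - y)) (f n).rOut_pos hn
          (hsub.trans hball) (fun z hz => hpos z (hsub hz)) (fun z hz => hzero z (hsub hz))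
          ((contDiff_translate hη _).smul contDiff_const) ?_
        refine (tsupport_smul_subset_left _ _).trans ?_
        rw [show (fun z => κ n (z - s • (x - y) - y)) = fun z => κ n (z - (y + s • (x - y))) by
          ext z; congr 1; abel]
        rw [tsupport_translate, hκ, (f n).tsupport_normed_eq]
        intro z hz
        rw [mem_preimage, mem_closedBall_zero_iff] at hz
        rwa [mem_closedBall, dist_eq_norm]
    rw [abs_nonpos_iff] at hmain
    have hi : ∀ w, Integrable fun z => χ z * κ n (z - w) := fun w =>
      ((contDiff_translate ((f n).contDiff_normed (n := 1)) w).continuous.integrable_of_hasCompactSupport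
        (hasCompactSupport_translate (f n).hasCompactSupport_normed w)).bdd_mul (c := 1)
        hL.measurable.aestronglyMeasurable (.of_forall hχ1)
    rw [← sub_eq_zero, ← integral_sub (hi x) (hi y), ← hmain]
    refine integral_congr_ae (.of_forall fun z => ?_)
    simp only
    rw [show z - (x - y) - y = z - x by abel]
    ring
  -- one point of convergence fixes the constant
  have hpt : ∃ x₀ ∈ U, Tendsto (fun n => ∫ y, χ y * κ n (y - x₀)) atTop (𝓝 (χ x₀)) := by
    by_contra! hcon
    have h0 : volume U = 0 := by
      refine measure_mono_null (fun x hx => ?_) (ae_iff.1 hae)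
      intro h
      exact hcon x hx (h.congr fun n => hconvol n x)
    exact (hU.measure_pos volume hne).ne' h0
  obtain ⟨x₀, hx₀, hlim₀⟩ := hpt
  refine ⟨χ x₀, ?_⟩
  filter_upwards [hae] with x hx hxU
  have h1 : Tendsto (fun n => ∫ y, χ y * κ n (y - x)) atTop (𝓝 (χ x)) :=
    hx.congr fun n => hconvol n x
  exact tendsto_nhds_unique (h1.congr' (hconst x hxU x₀ hx₀)) hlim₀

end IsBlowUpLimit

lemma tendsto_smoothTransition {t : ℝ} (ht : 0 ≤ t) :
    Tendsto (fun n : ℕ => Real.smoothTransition (t * ((n : ℝ) + 1) - 1)) atTop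
      (𝓝 (if 0 < t then 1 else 0)) := by
  split_ifs with h
  · refine tendsto_const_nhds.congr' ?_
    have h1 : Tendsto (fun n : ℕ => t * ((n : ℝ) + 1)) atTop atTop :=
      (tendsto_atTop_add_const_right _ 1 tendsto_natCast_atTop_atTop).const_mul_atTop h
    filter_upwards [h1.eventually_ge_atTop 2] with n hn
    exact (Real.smoothTransition.one_of_one_le (by linarith)).symm
  · refine tendsto_const_nhds.congr fun n => ?_
    rw [le_antisymm (not_lt.1 h) ht]
    exact (Real.smoothTransition.zero_of_nonpos (by norm_num)).symm

namespace IsBlowUpSequence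

variable {C : ℝ} {P : ℝ → ℝ} {V : ℕ → Plane → ℝ}

lemma perimeter_nonneg (hV : IsBlowUpSequence C P V) {δ : ℝ} (hδ : 0 < δ) : 0 ≤ P δ := by
  have := hV.perimeter 0 δ hδ (fun _ => 0) contDiff_const HasCompactSupport.zero
    (by simp [tsupport, Function.support]) (by simp)
  simpa [divergence] using this

/-- The perimeter bound controls how much of the fluid set leaves it under a translation. It is used
with `ζ` times a smooth approximation of the characteristic function that is zero near `{u = 0}`. -/
lemma integral_translate_le (hV : IsBlowUpSequence C P V) (m : ℕ) {δ ρ : ℝ} (hδ : 0 < δ)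
    {x₀ h : Plane} (hsub : closedBall x₀ (2 * ρ) ⊆ ball 0 1 ∩ {x | δ < x 1})
    {ζ : Plane → ℝ} (hζ : ContDiff ℝ 1 ζ) (h0 : ∀ x, 0 ≤ ζ x) (h1 : ∀ x, ζ x ≤ 1)
    (hs : tsupport ζ ⊆ closedBall x₀ ρ) (hh : ‖h‖ ≤ ρ) :
    ∫ x, ζ x * chi (V m) x * (1 - chi (V m) (x + h)) ≤ ‖h‖ * P δ := by
  obtain ⟨c, R, hp, hball⟩ := hV.exists_profile m
  set u := V m with hu
  have hρ : 0 ≤ ρ := (norm_nonneg h).trans hh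
  have hs1 : tsupport ζ ⊆ ball 0 1 := fun x hx =>
    (hsub (closedBall_subset_closedBall (by linarith) (hs hx))).1
  have hs2 : tsupport ζ ⊆ ball c R := hs1.trans
    ((ball_subset_ball (by norm_num)).trans hball)
  have hX : ∀ x, |chi u x| ≤ 1 := fun x => by
    rw [abs_of_nonneg (chi_nonneg u x)]; exact chi_le_one u x
  set T : ℕ → ℝ → ℝ := fun n t => Real.smoothTransition (t * ((n : ℝ) + 1) - 1) with hT
  have hT0 : ∀ n t, 0 ≤ T n t := fun n t => Real.smoothTransition.nonneg _
  have hT1 : ∀ n t, T n t ≤ 1 := fun n t => Real.smoothTransition.le_one _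
  have cT : ∀ n, ContDiff ℝ 1 (T n) := fun n =>
    Real.smoothTransition.contDiff.comp ((contDiff_id.mul contDiff_const).sub contDiff_const)
  have key : ∀ n, ∫ x, ζ x * T n (u x) * (chi u x - chi u (x + h)) ≤ ‖h‖ * P δ := by
    intro n
    set η : Plane → ℝ := fun x => ζ x * T n (u x) with hη
    have sη : tsupport η ⊆ tsupport ζ := tsupport_mul_subset_left
    have cη : ContDiff ℝ 1 η := contDiff_of_tsupport fun x hx =>
      hζ.contDiffAt.mul ((hp.contDiffOn_comp (f := T n) (ε := 1 / ((n : ℝ) + 1)) (by positivity)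
        (cT n) fun t ht => Real.smoothTransition.zero_of_nonpos (by
          rw [le_div_iff₀ (by positivity)] at ht; linarith)).contDiffAt
        (isOpen_ball.mem_nhds (hs2 (sη hx))))
    have hc : HasCompactSupport η := hasCompactSupport_of_tsupport (sη.trans hs1)
    have hB : ∀ s ∈ Icc (0 : ℝ) 1,
        |∫ x, chi u x * divergence (fun y => η (y - s • h) • h) x| ≤ ‖h‖ * P δ := by
      intro s hs'
      have ct := contDiff_translate cη (s • h)
      have hdir : ∀ e : Plane, ‖e‖ ≤ 1 →
          ∫ x, chi u x * fderiv ℝ (fun y => η (y - s • h)) x e ≤ P δ := by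
        intro e he
        have hts : tsupport (fun y => η (y - s • h) • e)
            ⊆ ball 0 1 ∩ {x | δ < x 1} := by
          refine (tsupport_smul_subset_left _ _).trans ?_
          rw [tsupport_translate]
          intro y hy
          refine hsub ?_
          have h2 := hs (sη hy)
          rw [mem_closedBall, dist_eq_norm] at h2 ⊢
          have h3 : ‖s • h‖ ≤ ρ := by
            rw [norm_smul, Real.norm_of_nonneg hs'.1]
            exact (mul_le_of_le_one_left (norm_nonneg _) hs'.2).trans hh
          have h4 := norm_add_le (y - s • h - x₀) (s • h)
          rw [show y - s • h - x₀ + s • h = y - x₀ by abel] at h4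
          linarith
        have h5 := hV.perimeter m δ hδ (fun y => η (y - s • h) • e) (ct.smul contDiff_const)
          (hasCompactSupport_of_tsupport (hts.trans inter_subset_left)) hts (fun y => by
            rw [norm_smul, Real.norm_eq_abs, abs_of_nonneg (mul_nonneg (h0 _) (hT0 _ _))]
            exact mul_le_one₀ (mul_le_one₀ (h1 _) (hT0 _ _) (hT1 _ _)) (norm_nonneg _) he)
        refine le_trans (le_of_eq (integral_congr_ae (.of_forall fun x => ?_))) h5
        simp only
        rw [divergence_smul_const (ct.differentiable (by norm_num) x)]
      have e1 : ∫ x, chi u x * divergence (fun y => η (y - s • h) • h) x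
          = ∫ x, chi u x * fderiv ℝ (fun y => η (y - s • h)) x h :=
        integral_congr_ae (.of_forall fun x => by
          simp only; rw [divergence_smul_const (ct.differentiable (by norm_num) x)])
      rw [e1]
      rcases eq_or_ne h 0 with h00 | hne
      · simp only [h00, map_zero, mul_zero, integral_zero, abs_zero, norm_zero, zero_mul, le_refl]
      have hn : 0 < ‖h‖ := norm_pos_iff.2 hne
      have hnorm : ‖‖h‖⁻¹ • h‖ ≤ 1 := by
        rw [norm_smul, norm_inv, norm_norm, inv_mul_cancel₀ hn.ne']
      have t1 := hdir (‖h‖⁻¹ • h) hnorm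
      have t2 := hdir (-(‖h‖⁻¹ • h)) (by rwa [norm_neg])
      simp only [map_neg, map_smul, smul_eq_mul, mul_neg, integral_neg] at t1 t2
      have e2 : ∫ x, chi u x * (‖h‖⁻¹ * fderiv ℝ (fun y => η (y - s • h)) x h)
          = ‖h‖⁻¹ * ∫ x, chi u x * fderiv ℝ (fun y => η (y - s • h)) x h := by
        rw [← integral_const_mul]
        exact integral_congr_ae (.of_forall fun x => by ring)
      rw [e2] at t1 t2
      rw [abs_le]
      rw [inv_mul_le_iff₀ hn] at t1
      rw [← mul_neg, inv_mul_le_iff₀ hn] at t2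
      constructor <;> linarith
    have h6 := abs_integral_translate_le hp.measurable_chi hX cη hc h hB
    have hi : ∀ w : Plane, Integrable fun x => chi u x * η (x - w) := fun w =>
      ((contDiff_translate cη w).continuous.integrable_of_hasCompactSupport
        (hasCompactSupport_translate hc w)).bdd_mul (c := 1)
        hp.measurable_chi.aestronglyMeasurable (.of_forall hX)
    have hi0 : Integrable fun x => chi u x * η x := by simpa using hi 0
    have h7 : ∫ x, chi u x * (η (x - h) - η x)
        = (∫ x, chi u (x + h) * η x) - ∫ x, chi u x * η x := by
      have := integral_add_right_eq_self (fun x => chi u x * η (x - h)) (μ := volume) h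
      simp only [add_sub_cancel_right] at this
      rw [this, ← integral_sub (hi h) hi0]
      exact integral_congr_ae (.of_forall fun x => by ring)
    have hi2 : Integrable fun x => chi u (x + h) * η x := by
      have := (hi h).comp_add_right h
      simpa using this
    rw [h7] at h6
    have h8 : ∫ x, ζ x * T n (u x) * (chi u x - chi u (x + h))
        = (∫ x, chi u x * η x) - ∫ x, chi u (x + h) * η x := by
      rw [← integral_sub hi0 hi2]
      exact integral_congr_ae (.of_forall fun x => by simp only [hη]; ring)
    rw [h8]
    linarith [neg_abs_le ((∫ x, chi u (x + h) * η x) - ∫ x, chi u x * η x)]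
  refine le_of_tendsto' (f := fun n => ∫ x, ζ x * T n (u x) * (chi u x - chi u (x + h)))
    (x := atTop) ?_ key
  refine tendsto_integral_of_ball (M := 1) (fun n => ?_) (fun n x _ => ?_) (fun n x hx => ?_)
    (fun x hx => ?_) fun x hx => ?_
  · exact ((hζ.continuous.measurable.mul ((cT n).continuous.measurable.comp hp.measurable)).mul
      (hp.measurable_chi.sub (hp.measurable_chi.comp (measurable_id.add_const h)))).aestronglyMeasurable
  · have h2 : |chi u x - chi u (x + h)| ≤ 1 := by
      rw [abs_le]
      constructor <;> linarith [chi_nonneg u x, chi_le_one u x, chi_nonneg u (x + h),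
        chi_le_one u (x + h)]
    rw [abs_mul, abs_of_nonneg (mul_nonneg (h0 _) (hT0 _ _))]
    exact mul_le_one₀ (mul_le_one₀ (h1 _) (hT0 _ _) (hT1 _ _)) (abs_nonneg _) h2
  · rw [eq_zero_of_tsupport hs1 hx]; simp
  · rw [eq_zero_of_tsupport hs1 hx]; simp
  · have h2 := tendsto_smoothTransition (hp.nonneg x)
    have h3 : ζ x * chi u x * (1 - chi u (x + h))
        = ζ x * (if 0 < u x then 1 else 0) * (chi u x - chi u (x + h)) := by
      by_cases hx2 : 0 < u x
      · rw [chi_of_pos hx2, if_pos hx2]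
      · rw [chi_of_not_pos hx2, if_neg hx2]; ring
    rw [h3]
    exact (h2.const_mul (ζ x)).mul_const _

end IsBlowUpSequence

namespace IsBlowUpLimit

variable {C : ℝ} {P : ℝ → ℝ} {V : ℕ → Plane → ℝ} {v χ : Plane → ℝ}
variable (hL : IsBlowUpLimit V v χ) (hV : IsBlowUpSequence C P V)
include hL hV

/-- If the limit of the characteristic functions is constant in an open set, then the constant is `0`
or `1`: a constant in between would be the weak limit of a sequence that oscillates, which the bound
on the perimeters excludes. -/
lemma const_eq_zero_or_one {U : Set Plane} (hU : IsOpen U) (hne : U.Nonempty)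
    (hball : U ⊆ ball 0 1) (hpos : ∀ x ∈ U, 0 < x 1) {c : ℝ}
    (hc : ∀ᵐ x : Plane, x ∈ U → χ x = c) : c = 0 ∨ c = 1 := by
  obtain ⟨x₀, hx₀⟩ := hne
  have hc01 : 0 ≤ c ∧ c ≤ 1 := by
    by_contra hcon
    have h0 : volume U = 0 := by
      refine measure_mono_null (fun x hx => ?_) (ae_iff.1 hc)
      intro h
      rw [← h hx] at hcon
      exact hcon ⟨hL.nonneg x, hL.le_one x⟩
    exact (hU.measure_pos volume ⟨x₀, hx₀⟩).ne' h0
  set δ := x₀ 1 / 2 with hδdef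
  have hδ : 0 < δ := half_pos (hpos x₀ hx₀)
  have hopen : IsOpen (U ∩ {x : Plane | δ < x 1}) :=
    hU.inter (isOpen_lt continuous_const (by fun_prop))
  obtain ⟨r, hr, hrU⟩ := Metric.isOpen_iff.1 hopen x₀ ⟨hx₀, by
    simp only [mem_ofPred_eq, hδdef]; linarith [hpos x₀ hx₀]⟩
  set ρ := r / 3 with hρdef
  have hρ : 0 < ρ := by positivity
  have hcl : closedBall x₀ (2 * ρ) ⊆ U ∩ {x : Plane | δ < x 1} :=
    (closedBall_subset_ball (by rw [hρdef]; linarith)).trans hrU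
  have hsub : closedBall x₀ (2 * ρ) ⊆ ball 0 1 ∩ {x : Plane | δ < x 1} := fun x hx =>
    ⟨hball (hcl hx).1, (hcl hx).2⟩
  let ζ : ContDiffBump x₀ := ⟨ρ / 2, ρ, by positivity, by linarith⟩
  have hζs : tsupport ζ ⊆ closedBall x₀ ρ := ζ.tsupport_eq.subset
  have hζ1 : tsupport ζ ⊆ ball 0 1 := fun x hx =>
    (hsub (closedBall_subset_closedBall (by linarith) (hζs hx))).1
  have hζ0 : 0 < ∫ x, ζ x := ζ.integral_pos
  have hζi : Integrable ζ := ζ.integrable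
  have hX : ∀ m x, |chi (V m) x| ≤ 1 := fun m x => by
    rw [abs_of_nonneg (chi_nonneg _ x)]; exact chi_le_one _ x
  have key : ∀ ε ∈ Ioo 0 ρ, c * (1 - c) * ∫ x, ζ x ≤ ε * P δ := by
    intro ε hε
    let f : ContDiffBump (0 : Plane) := ⟨ε / 2, ε, by linarith [hε.1], by linarith [hε.1]⟩
    set κ : Plane → ℝ := f.normed volume with hκ
    have κc : Continuous κ := f.continuous_normed
    have κi : Integrable κ := f.integrable_normed
    have κ1 : ∫ h, κ h = 1 := f.integral_normed
    have κ0 : ∀ h, 0 ≤ κ h := f.nonneg_normed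
    have κs : ∀ h, ε < ‖h‖ → κ h = 0 := fun h hh => image_eq_zero_of_notMem_tsupport fun h' => by
      rw [hκ, f.tsupport_normed_eq, mem_closedBall_zero_iff] at h'
      exact absurd h' (not_le.2 hh)
    set a : ℕ → Plane → ℝ := fun m x => ∫ h, κ h * chi (V m) (x + h) with ha
    have hXm := fun m => hV.measurable_chi m
    have hprod : ∀ m, Measurable fun q : Plane × Plane => chi (V m) (q.1 + q.2) := fun m =>
      (hXm m).comp (measurable_fst.add measurable_snd)
    have ha1 : ∀ m x, |a m x| ≤ 1 := fun m x => by
      rw [ha, ← κ1, ← Real.norm_eq_abs]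
      refine norm_integral_le_of_norm_le κi (.of_forall fun h => ?_)
      rw [norm_mul, Real.norm_of_nonneg (κ0 h)]
      exact mul_le_of_le_one_right (κ0 h) (hX m _)
    have ham : ∀ m, StronglyMeasurable (a m) := fun m => by
      refine StronglyMeasurable.integral_prod_right (f := fun x h => κ h * chi (V m) (x + h)) ?_
      exact ((κc.measurable.comp measurable_snd).mul (hprod m)).stronglyMeasurable
    have hκX : ∀ m x, Integrable fun h => κ h * chi (V m) (x + h) := fun m x =>
      κi.mul_bdd (c := 1) ((hXm m).comp (measurable_const.add measurable_id)).aestronglyMeasurable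
        (.of_forall fun h => hX m _)
    -- averaging the translation estimate over the translations
    have hle : ∀ m, ∫ x, ζ x * chi (V m) x * (1 - a m x) ≤ ε * P δ := by
      intro m
      have e1 : ∀ x, ζ x * chi (V m) x * (1 - a m x)
          = ∫ h, κ h * (ζ x * chi (V m) x * (1 - chi (V m) (x + h))) := by
        intro x
        have : ∀ h, κ h * (ζ x * chi (V m) x * (1 - chi (V m) (x + h)))
            = ζ x * chi (V m) x * (κ h - κ h * chi (V m) (x + h)) := fun h => by ring
        simp only [this]
        rw [integral_const_mul, integral_sub κi (hκX m x), κ1]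
      simp only [e1]
      rw [integral_integral_swap]
      · have e2 : ∀ h, ∫ x, κ h * (ζ x * chi (V m) x * (1 - chi (V m) (x + h)))
            ≤ κ h * (ε * P δ) := by
          intro h
          rw [integral_const_mul]
          rcases lt_or_ge ε ‖h‖ with hh | hh
          · rw [κs h hh, zero_mul, zero_mul]
          · refine mul_le_mul_of_nonneg_left ((hV.integral_translate_le m hδ hsub (ζ.contDiff (n := 1))
              (fun x => ζ.nonneg) (fun x => ζ.le_one) hζs (hh.trans hε.2.le)).trans ?_) (κ0 h)
            exact mul_le_mul_of_nonneg_right hh (hV.perimeter_nonneg hδ)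
        have h2 : ∫ h, κ h * (ε * P δ) = ε * P δ := by rw [integral_mul_const, κ1, one_mul]
        rw [← h2]
        refine integral_mono_of_nonneg (.of_forall fun h => ?_) (κi.mul_const _)
          (.of_forall e2)
        refine integral_nonneg fun x => mul_nonneg (κ0 h) (mul_nonneg
          (mul_nonneg ζ.nonneg (chi_nonneg _ _)) (sub_nonneg.2 (chi_le_one _ _)))
      · have h3 : Integrable (fun q : Plane × Plane => ζ q.1 * κ q.2) (volume.prod volume) :=
          hζi.mul_prod κi
        refine (h3.mul_bdd (c := 1) (g := fun q : Plane × Plane =>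
          chi (V m) q.1 * (1 - chi (V m) (q.1 + q.2))) ?_ (.of_forall fun q => ?_)).congr
          (.of_forall fun q => ?_)
        · exact (((hXm m).comp measurable_fst).mul (measurable_const.sub (hprod m))).aestronglyMeasurable
        · rw [norm_mul]
          refine mul_le_one₀ (hX m _) (norm_nonneg _) ?_
          rw [Real.norm_of_nonneg (sub_nonneg.2 (chi_le_one _ _))]
          linarith [chi_nonneg (V m) (q.1 + q.2)]
        · simp only [Function.uncurry]
          ring
    -- the averages converge to the constant
    have halim : ∀ x ∈ closedBall x₀ ρ, Tendsto (fun m => a m x) atTop (𝓝 c) := by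
      intro x hx
      have hU2 : ∀ y, ‖y - x‖ ≤ ε → y ∈ U := fun y hy => by
        refine (hcl ?_).1
        rw [mem_closedBall, dist_eq_norm] at hx ⊢
        have := norm_add_le (y - x) (x - x₀)
        rw [sub_add_sub_cancel] at this
        linarith [hε.2]
      have hz : ∀ y : Plane, 1 ≤ ‖y‖ → κ (y - x) = 0 := fun y hy => κs _ (by
        by_contra h
        exact absurd (mem_ball_zero_iff.1 (hball (hU2 y (not_lt.1 h)))) (not_lt.2 hy))
      have h1 := hL.tendsto_integral_chi (f := fun y => κ (y - x)) (by fun_prop) hz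
      have h2 : ∫ y, κ (y - x) * χ y = c := by
        have : ∫ y, κ (y - x) * χ y = ∫ y, c * κ (y - x) := by
          refine integral_congr_ae ?_
          filter_upwards [hc] with y hy
          by_cases hyx : ‖y - x‖ ≤ ε
          · rw [hy (hU2 y hyx), mul_comm]
          · rw [κs _ (not_le.1 hyx)]; simp
        rw [this, integral_const_mul, integral_sub_right_eq_self κ, κ1, mul_one]
      rw [h2] at h1
      refine h1.congr fun m => ?_
      have := integral_add_left_eq_self (fun y => κ (y - x) * chi (V m) y) (μ := volume) x
      rw [ha, ← this]
      exact integral_congr_ae (.of_forall fun y => by simp)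
    have hζz : ∀ x : Plane, 1 ≤ ‖x‖ → ζ x = 0 := fun x hx => eq_zero_of_tsupport hζ1 hx
    have l1 : Tendsto (fun m => ∫ x, ζ x * chi (V m) x * (c - a m x)) atTop
        (𝓝 (∫ _ : Plane, (0 : ℝ))) := by
      refine tendsto_integral_of_ball (M := 2) (fun m => ?_) (fun m x _ => ?_) (fun m x hx => ?_)
        (fun _ _ => rfl) fun x hx => ?_
      · exact ((ζ.continuous.measurable.mul (hXm m)).mul
          (measurable_const.sub (ham m).measurable)).aestronglyMeasurable
      · rw [abs_mul, abs_mul, abs_of_nonneg ζ.nonneg]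
        have h2 : |c - a m x| ≤ 2 := (abs_sub _ _).trans (by
          rw [abs_of_nonneg hc01.1]; linarith [hc01.2, ha1 m x])
        calc _ ≤ 1 * |c - a m x| := mul_le_mul_of_nonneg_right
              (mul_le_one₀ ζ.le_one (abs_nonneg _) (hX m x)) (abs_nonneg _)
          _ ≤ 2 := by rw [one_mul]; exact h2
      · rw [hζz x hx]; simp
      · by_cases hxs : x ∈ closedBall x₀ ρ
        · refine squeeze_zero_norm (a := fun m => |c - a m x|) (fun m => ?_) ?_
          · rw [norm_mul]
            refine mul_le_of_le_one_left (norm_nonneg _) ?_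
            rw [norm_mul, Real.norm_of_nonneg ζ.nonneg]
            exact mul_le_one₀ ζ.le_one (abs_nonneg _) (hX m x)
          · have := ((halim x hxs).const_sub c).abs
            simpa using this
        · have : ζ x = 0 := image_eq_zero_of_notMem_tsupport fun h => hxs (hζs h)
          simp [this]
    have l2 := (hL.tendsto_integral_chi ζ.continuous hζz).mul_const (1 - c)
    have l3 := l2.add l1
    rw [integral_zero, add_zero] at l3
    have h5 : ∫ x, ζ x * χ x = c * ∫ x, ζ x := by
      rw [← integral_const_mul]
      refine integral_congr_ae ?_
      filter_upwards [hc] with y hy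
      by_cases hys : y ∈ closedBall x₀ ρ
      · rw [hy (hcl (closedBall_subset_closedBall (by linarith) hys)).1, mul_comm]
      · rw [image_eq_zero_of_notMem_tsupport fun h => hys (hζs h)]; simp
    rw [h5] at l3
    have h6 : c * (∫ x, ζ x) * (1 - c) ≤ ε * P δ := by
      refine le_of_tendsto' l3 fun m => ?_
      refine le_trans (le_of_eq ?_) (hle m)
      rw [← integral_mul_const, ← integral_add]
      · exact integral_congr_ae (.of_forall fun x => by simp only; ring)
      · exact (hζi.mul_bdd (c := 1) (hXm m).aestronglyMeasurable
          (.of_forall (hX m))).mul_const _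
      · exact (hζi.mul_bdd (c := 1) (hXm m).aestronglyMeasurable
          (.of_forall (hX m))).mul_bdd (c := 2)
          (measurable_const.sub (ham m).measurable).aestronglyMeasurable
          (.of_forall fun x => (abs_sub _ _).trans (by
            rw [abs_of_nonneg hc01.1]; linarith [hc01.2, ha1 m x]))
    linarith
  have hfinal : c * (1 - c) * ∫ x, ζ x ≤ 0 := by
    have h1 : Tendsto (fun ε : ℝ => ε * P δ) (𝓝[>] 0) (𝓝 0) := by
      have : Tendsto (fun ε : ℝ => ε * P δ) (𝓝 0) (𝓝 (0 * P δ)) := tendsto_id.mul_const _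
      rw [zero_mul] at this
      exact this.mono_left nhdsWithin_le_nhds
    refine ge_of_tendsto h1 ?_
    filter_upwards [Ioo_mem_nhdsGT hρ] with ε hε using key ε hε
  have h2 : c * (1 - c) ≤ 0 := by
    by_contra h
    exact absurd (mul_pos (not_le.1 h) hζ0) (not_lt.2 hfinal)
  have h3 : c * (1 - c) = 0 := le_antisymm h2 (mul_nonneg hc01.1 (sub_nonneg.2 hc01.2))
  rcases mul_eq_zero.1 h3 with h | h
  · exact Or.inl h
  · exact Or.inr (by linarith)

end IsBlowUpLimit

/-! ### The equation for the angular profile -/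

/-- The test functions on the interval `(a, b)`. -/
def testSpace (a b : ℝ) : Submodule ℝ (ℝ → ℝ) where
  carrier := {β | ContDiff ℝ ∞ β ∧ HasCompactSupport β ∧ tsupport β ⊆ Ioo a b}
  add_mem' hf hg := ⟨hf.1.add hg.1, hf.2.1.add hg.2.1,
    (tsupport_add _ _).trans (union_subset hf.2.2 hg.2.2)⟩
  zero_mem' := ⟨contDiff_const, HasCompactSupport.zero, by simp [tsupport]⟩
  smul_mem' c f hf := ⟨hf.1.const_smul c, hf.2.1.smul_left (f := fun _ => c),
    (tsupport_smul_subset_right (fun _ => c) f).trans hf.2.2⟩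

lemma mem_testSpace_of_eq_zero {a b a' b' : ℝ} {β : ℝ → ℝ} (hβ : ContDiff ℝ ∞ β)
    (ha : a < a') (hb : b' < b) (h : ∀ t, t ∉ Icc a' b' → β t = 0) : β ∈ testSpace a b := by
  have h2 : tsupport β ⊆ Icc a' b' :=
    closure_minimal (fun t ht => by_contra fun h3 => ht (h t h3)) isClosed_Icc
  exact ⟨hβ, isCompact_Icc.of_isClosed_subset (isClosed_tsupport β) h2,
    h2.trans (Icc_subset_Ioo ha hb)⟩

lemma exists_Icc_of_mem_testSpace {a b : ℝ} (hab : a < b) {β : ℝ → ℝ} (hβ : β ∈ testSpace a b) :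
    ∃ a' b', a < a' ∧ b' < b ∧ a' ≤ b' ∧ ∀ t, t ∉ Icc a' b' → β t = 0 := by
  rcases (tsupport β).eq_empty_or_nonempty with h | h
  · refine ⟨(a + b) / 2, (a + b) / 2, by linarith, by linarith, le_rfl, fun t _ => ?_⟩
    exact image_eq_zero_of_notMem_tsupport (by simp [h])
  · obtain ⟨x, hx⟩ := hβ.2.1.isCompact.exists_isLeast h
    obtain ⟨y, hy⟩ := hβ.2.1.isCompact.exists_isGreatest h
    exact ⟨x, y, (hβ.2.2 hx.1).1, (hβ.2.2 hy.1).2, hx.2 hy.1, fun t ht =>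
      image_eq_zero_of_notMem_tsupport fun h2 => ht ⟨hx.2 h2, hy.2 h2⟩⟩

lemma contDiff_integral {f : ℝ → ℝ} (hf : ContDiff ℝ ∞ f) (a : ℝ) :
    ContDiff ℝ ∞ fun t => ∫ s in a..t, f s := by
  have h : ∀ t, HasDerivAt (fun t => ∫ s in a..t, f s) (f t) t := fun t =>
    (hf.continuous.integral_hasStrictDerivAt a t).hasDerivAt
  rw [contDiff_infty_iff_deriv]
  refine ⟨fun t => (h t).differentiableAt, ?_⟩
  rwa [show deriv (fun t => ∫ s in a..t, f s) = f from funext fun t => (h t).deriv]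

/-- The equation `σ''' + 9 σ' = β` has a solution with compact support if `β` is orthogonal to the
solutions `1`, `cos 3t` and `sin 3t` of the homogeneous equation. -/
lemma exists_deriv_eq {a b : ℝ} (hab : a < b) {β : ℝ → ℝ} (hβ : β ∈ testSpace a b)
    (h0 : ∫ t, β t = 0) (h1 : ∫ t, cos (3 * t) * β t = 0)
    (h2 : ∫ t, sin (3 * t) * β t = 0) :
    ∃ σ ∈ testSpace a b, ∀ t, deriv (deriv (deriv σ)) t + 9 * deriv σ t = β t := by
  obtain ⟨a', b', ha, hb, hab', hz⟩ := exists_Icc_of_mem_testSpace hab hβ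
  have cβ := hβ.1
  have key : ∀ w : ℝ → ℝ, ContDiff ℝ ∞ w → ∫ t, w t * β t = 0 →
      (∀ t, HasDerivAt (fun t => ∫ s in a..t, w s * β s) (w t * β t) t) ∧
      ContDiff ℝ ∞ (fun t => ∫ s in a..t, w s * β s) ∧
      ∀ t, t ∉ Icc a' b' → ∫ s in a..t, w s * β s = 0 := by
    intro w hw hw0
    have cw : ContDiff ℝ ∞ fun t => w t * β t := hw.mul cβ
    refine ⟨fun t => (cw.continuous.integral_hasStrictDerivAt a t).hasDerivAt,
      contDiff_integral cw a, fun t ht => ?_⟩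
    rcases lt_or_ge t a' with h | h
    · rw [intervalIntegral.integral_congr (g := fun _ => (0 : ℝ)), intervalIntegral.integral_zero]
      intro s hs
      simp only
      rw [hz s, mul_zero]
      intro h3
      rcases le_total a t with h4 | h4
      · rw [uIcc_of_le h4] at hs; linarith [hs.2, h3.1]
      · rw [uIcc_of_ge h4] at hs; linarith [hs.2, h3.1]
    · have htb : b' < t := not_le.1 fun h3 => ht ⟨h, h3⟩
      rw [intervalIntegral.integral_of_le (by linarith),
        setIntegral_eq_integral_of_forall_compl_eq_zero, hw0]
      intro s hs
      rw [hz s, mul_zero]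
      intro h3
      exact hs ⟨by linarith [h3.1], by linarith [h3.2]⟩
  obtain ⟨d0, c0, z0⟩ := key (fun _ => 1) contDiff_const (by simpa using h0)
  obtain ⟨d1, c1, z1⟩ := key (fun t => cos (3 * t))
    (Real.contDiff_cos.comp (contDiff_const.mul contDiff_id)) h1
  obtain ⟨d2, c2, z2⟩ := key (fun t => sin (3 * t))
    (Real.contDiff_sin.comp (contDiff_const.mul contDiff_id)) h2
  set I0 := fun t => ∫ s in a..t, 1 * β s
  set I1 := fun t => ∫ s in a..t, cos (3 * s) * β s
  set I2 := fun t => ∫ s in a..t, sin (3 * s) * β s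
  have ccos : ContDiff ℝ ∞ fun t : ℝ => cos (3 * t) :=
    Real.contDiff_cos.comp (contDiff_const.mul contDiff_id)
  have csin : ContDiff ℝ ∞ fun t : ℝ => sin (3 * t) :=
    Real.contDiff_sin.comp (contDiff_const.mul contDiff_id)
  have dcos : ∀ t : ℝ, HasDerivAt (fun t => cos (3 * t)) (-sin (3 * t) * 3) t := fun t => by
    simpa using ((hasDerivAt_id t).const_mul 3).cos
  have dsin : ∀ t : ℝ, HasDerivAt (fun t => sin (3 * t)) (cos (3 * t) * 3) t := fun t => by
    simpa using ((hasDerivAt_id t).const_mul 3).sin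
  set σ : ℝ → ℝ := fun t =>
    1 / 9 * (I0 t - cos (3 * t) * I1 t - sin (3 * t) * I2 t) with hσ
  have e1 : deriv σ = fun t => 1 / 3 * (sin (3 * t) * I1 t - cos (3 * t) * I2 t) := by
    funext t
    have := ((((d0 t).sub ((dcos t).mul (d1 t))).sub ((dsin t).mul (d2 t))).const_mul (1 / 9)).deriv
    refine (show deriv σ t = _ from this).trans ?_
    linear_combination (-(1 / 9) * β t) * Real.sin_sq_add_cos_sq (3 * t)
  have e2 : deriv (deriv σ) = fun t => cos (3 * t) * I1 t + sin (3 * t) * I2 t := by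
    rw [e1]
    funext t
    refine ((((dsin t).mul (d1 t)).sub ((dcos t).mul (d2 t))).const_mul (1 / 3)).deriv.trans ?_
    ring
  refine ⟨σ, mem_testSpace_of_eq_zero ?_ ha hb fun t ht => ?_, fun t => ?_⟩
  · exact contDiff_const.mul ((c0.sub (ccos.mul c1)).sub (csin.mul c2))
  · simp only [hσ]
    have h3 : I0 t = 0 := z0 t ht
    have h4 : I1 t = 0 := z1 t ht
    have h5 : I2 t = 0 := z2 t ht
    rw [h3, h4, h5]; ring
  · have e3 : deriv (deriv (deriv σ)) t = -3 * sin (3 * t) * I1 t + 3 * cos (3 * t) * I2 t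
        + β t := by
      rw [e2]
      refine (((dcos t).mul (d1 t)).add ((dsin t).mul (d2 t))).deriv.trans ?_
      linear_combination (β t) * Real.sin_sq_add_cos_sq (3 * t)
    rw [e3, e1]
    ring

/-- Integration against a locally integrable function, as a linear form on the test functions. -/
def testPairing {w : ℝ → ℝ} (hw : LocallyIntegrable w) (a b : ℝ) : testSpace a b →ₗ[ℝ] ℝ where
  toFun β := ∫ t, w t * β.1 t
  map_add' f g := by
    have h : ∀ f : testSpace a b, Integrable fun t => w t * f.1 t := fun f =>
      hw.integrable_smul_right_of_hasCompactSupport f.2.1.continuous f.2.2.1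
    rw [← integral_add (h f) (h g)]
    simp [mul_add]
  map_smul' c f := by
    rw [RingHom.id_apply, smul_eq_mul, ← integral_const_mul]
    refine integral_congr_ae (.of_forall fun t => ?_)
    simp only [Submodule.coe_smul, Pi.smul_apply, smul_eq_mul]
    ring

/-- A weak solution of `q''' + 9 q' = 0` is a linear combination of `1`, `cos 3t`, `sin 3t`: as a
linear form it vanishes where these three forms do. -/
theorem exists_eq_of_weak_ode {a b : ℝ} (hab : a < b) {q : ℝ → ℝ} (hq : Continuous q)
    (h : ∀ σ ∈ testSpace a b, ∫ t, q t * (deriv (deriv (deriv σ)) t + 9 * deriv σ t) = 0) :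
    ∃ A B D : ℝ, ∀ t ∈ Ioo a b, q t = A + B * cos (3 * t) + D * sin (3 * t) := by
  have l0 : LocallyIntegrable (fun _ : ℝ => (1 : ℝ)) := continuous_const.locallyIntegrable
  have l1 : LocallyIntegrable fun t : ℝ => cos (3 * t) :=
    (by fun_prop : Continuous fun t : ℝ => cos (3 * t)).locallyIntegrable
  have l2 : LocallyIntegrable fun t : ℝ => sin (3 * t) :=
    (by fun_prop : Continuous fun t : ℝ => sin (3 * t)).locallyIntegrable
  have hspan := mem_span_of_iInf_ker_le_ker (𝕜 := ℝ)
    (L := ![testPairing l0 a b, testPairing l1 a b, testPairing l2 a b])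
    (K := testPairing hq.locallyIntegrable a b) (by
      intro β hβ
      simp only [Submodule.mem_iInf, LinearMap.mem_ker] at hβ ⊢
      have t0 : ∫ t, 1 * β.1 t = 0 := hβ 0
      have t1 : ∫ t, cos (3 * t) * β.1 t = 0 := hβ 1
      have t2 : ∫ t, sin (3 * t) * β.1 t = 0 := hβ 2
      obtain ⟨σ, hσ, he⟩ := exists_deriv_eq hab β.2 (by simpa using t0) t1 t2
      have h3 := h σ hσ
      simp only [he] at h3
      exact h3)
  rw [Submodule.mem_span_range_iff_exists_fun] at hspan
  obtain ⟨c, hc⟩ := hspan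
  refine ⟨c 0, c 1, c 2, ?_⟩
  set f : ℝ → ℝ := fun t => q t - (c 0 + c 1 * cos (3 * t) + c 2 * sin (3 * t)) with hf
  have cf : Continuous f := by fun_prop
  have hae := isOpen_Ioo.ae_eq_zero_of_integral_contDiff_smul_eq_zero (U := Ioo a b) (μ := volume)
    (f := f) (cf.locallyIntegrable.locallyIntegrableOn _) (fun β hβ hcs hs => by
      have h3 := LinearMap.congr_fun hc ⟨β, hβ, hcs, hs⟩
      simp only [Fin.sum_univ_three, LinearMap.add_apply, LinearMap.smul_apply, smul_eq_mul] at h3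
      have h4 : c 0 * (∫ t, 1 * β t) + c 1 * (∫ t, cos (3 * t) * β t)
        + c 2 * (∫ t, sin (3 * t) * β t) = ∫ t, q t * β t := h3
      have hi : ∀ w : ℝ → ℝ, LocallyIntegrable w → Integrable fun t => w t * β t := fun w hw =>
        hw.integrable_smul_right_of_hasCompactSupport hβ.continuous hcs
      have i0 := (hi _ l0).const_mul (c 0)
      have i1 := (hi _ l1).const_mul (c 1)
      have i2 := (hi _ l2).const_mul (c 2)
      have h5 : ∀ t, β t • f t = q t * β t - (c 0 * (1 * β t) + c 1 * (cos (3 * t) * β t)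
        + c 2 * (sin (3 * t) * β t)) := fun t => by simp only [hf, smul_eq_mul]; ring
      simp only [h5]
      rw [integral_sub (hi q hq.locallyIntegrable) ((i0.fun_add i1).fun_add i2),
        integral_add (i0.fun_add i1) i2, integral_add i0 i1, integral_const_mul (c 0),
        integral_const_mul (c 1), integral_const_mul (c 2)]
      linarith)
  intro t ht
  have h6 : f t = 0 := by
    have h7 : EqOn f 0 (Ioo a b) := by
      refine Measure.eqOn_open_of_ae_eq (μ := volume) ?_ isOpen_Ioo cf.continuousOn
        continuousOn_const
      rw [Filter.EventuallyEq, ae_restrict_iff' measurableSet_Ioo]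
      exact hae
    exact h7 ht
  simp only [hf] at h6
  linarith

/-! ### Angular profiles -/

/-- The maximal interval of positivity around a point of positivity. -/
lemma exists_component {q : ℝ → ℝ} (hq : Continuous q) (h0 : ∀ t, 0 ≤ q t) {l r θ : ℝ} (hl : q l = 0)
    (hr : q r = 0) (hθ : θ ∈ Icc l r) (hpos : 0 < q θ) :
    ∃ α β, l ≤ α ∧ α < θ ∧ θ < β ∧ β ≤ r ∧ q α = 0 ∧ q β = 0 ∧ ∀ t ∈ Ioo α β, 0 < q t := by
  have hcl : IsClosed {t | q t = 0} := isClosed_eq hq continuous_const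
  obtain ⟨α, hα, hα2⟩ := (isCompact_Icc.inter_right hcl).exists_isGreatest
    (⟨l, ⟨le_rfl, hθ.1⟩, hl⟩ : (Icc l θ ∩ {t | q t = 0}).Nonempty)
  obtain ⟨β, hβ, hβ2⟩ := (isCompact_Icc.inter_right hcl).exists_isLeast
    (⟨r, ⟨hθ.2, le_rfl⟩, hr⟩ : (Icc θ r ∩ {t | q t = 0}).Nonempty)
  have hα3 : q α = 0 := hα.2
  have hβ3 : q β = 0 := hβ.2
  refine ⟨α, β, hα.1.1, hα.1.2.lt_of_ne ?_, hβ.1.1.lt_of_ne ?_, hβ.1.2, hα3, hβ3, fun t ht => ?_⟩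
  · rintro rfl; linarith
  · rintro rfl; linarith
  · refine (h0 t).lt_of_ne fun h => ?_
    rcases le_total t θ with h2 | h2
    · exact absurd (hα2 ⟨⟨hα.1.1.trans ht.1.le, h2⟩, h.symm⟩) (not_le.2 ht.1)
    · exact absurd (hβ2 ⟨⟨h2, ht.2.le.trans hβ.1.2⟩, h.symm⟩) (not_le.2 ht.2)

/-- On an interval of positivity the profile is `A (1 - cos 3(t - α))`, since it has a double zero at
the end point `α`; so the length of the interval is `2π/3`. -/
lemma component_eq {q : ℝ → ℝ} (hq : Continuous q) {K α β : ℝ} (hαβ : α < β) (hα : q α = 0)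
    (hβ : q β = 0) (hpos : ∀ t ∈ Ioo α β, 0 < q t) (hK : ∀ s t, q s = 0 → q t ≤ K * (t - s) ^ 2)
    (hode : ∀ σ ∈ testSpace α β, ∫ t, q t * (deriv (deriv (deriv σ)) t + 9 * deriv σ t) = 0) :
    β = α + 2 * π / 3 ∧ ∃ A, 0 < A ∧
      ∀ t ∈ Icc α β, q t = A * (1 - cos (3 * (t - α))) := by
  obtain ⟨A, B, D, hABD⟩ := exists_eq_of_weak_ode hαβ hq hode
  set f : ℝ → ℝ := fun t => A + B * cos (3 * t) + D * sin (3 * t) with hf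
  have cf : Continuous f := by fun_prop
  have hIcc : ∀ t ∈ Icc α β, q t = f t := by
    have : EqOn q f (closure (Ioo α β)) := EqOn.closure (fun t ht => hABD t ht) hq cf
    rwa [closure_Ioo hαβ.ne] at this
  have hfα : f α = 0 := by rw [← hIcc α ⟨le_rfl, hαβ.le⟩, hα]
  have hd : HasDerivAt f (B * (-sin (3 * α) * 3) + D * (cos (3 * α) * 3)) α := by
    have d3 : HasDerivAt (fun t : ℝ => 3 * t) 3 α := by simpa using (hasDerivAt_id α).const_mul 3
    exact ((d3.cos.const_mul B).const_add A).add (d3.sin.const_mul D)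
  have hd0 : B * (-sin (3 * α) * 3) + D * (cos (3 * α) * 3) = 0 := by
    set d := B * (-sin (3 * α) * 3) + D * (cos (3 * α) * 3) with hdd
    have h1 := hd.tendsto_slope.mono_left (nhdsWithin_mono α (fun t ht => (ne_of_gt ht) :
      Ioi α ⊆ {α}ᶜ))
    have hIoo : Ioo α β ∈ 𝓝[>] α := Ioo_mem_nhdsGT hαβ
    have h2 : Tendsto (fun t => K * (t - α)) (𝓝[>] α) (𝓝 0) := by
      have : Tendsto (fun t => K * (t - α)) (𝓝 α) (𝓝 (K * (α - α))) :=
        (by fun_prop : Continuous fun t => K * (t - α)).tendsto α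
      rw [sub_self, mul_zero] at this
      exact this.mono_left nhdsWithin_le_nhds
    refine le_antisymm (le_of_tendsto_of_tendsto h1 h2 ?_) (ge_of_tendsto h1 ?_)
    · filter_upwards [hIoo] with t ht
      rw [slope_def_field, hfα, ← hIcc t ⟨ht.1.le, ht.2.le⟩, div_le_iff₀ (by linarith [ht.1])]
      have := hK α t hα
      nlinarith
    · filter_upwards [hIoo] with t ht
      rw [slope_def_field, hfα, ← hIcc t ⟨ht.1.le, ht.2.le⟩]
      exact div_nonneg (by linarith [hpos t ht]) (by linarith [ht.1])
  have hform : ∀ t, f t = A * (1 - cos (3 * (t - α))) := by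
    intro t
    simp only [hf] at hfα ⊢
    have e1 : cos (3 * t) = cos (3 * (t - α)) * cos (3 * α)
        - sin (3 * (t - α)) * sin (3 * α) := by rw [← Real.cos_add]; ring_nf
    have e2 : sin (3 * t) = sin (3 * (t - α)) * cos (3 * α)
        + cos (3 * (t - α)) * sin (3 * α) := by rw [← Real.sin_add]; ring_nf
    rw [e1, e2]
    linear_combination cos (3 * (t - α)) * hfα + sin (3 * (t - α)) / 3 * hd0
  have hA : 0 < A := by
    have h1 := hpos ((α + β) / 2) ⟨by linarith, by linarith⟩
    rw [hIcc _ ⟨by linarith, by linarith⟩, hform] at h1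
    exact pos_of_mul_pos_left h1 (by linarith [Real.cos_le_one (3 * ((α + β) / 2 - α))])
  refine ⟨?_, A, hA, fun t ht => by rw [hIcc t ht, hform]⟩
  have hle : β ≤ α + 2 * π / 3 := by
    by_contra h
    have h1 := hpos (α + 2 * π / 3) ⟨by linarith [Real.pi_pos], not_le.1 h⟩
    rw [hIcc _ ⟨by linarith [Real.pi_pos], (not_le.1 h).le⟩, hform,
      show 3 * (α + 2 * π / 3 - α) = 2 * π by ring, Real.cos_two_pi] at h1
    linarith
  have h1 := hIcc β ⟨hαβ.le, le_rfl⟩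
  rw [hβ, hform] at h1
  have h2 : cos (3 * (β - α)) = 1 := by
    rcases mul_eq_zero.1 h1.symm with h | h <;> linarith
  by_contra hne
  have hlt := hle.lt_of_ne hne
  have := (Real.cos_eq_one_iff_of_lt_of_lt (x := 3 * (β - α)) (by linarith [Real.pi_pos])
    (by linarith)).1 h2
  linarith

/-- A profile on `[0, π]` vanishes, or it is positive in a single interval, of length `2π/3`. -/
theorem profile_eq {q : ℝ → ℝ} (hq : Continuous q) (h0 : ∀ t, 0 ≤ q t) (hl : q 0 = 0)
    (hr : q π = 0) {K : ℝ} (hK : ∀ s t, q s = 0 → q t ≤ K * (t - s) ^ 2)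
    (hode : ∀ α β, 0 ≤ α → α < β → β ≤ π → (∀ t ∈ Ioo α β, 0 < q t) → ∀ σ ∈ testSpace α β,
      ∫ t, q t * (deriv (deriv (deriv σ)) t + 9 * deriv σ t) = 0) :
    (∀ t ∈ Icc 0 π, q t = 0) ∨ ∃ α ∈ Icc 0 (π / 3), ∃ A, 0 < A ∧
      (∀ t ∈ Icc α (α + 2 * π / 3), q t = A * (1 - cos (3 * (t - α)))) ∧
      (∀ t ∈ Ioo α (α + 2 * π / 3), 0 < q t) ∧
      ∀ t ∈ Icc 0 π, t ∉ Ioo α (α + 2 * π / 3) → q t = 0 := by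
  have key : ∀ θ ∈ Icc 0 π, 0 < q θ → ∃ α β, 0 ≤ α ∧ α < θ ∧ θ < β ∧ β ≤ π ∧ q α = 0 ∧
      q β = 0 ∧ (∀ t ∈ Ioo α β, 0 < q t) ∧ β = α + 2 * π / 3 ∧ ∃ A, 0 < A ∧
      ∀ t ∈ Icc α β, q t = A * (1 - cos (3 * (t - α))) := by
    intro θ hθ hpos
    obtain ⟨α, β, h1, h2, h3, h4, h5, h6, h7⟩ := exists_component hq h0 hl hr hθ hpos
    exact ⟨α, β, h1, h2, h3, h4, h5, h6, h7, component_eq hq (h2.trans h3) h5 h6 h7 hK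
      (hode α β h1 (h2.trans h3) h4 h7)⟩
  by_cases hz : ∀ t ∈ Icc 0 π, q t = 0
  · exact Or.inl hz
  right
  push Not at hz
  obtain ⟨θ, hθ, hne⟩ := hz
  obtain ⟨α, β, h1, h2, h3, h4, h5, h6, h7, rfl, A, hA, h8⟩ := key θ hθ ((h0 θ).lt_of_ne' hne)
  refine ⟨α, ⟨h1, by linarith⟩, A, hA, h8, h7, fun t ht hn => ?_⟩
  by_contra hne2
  -- a second interval of length `2π/3` would contain the midpoint `π/2` of `[0, π]`, as the first
  obtain ⟨α', β', k1, k2, k3, k4, k5, k6, k7, rfl, -⟩ := key t ht ((h0 t).lt_of_ne' hne2)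
  rcases lt_or_ge α' α with h | h
  · exact absurd h5 (k7 α ⟨h, by linarith [Real.pi_pos]⟩).ne'
  · rcases h.lt_or_eq with h | rfl
    · exact absurd k5 (h7 α' ⟨h, by linarith [Real.pi_pos]⟩).ne'
    · exact hn ⟨k2, k3⟩

/-! ### Homogeneity of blow-up limits -/

namespace IsBlowUpLimit

variable {C : ℝ} {P : ℝ → ℝ} {V : ℕ → Plane → ℝ} {v χ : Plane → ℝ}
variable (hL : IsBlowUpLimit V v χ) (hV : IsBlowUpSequence C P V)
include hL hV

/-- Scaling of a test function: the derivative in the scaling parameter vanishes by Euler's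
identity. -/
lemma integral_sq_mul_comp_smul {η : Plane → ℝ} (hη : ContDiff ℝ 1 η)
    (hs : tsupport η ⊆ ball 0 1) {t : ℝ} (ht : 1 ≤ t) :
    t ^ 5 * ∫ x, v x ^ 2 * η (t • x) = ∫ x, v x ^ 2 * η x := by
  have hvm := hL.measurable_fun hV
  have hcs := hasCompactSupport_of_tsupport hs
  obtain ⟨M₁, hM₁⟩ := hη.continuous.bounded_above_of_compact_support hcs
  obtain ⟨M₂, hM₂⟩ := (hη.continuous_fderiv one_ne_zero).bounded_above_of_compact_support
    (hcs.fderiv (𝕜 := ℝ))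
  have hM₁0 : 0 ≤ M₁ := (norm_nonneg _).trans (hM₁ 0)
  have hM₂0 : 0 ≤ M₂ := (norm_nonneg _).trans (hM₂ 0)
  have hcη := hη.continuous
  have hcf := hη.continuous_fderiv one_ne_zero
  set G : ℝ → ℝ := fun s => ∫ x, v x ^ 2 * (s ^ 5 * η (s • x)) with hG
  have hderiv : ∀ s, HasDerivAt G
      (∫ x, v x ^ 2 * (5 * s ^ 4 * η (s • x) + s ^ 5 * fderiv ℝ η (s • x) x)) s := by
    intro s
    have hB : Integrable ((closedBall (0 : Plane) 1).indicator fun _ =>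
        (9 * (C + 1)) ^ 2 * (5 * (|s| + 1) ^ 4 * M₁ + (|s| + 1) ^ 5 * M₂)) :=
      (integrable_indicator_iff isClosed_closedBall.measurableSet).2
        (integrableOn_const (measure_closedBall_lt_top.ne))
    refine (hasDerivAt_integral_of_dominated_loc_of_deriv_le (ball_mem_nhds s one_pos)
      (F := fun s x => v x ^ 2 * (s ^ 5 * η (s • x)))
      (F' := fun s x => v x ^ 2 * (5 * s ^ 4 * η (s • x) + s ^ 5 * fderiv ℝ η (s • x) x))
      (bound := (closedBall (0 : Plane) 1).indicator fun _ =>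
        (9 * (C + 1)) ^ 2 * (5 * (|s| + 1) ^ 4 * M₁ + (|s| + 1) ^ 5 * M₂)) ?_ ?_ ?_ ?_ hB ?_).2
    · refine .of_forall fun s => ((hvm.pow_const 2).mul ?_).aestronglyMeasurable
      exact (by fun_prop : Continuous fun x : Plane => s ^ 5 * η (s • x)).measurable
    · refine ((integrable_indicator_iff (f := fun _ => (9 * (C + 1)) ^ 2 * (|s| ^ 5 * M₁))
        (isClosed_closedBall (x := (0 : Plane)) (ε := 1)).measurableSet).2
        (integrableOn_const (measure_closedBall_lt_top.ne))).mono' ((hvm.pow_const 2).mul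
          (by fun_prop : Continuous fun x : Plane => s ^ 5 * η (s • x)).measurable).aestronglyMeasurable
        (.of_forall fun x => ?_)
      by_cases hx : x ∈ closedBall (0 : Plane) 1
      · rw [indicator_of_mem hx, norm_mul, norm_pow, norm_mul, norm_pow, Real.norm_eq_abs s]
        refine mul_le_mul (pow_le_pow_left₀ (norm_nonneg _) (hL.abs_le hV x) 2) ?_ (by positivity)
          (sq_nonneg _)
        exact mul_le_mul_of_nonneg_left (hM₁ _) (by positivity)
      · rw [indicator_of_notMem hx, hL.eq_zero x hx]; simp
    · refine ((hvm.pow_const 2).mul ?_).aestronglyMeasurable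
      exact (by fun_prop : Continuous fun x : Plane =>
        5 * s ^ 4 * η (s • x) + s ^ 5 * fderiv ℝ η (s • x) x).measurable
    · refine .of_forall fun x r hr => ?_
      by_cases hx : x ∈ closedBall (0 : Plane) 1
      · rw [indicator_of_mem hx]
        have hr1 : |r| ≤ |s| + 1 := by
          rw [mem_ball, Real.dist_eq] at hr
          have := abs_add_le (r - s) s
          rw [sub_add_cancel] at this
          linarith
        have hx1 : ‖x‖ ≤ 1 := by simpa using hx
        have h1 : ‖fderiv ℝ η (r • x) x‖ ≤ M₂ :=
          ((fderiv ℝ η (r • x)).le_opNorm x).trans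
            ((mul_le_of_le_one_right (norm_nonneg _) hx1).trans (hM₂ _))
        rw [norm_mul, norm_pow]
        refine mul_le_mul (pow_le_pow_left₀ (norm_nonneg _) (hL.abs_le hV x) 2) ?_ (norm_nonneg _)
          (sq_nonneg _)
        refine (norm_add_le _ _).trans ?_
        rw [norm_mul, norm_mul, norm_mul, norm_pow, norm_pow, Real.norm_eq_abs r,
          Real.norm_of_nonneg (by norm_num : (0 : ℝ) ≤ 5)]
        have h2 := hM₁ (r • x)
        gcongr
      · rw [indicator_of_notMem hx, hL.eq_zero x hx]; simp
    · refine .of_forall fun x r _ => ?_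
      have h1 : HasDerivAt (fun r : ℝ => η (r • x)) (fderiv ℝ η (r • x) x) r := by
        have h2 : HasDerivAt (fun r : ℝ => r • x) x r := by
          simpa using (hasDerivAt_id r).smul_const x
        exact (hη.differentiable one_ne_zero _).hasFDerivAt.comp_hasDerivAt r h2
      have h3 := ((hasDerivAt_pow 5 r).mul h1).const_mul (v x ^ 2)
      simpa using h3
  have hzero : ∀ s, 1 ≤ s → HasDerivAt G 0 s := by
    intro s hs1
    have hs0 : (0 : ℝ) < s := by linarith
    have h1 : ContDiff ℝ 1 fun x : Plane => η (s • x) := hη.comp (contDiff_const_smul s)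
    have h2 : tsupport (fun x : Plane => η (s • x)) ⊆ ball 0 1 := by
      intro x hx
      have h3 : s • x ∈ tsupport η :=
        tsupport_comp_subset_preimage η (f := fun x : Plane => s • x) (by fun_prop) hx
      have h4 := mem_ball_zero_iff.1 (hs h3)
      rw [norm_smul, Real.norm_of_nonneg hs0.le] at h4
      rw [mem_ball_zero_iff]
      nlinarith [norm_nonneg x]
    have h3 := hL.euler hV h1 h2
    have h4 : ∀ x, fderiv ℝ (fun x : Plane => η (s • x)) x x = s * fderiv ℝ η (s • x) x := by
      intro x
      have h5 : HasFDerivAt (fun x : Plane => η (s • x))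
          ((fderiv ℝ η (s • x)).comp (s • ContinuousLinearMap.id ℝ Plane)) x :=
        (hη.differentiable one_ne_zero _).hasFDerivAt.comp x ((hasFDerivAt_id x).const_smul s)
      rw [h5.fderiv]; simp
    have h6 : ∫ x, v x ^ 2 * (5 * s ^ 4 * η (s • x) + s ^ 5 * fderiv ℝ η (s • x) x) = 0 := by
      rw [← mul_zero (s ^ 4), ← h3, ← integral_const_mul]
      refine integral_congr_ae (.of_forall fun x => ?_)
      simp only [h4]; ring
    rw [← h6]
    exact hderiv s
  have hconst := constant_of_has_deriv_right_zero (f := G) (a := 1) (b := t)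
    (fun s _ => (hderiv s).continuousAt.continuousWithinAt)
    (fun s hs => (hzero s hs.1).hasDerivWithinAt) t ⟨ht, le_rfl⟩
  simp only [hG, one_pow, one_mul, one_smul] at hconst
  rw [← hconst, ← integral_const_mul]
  exact integral_congr_ae (.of_forall fun x => by ring)

/-- The square of a blow-up limit is homogeneous of degree three. -/
theorem sq_smul {t : ℝ} (ht0 : 0 < t) (ht : t ≤ 1) {x : Plane} (hx : ‖x‖ < 1) :
    v (t • x) ^ 2 = t ^ 3 * v x ^ 2 := by
  have hvm := hL.measurable_fun hV
  have hmem : ∀ y : Plane, ‖y‖ < 1 → y ∈ closedBall (0 : Plane) 1 := fun y hy => by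
    simpa using hy.le
  have hsm : ∀ y : Plane, ‖y‖ < 1 → ‖t • y‖ < 1 := fun y hy => by
    rw [norm_smul, Real.norm_of_nonneg ht0.le]
    nlinarith [norm_nonneg y]
  set f : Plane → ℝ := fun y => v (t • y) ^ 2 - t ^ 3 * v y ^ 2 with hf
  have fm : Measurable f := ((hvm.comp (measurable_const_smul t)).pow_const 2).sub
    ((hvm.pow_const 2).const_mul _)
  have hb : ∀ y, ‖v y ^ 2‖ ≤ (9 * (C + 1)) ^ 2 := fun y => by
    rw [norm_pow]; exact pow_le_pow_left₀ (norm_nonneg _) (hL.abs_le hV y) 2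
  have fb : ∀ y, ‖f y‖ ≤ 2 * (9 * (C + 1)) ^ 2 := fun y => by
    refine (norm_sub_le _ _).trans ?_
    have h1 := hb (t • y)
    have h2 : ‖t ^ 3 * v y ^ 2‖ ≤ (9 * (C + 1)) ^ 2 := by
      rw [norm_mul]
      refine (mul_le_of_le_one_left (norm_nonneg _) ?_).trans (hb y)
      rw [norm_pow, Real.norm_of_nonneg ht0.le]
      exact pow_le_one₀ ht0.le ht
    linarith
  have hae := isOpen_ball.ae_eq_zero_of_integral_contDiff_smul_eq_zero (U := ball
    (0 : Plane) 1) (μ := volume) (f := f) (by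
      refine LocallyIntegrable.locallyIntegrableOn ?_ _
      have hcon : LocallyIntegrable fun _ : Plane => 2 * (9 * (C + 1)) ^ 2 :=
        continuous_const.locallyIntegrable
      exact hcon.mono fm.aestronglyMeasurable (.of_forall fun y =>
        (fb y).trans (le_abs_self _))) (fun η hη hc hs => by
      have h1 := hL.integral_sq_mul_comp_smul hV (hη.of_le (by exact_mod_cast le_top)) hs
        (t := t⁻¹) ((one_le_inv₀ ht0).2 ht)
      have h2 := integral_comp_affine (fun y => v (t • y) ^ 2 * η y) 0 (inv_pos.2 ht0)
      simp only [zero_add, smul_inv_smul₀ ht0.ne'] at h2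
      rw [h2] at h1
      have hi : ∀ w : Plane → ℝ, Measurable w → (∀ y, ‖w y‖ ≤ (9 * (C + 1)) ^ 2) →
          Integrable fun y => w y * η y := fun w hw hwb =>
        (hη.continuous.integrable_of_hasCompactSupport hc).bdd_mul hw.aestronglyMeasurable
          (.of_forall hwb)
      have h3 : ∀ y, η y • f y = v (t • y) ^ 2 * η y - t ^ 3 * (v y ^ 2 * η y) := fun y => by
        simp only [hf, smul_eq_mul]; ring
      simp only [h3]
      rw [integral_sub (hi (fun y => v (t • y) ^ 2) ((hvm.comp (measurable_const_smul t)).pow_const 2)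
        fun y => hb _) ((hi _ (hvm.pow_const 2) hb).const_mul _), integral_const_mul, ← h1]
      field_simp
      ring)
  have hcont : ContinuousOn f (ball 0 1) := by
    have hv := hL.continuousOn hV
    refine ((hv.comp (by fun_prop) fun y hy => hmem _ (hsm y (by simpa using hy))).pow 2).sub
      (((hv.mono ball_subset_closedBall).pow 2).const_smul (t ^ 3))
  have h0 : EqOn f 0 (ball 0 1) := by
    refine Measure.eqOn_open_of_ae_eq (μ := volume) ?_ isOpen_ball hcont continuousOn_const
    rw [Filter.EventuallyEq, ae_restrict_iff' isOpen_ball.measurableSet]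
    exact hae
  have h1 : f x = 0 := h0 (by simpa using hx)
  simp only [hf] at h1
  linarith

end IsBlowUpLimit

/-! ### Polar coordinates -/

/-- The point with polar coordinates `(r, θ)`. -/
def polar (r θ : ℝ) : Plane := !₂[r * cos θ, r * sin θ]

@[simp] lemma polar_zero (r θ : ℝ) : polar r θ 0 = r * cos θ := rfl
@[simp] lemma polar_one (r θ : ℝ) : polar r θ 1 = r * sin θ := rfl

lemma norm_sq_polar (r θ : ℝ) : ‖polar r θ‖ ^ 2 = r ^ 2 := by
  rw [norm_sq_plane]
  simp only [polar_zero, polar_one]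
  linear_combination r ^ 2 * Real.sin_sq_add_cos_sq θ

lemma norm_polar {r : ℝ} (hr : 0 ≤ r) (θ : ℝ) : ‖polar r θ‖ = r := by
  have := norm_sq_polar r θ
  rwa [sq_eq_sq₀ (norm_nonneg _) hr] at this

lemma smul_polar (s r θ : ℝ) : s • polar r θ = polar (s * r) θ := by
  ext i; fin_cases i <;> simp [polar, mul_assoc]

lemma hasDerivAt_polar (r θ : ℝ) : HasDerivAt (polar r) (rot (polar r θ)) θ := by
  have h : HasDerivAt (fun θ => ![r * cos θ, r * sin θ])
      ![-(r * sin θ), r * cos θ] θ := by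
    rw [hasDerivAt_pi]
    intro i
    fin_cases i
    · simpa using (Real.hasDerivAt_cos θ).const_mul r
    · simpa using (Real.hasDerivAt_sin θ).const_mul r
  have h2 := (PiLp.continuousLinearEquiv 2 ℝ (fun _ : Fin 2 => ℝ)).symm.toContinuousLinearMap.hasFDerivAt.comp_hasDerivAt θ h
  refine h2.congr_deriv ?_
  ext i; fin_cases i <;> simp [polar, rot]

lemma hasDerivAt_comp_polar {B : Plane → ℝ} (hB : Differentiable ℝ B) (r θ : ℝ) :
    HasDerivAt (fun θ => B (polar r θ)) (angular B (polar r θ)) θ :=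
  (hB _).hasFDerivAt.comp_hasDerivAt θ (hasDerivAt_polar r θ)

/-- Integration in polar coordinates of a function in which the variables separate. -/
lemma integral_eq_polar {f : Plane → ℝ} {g h : ℝ → ℝ}
    (hf : ∀ r, 0 < r → ∀ θ ∈ Ioo (-π) π, f (polar r θ) = g r * h θ) :
    ∫ x, f x = (∫ r in Ioi (0 : ℝ), r * g r) * ∫ θ in Ioo (-π) π, h θ := by
  have h1 := (LinearIsometryEquiv.measurePreserving
    Complex.orthonormalBasisOneI.repr).integral_comp
    Complex.orthonormalBasisOneI.repr.toHomeomorph.measurableEmbedding f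
  rw [← h1, ← Complex.integral_comp_polarCoord_symm]
  have h2 := setIntegral_prod_mul (μ := (volume : Measure ℝ)) (ν := (volume : Measure ℝ))
    (fun r => r * g r) h (Ioi 0) (Ioo (-π) π)
  rw [← h2]
  refine setIntegral_congr_fun (measurableSet_Ioi.prod measurableSet_Ioo) fun p hp => ?_
  obtain ⟨hp1, hp2⟩ := mem_prod.1 hp
  have h3 : Complex.orthonormalBasisOneI.repr (Complex.polarCoord.symm p) = polar p.1 p.2 := by
    ext i
    have := congrFun (Complex.orthonormalBasisOneI_repr_apply (Complex.polarCoord.symm p)) i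
    refine this.trans ?_
    fin_cases i <;> simp [Complex.polarCoord_symm_apply, polar, Complex.cos_ofReal_re,
      Complex.sin_ofReal_re]
  simp only [smul_eq_mul]
  rw [h3, hf p.1 hp1 p.2 hp2]
  ring

/-! ### Test functions in polar coordinates -/

/-- A bump function of the squared radius. -/
def radialBump : ContDiffBump (1 / 2 : ℝ) := ⟨1 / 8, 1 / 4, by norm_num, by norm_num⟩

lemma contDiff_radialBump : ContDiff ℝ ∞ radialBump := radialBump.contDiff

lemma radialBump_eq_zero {t : ℝ} (ht : t ≤ 1 / 4 ∨ 3 / 4 ≤ t) : radialBump t = 0 := by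
  refine radialBump.zero_of_le_dist ?_
  change 1 / 4 ≤ dist t (1 / 2)
  rw [Real.dist_eq]
  rcases ht with ht | ht
  · rw [abs_of_nonpos (by linarith)]; linarith
  · rw [abs_of_nonneg (by linarith)]; linarith

lemma radialBump_eq_zero_of_norm {x : Plane} (hx : 1 ≤ ‖x‖) : radialBump (‖x‖ ^ 2) = 0 :=
  radialBump_eq_zero (Or.inr (by nlinarith))

lemma continuous_radialBump : Continuous radialBump := contDiff_radialBump.continuous

lemma radialWeight_pos (n : ℕ) : 0 < ∫ r in Ioi (0 : ℝ), r * (r ^ n * radialBump (r ^ 2)) := by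
  have hc := continuous_radialBump
  have hcont : Continuous fun r : ℝ => r * (r ^ n * radialBump (r ^ 2)) := by fun_prop
  have hcs : HasCompactSupport fun r : ℝ => r * (r ^ n * radialBump (r ^ 2)) := by
    refine HasCompactSupport.of_support_subset_isCompact (isCompact_Icc (a := (-1 : ℝ)) (b := 1)) ?_
    intro r hr
    by_contra h
    refine hr ?_
    have : 1 ≤ r ^ 2 := by
      rcases not_and_or.1 h with h | h <;> nlinarith
    simp only
    rw [radialBump_eq_zero (Or.inr (by linarith))]; simp
  rw [setIntegral_pos_iff_support_of_nonneg_ae]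
  · have hopen : IsOpen (Ioo (1 / 2 + 1 / 100 : ℝ) (3 / 4)) := isOpen_Ioo
    refine lt_of_lt_of_le (b := volume (Ioo (1 / 2 + 1 / 100 : ℝ) (3 / 4))) (by simp; norm_num)
      (measure_mono fun r hr => ⟨?_, ?_⟩)
    · have hr0 : 0 < r := by linarith [hr.1]
      have : 0 < radialBump (r ^ 2) := radialBump.pos_of_mem_ball (by
        change r ^ 2 ∈ ball (1 / 2 : ℝ) (1 / 4)
        rw [mem_ball, Real.dist_eq, abs_lt]
        constructor <;> nlinarith [hr.1, hr.2])
      exact (by positivity : 0 < r * (r ^ n * radialBump (r ^ 2))).ne'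
    · have : (0 : ℝ) < r := by linarith [hr.1]
      exact this
  · refine (ae_restrict_iff' measurableSet_Ioi).2 (.of_forall fun r hr => ?_)
    have hr0 : (0 : ℝ) < r := hr
    have := radialBump.nonneg (x := r ^ 2)
    simp only [Pi.zero_apply]
    positivity
  · exact (hcont.integrable_of_hasCompactSupport hcs).integrableOn

/-- The polar angle in the upper half plane. -/
def angle (x : Plane) : ℝ := π / 2 - Real.arctan (x 0 / x 1)

lemma angle_mem (x : Plane) : angle x ∈ Ioo 0 π := by
  have h1 := Real.arctan_lt_pi_div_two (x 0 / x 1)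
  have h2 := Real.neg_pi_div_two_lt_arctan (x 0 / x 1)
  constructor <;> simp only [angle] <;> linarith

lemma angle_polar {r θ : ℝ} (hr : 0 < r) (hθ : θ ∈ Ioo 0 π) : angle (polar r θ) = θ := by
  have hs : 0 < sin θ := Real.sin_pos_of_mem_Ioo hθ
  have h : polar r θ 0 / polar r θ 1 = Real.tan (π / 2 - θ) := by
    rw [Real.tan_eq_sin_div_cos, Real.sin_pi_div_two_sub, Real.cos_pi_div_two_sub, polar_zero,
      polar_one, mul_div_mul_left _ _ hr.ne']
  rw [angle, h, Real.arctan_tan] <;> linarith [hθ.1, hθ.2]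

lemma norm_pos_of_height_pos {x : Plane} (hx : 0 < x 1) : 0 < ‖x‖ :=
  norm_pos_iff.2 fun h => by simp [h] at hx

lemma polar_angle {x : Plane} (hx : 0 < x 1) : polar ‖x‖ (angle x) = x := by
  have hn : ‖x‖ = x 1 * Real.sqrt (1 + (x 0 / x 1) ^ 2) := by
    rw [← sq_eq_sq₀ (norm_nonneg _) (by positivity), mul_pow, Real.sq_sqrt (by positivity),
      norm_sq_plane]
    field_simp
    ring
  have hs : 0 < Real.sqrt (1 + (x 0 / x 1) ^ 2) := Real.sqrt_pos.2 (by positivity)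
  ext i
  fin_cases i
  · change ‖x‖ * cos (angle x) = x 0
    rw [angle, Real.cos_pi_div_two_sub, Real.sin_arctan, hn]
    field_simp
  · change ‖x‖ * sin (angle x) = x 1
    rw [angle, Real.sin_pi_div_two_sub, Real.cos_arctan, hn]
    field_simp

lemma contDiffAt_angle {x : Plane} (hx : 0 < x 1) : ContDiffAt ℝ ∞ angle x := by
  have h0 : ContDiff ℝ ∞ fun x : Plane => x 0 := contDiff_piLp_apply 2
  have h1 : ContDiff ℝ ∞ fun x : Plane => x 1 := contDiff_piLp_apply 2
  exact contDiffAt_const.sub (Real.contDiff_arctan.contDiffAt.comp x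
    (h0.contDiffAt.div h1.contDiffAt hx.ne'))

/-- The test function whose angular part is `b`. -/
def polarTest (b : ℝ → ℝ) (x : Plane) : ℝ :=
  if 0 < x 1 then radialBump (‖x‖ ^ 2) * b (angle x) else 0

section

variable {b : ℝ → ℝ} (hb : b ∈ testSpace 0 π)
include hb

lemma polarTest_polar {r θ : ℝ} (hr : 0 < r) (hθ : θ ∈ Ioo (-π) π) :
    polarTest b (polar r θ) = radialBump (r ^ 2) * b θ := by
  rcases lt_or_ge 0 θ with h | h
  · have hs := Real.sin_pos_of_mem_Ioo (⟨h, hθ.2⟩ : θ ∈ Ioo 0 π)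
    rw [polarTest, if_pos (by rw [polar_one]; positivity), norm_sq_polar,
      angle_polar hr ⟨h, hθ.2⟩]
  · have hs := Real.sin_nonpos_of_nonpos_of_neg_pi_le h hθ.1.le
    have hbθ : b θ = 0 := image_eq_zero_of_notMem_tsupport fun h2 => absurd (hb.2.2 h2).1 (not_lt.2 h)
    rw [polarTest, if_neg (by rw [polar_one, not_lt]; exact mul_nonpos_of_nonneg_of_nonpos hr.le hs),
      hbθ, mul_zero]

lemma exists_support_polarTest : ∃ δ, 0 < δ ∧ tsupport (polarTest b) ⊆
    {x : Plane | δ ≤ x 1} ∩ closedBall 0 (9 / 10) := by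
  obtain ⟨ε, ε', h1, h2, -, hz⟩ := exists_Icc_of_mem_testSpace Real.pi_pos hb
  have hs : ∃ σ, 0 < σ ∧ ∀ θ ∈ Icc ε ε', σ ≤ sin θ := by
    rcases lt_or_ge ε' ε with h | h
    · exact ⟨1, one_pos, fun θ hθ => absurd (hθ.1.trans hθ.2) (not_le.2 h)⟩
    · obtain ⟨θ₀, hθ₀, hmin⟩ := isCompact_Icc.exists_isMinOn ⟨ε, le_rfl, h⟩
        Real.continuous_sin.continuousOn (s := Icc ε ε')
      exact ⟨sin θ₀, Real.sin_pos_of_mem_Ioo ⟨h1.trans_le hθ₀.1, hθ₀.2.trans_lt h2⟩,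
        fun θ hθ => hmin hθ⟩
  obtain ⟨σ, hσ, hmin⟩ := hs
  refine ⟨1 / 2 * σ, by positivity, closure_minimal (fun x hx => ?_)
    ((isClosed_le continuous_const (by fun_prop)).inter isClosed_closedBall)⟩
  have hx1 : 0 < x 1 := by
    by_contra h
    exact hx (by rw [polarTest, if_neg h])
  rw [Function.mem_support, polarTest, if_pos hx1] at hx
  have hψ := left_ne_zero_of_mul hx
  have hθ : angle x ∈ Icc ε ε' := by
    by_contra h
    exact right_ne_zero_of_mul hx (hz _ h)
  have hn1 : 1 / 4 < ‖x‖ ^ 2 := by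
    by_contra h; exact hψ (radialBump_eq_zero (Or.inl (not_lt.1 h)))
  have hn2 : ‖x‖ ^ 2 < 3 / 4 := by
    by_contra h; exact hψ (radialBump_eq_zero (Or.inr (not_lt.1 h)))
  have hn := norm_nonneg x
  constructor
  · have h3 : x 1 = ‖x‖ * sin (angle x) := by
      conv_lhs => rw [← polar_angle hx1]
      rfl
    change 1 / 2 * σ ≤ x 1
    rw [h3]
    exact mul_le_mul (by nlinarith) (hmin _ hθ) hσ.le hn
  · rw [mem_closedBall_zero_iff]; nlinarith

lemma tsupport_polarTest : tsupport (polarTest b) ⊆ ball 0 1 := by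
  obtain ⟨δ, -, h⟩ := exists_support_polarTest hb
  exact fun x hx => closedBall_subset_ball (by norm_num) (h hx).2

lemma contDiff_polarTest : ContDiff ℝ ∞ (polarTest b) := by
  obtain ⟨δ, hδ, h⟩ := exists_support_polarTest hb
  rw [contDiff_iff_contDiffAt]
  intro x
  rcases lt_or_ge 0 (x 1) with hx | hx
  · have h1 : ContDiffAt ℝ ∞ (fun x : Plane => radialBump (‖x‖ ^ 2) * b (angle x)) x :=
      (contDiff_radialBump.comp (contDiff_norm_sq ℝ)).contDiffAt.mul
        (hb.1.contDiffAt.comp x (contDiffAt_angle hx))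
    refine h1.congr_of_eventuallyEq ?_
    filter_upwards [(isOpen_lt continuous_const (by fun_prop)).mem_nhds
      (show x ∈ {x : Plane | 0 < x 1} from hx)] with y hy
    rw [polarTest, if_pos hy]
  · have h2 : polarTest b =ᶠ[𝓝 x] 0 := notMem_tsupport_iff_eventuallyEq.1 fun h3 =>
      absurd (h h3).1 (not_le.2 (hx.trans_lt hδ))
    exact contDiffAt_const.congr_of_eventuallyEq h2

end

/-- The angular derivative of a function that separates in polar coordinates. -/
lemma angular_polar {B : Plane → ℝ} (hB : Differentiable ℝ B) {r c : ℝ} {h : ℝ → ℝ}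
    (hB2 : ∀ θ ∈ Ioo (-π) π, B (polar r θ) = c * h θ) (hh : Differentiable ℝ h) :
    ∀ θ ∈ Ioo (-π) π, angular B (polar r θ) = c * deriv h θ := by
  intro θ hθ
  have h1 : (fun θ => B (polar r θ)) =ᶠ[𝓝 θ] fun θ => c * h θ := by
    filter_upwards [isOpen_Ioo.mem_nhds hθ] with t ht using hB2 t ht
  exact (hasDerivAt_comp_polar hB r θ).unique (((hh θ).hasDerivAt.const_mul c).congr_of_eventuallyEq h1)

lemma contDiff_deriv {h : ℝ → ℝ} (hh : ContDiff ℝ ∞ h) : ContDiff ℝ ∞ (deriv h) :=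
  (contDiff_infty_iff_deriv.1 hh).2

lemma differentiable_of_top {E : Type*} [NormedAddCommGroup E] [NormedSpace ℝ E] {h : E → ℝ}
    (hh : ContDiff ℝ ∞ h) : Differentiable ℝ h := hh.differentiable (by simp)

lemma deriv_mem_testSpace {a b : ℝ} {β : ℝ → ℝ} (hβ : β ∈ testSpace a b) :
    deriv β ∈ testSpace a b :=
  ⟨contDiff_deriv hβ.1, hβ.2.1.deriv, (tsupport_deriv_subset).trans hβ.2.2⟩

/-- The angular profile of the square of a function. -/
def angularProfile (v : Plane → ℝ) (θ : ℝ) : ℝ := 8 * v (polar (1 / 2) θ) ^ 2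

namespace IsBlowUpLimit

variable {C : ℝ} {P : ℝ → ℝ} {V : ℕ → Plane → ℝ} {v χ : Plane → ℝ}
variable (hL : IsBlowUpLimit V v χ) (hV : IsBlowUpSequence C P V)
include hL hV

lemma sq_polar {r : ℝ} (hr : 0 < r) (hr1 : r < 1) (θ : ℝ) :
    v (polar r θ) ^ 2 = r ^ 3 * angularProfile v θ := by
  rw [angularProfile]
  rcases le_total r (1 / 2) with h | h
  · have := hL.sq_smul hV (t := 2 * r) (by linarith) (by linarith) (x := polar (1 / 2) θ)
      (by rw [norm_polar (by norm_num)]; norm_num)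
    rw [smul_polar, show 2 * r * (1 / 2) = r by ring] at this
    rw [this]; ring
  · have := hL.sq_smul hV (t := (2 * r)⁻¹) (by positivity) (inv_le_one_of_one_le₀ (by linarith))
      (x := polar r θ) (by rw [norm_polar hr.le]; exact hr1)
    rw [smul_polar, show (2 * r)⁻¹ * r = 1 / 2 by field_simp] at this
    rw [this]; field_simp; ring

lemma continuous_angularProfile : Continuous (angularProfile v) := by
  have h1 : Continuous (polar (1 / 2)) :=
    continuous_iff_continuousAt.2 fun θ => (hasDerivAt_polar (1 / 2) θ).continuousAt
  have h2 : Continuous fun θ => v (polar (1 / 2) θ) :=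
    (hL.continuousOn hV).comp_continuous h1 fun θ => by
      rw [mem_closedBall_zero_iff, norm_polar (by norm_num)]; norm_num
  exact continuous_const.mul (h2.pow 2)

omit hL hV in
lemma angularProfile_nonneg (θ : ℝ) : 0 ≤ angularProfile v θ := by
  rw [angularProfile]; positivity

lemma angularProfile_eq_zero {θ : ℝ} (h : sin θ ≤ 0) : angularProfile v θ = 0 := by
  rw [angularProfile, hL.eq_zero_of_le hV (by rw [polar_one]; linarith)]; norm_num

/-- The profile vanishes to second order, because the limit is Lipschitz continuous. -/
lemma angularProfile_le (s t : ℝ) (hs : angularProfile v s = 0) :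
    angularProfile v t ≤ 8 * (3 * (C + 1)) ^ 2 * (t - s) ^ 2 := by
  have hC := hV.const_nonneg
  have h0 : v (polar (1 / 2) s) = 0 := by
    simpa [angularProfile] using hs
  have hmem : ∀ θ, polar (1 / 2) θ ∈ closedBall (0 : Plane) 1 := fun θ => by
    rw [mem_closedBall_zero_iff, norm_polar (by norm_num)]; norm_num
  have h1 := hL.lipschitz hV (hmem t) (hmem s)
  have h2 : ‖polar (1 / 2) t - polar (1 / 2) s‖ ≤ 1 * ‖t - s‖ :=
    convex_univ.norm_image_sub_le_of_norm_hasDerivWithin_le (s := univ)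
      (f := polar (1 / 2)) (f' := fun θ => rot (polar (1 / 2) θ))
      (fun θ _ => (hasDerivAt_polar (1 / 2) θ).hasDerivWithinAt)
      (fun θ _ => by rw [norm_rot, norm_polar (by norm_num)]; norm_num) (mem_univ s) (mem_univ t)
  rw [h0, sub_zero] at h1
  rw [angularProfile]
  have h3 : |v (polar (1 / 2) t)| ≤ 3 * (C + 1) * |t - s| := by
    refine h1.trans (mul_le_mul_of_nonneg_left ?_ (by positivity))
    rwa [one_mul, Real.norm_eq_abs] at h2
  have h4 := pow_le_pow_left₀ (abs_nonneg _) h3 2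
  rw [sq_abs, mul_pow, sq_abs] at h4
  linarith

/-- In the fluid the angular profile solves a linear equation: there the characteristic function is
one, and the right-hand side of the angular identity is the integral of a divergence. -/
theorem angularProfile_ode {α β : ℝ} (hα : 0 ≤ α) (hβ : β ≤ π)
    (hpos : ∀ t ∈ Ioo α β, 0 < angularProfile v t) {σ : ℝ → ℝ} (hσ : σ ∈ testSpace α β) :
    ∫ t, angularProfile v t * (deriv (deriv (deriv σ)) t + 9 * deriv σ t) = 0 := by
  set q := angularProfile v with hq
  have hσ0 : σ ∈ testSpace 0 π := ⟨hσ.1, hσ.2.1, hσ.2.2.trans (Ioo_subset_Ioo hα hβ)⟩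
  set B := polarTest σ with hB
  have cB : ContDiff ℝ ∞ B := contDiff_polarTest hσ0
  have sB := tsupport_polarTest hσ0
  have cA := contDiff_angular cB
  have cA2 := contDiff_angular cA
  have p0 : ∀ r, 0 < r → ∀ θ ∈ Ioo (-π) π, B (polar r θ) = radialBump (r ^ 2) * σ θ :=
    fun r hr θ hθ => polarTest_polar hσ0 hr hθ
  have p1 := fun r hr => angular_polar (differentiable_of_top cB) (p0 r hr)
    (differentiable_of_top hσ.1)
  have p2 := fun r hr => angular_polar (differentiable_of_top cA) (p1 r hr)
    (differentiable_of_top (contDiff_deriv hσ.1))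
  have p3 := fun r hr => angular_polar (differentiable_of_top cA2) (p2 r hr)
    (differentiable_of_top (contDiff_deriv (contDiff_deriv hσ.1)))
  have hid := hL.angular_identity hV cB sB
  -- the right-hand side
  have hr0 : ∫ x, ‖x‖ ^ 2 * (x 1 * angular B x + x 0 * B x) * χ x
      = ∫ x, ‖x‖ ^ 2 * (x 1 * angular B x + x 0 * B x) := by
    refine integral_congr_ae ?_
    filter_upwards [hL.chi_eq_one hV] with x hx
    by_cases hxt : x ∈ tsupport B
    · obtain ⟨δ, hδ, hs⟩ := exists_support_polarTest hσ0
      have hx1 : 0 < x 1 := hδ.trans_le (hs hxt).1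
      have hball := sB hxt
      have hn : 0 < ‖x‖ := norm_pos_of_height_pos hx1
      have hθ := angle_mem x
      have hθ' : angle x ∈ Ioo (-π) π := ⟨by linarith [hθ.1, Real.pi_pos], hθ.2⟩
      have hpa := polar_angle hx1
      by_cases hθ2 : angle x ∈ Ioo α β
      · have h1 := hL.sq_polar hV hn (mem_ball_zero_iff.1 hball) (angle x)
        rw [hpa] at h1
        have h2 : 0 < v x := by
          refine (hL.nonneg_fun hV x).lt_of_ne' fun h3 => ?_
          rw [h3] at h1
          have := mul_pos (pow_pos hn 3) (hpos _ hθ2)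
          rw [← hq] at h1
          linarith [h1, this]
        rw [hx hball h2, mul_one]
      · have h1 : σ (angle x) = 0 := image_eq_zero_of_notMem_tsupport fun h => hθ2 (hσ.2.2 h)
        have h2 : deriv σ (angle x) = 0 := image_eq_zero_of_notMem_tsupport fun h =>
          hθ2 ((deriv_mem_testSpace hσ).2.2 h)
        have h3 := p0 _ hn _ hθ'
        have h4 := p1 _ hn _ hθ'
        rw [hpa] at h3 h4
        rw [h3, h4, h1, h2]; simp
    · rw [image_eq_zero_of_notMem_tsupport hxt,
        image_eq_zero_of_notMem_tsupport fun h => hxt (tsupport_angular h)]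
      simp
  have hr1 : ∫ x, ‖x‖ ^ 2 * (x 1 * angular B x + x 0 * B x) = 0 := by
    rw [integral_eq_polar (g := fun r => r ^ 3 * radialBump (r ^ 2))
      (h := fun θ => sin θ * deriv σ θ + cos θ * σ θ) fun r hr θ hθ => by
        rw [norm_sq_polar, p1 r hr θ hθ, p0 r hr θ hθ, polar_zero, polar_one]; ring]
    have h1 : ∫ θ, (sin θ * deriv σ θ + cos θ * σ θ) = 0 := by
      have hcs : HasCompactSupport fun θ => sin θ * σ θ := hσ.2.1.mul_left
      have hd : ∀ θ, HasDerivAt (fun θ => sin θ * σ θ)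
          (sin θ * deriv σ θ + cos θ * σ θ) θ := fun θ => by
        refine ((Real.hasDerivAt_sin θ).mul
          (differentiable_of_top hσ.1 θ).hasDerivAt).congr_deriv ?_
        ring
      have c1 := hσ.1.continuous
      have c2 := (contDiff_deriv hσ.1).continuous
      have hfun : (fun θ => sin θ * deriv σ θ + cos θ * σ θ)
        = deriv fun θ => sin θ * σ θ := funext fun θ => (hd θ).deriv.symm
      refine integral_eq_zero_of_hasDerivAt_of_integrable hd ?_
        ((by fun_prop : Continuous fun θ => sin θ * σ θ).integrable_of_hasCompactSupport hcs)
      refine (by fun_prop : Continuous fun θ => sin θ * deriv σ θ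
        + cos θ * σ θ).integrable_of_hasCompactSupport ?_
      rw [hfun]; exact hcs.deriv
    have h2 : ∫ θ in Ioo (-π) π, (sin θ * deriv σ θ + cos θ * σ θ) = 0 := by
      rw [setIntegral_eq_integral_of_forall_compl_eq_zero, h1]
      intro θ hθ
      have hn : θ ∉ Ioo α β := fun h => hθ ⟨by linarith [h.1, Real.pi_pos], h.2.trans_le hβ⟩
      rw [image_eq_zero_of_notMem_tsupport fun h => hn ((deriv_mem_testSpace hσ).2.2 h),
        image_eq_zero_of_notMem_tsupport fun h => hn (hσ.2.2 h)]
      simp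
    rw [h2, mul_zero]
  rw [hr0, hr1, mul_zero] at hid
  rw [integral_eq_polar (g := fun r => r ^ 3 * radialBump (r ^ 2))
      (h := fun θ => q θ * (deriv (deriv (deriv σ)) θ + 9 * deriv σ θ)) fun r hr θ hθ => by
        rw [p3 r hr θ hθ, p1 r hr θ hθ]
        rcases lt_or_ge r 1 with h | h
        · rw [hL.sq_polar hV hr h θ]; ring
        · rw [radialBump_eq_zero (Or.inr (by nlinarith))]; simp] at hid
  have h1 := (mul_eq_zero.1 hid).resolve_left (radialWeight_pos 3).ne'
  rw [← h1, setIntegral_eq_integral_of_forall_compl_eq_zero]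
  intro θ hθ
  have hn : θ ∉ Ioo α β := fun h => hθ ⟨by linarith [h.1, Real.pi_pos], h.2.trans_le hβ⟩
  rw [image_eq_zero_of_notMem_tsupport fun h => hn
      ((deriv_mem_testSpace (deriv_mem_testSpace (deriv_mem_testSpace hσ))).2.2 h),
    image_eq_zero_of_notMem_tsupport fun h => hn ((deriv_mem_testSpace hσ).2.2 h)]
  simp

end IsBlowUpLimit

/-! ### Classification of blow-up limits -/

/-- The fluid of the Stokes corner flow: a sector with opening angle `2π/3`. -/
def stokesCorner : Set Plane := {x | ‖x‖ < 2 * x 1}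

lemma isOpen_stokesCorner : IsOpen stokesCorner :=
  isOpen_lt continuous_norm (by fun_prop)

lemma half_lt_sin_iff {θ : ℝ} (hθ : θ ∈ Ioo 0 π) :
    1 / 2 < sin θ ↔ θ ∈ Ioo (π / 6) (π / 6 + 2 * π / 3) := by
  have h0 := Real.pi_pos
  have key : ∀ t ∈ Ioc 0 (π / 2), (1 / 2 < sin t ↔ π / 6 < t) := fun t ht => by
    rw [← Real.sin_pi_div_six]
    exact Real.strictMonoOn_sin.lt_iff_lt ⟨by linarith, by linarith⟩ ⟨by linarith [ht.1], ht.2⟩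
  rcases le_total θ (π / 2) with h | h
  · rw [key θ ⟨hθ.1, h⟩]
    exact ⟨fun h2 => ⟨h2, by linarith⟩, fun h2 => h2.1⟩
  · rw [← Real.sin_pi_sub, key _ ⟨by linarith [hθ.2], by linarith⟩]
    exact ⟨fun h2 => ⟨by linarith, by linarith⟩, fun h2 => by linarith [h2.2]⟩

lemma mem_stokesCorner_iff {x : Plane} (hx : 0 < x 1) : x ∈ stokesCorner ↔
    angle x ∈ Ioo (π / 6) (π / 6 + 2 * π / 3) := by
  have hn : 0 < ‖x‖ := norm_pos_of_height_pos hx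
  rw [← half_lt_sin_iff (angle_mem x)]
  have h : x 1 = ‖x‖ * sin (angle x) := by
    conv_lhs => rw [← polar_angle hx]
    rfl
  change ‖x‖ < 2 * x 1 ↔ _
  rw [h]
  constructor <;> intro h2 <;> nlinarith

lemma volume_line_eq_zero (θ : ℝ) :
    volume {x : Plane | x 0 * sin θ - x 1 * cos θ = 0} = 0 := by
  let ℓ : Plane →ₗ[ℝ] ℝ :=
    { toFun := fun x => x 0 * sin θ - x 1 * cos θ
      map_add' := fun x y => by simp only [PiLp.add_apply]; ring
      map_smul' := fun c x => by simp only [PiLp.smul_apply, smul_eq_mul, RingHom.id_apply]; ring }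
  have h := Measure.addHaar_submodule (volume : Measure Plane) (LinearMap.ker ℓ) fun htop => by
    have h1 : ℓ !₂[sin θ, -cos θ] = 0 := by
      rw [← LinearMap.mem_ker, htop]; trivial
    have h2 : sin θ * sin θ - -cos θ * cos θ = 0 := h1
    nlinarith [Real.sin_sq_add_cos_sq θ]
  exact h

/-! #### Rotationally symmetric test functions -/

lemma angular_radial_mul {f : Plane → ℝ} (hf : Differentiable ℝ f) :
    (angular fun x => radialBump (‖x‖ ^ 2) * f x) = fun x => radialBump (‖x‖ ^ 2) * angular f x := by
  funext x
  have h1 : HasFDerivAt (fun x : Plane => radialBump (‖x‖ ^ 2))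
      (deriv radialBump (‖x‖ ^ 2) • ((2 : ℝ) • innerSL ℝ x)) x :=
    (differentiable_of_top contDiff_radialBump _).hasDerivAt.comp_hasFDerivAt x
      ((hasStrictFDerivAt_norm_sq x).hasFDerivAt.congr_fderiv (by
        rw [← Nat.cast_smul_eq_nsmul ℝ]; norm_num))
  have h2 := (h1.mul (hf x).hasFDerivAt).fderiv
  rw [angular]
  refine (congrArg (fun L => L (rot x)) h2).trans ?_
  simp [inner_rot_self, angular]

lemma angular_coord_zero : (angular fun x : Plane => x 0) = fun x => -x 1 := by
  funext x
  have h : HasFDerivAt (fun x : Plane => x 0) (EuclideanSpace.proj (0 : Fin 2) : Plane →L[ℝ] ℝ) x :=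
    (EuclideanSpace.proj (0 : Fin 2) : Plane →L[ℝ] ℝ).hasFDerivAt
  rw [angular, h.fderiv]; simp

lemma angular_coord_one : (angular fun x : Plane => -x 1) = fun x => -x 0 := by
  funext x
  have h : HasFDerivAt (fun x : Plane => -x 1) (-(EuclideanSpace.proj (1 : Fin 2) : Plane →L[ℝ] ℝ)) x :=
    (EuclideanSpace.proj (1 : Fin 2) : Plane →L[ℝ] ℝ).hasFDerivAt.neg
  rw [angular, h.fderiv]; simp

lemma angular_neg_coord_zero : (angular fun x : Plane => -x 0) = fun x => x 1 := by
  funext x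
  have h : HasFDerivAt (fun x : Plane => -x 0) (-(EuclideanSpace.proj (0 : Fin 2) : Plane →L[ℝ] ℝ)) x :=
    (EuclideanSpace.proj (0 : Fin 2) : Plane →L[ℝ] ℝ).hasFDerivAt.neg
  rw [angular, h.fderiv]; simp

/-- The characteristic function of a limit, as a function of the polar angle: constants `c₁`, `1`,
`c₂` in the intervals `(0, α)`, `(α, β)`, `(β, π)`. -/
def stepProfile (α β c₁ c₂ θ : ℝ) : ℝ :=
  c₁ * (Ioo 0 α).indicator 1 θ + (Ioo α β).indicator 1 θ + c₂ * (Ioo β π).indicator 1 θ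

lemma integral_stepProfile_mul {α β c₁ c₂ : ℝ} (hα : 0 ≤ α) (hαβ : α ≤ β) (hβ : β ≤ π)
    {w : ℝ → ℝ} (hw : Continuous w) :
    ∫ θ in Ioo (-π) π, stepProfile α β c₁ c₂ θ * w θ
      = c₁ * (∫ θ in (0 : ℝ)..α, w θ) + (∫ θ in α..β, w θ) + c₂ * ∫ θ in β..π, w θ := by
  have hind : ∀ a b : ℝ, a ≤ b →
      Integrable (fun θ => (Ioo a b).indicator (1 : ℝ → ℝ) θ * w θ) ∧
      ∫ θ, (Ioo a b).indicator (1 : ℝ → ℝ) θ * w θ = ∫ θ in a..b, w θ := by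
    intro a b hab
    have e : (fun θ => (Ioo a b).indicator (1 : ℝ → ℝ) θ * w θ) = (Ioo a b).indicator w := by
      funext θ
      by_cases h : θ ∈ Ioo a b <;> simp [h]
    rw [e]
    refine ⟨(integrable_indicator_iff measurableSet_Ioo).2
      ((hw.integrableOn_Icc).mono_set Ioo_subset_Icc_self), ?_⟩
    rw [integral_indicator measurableSet_Ioo, intervalIntegral.integral_of_le hab,
      integral_Ioc_eq_integral_Ioo]
  obtain ⟨i1, e1⟩ := hind 0 α hα
  obtain ⟨i2, e2⟩ := hind α β hαβ
  obtain ⟨i3, e3⟩ := hind β π hβ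
  rw [setIntegral_eq_integral_of_forall_compl_eq_zero]
  · rw [← e1, ← e2, ← e3, ← integral_const_mul, ← integral_const_mul,
      ← integral_add (i1.const_mul c₁) i2, ← integral_add ((i1.const_mul c₁).fun_add i2)
        (i3.const_mul c₂)]
    refine integral_congr_ae (.of_forall fun θ => ?_)
    simp only [stepProfile]
    ring
  · intro θ hθ
    have h0 := Real.pi_pos
    have hn : ∀ a b : ℝ, 0 ≤ a → b ≤ π → θ ∉ Ioo a b := fun a b ha hb h =>
      hθ ⟨by linarith [h.1], by linarith [h.2]⟩
    rw [stepProfile, indicator_of_notMem (hn 0 α le_rfl (by linarith)),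
      indicator_of_notMem (hn α β hα hβ), indicator_of_notMem (hn β π (by linarith) le_rfl)]
    simp

lemma convex_openHalfPlane (a b : ℝ) : Convex ℝ {x : Plane | 0 < a * x 0 + b * x 1} := by
  intro x hx y hy s t hs ht hst
  simp only [mem_ofPred_eq, PiLp.add_apply, PiLp.smul_apply, smul_eq_mul] at hx hy ⊢
  rcases hs.eq_or_lt with rfl | hs
  · rw [zero_add] at hst; subst hst; linarith
  · nlinarith [mul_pos hs hx, mul_nonneg ht hy.le]

namespace IsBlowUpLimit

variable {C : ℝ} {P : ℝ → ℝ} {V : ℕ → Plane → ℝ} {v χ : Plane → ℝ}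
variable (hL : IsBlowUpLimit V v χ) (hV : IsBlowUpSequence C P V)
include hL hV

lemma chi_eq_zero_of_le : ∀ᵐ x : Plane, x ∈ ball (0 : Plane) 1 → x 1 ≤ 0 → χ x = 0 := by
  set s : Set Plane := ball 0 1 ∩ {x | x 1 ≤ 0} with hs
  have hsm : MeasurableSet s := isOpen_ball.measurableSet.inter
    (isClosed_le (by fun_prop) continuous_const).measurableSet
  have h1 := hL.weak (s.indicator 1) (aestronglyMeasurable_const.indicator hsm)
    ⟨1, fun x => by by_cases h : x ∈ s <;> simp [h]⟩ fun x hx =>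
      indicator_of_notMem (fun h => absurd (mem_ball_zero_iff.1 h.1) (not_lt.2 hx)) _
  have h2 : ∀ m, ∫ x, s.indicator (1 : Plane → ℝ) x * chi (V m) x = 0 := by
    intro m
    obtain ⟨c, R, hp, -⟩ := hV.exists_profile m
    refine integral_eq_zero_of_ae (.of_forall fun x => ?_)
    by_cases h : x ∈ s
    · simp [chi_of_not_pos (show ¬ 0 < V m x by rw [hp.eq_zero_of_le x h.2]; exact lt_irrefl 0)]
    · simp [h]
  simp only [h2] at h1
  have h3 := tendsto_nhds_unique h1 tendsto_const_nhds
  have h4 : (fun x => s.indicator (1 : Plane → ℝ) x * χ x) = s.indicator χ := by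
    funext x
    by_cases h : x ∈ s <;> simp [h]
  rw [h4, integral_indicator hsm, setIntegral_eq_zero_iff_of_nonneg_ae] at h3
  · filter_upwards [(ae_restrict_iff' hsm).1 h3] with x hx h5 h6
    exact hx ⟨h5, h6⟩
  · exact .of_forall fun x => hL.nonneg x
  · refine Measure.integrableOn_of_bounded (M := 1) ?_ hL.measurable.aestronglyMeasurable
      (.of_forall fun x => ?_)
    · exact ((measure_mono inter_subset_left).trans_lt measure_ball_lt_top).ne
    · rw [Real.norm_of_nonneg (hL.nonneg x)]; exact hL.le_one x

lemma eq_zero_of_angularProfile {x : Plane} (hx : ‖x‖ < 1) (hx1 : 0 < x 1)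
    (h : angularProfile v (angle x) = 0) : v x = 0 := by
  have hn : 0 < ‖x‖ := norm_pos_of_height_pos hx1
  have h1 := hL.sq_polar hV hn hx (angle x)
  rw [polar_angle hx1, h, mul_zero] at h1
  exact pow_eq_zero_iff (two_ne_zero) |>.1 h1

lemma pos_of_angularProfile {x : Plane} (hx : ‖x‖ < 1) (hx1 : 0 < x 1)
    (h : 0 < angularProfile v (angle x)) : 0 < v x := by
  have hn : 0 < ‖x‖ := norm_pos_of_height_pos hx1
  have h1 := hL.sq_polar hV hn hx (angle x)
  rw [polar_angle hx1] at h1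
  refine (hL.nonneg_fun hV x).lt_of_ne' fun h3 => ?_
  rw [h3] at h1
  have := mul_pos (pow_pos hn 3) h
  linarith

/-- In a convex open subset of the upper half disc in which the limit vanishes, the fluid is either
absent or present in the limit. -/
lemma exists_chi_eq_zero_or_one {U : Set Plane} (hU : IsOpen U) (hconv : Convex ℝ U)
    (hball : U ⊆ ball 0 1) (hpos : ∀ x ∈ U, 0 < x 1) (h0 : ∀ x ∈ U, v x = 0) :
    ∃ c, (c = 0 ∨ c = 1) ∧ ∀ᵐ x : Plane, x ∈ U → χ x = c := by
  rcases U.eq_empty_or_nonempty with rfl | hne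
  · exact ⟨0, Or.inl rfl, by simp⟩
  · obtain ⟨c, hc⟩ := hL.exists_chi_eq_const hV hU hconv hball hpos h0
    exact ⟨c, hL.const_eq_zero_or_one hV hU hne hball hpos hc, hc⟩

/-- The limit of the characteristic functions is a step function of the polar angle. -/
lemma exists_chi_eq_stepProfile {α β : ℝ} (hα : α ∈ Icc 0 (π / 3))
    (hβ : β ∈ Icc (2 * π / 3) π)
    (hpos : ∀ t ∈ Ioo α β, 0 < angularProfile v t)
    (hzero : ∀ t ∈ Icc 0 π, t ∉ Ioo α β → angularProfile v t = 0) :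
    ∃ c₁ c₂, (c₁ = 0 ∨ c₁ = 1) ∧ (c₂ = 0 ∨ c₂ = 1) ∧ ∀ᵐ x : Plane, x ∈ ball (0 : Plane) 1 →
      χ x = if 0 < x 1 then stepProfile α β c₁ c₂ (angle x) else 0 := by
  have h0 := Real.pi_pos
  have hpol : ∀ x : Plane, 0 < x 1 → ∀ γ : ℝ,
      x 0 * sin γ - x 1 * cos γ = ‖x‖ * sin (γ - angle x) := by
    intro x hx γ
    conv_lhs => rw [← polar_angle hx]
    rw [polar_zero, polar_one, Real.sin_sub]; ring
  have hopen : ∀ a b : ℝ, IsOpen {x : Plane | 0 < a * x 0 + b * x 1} := fun a b =>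
    isOpen_lt continuous_const (by fun_prop)
  set U : ℝ → ℝ → Set Plane := fun a b =>
    (ball 0 1 ∩ {x : Plane | 0 < 0 * x 0 + 1 * x 1}) ∩ {x | 0 < a * x 0 + b * x 1} with hUdef
  have hmem : ∀ a b x, x ∈ U a b ↔ (‖x‖ < 1 ∧ 0 < x 1) ∧ 0 < a * x 0 + b * x 1 := by
    intro a b x
    simp [hUdef, Set.mem_inter_iff]
  have key : ∀ a b, (∀ x ∈ U a b, angle x ∉ Ioo α β) →
      ∃ c, (c = 0 ∨ c = 1) ∧ ∀ᵐ x : Plane, x ∈ U a b → χ x = c := by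
    intro a b h
    refine hL.exists_chi_eq_zero_or_one hV ((isOpen_ball.inter (hopen 0 1)).inter (hopen a b))
      (((convex_ball 0 1).inter (convex_openHalfPlane 0 1)).inter (convex_openHalfPlane a b))
      (fun x hx => hx.1.1) (fun x hx => ((hmem a b x).1 hx).1.2) fun x hx => ?_
    obtain ⟨⟨h1, h2⟩, -⟩ := (hmem a b x).1 hx
    exact hL.eq_zero_of_angularProfile hV h1 h2
      (hzero _ (Ioo_subset_Icc_self (angle_mem x)) (h x hx))
  have m1 : ∀ x : Plane, ‖x‖ < 1 → 0 < x 1 →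
      (x ∈ U (sin α) (-cos α) ↔ angle x < α) := by
    intro x hx hx1
    rw [hmem]
    have h2 := hpol x hx1 α
    have h3 := angle_mem x
    constructor
    · rintro ⟨-, h4⟩
      by_contra h5
      have h6 := Real.sin_nonpos_of_nonpos_of_neg_pi_le (x := α - angle x) (by linarith)
        (by linarith [h3.2, hα.1])
      nlinarith [norm_pos_of_height_pos hx1]
    · intro h4
      have h6 := Real.sin_pos_of_pos_of_lt_pi (x := α - angle x) (by linarith)
        (by linarith [h3.1, hα.2])
      exact ⟨⟨hx, hx1⟩, by nlinarith [mul_pos (norm_pos_of_height_pos hx1) h6]⟩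
  have m2 : ∀ x : Plane, ‖x‖ < 1 → 0 < x 1 →
      (x ∈ U (-sin β) (cos β) ↔ β < angle x) := by
    intro x hx hx1
    rw [hmem]
    have h2 := hpol x hx1 β
    have h3 := angle_mem x
    constructor
    · rintro ⟨-, h4⟩
      by_contra h5
      have h6 := Real.sin_nonneg_of_nonneg_of_le_pi (x := β - angle x) (by linarith)
        (by linarith [h3.1, hβ.2])
      nlinarith [mul_nonneg (norm_pos_of_height_pos hx1).le h6]
    · intro h4
      have h6 := Real.sin_neg_of_neg_of_neg_pi_lt (x := β - angle x) (by linarith)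
        (by linarith [h3.2, hβ.1])
      exact ⟨⟨hx, hx1⟩, by nlinarith [mul_neg_of_pos_of_neg (norm_pos_of_height_pos hx1) h6]⟩
  obtain ⟨c₁, hc₁, ae1⟩ := key (sin α) (-cos α) fun x hx h => by
    obtain ⟨⟨h1, h2⟩, -⟩ := (hmem _ _ x).1 hx
    exact absurd h.1 (not_lt.2 ((m1 x h1 h2).1 hx).le)
  obtain ⟨c₂, hc₂, ae2⟩ := key (-sin β) (cos β) fun x hx h => by
    obtain ⟨⟨h1, h2⟩, -⟩ := (hmem _ _ x).1 hx
    exact absurd h.2 (not_lt.2 ((m2 x h1 h2).1 hx).le)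
  refine ⟨c₁, c₂, hc₁, hc₂, ?_⟩
  have n1 := measure_eq_zero_iff_ae_notMem.1 (volume_line_eq_zero α)
  have n2 := measure_eq_zero_iff_ae_notMem.1 (volume_line_eq_zero β)
  filter_upwards [ae1, ae2, hL.chi_eq_one hV, hL.chi_eq_zero_of_le hV, n1, n2]
    with x x1 x2 x3 x4 x5 x6 hx
  split_ifs with hx1
  · have hn := mem_ball_zero_iff.1 hx
    have hne : ∀ γ, x 0 * sin γ - x 1 * cos γ ≠ 0 → angle x ≠ γ := fun γ h1 h2 => by
      rw [hpol x hx1, h2, sub_self, Real.sin_zero, mul_zero] at h1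
      exact h1 rfl
    have hθ := angle_mem x
    rcases lt_or_gt_of_ne (hne α x5) with h | h
    · rw [x1 ((m1 x hn hx1).2 h), stepProfile, indicator_of_mem (show angle x ∈ Ioo 0 α from ⟨hθ.1, h⟩),
        indicator_of_notMem fun h2 => absurd h2.1 (not_lt.2 h.le),
        indicator_of_notMem fun h2 => absurd h2.1 (not_lt.2 (by linarith [hα.2, hβ.1]))]
      simp
    · rcases lt_or_gt_of_ne (hne β x6) with h3 | h3
      · rw [x3 hx (hL.pos_of_angularProfile hV hn hx1 (hpos _ ⟨h, h3⟩)), stepProfile,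
          indicator_of_notMem fun h2 => absurd h2.2 (not_lt.2 h.le),
          indicator_of_mem (show angle x ∈ Ioo α β from ⟨h, h3⟩),
          indicator_of_notMem fun h2 => absurd h2.1 (not_lt.2 h3.le)]
        simp
      · rw [x2 ((m2 x hn hx1).2 h3), stepProfile,
          indicator_of_notMem fun h2 => absurd h2.2 (not_lt.2 h.le),
          indicator_of_notMem fun h2 => absurd h2.2 (not_lt.2 h3.le),
          indicator_of_mem (show angle x ∈ Ioo β π from ⟨h3, hθ.2⟩)]
        simp
  · exact x4 hx (not_lt.1 hx1)

/-- The two conditions at the free boundary of a limit, obtained from the angular identity with the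
test functions `ψ(|x|²)` and `ψ(|x|²) x₁`. -/
lemma free_boundary_conditions {α β c₁ c₂ : ℝ} (hα : 0 ≤ α) (hαβ : α ≤ β) (hβ : β ≤ π)
    (hχ : ∀ᵐ x : Plane, x ∈ ball (0 : Plane) 1 →
      χ x = if 0 < x 1 then stepProfile α β c₁ c₂ (angle x) else 0) :
    (1 - c₁) * sin α = (1 - c₂) * sin β ∧
    4 * ∫ θ in Ioo (-π) π, angularProfile v θ * sin θ
      = (1 - c₁) * sin α * cos α - (1 - c₂) * sin β * cos β := by
  have hpi := Real.pi_pos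
  have hpol : ∀ (f : Plane → ℝ) (n : ℕ) (w : ℝ → ℝ), Continuous w →
      (∀ x, 1 ≤ ‖x‖ → f x = 0) →
      (∀ r, 0 < r → ∀ θ, f (polar r θ) = r ^ n * radialBump (r ^ 2) * w θ) →
      ∫ x, f x * χ x = (∫ r in Ioi (0 : ℝ), r * (r ^ n * radialBump (r ^ 2))) *
        (c₁ * (∫ θ in (0 : ℝ)..α, w θ) + (∫ θ in α..β, w θ) + c₂ * ∫ θ in β..π, w θ) := by
    intro f n w hw hf0 hf
    rw [← integral_stepProfile_mul hα hαβ hβ hw, ← integral_eq_polar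
      (f := fun x => f x * if 0 < x 1 then stepProfile α β c₁ c₂ (angle x) else 0)]
    · refine integral_congr_ae ?_
      filter_upwards [hχ] with x hx
      by_cases h : x ∈ ball (0 : Plane) 1
      · rw [hx h]
      · rw [hf0 x (not_lt.1 fun h2 => h (mem_ball_zero_iff.2 h2))]; simp
    · intro r hr θ hθ
      rw [hf r hr θ]
      rcases lt_or_ge 0 θ with h | h
      · have hs := Real.sin_pos_of_mem_Ioo (⟨h, hθ.2⟩ : θ ∈ Ioo 0 π)
        rw [if_pos (by rw [polar_one]; positivity), angle_polar hr ⟨h, hθ.2⟩]; ring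
      · have hs := Real.sin_nonpos_of_nonpos_of_neg_pi_le h hθ.1.le
        have hz : stepProfile α β c₁ c₂ θ = 0 := by
          rw [stepProfile, indicator_of_notMem fun h2 => absurd h2.1 (not_lt.2 h),
            indicator_of_notMem fun h2 => absurd h2.1 (not_lt.2 (by linarith)),
            indicator_of_notMem fun h2 => absurd h2.1 (not_lt.2 (by linarith))]
          simp
        rw [if_neg (by rw [polar_one, not_lt]; exact mul_nonpos_of_nonneg_of_nonpos hr.le hs), hz]
        simp
  have cψ : ContDiff ℝ ∞ fun x : Plane => radialBump (‖x‖ ^ 2) :=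
    contDiff_radialBump.comp (contDiff_norm_sq ℝ)
  have c0 : ContDiff ℝ ∞ fun x : Plane => x 0 := contDiff_piLp_apply 2
  have c1 : ContDiff ℝ ∞ fun x : Plane => x 1 := contDiff_piLp_apply 2
  have hts : ∀ f : Plane → ℝ, tsupport (fun x : Plane => radialBump (‖x‖ ^ 2) * f x)
      ⊆ ball 0 1 := by
    intro f
    refine (closure_minimal (fun x hx => ?_) isClosed_closedBall).trans
      (closedBall_subset_ball (by norm_num : (9 / 10 : ℝ) < 1))
    rw [mem_closedBall_zero_iff]
    by_contra h
    exact hx (by simp [radialBump_eq_zero (Or.inr (by nlinarith) : ‖x‖ ^ 2 ≤ 1 / 4 ∨ 3 / 4 ≤ ‖x‖ ^ 2)])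
  constructor
  · have h1 := hL.angular_identity hV (β := fun x => radialBump (‖x‖ ^ 2) * 1)
      (cψ.mul contDiff_const) (hts _)
    have a1 : (angular fun x : Plane => radialBump (‖x‖ ^ 2) * 1) = fun _ => 0 := by
      rw [angular_radial_mul (differentiable_const _)]
      funext x; simp [angular]
    have a2 : (angular fun _ : Plane => (0 : ℝ)) = fun _ => 0 := by funext x; simp [angular]
    rw [a1, a2, a2] at h1
    simp only [mul_zero, add_zero, zero_add, integral_zero, mul_one] at h1
    rw [hpol _ 3 cos Real.continuous_cos (fun x hx => by rw [radialBump_eq_zero_of_norm hx]; simp)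
      fun r hr θ => by rw [norm_sq_polar, polar_zero]; ring] at h1
    have h2 := (mul_eq_zero.1 ((mul_eq_zero.1 h1.symm).resolve_left two_ne_zero)).resolve_left
      (radialWeight_pos 3).ne'
    simp only [integral_cos, Real.sin_zero, Real.sin_pi] at h2
    linarith
  · have h1 := hL.angular_identity hV (β := fun x => radialBump (‖x‖ ^ 2) * x 0)
      (cψ.mul c0) (hts _)
    rw [angular_radial_mul (differentiable_of_top c0), angular_coord_zero,
      angular_radial_mul (differentiable_of_top c1.neg), angular_coord_one,
      angular_radial_mul (differentiable_of_top c0.neg), angular_neg_coord_zero] at h1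
    simp only at h1
    rw [integral_eq_polar (g := fun r => r ^ 4 * radialBump (r ^ 2))
      (h := fun θ => -8 * (angularProfile v θ * sin θ)) fun r hr θ hθ => by
        rw [norm_sq_polar, polar_one]
        rcases lt_or_ge r 1 with h | h
        · rw [hL.sq_polar hV hr h θ]; ring
        · rw [radialBump_eq_zero (Or.inr (by nlinarith))]; simp,
      hpol _ 4 (fun θ => cos θ ^ 2 - sin θ ^ 2) (by fun_prop)
        (fun x hx => by rw [radialBump_eq_zero_of_norm hx]; simp)
        fun r hr θ => by rw [norm_sq_polar, polar_zero, polar_one]; ring, mul_left_comm] at h1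
    have h2 := mul_left_cancel₀ (radialWeight_pos 4).ne' h1
    rw [integral_const_mul] at h2
    simp only [integral_cos_sq_sub_sin_sq, Real.sin_zero, Real.sin_pi] at h2
    linarith

/-- A blow-up limit that is not zero is a Stokes corner flow: the fluid occupies the sector with
opening angle `2π/3` that is symmetric about the vertical axis. -/
theorem eq_zero_or_stokesCorner :
    (∀ x ∈ ball (0 : Plane) 1, v x = 0) ∨
    ((∀ x ∈ ball (0 : Plane) 1, x ∉ stokesCorner → v x = 0) ∧
      ∀ᵐ x : Plane, x ∈ ball (0 : Plane) 1 → χ x = stokesCorner.indicator 1 x) := by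
  have hpi := Real.pi_pos
  have hcont := hL.continuous_angularProfile hV
  rcases profile_eq hcont (angularProfile_nonneg (v := v))
    (hL.angularProfile_eq_zero hV (by simp)) (hL.angularProfile_eq_zero hV (by simp))
    (hL.angularProfile_le hV)
    (fun α β h1 _ h2 h3 σ hσ => hL.angularProfile_ode hV h1 h2 h3 hσ) with h | h
  · left
    intro x hx
    rcases lt_or_ge 0 (x 1) with h1 | h1
    · exact hL.eq_zero_of_angularProfile hV (mem_ball_zero_iff.1 hx) h1
        (h _ (Ioo_subset_Icc_self (angle_mem x)))
    · exact hL.eq_zero_of_le hV h1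
  right
  obtain ⟨α, hα, A, hA, -, hpos, hzero⟩ := h
  set β := α + 2 * π / 3 with hβdef
  have hβ : β ∈ Icc (2 * π / 3) π := ⟨by linarith [hα.1], by linarith [hα.2]⟩
  have hαβ : α < β := by linarith
  obtain ⟨c₁, c₂, hc₁, hc₂, hχ⟩ := hL.exists_chi_eq_stepProfile hV hα hβ hpos hzero
  obtain ⟨e1, e2⟩ := hL.free_boundary_conditions hV hα.1 hαβ.le hβ.2 hχ
  have hI : 0 < ∫ θ in Ioo (-π) π, angularProfile v θ * sin θ := by
    have hc2 : Continuous fun θ => angularProfile v θ * sin θ := hcont.mul Real.continuous_sin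
    rw [setIntegral_pos_iff_support_of_nonneg_ae]
    · refine lt_of_lt_of_le (b := volume (Ioo α β)) (by simp [hαβ])
        (measure_mono fun θ hθ => ⟨?_, ?_⟩)
      · exact (mul_pos (hpos θ hθ) (Real.sin_pos_of_pos_of_lt_pi (by linarith [hθ.1, hα.1])
          (by linarith [hθ.2, hβ.2]))).ne'
      · exact ⟨by linarith [hθ.1, hα.1], by linarith [hθ.2, hβ.2]⟩
    · refine .of_forall fun θ => ?_
      rcases le_total (sin θ) 0 with h | h
      · simp [hL.angularProfile_eq_zero hV h]
      · exact mul_nonneg (angularProfile_nonneg θ) h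
    · exact (hc2.integrableOn_Icc).mono_set Ioo_subset_Icc_self
  have hcos : cos β < cos α := Real.cos_lt_cos_of_nonneg_of_le_pi hα.1 hβ.2 hαβ
  have hk : 0 < (1 - c₁) * sin α := by
    rw [← e1, ← mul_sub] at e2
    by_contra h
    nlinarith [not_lt.1 h]
  have hc₁0 : c₁ = 0 := hc₁.resolve_right fun h => by rw [h] at hk; simp at hk
  have hc₂0 : c₂ = 0 := hc₂.resolve_right fun h => by rw [e1, h] at hk; simp at hk
  have hα6 : α = π / 6 := by
    rw [hc₁0, hc₂0] at e1
    have h1 : sin β - sin α = 0 := by linarith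
    rw [Real.sin_sub_sin, show (β - α) / 2 = π / 3 by rw [hβdef]; ring,
      show (β + α) / 2 = α + π / 3 by rw [hβdef]; ring] at h1
    have h2 : cos (α + π / 3) = cos (π / 2) := by
      rw [Real.cos_pi_div_two]
      refine (mul_eq_zero.1 h1).resolve_left ?_
      have := Real.sin_pos_of_pos_of_lt_pi (x := π / 3) (by linarith) (by linarith)
      positivity
    have h3 := Real.injOn_cos ⟨by linarith [hα.1], by linarith [hα.2]⟩
      ⟨by linarith, by linarith⟩ h2
    linarith
  have hmem : ∀ x : Plane, 0 < x 1 → (x ∈ stokesCorner ↔ angle x ∈ Ioo α β) := fun x hx => by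
    rw [mem_stokesCorner_iff hx, hβdef, hα6]
  refine ⟨fun x hx hxS => ?_, ?_⟩
  · rcases lt_or_ge 0 (x 1) with h1 | h1
    · exact hL.eq_zero_of_angularProfile hV (mem_ball_zero_iff.1 hx) h1
        (hzero _ (Ioo_subset_Icc_self (angle_mem x)) fun h => hxS ((hmem x h1).2 h))
    · exact hL.eq_zero_of_le hV h1
  · filter_upwards [hχ] with x hx hxb
    rw [hx hxb]
    split_ifs with h1
    · rw [stepProfile, hc₁0, hc₂0, zero_mul, zero_mul, zero_add, add_zero]
      by_cases h : x ∈ stokesCorner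
      · rw [indicator_of_mem h, indicator_of_mem ((hmem x h1).1 h)]; rfl
      · rw [indicator_of_notMem h, indicator_of_notMem fun h2 => h ((hmem x h1).2 h2)]
    · have h2 : x ∉ stokesCorner := fun h : ‖x‖ < 2 * x 1 => by linarith [norm_nonneg x]
      rw [indicator_of_notMem h2]

end IsBlowUpLimit

/-! ### Energies of blow-up limits -/

/-- The energy of the upper half plane filled with fluid at rest. -/
def halfPlaneEnergy : ℝ := ∫ x : Plane, cutoff 1 x ^ 3 * max (x 1) 0

/-- The energy of the Stokes corner flow. -/
def cornerEnergy : ℝ := ∫ x : Plane, cutoff 1 x ^ 3 * x 1 * stokesCorner.indicator 1 x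

lemma cutoff_pos {x : Plane} (hx : ‖x‖ < 1) : 0 < cutoff 1 x :=
  lt_max_of_lt_left (by nlinarith [norm_nonneg x])

lemma height_pos_of_mem_stokesCorner {x : Plane} (hx : x ∈ stokesCorner) : 0 < x 1 := by
  have h : ‖x‖ < 2 * x 1 := hx
  linarith [norm_nonneg x]

lemma height_mul_stokesCorner (x : Plane) : 0 ≤ x 1 * stokesCorner.indicator 1 x ∧
    x 1 * stokesCorner.indicator 1 x ≤ max (x 1) 0 := by
  by_cases h : x ∈ stokesCorner
  · simp [h, (height_pos_of_mem_stokesCorner h).le]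
  · simp [h]

lemma integral_pos_of_isOpen {f : Plane → ℝ} (hf : Measurable f) (h0 : ∀ x, 0 ≤ f x)
    (h1 : ∀ x, ‖x‖ < 1 → |f x| ≤ 1) (h2 : ∀ x, 1 ≤ ‖x‖ → f x = 0) {U : Set Plane} (hU : IsOpen U)
    (hne : U.Nonempty) (hpos : ∀ x ∈ U, 0 < f x) : 0 < ∫ x, f x := by
  rw [integral_pos_iff_support_of_nonneg h0 (integrable_of_ball hf.aestronglyMeasurable h1 h2)]
  exact (hU.measure_pos volume hne).trans_le (measure_mono fun x hx => (hpos x hx).ne')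

lemma measurable_stokesCorner_indicator :
    Measurable (stokesCorner.indicator (1 : Plane → ℝ)) :=
  measurable_const.indicator isOpen_stokesCorner.measurableSet

lemma abs_cutoff_mul_le {x : Plane} (hx : ‖x‖ < 1) {t : ℝ} (ht0 : 0 ≤ t) (ht : t ≤ max (x 1) 0) :
    |cutoff 1 x ^ 3 * t| ≤ 1 := by
  have h1 : cutoff 1 x ≤ 1 := by simpa using cutoff_le 1 x
  have h2 := cutoff_nonneg 1 x
  have h3 : t ≤ 1 := ht.trans ((height_le_norm x).trans hx.le)
  rw [abs_of_nonneg (by positivity)]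
  exact mul_le_one₀ (pow_le_one₀ h2 h1) ht0 h3

lemma cornerEnergy_pos : 0 < cornerEnergy := by
  have h0 := height_mul_stokesCorner
  have h := continuous_cutoff 1
  refine integral_pos_of_isOpen (U := stokesCorner ∩ ball 0 1) ?_ (fun x => ?_)
    (fun x hx => ?_) (fun x hx => ?_) (isOpen_stokesCorner.inter isOpen_ball)
    ⟨!₂[0, 1 / 2], ?_⟩ fun x hx => ?_
  · exact (by fun_prop : Continuous fun x : Plane => cutoff 1 x ^ 3 * x 1).measurable.mul
      measurable_stokesCorner_indicator
  · rw [mul_assoc]; exact mul_nonneg (pow_nonneg (cutoff_nonneg _ _) 3) (h0 x).1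
  · rw [mul_assoc]; exact abs_cutoff_mul_le hx (h0 x).1 (h0 x).2
  · rw [cutoff_eq_zero zero_le_one hx]; simp
  · have : ‖(!₂[0, 1 / 2] : Plane)‖ = 1 / 2 := by
      rw [EuclideanSpace.norm_eq]; simp
    refine ⟨?_, by rw [mem_ball_zero_iff, this]; norm_num⟩
    change ‖(!₂[0, 1 / 2] : Plane)‖ < 2 * (1 / 2)
    rw [this]; norm_num
  · rw [indicator_of_mem hx.1]
    have h1 := cutoff_pos (mem_ball_zero_iff.1 hx.2)
    have h2 := height_pos_of_mem_stokesCorner hx.1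
    simp only [Pi.one_apply, mul_one]
    positivity

lemma cornerEnergy_lt : cornerEnergy < halfPlaneEnergy := by
  have h0 := height_mul_stokesCorner
  have h := continuous_cutoff 1
  have hm1 := (by fun_prop : Continuous fun x : Plane => cutoff 1 x ^ 3 * max (x 1) 0).measurable
  have hm2 := (by fun_prop : Continuous fun x : Plane => cutoff 1 x ^ 3 * x 1).measurable.mul
      measurable_stokesCorner_indicator
  have i1 : Integrable fun x : Plane => cutoff 1 x ^ 3 * max (x 1) 0 :=
    integrable_of_ball (M := 1) hm1.aestronglyMeasurable
      (fun x hx => abs_cutoff_mul_le hx (le_max_right _ _) le_rfl) fun x hx => by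
        rw [cutoff_eq_zero zero_le_one hx]; simp
  have i2 : Integrable fun x : Plane => cutoff 1 x ^ 3 * x 1 * stokesCorner.indicator 1 x :=
    integrable_of_ball (M := 1) hm2.aestronglyMeasurable
      (fun x hx => by rw [mul_assoc]; exact abs_cutoff_mul_le hx (h0 x).1 (h0 x).2) fun x hx => by
        rw [cutoff_eq_zero zero_le_one hx]; simp
  rw [← sub_pos, cornerEnergy, halfPlaneEnergy, ← integral_sub i1 i2]
  have hz : ∀ x : Plane, cutoff 1 x ^ 3 * max (x 1) 0 - cutoff 1 x ^ 3 * x 1 * stokesCorner.indicator 1 x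
      = cutoff 1 x ^ 3 * (max (x 1) 0 - x 1 * stokesCorner.indicator 1 x) := fun x => by ring
  simp only [hz]
  have hp1 : ∀ x : Plane, 0 ≤ max (x 1) 0 - x 1 * stokesCorner.indicator 1 x := fun x => by
    linarith [(h0 x).2]
  refine integral_pos_of_isOpen
    (U := ({x : Plane | 2 * x 1 < ‖x‖} ∩ {x : Plane | 0 < x 1}) ∩ ball 0 1) ?_ (fun x => ?_)
    (fun x hx => ?_) (fun x hx => ?_) (((isOpen_lt (by fun_prop) continuous_norm).inter
      (isOpen_lt continuous_const (by fun_prop))).inter isOpen_ball)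
    ⟨!₂[3 / 10, 4 / 30], ?_⟩ fun x hx => ?_
  · simp only [← hz]; exact hm1.sub hm2
  · exact mul_nonneg (pow_nonneg (cutoff_nonneg _ _) 3) (hp1 x)
  · exact abs_cutoff_mul_le hx (hp1 x) (by linarith [(h0 x).1])
  · rw [cutoff_eq_zero zero_le_one hx]; simp
  · have h2 := norm_sq_plane !₂[3 / 10, 4 / 30]
    have h3 := norm_nonneg (!₂[3 / 10, 4 / 30] : Plane)
    simp only [Matrix.cons_val_zero, Matrix.cons_val_one] at h2
    refine ⟨⟨?_, ?_⟩, ?_⟩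
    · change 2 * (4 / 30) < ‖(!₂[3 / 10, 4 / 30] : Plane)‖
      nlinarith
    · change (0 : ℝ) < 4 / 30
      norm_num
    · rw [mem_ball_zero_iff]; nlinarith
  · have h1 := cutoff_pos (mem_ball_zero_iff.1 hx.2)
    have h2 : 0 < x 1 := hx.1.2
    have h3 : x ∉ stokesCorner := fun h4 : ‖x‖ < 2 * x 1 => by
      have : 2 * x 1 < ‖x‖ := hx.1.1
      linarith
    rw [indicator_of_notMem h3, max_eq_left h2.le, mul_zero, sub_zero]
    positivity

namespace IsBlowUpLimit

variable {C : ℝ} {P : ℝ → ℝ} {V : ℕ → Plane → ℝ} {v χ : Plane → ℝ}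
variable (hL : IsBlowUpLimit V v χ) (hV : IsBlowUpSequence C P V)
include hL hV

/-- The energy distinguishes the Stokes corner flow from the two limits without flow. -/
theorem energy_trichotomy :
    ((∀ x ∈ ball (0 : Plane) 1, v x = 0) ∧
      (Tendsto (fun m => weissEnergy (V m) 1) atTop (𝓝 0) ∨
        Tendsto (fun m => weissEnergy (V m) 1) atTop (𝓝 halfPlaneEnergy))) ∨
    (Tendsto (fun m => weissEnergy (V m) 1) atTop (𝓝 cornerEnergy) ∧
      (∀ x ∈ ball (0 : Plane) 1, x ∉ stokesCorner → v x = 0) ∧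
      ∀ᵐ x : Plane, x ∈ ball (0 : Plane) 1 → χ x = stokesCorner.indicator 1 x) := by
  have hlim := hL.tendsto_weissEnergy hV
  rcases hL.eq_zero_or_stokesCorner hV with h | ⟨h1, h2⟩
  · refine Or.inl ⟨h, ?_⟩
    have hconv : Convex ℝ {x : Plane | 0 < x 1} := by
      simpa using convex_openHalfPlane 0 1
    obtain ⟨c, hc, hae⟩ := hL.exists_chi_eq_zero_or_one hV
      (U := ball 0 1 ∩ {x : Plane | 0 < x 1})
      (isOpen_ball.inter (isOpen_lt continuous_const (by fun_prop)))
      ((convex_ball 0 1).inter hconv) inter_subset_left (fun x hx => hx.2) fun x hx => h x hx.1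
    have e : ∫ x, cutoff 1 x ^ 3 * x 1 * χ x = c * halfPlaneEnergy := by
      rw [halfPlaneEnergy, ← integral_const_mul]
      refine integral_congr_ae ?_
      filter_upwards [hae, hL.chi_eq_zero_of_le hV] with x h3 h4
      by_cases hx : x ∈ ball (0 : Plane) 1
      · rcases lt_or_ge 0 (x 1) with h5 | h5
        · rw [h3 ⟨hx, h5⟩, max_eq_left h5.le]; ring
        · rw [h4 hx h5, max_eq_right h5]; ring
      · rw [cutoff_eq_zero zero_le_one (not_lt.1 fun h5 => hx (mem_ball_zero_iff.2 h5))]; simp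
    rw [e] at hlim
    rcases hc with rfl | rfl
    · left; simpa using hlim
    · right; simpa using hlim
  · refine Or.inr ⟨?_, h1, h2⟩
    have e : ∫ x, cutoff 1 x ^ 3 * x 1 * χ x = cornerEnergy := by
      refine integral_congr_ae ?_
      filter_upwards [h2] with x h3
      by_cases hx : x ∈ ball (0 : Plane) 1
      · rw [h3 hx]
      · rw [cutoff_eq_zero zero_le_one (not_lt.1 fun h5 => hx (mem_ball_zero_iff.2 h5))]; simp
    rwa [e] at hlim

/-- At a point of the axis near which the limit consists of air, the energies tend to zero. -/
theorem tendsto_weissEnergy_of_air {z : Plane} (hz : z 1 = 0) {δ : ℝ} (hδ : 0 < δ)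
    (hball : closedBall z δ ⊆ ball 0 1)
    (hv : ∀ x ∈ closedBall z δ, v x = 0)
    (hχ : ∀ᵐ x : Plane, x ∈ closedBall z δ → χ x = 0) :
    Tendsto (fun m => weissEnergy (rescale (V m) z δ) 1) atTop (𝓝 0) := by
  -- the cut-off functions centred at `z`
  set ζ : ℕ → Plane → ℝ := fun n x => cutoff 1 (δ⁻¹ • (x - z)) ^ (n + 2) with hζ
  have cζ : ∀ n, ContDiff ℝ 1 (ζ n) := fun n => contDiff_unscale (contDiff_cutoff_pow 1 n)
  have hcz : ∀ y : Plane, 1 ≤ ‖y‖ → cutoff 1 y = 0 := fun y hy => cutoff_eq_zero zero_le_one hy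
  have sζ : ∀ n, tsupport (ζ n) ⊆ closedBall z δ := by
    intro n
    refine closure_minimal (fun x hx => ?_) isClosed_closedBall
    rw [mem_closedBall_iff_norm]
    by_contra h
    refine hx ?_
    simp only [hζ]
    rw [hcz, zero_pow (by omega)]
    rw [norm_smul, Real.norm_of_nonneg (inv_nonneg.2 hδ.le), inv_mul_eq_div, one_le_div hδ]
    exact (not_le.1 h).le
  have zζ : ∀ n (x : Plane), 1 ≤ ‖x‖ → ζ n x = 0 := fun n x hx =>
    eq_zero_of_tsupport ((sζ n).trans hball) hx
  have h1 := IsBlowUpLimit.tendsto_integral_mul_grad_sq hV (cζ 1) ((sζ 1).trans hball)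
    fun x hx => by
      have := hL.tendsto_apply (ball_subset_closedBall (hball (sζ 1 hx)))
      rwa [hv x (sζ 1 hx)] at this
  have h2 := hL.tendsto_integral_chi (f := fun x => ζ 1 x * x 1)
    ((cζ 1).continuous.mul (by fun_prop)) fun x hx => by rw [zζ 1 x hx, zero_mul]
  have h3 := hL.tendsto_integral_sq_of_continuous hV (f := ζ 0) (cζ 0).continuous (zζ 0)
  have e2 : ∫ x, ζ 1 x * x 1 * χ x = 0 := by
    refine integral_eq_zero_of_ae ?_
    filter_upwards [hχ] with x hx
    by_cases h : x ∈ closedBall z δ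
    · simp [hx h]
    · simp [image_eq_zero_of_notMem_tsupport fun h4 => h (sζ 1 h4)]
  have e3 : ∫ x, v x ^ 2 * ζ 0 x = 0 := by
    refine integral_eq_zero_of_ae (.of_forall fun x => ?_)
    by_cases h : x ∈ closedBall z δ
    · simp [hv x h]
    · simp [image_eq_zero_of_notMem_tsupport fun h4 => h (sζ 0 h4)]
  rw [e2] at h2
  rw [e3] at h3
  have hlim := ((h1.add h2).const_mul ((δ ^ 3)⁻¹)).sub ((h3.const_mul (9 * (δ ^ 5)⁻¹)))
  simp only [add_zero, mul_zero, sub_zero] at hlim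
  refine hlim.congr fun m => ?_
  obtain ⟨c, R, hp, -⟩ := hV.exists_profile m
  have hinv : ∀ x : Plane, δ⁻¹ • (z + δ • x - z) = x := fun x => by
    rw [add_sub_cancel_left, smul_smul, inv_mul_cancel₀ hδ.ne', one_smul]
  have f1 : ∫ x, cutoff 1 x ^ 3 * energyDensity (rescale (V m) z δ) x
      = (δ ^ 3)⁻¹ * ((∫ x, ζ 1 x * ‖grad (V m) x‖ ^ 2) + ∫ x, ζ 1 x * x 1 * chi (V m) x) := by
    have i1 : Integrable fun x => ζ 1 x * ‖grad (V m) x‖ ^ 2 := by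
      obtain ⟨M, hM⟩ := (cζ 1).continuous.bounded_above_of_compact_support
        (hasCompactSupport_of_norm (zζ 1))
      exact hp.integrable_grad_sq.bdd_mul (c := M) (cζ 1).continuous.aestronglyMeasurable
        (.of_forall hM)
    have i2 : Integrable fun x => ζ 1 x * x 1 * chi (V m) x :=
      hp.integrable_chi_mul ((cζ 1).continuous.mul (by fun_prop))
        (hasCompactSupport_of_norm (r := 1) fun x hx => by rw [zζ 1 x hx, zero_mul])
    have h := integral_comp_affine (fun x => ζ 1 x * energyDensity (V m) x) z hδ
    have h4 : ∫ x, ζ 1 x * energyDensity (V m) x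
        = (∫ x, ζ 1 x * ‖grad (V m) x‖ ^ 2) + ∫ x, ζ 1 x * x 1 * chi (V m) x := by
      rw [← integral_add i1 i2]
      refine integral_congr_ae (.of_forall fun x => ?_)
      simp only [energyDensity]; ring
    rw [← h4, show (δ ^ 3)⁻¹ = δ⁻¹ * (δ ^ 2)⁻¹ by rw [← mul_inv]; ring_nf, mul_assoc, ← h,
      ← integral_const_mul]
    refine integral_congr_ae (.of_forall fun x => ?_)
    simp only [hζ]
    rw [hp.energyDensity_rescale hz hδ, hinv]
    field_simp
    ring
  have f2 : ∫ x, cutoff 1 x ^ 2 * rescale (V m) z δ x ^ 2 = (δ ^ 5)⁻¹ * ∫ x, V m x ^ 2 * ζ 0 x := by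
    have h := integral_comp_affine (fun x => V m x ^ 2 * ζ 0 x) z hδ
    rw [show (δ ^ 5)⁻¹ = (δ ^ 3)⁻¹ * (δ ^ 2)⁻¹ by rw [← mul_inv, ← pow_add], mul_assoc, ← h,
      ← integral_const_mul]
    refine integral_congr_ae (.of_forall fun x => ?_)
    simp only [hζ]
    rw [rescale_sq hδ, hinv]
    field_simp
    ring
  rw [weissEnergy, f1, f2]
  ring

end IsBlowUpLimit

/-! ### Isolation of the non-degenerate points -/

/-- An approximate solution for which the perimeters of the rescaled fluid sets are bounded away from
the axis. -/
structure IsPerimeterBounded (c : Plane) (R C κ : ℝ) (P : ℝ → ℝ) (u : Plane → ℝ) : Prop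
    extends IsApproxSolution c R C κ u where
  perimeter : ∀ y : Plane, y 1 = 0 → ∀ r, 0 < r → closedBall y r ⊆ ball c R →
    ∀ δ, 0 < δ → ∀ φ : Plane → Plane, ContDiff ℝ 1 φ → HasCompactSupport φ →
    tsupport φ ⊆ ball 0 1 ∩ {x | δ < x 1} → (∀ x, ‖φ x‖ ≤ 1) →
    ∫ x, chi (rescale u y r) x * divergence φ x ≤ P δ

/-- The rescaled functions at `y` tend to zero uniformly. -/
def IsDegenerateAt (u : Plane → ℝ) (y : Plane) : Prop :=
  ∀ ε, 0 < ε → ∀ᶠ s in 𝓝[>] (0 : ℝ), ∀ x ∈ closedBall (0 : Plane) 1, rescale u y s x < ε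

namespace IsPerimeterBounded

variable {c : Plane} {R C κ : ℝ} {P : ℝ → ℝ} {u : Plane → ℝ}

lemma weissEnergy_rescale_one (hu : IsPerimeterBounded c R C κ P u) {y : Plane} (hy : y 1 = 0) {s : ℝ}
    (hs : 0 < s) (t : ℝ) :
    weissEnergy (rescale u y s) t = weissEnergy (rescale u y 1) (s * t) := by
  rw [← (hu.toIsProfile.rescale hy one_pos).weissEnergy_rescale hs, rescale_one_rescale hs]

/-- The energy at a point of the axis has a limit, which is almost a lower bound. -/
lemma exists_energy (hu : IsPerimeterBounded c R C κ P u) {y : Plane} (hy : y 1 = 0) {ρ : ℝ}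
    (hρ : 0 < ρ) (hs : ball y ρ ⊆ ball c R) :
    ∃ L, Tendsto (weissEnergy (rescale u y 1)) (𝓝[>] 0) (𝓝 L) ∧
      ∀ s ∈ Ioo 0 ρ, L ≤ weissEnergy (rescale u y s) 1 + errorConst C * κ * s := by
  have h1 := hu.toIsApproxSolution.rescale hy one_pos
  have h2 : ball 0 ρ ⊆ ball ((1 : ℝ)⁻¹ • (c - y)) (R / 1) := fun x hx => by
    rw [mem_ball_rescale one_pos]
    refine hs ?_
    rw [mem_ball_iff_norm]
    simpa using hx
  obtain ⟨L, h3, h4⟩ := h1.exists_tendsto_weissEnergy hρ h2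
  refine ⟨L, h3, fun s hs => ?_⟩
  have h5 := h4 s hs
  rwa [hu.weissEnergy_rescale_one hy hs.1, mul_one, ← mul_one κ]

/-- Rescalings at a fixed point form a blow-up sequence: the energy converges, and so its increments,
which control the distance from homogeneity, tend to zero. -/
theorem isBlowUpSequence (hu : IsPerimeterBounded c R C κ P u) {y : Plane} (hy : y 1 = 0) {ρ : ℝ}
    (hρ : ball y ρ ⊆ ball c R) {s : ℕ → ℝ} (hs : ∀ m, 0 < s m)
    (hsρ : ∀ m, 3 * s m < ρ) (h0 : Tendsto s atTop (𝓝 0)) :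
    IsBlowUpSequence C P (fun m => rescale u y (s m)) := by
  have hsub : ∀ m, ball 0 3 ⊆ ball ((s m)⁻¹ • (c - y)) (R / s m) := fun m x hx => by
    rw [mem_ball_rescale (hs m)]
    refine hρ ?_
    rw [mem_ball_iff_norm, add_sub_cancel_left, norm_smul, Real.norm_of_nonneg (hs m).le]
    have := mem_ball_zero_iff.1 hx
    nlinarith [hs m, hsρ m]
  have happ := fun m => hu.toIsApproxSolution.rescale hy (hs m)
  have hκ : Tendsto (fun m => κ * s m) atTop (𝓝 0) := by simpa using h0.const_mul κ
  have hρ0 : 0 < ρ := by linarith [hs 0, hsρ 0]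
  obtain ⟨L, hL, -⟩ := hu.exists_energy hy hρ0 hρ
  have hW : ∀ t, 0 < t → Tendsto (fun m => weissEnergy (rescale u y (s m)) t) atTop (𝓝 L) := by
    intro t ht
    simp only [fun m => hu.weissEnergy_rescale_one hy (hs m) t]
    refine hL.comp (tendsto_nhdsWithin_iff.2 ⟨by simpa using h0.mul_const t, .of_forall
      fun m => mul_pos (hs m) ht⟩)
  refine ⟨⟨_, _, _, hκ, fun m => ⟨happ m, hsub m⟩⟩, ?_, fun m δ hδ φ hφ hc ht h1 => ?_⟩
  · have h1 := (((hW 2 two_pos).sub (hW 1 one_pos)).add (hκ.const_mul (errorConst C))).const_mul (2 ^ 10)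
    simp only [sub_self, mul_zero, add_zero] at h1
    exact squeeze_zero (fun m => IsProfile.defect_nonneg _ _)
      (fun m => (happ m).defect_le (hsub m) (by norm_num)) h1
  · refine hu.perimeter y hy (s m) (hs m) ((fun x hx => ?_)) δ hδ φ hφ hc ht h1
    refine hρ ?_
    rw [mem_closedBall] at hx
    rw [mem_ball]
    linarith [hs m, hsρ m]

/-- At a non-degenerate point the energy is the one of the Stokes corner flow. -/
theorem tendsto_cornerEnergy (hu : IsPerimeterBounded c R C κ P u) {y : Plane} (hy : y 1 = 0)
    (hyc : y ∈ ball c R) (hnd : ¬ IsDegenerateAt u y) :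
    Tendsto (weissEnergy (rescale u y 1)) (𝓝[>] 0) (𝓝 cornerEnergy) := by
  obtain ⟨ρ, hρ, hs⟩ := Metric.isOpen_iff.1 isOpen_ball y hyc
  unfold IsDegenerateAt at hnd
  push Not at hnd
  obtain ⟨ε, hε, hfreq⟩ := hnd
  have hev : ∀ᶠ s in 𝓝[>] (0 : ℝ), 0 < s ∧ 3 * s < ρ := by
    filter_upwards [Ioo_mem_nhdsGT (show (0 : ℝ) < ρ / 3 by positivity)] with s hs
    exact ⟨hs.1, by linarith [hs.2]⟩
  obtain ⟨s, hs0, hsP⟩ := exists_seq_forall_of_frequently (hfreq.and_eventually hev)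
  have hs1 : Tendsto s atTop (𝓝 0) := hs0.mono_right nhdsWithin_le_nhds
  have hV := hu.isBlowUpSequence hy hs (fun m => (hsP m).2.1) (fun m => (hsP m).2.2) hs1
  obtain ⟨φ, hφ, v, χ, hL⟩ := hV.exists_isBlowUpLimit
  have hV' := hV.subseq hφ
  obtain ⟨L, hE, -⟩ := hu.exists_energy hy hρ hs
  have hlim : Tendsto (fun m => weissEnergy (rescale u y (s (φ m))) 1) atTop (𝓝 L) := by
    simp only [fun m => hu.weissEnergy_rescale_one hy (hsP (φ m)).2.1 1, mul_one]
    exact (hE.comp hs0).comp hφ.tendsto_atTop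
  rcases hL.energy_trichotomy hV' with ⟨h, -⟩ | ⟨h, -⟩
  · exfalso
    have hz : ∀ x ∈ closedBall (0 : Plane) 1, v x = 0 := by
      have h1 : EqOn v 0 (closure (ball (0 : Plane) 1)) := by
        refine EqOn.of_subset_closure (fun x hx => h x hx) ?_ continuousOn_const
          subset_closure le_rfl
        rw [closure_ball _ one_ne_zero]
        exact hL.continuousOn hV'
      rwa [closure_ball _ one_ne_zero] at h1
    obtain ⟨m, hm⟩ := (Metric.tendstoUniformlyOn_iff.1 hL.uniform ε hε).exists
    obtain ⟨x, hx, hx2⟩ := (hsP (φ m)).1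
    have h2 := hm x hx
    rw [hz x hx, dist_zero_left] at h2
    exact absurd ((le_abs_self _).trans_lt h2) (not_lt.2 hx2)
  · have := tendsto_nhds_unique hlim h
    rwa [this] at hE

/-- Non-degenerate points do not accumulate: rescaled at the limit point, with the distances as radii,
the accumulating points would tend to a point at distance `1 / 2` on the axis, near which the Stokes
corner flow has no fluid; but their energies are bounded away from zero. -/
theorem not_tendsto_of_nondegenerate (hu : IsPerimeterBounded c R C κ P u) {y : Plane} (hy : y 1 = 0)
    (hyc : y ∈ ball c R) (hnd : ¬ IsDegenerateAt u y) {x : ℕ → Plane} (hx : ∀ m, x m 1 = 0)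
    (hxne : ∀ m, x m ≠ y) (hxnd : ∀ m, ¬ IsDegenerateAt u (x m)) : ¬ Tendsto x atTop (𝓝 y) := by
  intro hlim
  obtain ⟨ρ, hρ, hs⟩ := Metric.isOpen_iff.1 isOpen_ball y hyc
  set t : ℕ → ℝ := fun m => x m 0 - y 0 with ht
  have hxt : ∀ m, x m = y + !₂[t m, 0] := fun m => by
    ext i; fin_cases i <;> simp [ht, hx, hy]
  have ht0 : ∀ m, t m ≠ 0 := fun m h => hxne m (by
    rw [hxt m, h]; ext i; fin_cases i <;> simp)
  have htlim : Tendsto t atTop (𝓝 0) := by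
    have h1 : Tendsto (fun m => x m 0) atTop (𝓝 (y 0)) :=
      ((by fun_prop : Continuous fun z : Plane => z 0).tendsto y).comp hlim
    simpa [ht] using h1.sub_const (y 0)
  -- pass to a subsequence on one side of `y`
  have hsign : ∃ σ : ℝ, (σ = 1 ∨ σ = -1) ∧ ∃ φ : ℕ → ℕ, StrictMono φ ∧ ∀ m, 0 < σ * t (φ m) := by
    by_cases h : ∃ᶠ m in atTop, 0 < t m
    · obtain ⟨φ, h1, h2⟩ := extraction_of_frequently_atTop h
      exact ⟨1, Or.inl rfl, φ, h1, fun m => by rw [one_mul]; exact h2 m⟩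
    · rw [not_frequently] at h
      obtain ⟨φ, h1, h2⟩ := extraction_of_eventually_atTop h
      exact ⟨-1, Or.inr rfl, φ, h1, fun m => by
        have := lt_of_le_of_ne (not_lt.1 (h2 m)) (ht0 _)
        linarith⟩
  obtain ⟨σ, hσ, φ, hφ, hpos⟩ := hsign
  have hσ2 : σ * σ = 1 := by rcases hσ with rfl | rfl <;> norm_num
  set r₀ : ℕ → ℝ := fun m => 2 * (σ * t (φ m)) with hr₀
  have hr₀lim : Tendsto r₀ atTop (𝓝 0) := by
    simpa [hr₀] using ((htlim.comp hφ.tendsto_atTop).const_mul σ).const_mul 2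
  obtain ⟨N, hN⟩ := eventually_atTop.1 (hr₀lim.eventually_lt_const (show 0 < ρ / 6 by positivity))
  set r : ℕ → ℝ := fun m => r₀ (m + N) with hr
  have hr0 : ∀ m, 0 < r m := fun m => mul_pos two_pos (hpos _)
  have hrρ : ∀ m, r m < ρ / 6 := fun m => hN _ (Nat.le_add_left N m)
  have hrlim : Tendsto r atTop (𝓝 0) := hr₀lim.comp (tendsto_add_atTop_nat N)
  set z : Plane := !₂[σ / 2, 0] with hz
  have hzx : ∀ m, x (φ (m + N)) = y + r m • z := fun m => by
    rw [hxt]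
    congr 1
    ext i
    fin_cases i
    · simp only [hz, hr, hr₀, PiLp.smul_apply, smul_eq_mul]
      change t (φ (m + N)) = 2 * (σ * t (φ (m + N))) * (σ / 2)
      linear_combination -(t (φ (m + N))) * hσ2
    · simp [hz]
  have hV := hu.isBlowUpSequence hy hs hr0 (fun m => by linarith [hrρ m]) hrlim
  obtain ⟨ψ, hψ, v, χ, hL⟩ := hV.exists_isBlowUpLimit
  have hV' := hV.subseq hψ
  have hE := hu.tendsto_cornerEnergy hy hyc hnd
  have hElim : Tendsto (fun m => weissEnergy (rescale u y (r (ψ m))) 1) atTop (𝓝 cornerEnergy) := by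
    simp only [fun m => hu.weissEnergy_rescale_one hy (hr0 (ψ m)) 1, mul_one]
    exact (hE.comp (tendsto_nhdsWithin_iff.2 ⟨hrlim, .of_forall hr0⟩)).comp
      hψ.tendsto_atTop
  rcases hL.energy_trichotomy hV' with ⟨-, h | h⟩ | ⟨-, hv, hχ⟩
  · exact cornerEnergy_pos.ne' (tendsto_nhds_unique hElim h)
  · exact cornerEnergy_lt.ne (tendsto_nhds_unique hElim h)
  -- a neighbourhood of `z` consists of air
  have hznorm : ‖z‖ = 1 / 2 := by
    rw [← sq_eq_sq₀ (norm_nonneg _) (by norm_num), norm_sq_plane]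
    change (σ / 2) ^ 2 + 0 ^ 2 = _
    linear_combination hσ2 / 4
  have hclose : ∀ w ∈ closedBall z (1 / 8), w ∈ ball (0 : Plane) 1 ∧ w ∉ stokesCorner := by
    intro w hw
    rw [mem_closedBall_iff_norm] at hw
    have h1 := norm_sub_norm_le z w
    rw [norm_sub_rev] at h1
    have h2 : ‖w‖ ≤ ‖w - z‖ + ‖z‖ := by simpa using norm_add_le (w - z) z
    refine ⟨by rw [mem_ball_zero_iff]; linarith, fun h : ‖w‖ < 2 * w 1 => ?_⟩
    have h3 : w 1 ≤ ‖w - z‖ := by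
      have := (le_abs_self _).trans (PiLp.norm_apply_le (w - z) 1)
      simpa [hz] using this
    linarith
  have hair := hL.tendsto_weissEnergy_of_air hV' (z := z) (by simp [hz]) (δ := 1 / 8) (by norm_num)
    (fun w hw => (hclose w hw).1) (fun w hw => hv w (hclose w hw).1 (hclose w hw).2) (by
      filter_upwards [hχ] with w h1 h2
      rw [h1 (hclose w h2).1, indicator_of_notMem (hclose w h2).2])
  -- but the energies there are at least that of the Stokes corner flow, up to a small error
  have hlow : ∀ m, cornerEnergy ≤ weissEnergy (rescale (rescale u y (r (ψ m))) z (1 / 8)) 1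
      + errorConst C * κ * (r (ψ m) * (1 / 8)) := by
    intro m
    set k := ψ m
    have hball : ball (y + r k • z) (ρ / 2) ⊆ ball c R := by
      refine (fun w hw => hs ?_)
      rw [mem_ball_iff_norm] at hw ⊢
      have h1 : ‖w - y‖ ≤ ‖w - (y + r k • z)‖ + ‖r k • z‖ := by
        have := norm_add_le (w - (y + r k • z)) (r k • z)
        rwa [show w - (y + r k • z) + r k • z = w - y by abel] at this
      rw [norm_smul, Real.norm_of_nonneg (hr0 k).le, hznorm] at h1
      linarith [hrρ k]
    have hax : (y + r k • z) 1 = 0 := by rw [← hzx]; exact hx _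
    obtain ⟨L, h1, h2⟩ := hu.exists_energy hax (ρ := ρ / 2) (by positivity) hball
    have h3 := hu.tendsto_cornerEnergy hax (hball (mem_ball_self (by positivity)))
      (by rw [← hzx]; exact hxnd _)
    rw [tendsto_nhds_unique h3 h1, rescale_rescale (hr0 k) (by norm_num)]
    exact h2 _ ⟨mul_pos (hr0 k) (by norm_num), by linarith [hrρ k, hr0 k]⟩
  have herr : Tendsto (fun m => errorConst C * κ * (r (ψ m) * (1 / 8))) atTop (𝓝 0) := by
    have h := ((hrlim.comp hψ.tendsto_atTop).mul_const (1 / 8)).const_mul (errorConst C * κ)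
    rw [zero_mul, mul_zero] at h
    exact h
  have := ge_of_tendsto' (hair.add herr) hlow
  rw [add_zero] at this
  exact absurd cornerEnergy_pos (not_lt.2 this)

end IsPerimeterBounded

/-! ### Localization -/

section Localize

variable {u : Plane → ℝ} {c : Plane} {R : ℝ}

/-- The restriction of `u` to a ball, extended by zero. -/
def localize (u : Plane → ℝ) (c : Plane) (R : ℝ) : Plane → ℝ := (ball c R).indicator u

lemma localize_of_mem {x : Plane} (hx : x ∈ ball c R) : localize u c R x = u x :=
  indicator_of_mem hx u

lemma localize_of_notMem {x : Plane} (hx : x ∉ ball c R) : localize u c R x = 0 :=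
  indicator_of_notMem hx u

lemma mem_of_localize_pos {x : Plane} (hx : 0 < localize u c R x) :
    x ∈ ball c R ∧ 0 < u x := by
  have h : x ∈ ball c R := by
    by_contra h
    rw [localize_of_notMem h] at hx
    exact lt_irrefl _ hx
  exact ⟨h, by rwa [localize_of_mem h] at hx⟩

lemma chi_localize {x : Plane} (hx : x ∈ ball c R) : chi (localize u c R) x = chi u x := by
  simp only [chi, localize_of_mem hx]

lemma grad_localize {x : Plane} (hx : x ∈ ball c R) : grad (localize u c R) x = grad u x := by
  have h : localize u c R =ᶠ[𝓝 x] u := by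
    filter_upwards [isOpen_ball.mem_nhds hx] with y hy using localize_of_mem hy
  simp only [grad, localize_of_mem hx, gradient, h.fderiv_eq]

end Localize

variable {p : ℝ → ℝ} {ρ₀ g : ℝ} {Ω : Set Plane} {u : Plane → ℝ}

lemma IsSubsonicVariationalSolution.isOpen_fluid
    (hu : IsSubsonicVariationalSolution p ρ₀ g Ω u) : IsOpen (fluid Ω u) :=
  hu.continuousOn.isOpen_inter_preimage hu.isOpen isOpen_Ioi

/-- In a small ball about a point of the axis, the solution is a local solution in the range in which
the density is expanded. -/
lemma IsSubsonicVariationalSolution.exists_isLocalSolution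
    (hu : IsSubsonicVariationalSolution p ρ₀ g Ω u) (hgrowth : GrowthBound Ω u) {η K : ℝ}
    (he : IsExpansion p ρ₀ g η K) {x₀ : Plane} (hx₀ : x₀ ∈ Ω) (hx₀1 : x₀ 1 = 0) :
    ∃ R C, 0 < R ∧ ball x₀ R ⊆ Ω ∧ IsLocalSolution p ρ₀ g η x₀ R C (localize u x₀ R) := by
  obtain ⟨R₀, hR₀, hsub⟩ := Metric.nhds_basis_closedBall.mem_iff.1 (hu.isOpen.mem_nhds hx₀)
  obtain ⟨C₁, hC₁⟩ := hgrowth _ hsub (isCompact_closedBall x₀ R₀)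
  set C := max C₁ 0 with hC
  have hC0 : 0 ≤ C := le_max_right _ _
  have hη := he.eta_pos
  set R := min R₀ (η / (C + 1)) with hR
  have hRpos : 0 < R := lt_min hR₀ (by positivity)
  have hRη : (C + 1) * R ≤ η := by
    have := min_le_right R₀ (η / (C + 1))
    rw [← hR, le_div_iff₀ (by positivity)] at this
    linarith
  have hball : ball x₀ R ⊆ closedBall x₀ R₀ := fun x hx =>
    (mem_ball.1 hx).le.trans (min_le_left _ _)
  have hΩ := hball.trans hsub
  have hheight : ∀ x ∈ ball x₀ R, x 1 < R := fun x hx => by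
    have h1 := (le_abs_self _).trans (PiLp.norm_apply_le (x - x₀) 1)
    rw [PiLp.sub_apply, hx₀1, sub_zero] at h1
    exact h1.trans_lt (mem_ball_iff_norm.1 hx)
  have hgrad : ∀ x, ‖grad (localize u x₀ R) x‖ ^ 2 ≤ C * max (x 1) 0 := fun x => by
    have h0 : 0 ≤ C * max (x 1) 0 := mul_nonneg hC0 (le_max_right _ _)
    by_cases hx : x ∈ ball x₀ R
    · rw [grad_localize hx]
      exact (hC₁ x (hball hx)).trans
        (mul_le_mul_of_nonneg_right (le_max_left _ _) (le_max_right _ _))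
    · rw [grad_of_not_pos (by rw [localize_of_notMem hx]; exact lt_irrefl 0)]
      simpa using h0
  have hzero : ∀ x : Plane, x 1 ≤ 0 → localize u x₀ R x = 0 := fun x hx1 => by
    by_cases hx : x ∈ ball x₀ R
    · rw [localize_of_mem hx, hu.eq_zero x (hΩ hx) hx1]
    · exact localize_of_notMem hx
  have hdiff : ContDiffOn ℝ 2 (localize u x₀ R) {x | 0 < localize u x₀ R x} := by
    intro x hx
    obtain ⟨h1, h2⟩ := mem_of_localize_pos hx
    have h3 : ContDiffAt ℝ 2 u x :=
      hu.contDiffOn.contDiffAt (hu.isOpen_fluid.mem_nhds ⟨hΩ h1, h2⟩)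
    refine (h3.congr_of_eventuallyEq ?_).contDiffWithinAt
    filter_upwards [isOpen_ball.mem_nhds h1] with y hy using localize_of_mem hy
  refine ⟨R, C, hRpos, hΩ, ⟨⟨hC0, fun x => ?_, hzero, fun x hx => localize_of_notMem hx,
    (hu.continuousOn.mono hΩ).congr fun x hx => localize_of_mem hx,
    hdiff.of_le (by norm_num), hgrad⟩, hdiff, fun x hx => ?_, fun x hx => ?_, ?_⟩⟩
  · by_cases hx : x ∈ ball x₀ R
    · rw [localize_of_mem hx]; exact hu.nonneg x (hΩ hx)
    · rw [localize_of_notMem hx]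
  · have := hheight x (mem_of_localize_pos hx).1
    nlinarith
  · have h1 := hheight x (mem_of_localize_pos hx).1
    have h2 : 0 < x 1 := by
      by_contra h
      rw [hzero x (not_lt.1 h)] at hx
      exact lt_irrefl _ hx
    have h3 := hgrad x
    rw [max_eq_left h2.le] at h3
    nlinarith
  · intro φ hφ hc hs
    have h0 : ∀ x, x ∉ ball x₀ R → φ x = 0 ∧ fderiv ℝ φ x = 0 ∧ divergence φ x = 0 :=
      fun x hx => by
        have h1 : x ∉ tsupport φ := fun h => hx (hs h)
        have h2 : fderiv ℝ φ x = 0 := fderiv_of_notMem_tsupport ℝ h1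
        exact ⟨image_eq_zero_of_notMem_tsupport h1, h2, by simp [divergence, h2]⟩
    have h1 := hu.variation_eq_zero φ hφ hc fun x hx => ⟨hΩ (hs hx), by
      have h2 := hheight x (hs hx)
      have h3 := he.lt_stagnationHeight
      change x 1 < _
      nlinarith⟩
    have hint : ∀ f f' : Plane → ℝ, (∀ x, x ∉ ball x₀ R → f x = 0 ∧ f' x = 0) →
        (∀ x ∈ ball x₀ R, f' x = f x) → ∫ x, f' x = ∫ x in Ω, f x := by
      intro f f' hf hff
      rw [setIntegral_eq_integral_of_forall_compl_eq_zero fun x hx => (hf x fun h => hx (hΩ h)).1]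
      refine integral_congr_ae (.of_forall fun x => ?_)
      by_cases hx : x ∈ ball x₀ R
      · exact hff x hx
      · exact (hf x hx).2.trans (hf x hx).1.symm
    rw [firstVariation] at h1
    rw [← h1]
    congr 1
    · congr 1
      · refine hint _ _ (fun x hx => by simp [(h0 x hx).2.2]) fun x hx => ?_
        rw [grad_localize hx, chi_localize hx]
      · refine congrArg (2 * ·) (hint _ _ (fun x hx => by simp [(h0 x hx).2.1]) fun x hx => ?_)
        rw [grad_localize hx]
    · refine hint _ _ (fun x hx => by simp [(h0 x hx).1]) fun x hx => ?_
      rw [grad_localize hx, chi_localize hx]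

/-- The weighted bound on the perimeter controls the perimeters of the rescaled fluid sets away from the
axis. -/
lemma WeightedPerimeterBound.integral_chi_le {C₀ : ℝ} (hper : WeightedPerimeterBound Ω u C₀)
    (ho : IsOpen (fluid Ω u)) {c : Plane} {R : ℝ} (hΩ : ball c R ⊆ Ω)
    {y : Plane} (hy : y 1 = 0) {r : ℝ} (hr : 0 < r)
    (hyr : closedBall y r ⊆ ball c R) {δ : ℝ} (hδ : 0 < δ) {Φ : Plane → Plane}
    (hΦ : ContDiff ℝ 1 Φ) (hc : HasCompactSupport Φ)
    (hs : tsupport Φ ⊆ ball 0 1 ∩ {x | δ < x 1}) (h1 : ∀ x, ‖Φ x‖ ≤ 1) :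
    ∫ x, chi (rescale (localize u c R) y r) x * divergence Φ x ≤ max C₀ 0 / Real.sqrt δ := by
  obtain ⟨μ, hμ, hbound⟩ := hper
  set φ : Plane → Plane := fun z => Φ (r⁻¹ • (z - y)) with hφ
  set W : Set Plane := ball y r ∩ {x | δ * r < x 1} with hW
  have hWo : IsOpen W := isOpen_ball.inter (isOpen_lt continuous_const (by fun_prop))
  have hWsub : W ⊆ Ω ∩ {x | 0 < x 1} := fun x hx =>
    ⟨hΩ (hyr (ball_subset_closedBall hx.1)), (mul_pos hδ hr).trans hx.2⟩
  have cφ : ContDiff ℝ 1 φ := contDiff_unscale hΦ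
  have sφ : tsupport φ ⊆ W := by
    rw [hφ, tsupport_unscale hr]
    rintro _ ⟨x, hx, rfl⟩
    obtain ⟨h2, h3⟩ := hs hx
    refine ⟨?_, ?_⟩
    · rw [mem_ball_iff_norm, add_sub_cancel_left, norm_smul, Real.norm_of_nonneg hr.le]
      have := mem_ball_zero_iff.1 h2
      nlinarith
    · have h4 : δ < x 1 := h3
      simp only [mem_ofPred_eq, PiLp.add_apply, PiLp.smul_apply, smul_eq_mul, hy, zero_add]
      nlinarith
  set I := ∫ x in fluid Ω u, divergence φ x with hI
  -- the rescaled integral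
  have e1 : ∫ x, chi (rescale (localize u c R) y r) x * divergence Φ x = r⁻¹ * I := by
    have h2 := integral_comp_affine (fun z => chi (localize u c R) z * divergence φ z) y hr
    have h3 : I = ∫ z, chi (localize u c R) z * divergence φ z := by
      rw [hI, ← integral_indicator ho.measurableSet]
      refine integral_congr_ae (.of_forall fun z => ?_)
      by_cases hz : z ∈ ball c R
      · simp only [chi_localize hz]
        by_cases hu0 : 0 < u z
        · rw [indicator_of_mem (show z ∈ fluid Ω u from ⟨hΩ hz, hu0⟩), chi_of_pos hu0, one_mul]
        · rw [indicator_of_notMem fun h : z ∈ fluid Ω u => hu0 h.2, chi_of_not_pos hu0, zero_mul]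
      · have h4 : divergence φ z = 0 := by
          have h5 : z ∉ tsupport φ := fun h =>
            hz (hyr (ball_subset_closedBall (sφ h).1))
          have h6 : fderiv ℝ φ z = 0 := fderiv_of_notMem_tsupport ℝ h5
          simp [divergence, h6]
        simp only [h4, mul_zero]
        by_cases h5 : z ∈ fluid Ω u <;> simp [h5, h4]
    rw [h3, show r⁻¹ = r * (r ^ 2)⁻¹ by field_simp, mul_assoc, ← h2, ← integral_const_mul]
    refine integral_congr_ae (.of_forall fun x => ?_)
    simp only [hφ]
    rw [divergence_unscale hΦ hr, chi_rescale hr]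
    field_simp
  -- the variation in `W`
  have hvar : ENNReal.ofReal I ≤ μ W := by
    rw [hμ W hWsub hWo, variation]
    exact le_iSup₂_of_le (f := fun φ (_ : φ ∈ {φ : Plane → Plane | ContDiff ℝ 1 φ ∧
      HasCompactSupport φ ∧ tsupport φ ⊆ W ∧ ∀ x, ‖φ x‖ ≤ 1}) =>
        ENNReal.ofReal (∫ x in fluid Ω u, divergence φ x)) φ
      ⟨cφ, hasCompactSupport_unscale hr hc, sφ, fun x => h1 _⟩ le_rfl
  have hle : ENNReal.ofReal (Real.sqrt (δ * r)) * μ W ≤ ENNReal.ofReal (C₀ * r ^ (3 / 2 : ℝ)) := by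
    refine le_trans ?_ (hbound y r hy hr (hyr.trans hΩ))
    rw [← setLIntegral_const]
    refine (setLIntegral_mono_ae' hWo.measurableSet (.of_forall fun x hx =>
      ENNReal.ofReal_le_ofReal (Real.sqrt_le_sqrt (le_of_lt hx.2)))).trans ?_
    exact lintegral_mono_set fun x hx => ⟨hx.1, (mul_pos hδ hr).trans hx.2⟩
  have hreal : Real.sqrt (δ * r) * I ≤ max C₀ 0 * r ^ (3 / 2 : ℝ) := by
    have h2 := (mul_le_mul_right hvar (ENNReal.ofReal (Real.sqrt (δ * r)))).trans hle
    rw [← ENNReal.ofReal_mul (Real.sqrt_nonneg _)] at h2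
    have h3 : 0 ≤ r ^ (3 / 2 : ℝ) := Real.rpow_nonneg hr.le _
    rcases ENNReal.ofReal_le_ofReal_iff'.1 h2 with h4 | h4
    · exact h4.trans (mul_le_mul_of_nonneg_right (le_max_left _ _) h3)
    · exact h4.trans (mul_nonneg (le_max_right _ _) h3)
  have hsδ : 0 < Real.sqrt δ := Real.sqrt_pos.2 hδ
  have hsr : 0 < Real.sqrt r := Real.sqrt_pos.2 hr
  have hr32 : r ^ (3 / 2 : ℝ) = r * Real.sqrt r := by
    rw [Real.sqrt_eq_rpow, show (3 / 2 : ℝ) = 1 + 1 / 2 by norm_num, Real.rpow_add hr, Real.rpow_one]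
  rw [Real.sqrt_mul hδ.le, hr32] at hreal
  rw [e1, le_div_iff₀ hsδ, inv_mul_eq_div, div_mul_eq_mul_div, div_le_iff₀ hr]
  refine le_of_mul_le_mul_right ?_ hsr
  linarith

/-- At a non-degenerate point the rescaled functions do not tend to zero uniformly. -/
lemma not_isDegenerateAt_of_isBlowUp {c : Plane} {R : ℝ} (h0 : ∀ x ∈ ball c R, 0 ≤ u x)
    {y : Plane} (hy : y ∈ ball c R) {u₀ : Plane → ℝ} (hb : IsBlowUp u y u₀)
    (hne : ¬ u₀ =ᵐ[volume] 0) : ¬ IsDegenerateAt (localize u c R) y := by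
  intro hdeg
  obtain ⟨Du₀, hgrad, r, hr, hr0, hweak, -⟩ := hb
  obtain ⟨ρ, hρ, hsub⟩ := Metric.isOpen_iff.1 isOpen_ball y hy
  refine hne ?_
  have hloc : LocallyIntegrable u₀ := by
    rw [locallyIntegrable_iff]
    intro K hK
    have : IsFiniteMeasure (volume.restrict K) :=
      ⟨by rw [Measure.restrict_apply_univ]; exact hK.measure_lt_top⟩
    exact (hgrad.memLp_fun K (subset_univ K) hK).integrable one_le_two
  refine ae_eq_zero_of_integral_contDiff_smul_eq_zero hloc fun η hη hc => ?_
  have hηi : Integrable η := hη.continuous.integrable_of_hasCompactSupport hc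
  have hη2 : MemLp η 2 volume := hη.continuous.memLp_of_hasCompactSupport hc
  have h1 := hweak η hη2 hc
  obtain ⟨A, hA, hball⟩ : ∃ A : ℝ, 0 < A ∧ tsupport η ⊆ closedBall 0 A := by
    obtain ⟨A, hA⟩ := hc.isCompact.isBounded.subset_closedBall 0
    exact ⟨max A 1, by positivity, hA.trans (closedBall_subset_closedBall (le_max_left _ _))⟩
  have h2 : Tendsto (fun m => ∫ x, rescale u y (r m) x * η x) atTop (𝓝 0) := by
    set N := ∫ x, ‖η x‖ with hN
    have hN0 : 0 ≤ N := integral_nonneg fun x => norm_nonneg _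
    have hA32 : 0 < A ^ (3 / 2 : ℝ) := Real.rpow_pos_of_pos hA _
    rw [Metric.tendsto_atTop']
    intro ε hε
    set ε' := ε / (A ^ (3 / 2 : ℝ) * (N + 1)) with hε'
    have hε'0 : 0 < ε' := by positivity
    have hrA : Tendsto (fun m => r m * A) atTop (𝓝[>] 0) :=
      tendsto_nhdsWithin_iff.2 ⟨by simpa using hr0.mul_const A,
        .of_forall fun m => mul_pos (hr m) hA⟩
    have hev := (hrA.eventually (hdeg ε' hε'0)).and (hrA.eventually (Ioo_mem_nhdsGT hρ))
    obtain ⟨M, hM⟩ := eventually_atTop.1 hev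
    refine ⟨M, fun m hm => ?_⟩
    obtain ⟨h3, h4⟩ := hM m hm.le
    have hpt : ∀ x, ‖rescale u y (r m) x * η x‖ ≤ A ^ (3 / 2 : ℝ) * ε' * ‖η x‖ := by
      intro x
      rw [norm_mul]
      by_cases hx : x ∈ tsupport η
      · refine mul_le_mul_of_nonneg_right ?_ (norm_nonneg _)
        have hx1 : A⁻¹ • x ∈ closedBall (0 : Plane) 1 := by
          rw [mem_closedBall_zero_iff, norm_smul, norm_inv, Real.norm_of_nonneg hA.le,
            inv_mul_le_iff₀ hA, mul_one]
          simpa using hball hx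
        have h5 := h3 _ hx1
        have h6 : y + (r m * A) • A⁻¹ • x = y + r m • x := by
          rw [smul_smul, mul_assoc, mul_inv_cancel₀ hA.ne', mul_one]
        have h7 : y + r m • x ∈ ball c R := by
          refine hsub ?_
          rw [← h6, mem_ball_iff_norm, add_sub_cancel_left, norm_smul,
            Real.norm_of_nonneg (mul_pos (hr m) hA).le]
          have h8 := mem_closedBall_zero_iff.1 hx1
          nlinarith [h4.1, h4.2, norm_nonneg (A⁻¹ • x)]
        rw [rescale, h6, localize_of_mem h7, Real.mul_rpow (hr m).le hA.le] at h5
        have hrp : 0 < r m ^ (3 / 2 : ℝ) := Real.rpow_pos_of_pos (hr m) _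
        rw [rescale, Real.norm_of_nonneg (div_nonneg (h0 _ h7) hrp.le), div_le_iff₀ hrp]
        rw [div_lt_iff₀ (by positivity)] at h5
        linarith
      · rw [image_eq_zero_of_notMem_tsupport hx]; simp
    rw [dist_zero_right]
    calc ‖∫ x, rescale u y (r m) x * η x‖ ≤ ∫ x, A ^ (3 / 2 : ℝ) * ε' * ‖η x‖ :=
          norm_integral_le_of_norm_le (hηi.norm.const_mul _) (.of_forall hpt)
      _ = A ^ (3 / 2 : ℝ) * ε' * N := by rw [integral_const_mul]
      _ < A ^ (3 / 2 : ℝ) * ε' * (N + 1) := by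
          refine mul_lt_mul_of_pos_left (by linarith) (by positivity)
      _ = ε := by rw [hε']; field_simp
  have h3 := tendsto_nhds_unique h1 h2
  rw [← h3]
  exact integral_congr_ae (.of_forall fun x => by simp only [smul_eq_mul]; ring)

end GravityWave

end

theorem mainTheorem9 (p : ℝ → ℝ) (ρ₀ g : ℝ) (hp : GravityWave.IsPressureLaw p ρ₀ g)
    (Ω : Set GravityWave.Plane) (u : GravityWave.Plane → ℝ)
    (hu : GravityWave.IsSubsonicVariationalSolution p ρ₀ g Ω u)
    (hgrowth : GravityWave.GrowthBound Ω u)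
    (C₀ : ℝ) (hper : GravityWave.WeightedPerimeterBound Ω u C₀)
    (x₀ : GravityWave.Plane) (hx₀ : x₀ ∈ GravityWave.nondegenerateSet Ω u) :
    ∃ V : Set GravityWave.Plane, IsOpen V ∧ x₀ ∈ V ∧
      V ∩ GravityWave.nondegenerateSet Ω u = {x₀} := by
  obtain ⟨η, K, he⟩ := hp.exists_isExpansion
  obtain ⟨R, C, hR, hΩ, hloc⟩ := hu.exists_isLocalSolution hgrowth he hx₀.1.1 hx₀.1.2.2
  have hflow : GravityWave.IsPerimeterBounded x₀ R C (4 * ρ₀ * K * (C + 1) ^ 2)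
      (fun δ => max C₀ 0 / Real.sqrt δ) (GravityWave.localize u x₀ R) :=
    ⟨hloc.isApproxSolution he, fun y hy r hr hyr δ hδ φ hφ hc hs h1 =>
      hper.integral_chi_le hu.isOpen_fluid hΩ hy hr hyr hδ hφ hc hs h1⟩
  have hnd : ∀ y ∈ Metric.ball x₀ R, y ∈ GravityWave.nondegenerateSet Ω u →
      ¬ GravityWave.IsDegenerateAt (GravityWave.localize u x₀ R) y := fun y hy hyn => by
    obtain ⟨u₀, hb, hne⟩ := hyn.2
    exact GravityWave.not_isDegenerateAt_of_isBlowUp (fun x hx => hu.nonneg x (hΩ hx)) hy hb hne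
  have hx₀R : x₀ ∈ Metric.ball x₀ R := Metric.mem_ball_self hR
  by_contra hcon
  push Not at hcon
  have hex : ∀ n : ℕ, ∃ y ∈ GravityWave.nondegenerateSet Ω u, y ≠ x₀ ∧
      y ∈ Metric.ball x₀ (min R (1 / ((n : ℝ) + 1))) := by
    intro n
    have hpos : 0 < min R (1 / ((n : ℝ) + 1)) := lt_min hR (by positivity)
    by_contra hno
    push Not at hno
    refine hcon _ Metric.isOpen_ball (Metric.mem_ball_self hpos) (Set.eq_singleton_iff_unique_mem.2
      ⟨⟨Metric.mem_ball_self hpos, hx₀⟩, fun y hy => ?_⟩)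
    by_contra hne
    exact hno y hy.2 hne hy.1
  choose x hxn hxne hxb using hex
  refine hflow.not_tendsto_of_nondegenerate hx₀.1.2.2 hx₀R (hnd x₀ hx₀R hx₀)
    (fun m => (hxn m).1.2.2) hxne
    (fun m => hnd _ (Metric.ball_subset_ball (min_le_left _ _) (hxb m)) (hxn m)) ?_
  rw [tendsto_iff_dist_tendsto_zero]
  exact squeeze_zero (fun _ => dist_nonneg)
    (fun m => ((Metric.mem_ball.1 (hxb m)).le.trans (min_le_right _ _)))
    tendsto_one_div_add_atTop_nhds_zero_nat
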